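/- **Setting.** Let $k$ be a commutative ring containing $\mathbb Q$. A *vertex algebra* is a $\mathbb Z_{\ge 0}$-graded (by *conformal weight*) $k$-module $V$ with a vacuum $\mathbf 1\in V_0$ and bilinear operations ${}_{(n)}$ ($n\in\mathbb Z$) of degree $-n-1$ satisfying $\mathbf 1_{(n)}a=\delta_{n,-1}a$, $a_{(-1)}\mathbf 1=a$, $a_{(n)}\mathbf 1=0$ for $n\ge 0$, and the Borcherds identity; put $\partial^{(j)}a=a_{(-1-j)}\mathbf 1$ and $x\cdot y=x_{(-1)}y$. A *$\partial$-algebra* is a commutative $\mathbb Z_{\ge 0}$-graded $k$-algebra with endomorphisms $\partial^{(j)}$ of degree $j$ ($j\ge0$) such that $\partial^{(0)}=\mathrm{id}$, $\partial^{(i)}\partial^{(j)}=\binom{i+j}{i}\partial^{(i+j)}$ and $\partial^{(n)}(ab)=\sum_{p+q=n}\partial^{(p)}a\,\partial^{(q)}b$. A *vertex algebroid* $\mathcal A=(A,T,\Omega,\partial,\gamma,\langle\,,\rangle,c)$ consists of a commutative $k$-algebra $A$, a Lie $A$-algebroid $T$, an $A$-module $\Omega$ with an action of the Lie algebra $T$,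 a $T$-equivariant derivation $\partial:A\to\Omega$, a symmetric $k$-bilinear pairing $\langle\,,\rangle:(T\oplus\Omega)^2\to A$ which is zero on $\Omega\times\Omega$ and $A$-bilinear on $T\times\Omega$, a skew symmetric $k$-bilinear map $c:T\times T\to\Omega$ and a $k$-bilinear map $\gamma:A\times T\to\Omega$, such that $\langle\tau,\partial a\rangle=\tau(a)$, $\tau(a\omega)=\tau(a)\omega+a\tau(\omega)$, $(a\tau)(\omega)=a\tau(\omega)+\langle\tau,\omega\rangle\partial a$, $\tau\langle\nu,\omega\rangle=\langle[\tau,\nu],\omega\rangle+\langle\nu,\tau(\omega)\rangle$ and $$\gamma(a,b\tau)=\gamma(ab,\tau)-a\gamma(b,\tau)-\tau(a)\partial b-\tau(b)\partial a,$$ $$\langle a\tau_1,\tau_2\rangle=a\langle\tau_1,\tau_2\rangle+\langle\gamma(a,\tau_1),\tau_2\rangle-\tau_1\tau_2(a),$$ $$c(a\tau_1,\tau_2)=ac(\tau_1,\tau_2)+\gamma(a,[\tau_1,\tau_2])-\gamma(\tau_2(a),\tau_1)+\tau_2(\gamma(a,\tau_1))-\tfrac12\langle\tau_1,\tau_2\rangle\partial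 a+\tfrac12\partial\tau_1\tau_2(a)-\tfrac12\partial\langle\tau_2,\gamma(a,\tau_1)\rangle,$$ $$\langle[\tau_1,\tau_2],\tau_3\rangle+\langle\tau_2,[\tau_1,\tau_3]\rangle=\tau_1\langle\tau_2,\tau_3\rangle-\tfrac12\tau_2\langle\tau_1,\tau_3\rangle-\tfrac12\tau_3\langle\tau_1,\tau_2\rangle+\langle\tau_2,c(\tau_1,\tau_3)\rangle+\langle\tau_3,c(\tau_1,\tau_2)\rangle,$$ $$d_{Lie}c(\tau_1,\tau_2,\tau_3)=-\tfrac12\partial\{\langle[\tau_1,\tau_2],\tau_3\rangle+\langle[\tau_1,\tau_3],\tau_2\rangle-\langle[\tau_2,\tau_3],\tau_1\rangle-\tau_1\langle\tau_2,\tau_3\rangle+\tau_2\langle\tau_1,\tau_3\rangle-2\langle\tau_3,c(\tau_1,\tau_2)\rangle\},$$ where $d_{Lie}c(\tau_1,\tau_2,\tau_3)=\tau_1c(\tau_2,\tau_3)-\tau_2c(\tau_1,\tau_3)+\tau_3c(\tau_1,\tau_2)-c([\tau_1,\tau_2],\tau_3)+c([\tau_1,\tau_3],\tau_2)-c([\tau_2,\tau_3],\tau_1)$.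 On $A$ (weight $0$) and $T\oplus\Omega$ (weight $1$) it defines the operations of a $1$-truncated vertex algebra: $\mathbf 1=1_A$, $\partial:A\to\Omega\subset T\oplus\Omega$, $a_{(-1)}b=ab$, $a_{(-1)}\omega=a\omega$, $a_{(-1)}\tau=a\tau-\gamma(a,\tau)$, $\tau_{(0)}a=\tau(a)$, $\omega_{(0)}a=0$, $\tau_{(0)}\omega=\tau(\omega)$, $\omega_{(0)}\tau=-\tau(\omega)+\partial\langle\tau,\omega\rangle$, $\omega_{(0)}\omega'=0$, $\tau_{(0)}\tau'=[\tau,\tau']-c(\tau,\tau')+\frac12\partial\langle\tau,\tau'\rangle$, $x_{(1)}y=\langle x,y\rangle$. A morphism $\mathcal A\to\mathcal A'$ is a pair of maps $A\to A'$ and $T\oplus\Omega\to T'\oplus\Omega'$ preserving these operations and mapping $\Omega$ to $\Omega'$. The *vertex envelope* $U\mathcal A$ is the vertex algebra freely generated by this $1$-truncated vertex algebra: it carries a map from $(A,T\oplus\Omega)$ to its weights $0,1$ which preserves the operations and is universal among such maps to vertex algebras. A *monomial* is an element $x^p\cdot(x^{p-1}\cdot(\cdots\cdot x^1))$ of $U\mathcal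 A$ whose letters $x^i$ are of the form $\partial^{(j)}a$, $\partial^{(j)}\omega$ or $\partial^{(j)}\tau$ ($a\in A$, $\omega\in\Omega$, $\tau\in T$, $j\ge0$). Let $F_iU\mathcal A$ be the $k$-span of the monomials with at most $i$ letters of the form $\partial^{(j)}\tau$, and $F_{-1}=0$. Let $\mathcal A^{ab}$ be the pair formed by $A$ and the derivation $A\to T\oplus\Omega$, $a\mapsto(0,\partial a)$, and let $J=J(\mathcal A^{ab})$ be its jet algebra, the universal $\partial$-algebra with a $k$-algebra map $A\to J_0$ and an $A$-linear map $T\oplus\Omega\to J_1$ compatible with $\partial$. Let $J^+=\bigoplus_{i\ge1}J_i$. For $i,p\ge0$ let $H_{i,p}U\mathcal A$ be $F_{i-1}U\mathcal A$ plus the $k$-span of the monomials with exactly $i$ letters of the form $\partial^{(j)}\tau$ and at least $p$ letters which are not of the form $\partial^{(0)}a$. Thus $F_{i-1}\subset\dots\subset H_{i,2}\subset H_{i,1}\subset H_{i,0}=F_i$. Put $\mathrm{gr}_FU\mathcal A=\bigoplus_iF_i/F_{i-1}$ and $\mathrm{gr}_HU\mathcal A=\bigoplus_{i,p}H_{i,p}/H_{i,p+1}$.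 **Theorem 9.16.** Let $k\supset\mathbb Q$ and let $\mathcal A$ be a vertex algebroid over $k$ such that $T$ and $\Omega$ are free $A$-modules. 1. The vacuum, the operation $x\cdot y$, the operators $\partial^{(j)}$ and the conformal weight of $U\mathcal A$ induce a $\partial$-algebra structure on $\mathrm{gr}_FU\mathcal A$. There is a unique morphism of $\partial$-algebras $J(\mathcal A^{ab})\to\mathrm{gr}_FU\mathcal A$ which sends $a\in A$ and $\omega\in\Omega$ to their classes in $F_0$ and $\tau\in T$ to its class in $F_1/F_0$, and it is an isomorphism. Under it, $H$ is the refinement of $F$ by the $J^+$-adic filtration: an element $x\in F_i$ lies in $H_{i,p}$ if and only if its class in $F_i/F_{i-1}$ lies in the image of $(J^+)^p$. 2. The same data induce a $\partial$-algebra structure on $\mathrm{gr}_HU\mathcal A$. Let $T^{(i)},\Omega^{(i)}$ be copies of $T,\Omega$. There is a unique morphism of algebras $$\mathrm{Sym}_A\Bigl\{\bigl(\bigoplus_{i\ge1}T^{(i)}\bigr)\oplus\bigl(\bigoplus_{i\ge1}\Omega^{(i)}\bigr)\Bigr\}\longrightarrow\mathrm{gr}_HU\mathcal A$$ sending $a$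 to the class of $a$ in $H_{0,0}/H_{0,1}$, $\tau^{(i)}$ to the class of $\partial^{(i-1)}\tau$ in $H_{1,1}/H_{1,2}$ and $\omega^{(i)}$ to the class of $\partial^{(i-1)}\omega$ in $H_{0,1}/H_{0,2}$. It is an isomorphism, and it is compatible with the $\partial^{(j)}$, where $\partial^{(j)}a=0$ and $\partial^{(j)}x^{(i)}=\binom{i+j-1}{j}x^{(i+j)}$ for $j\ge1$. 3. $H$ is compatible with the conformal grading: each $H_{i,p}$ is the sum of its homogeneous components. It is finite on each component of fixed conformal weight $n$: $U\mathcal A_n\subset H_{n,0}$, $U\mathcal A_n\cap H_{0,n+1}=0$, and $U\mathcal A_n\cap H_{i+1,p}=U\mathcal A_n\cap H_{i,0}$ for all $i\ge0$, $p>n$. 4. $H$ is functorial: for every morphism of vertex algebroids $\mathcal A\to\mathcal A'$, the induced morphism $U\mathcal A\to U\mathcal A'$ maps $H_{i,p}U\mathcal A$ into $H_{i,p}U\mathcal A'$ for all $i,p$. -/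

import Mathlib

/-- A `ℤ≥0`-graded vertex algebra over `k` with underlying module `V`: a grading `V = ⨁ wt i`,
a vacuum vector of weight `0`, and bilinear operations `op n a b = a_(n) b` of degree `-n - 1`.
The sums in the Borcherds identity have only finitely many nonzero terms, because
`a_(n) b = 0` for `n` large. -/
structure VertexAlgebra (k V : Type*) [CommRing k] [AddCommGroup V] [Module k V] where
  wt : ℕ → Submodule k V
  isInternal : DirectSum.IsInternal wt
  vac : V
  vac_mem : vac ∈ wt 0
  op : ℤ → V →ₗ[k] V →ₗ[k] V
  op_mem : ∀ {i j m : ℕ} {n : ℤ} {a b : V}, a ∈ wt i → b ∈ wt j →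
    (m : ℤ) = i + j - n - 1 → op n a b ∈ wt m
  op_eq_zero : ∀ {i j : ℕ} {n : ℤ} {a b : V}, a ∈ wt i → b ∈ wt j →
    (i : ℤ) + j - n - 1 < 0 → op n a b = 0
  vac_op : ∀ (n : ℤ) (a : V), op n vac a = if n = -1 then a else 0
  op_vac : ∀ a : V, op (-1) a vac = a
  op_vac_of_nonneg : ∀ (n : ℤ) (a : V), 0 ≤ n → op n a vac = 0
  borcherds : ∀ (a b c : V) (m n l : ℤ),
    ∑ᶠ j : ℕ, Ring.choose m j • op (m + l - j) (op (n + j) a b) c =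
    ∑ᶠ j : ℕ, ((-1 : ℤ) ^ j * Ring.choose n j) •
      (op (m + n - j) a (op (l + j) b c) -
        (n.negOnePow : ℤ) • op (n + l - j) b (op (m + j) a c))

namespace VertexAlgebra

variable {k V W : Type*} [CommRing k] [AddCommGroup V] [Module k V]
  [AddCommGroup W] [Module k W]

/-- The operators `∂^(j) a = a_(-1-j) 1`. -/
def der (𝒱 : VertexAlgebra k V) (j : ℕ) : V →ₗ[k] V := (𝒱.op (-1 - j)).flip 𝒱.vac

/-- Morphisms of graded vertex algebras. -/
structure IsHom (𝒱 : VertexAlgebra k V) (𝒲 : VertexAlgebra k W) (f : V →ₗ[k] W) : Prop where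
  map_vac : f 𝒱.vac = 𝒲.vac
  map_op : ∀ (n : ℤ) (a b : V), f (𝒱.op n a b) = 𝒲.op n (f a) (f b)
  map_wt : ∀ (i : ℕ) (a : V), a ∈ 𝒱.wt i → f a ∈ 𝒲.wt i

end VertexAlgebra

/-- A vertex algebroid `(A, T, Ω, ∂, γ, ⟨ , ⟩, c)` over a ring `k` containing `1/2`.
Here `T` is a Lie `A`-algebroid (a Lie–Rinehart algebra), acting on the `A`-module `Ω`.
The symmetric pairing on `T ⊕ Ω`, which vanishes on `Ω × Ω`, is given by its restrictions `pairT`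
to `T × T` and `pair` to `T × Ω`. -/
structure VertexAlgebroid (k A T Ω : Type*) [CommRing k] [Invertible (2 : k)]
    [CommRing A] [Algebra k A]
    [LieRing T] [LieAlgebra k T] [Module A T] [LieRingModule T A] [LieRinehartRing A T]
    [LieRinehartAlgebra k A T]
    [AddCommGroup Ω] [Module k Ω] [Module A Ω] [IsScalarTower k A Ω]
    [LieRingModule T Ω] [LieModule k T Ω] where
  d : Derivation k A Ω
  pair : T →ₗ[A] Ω →ₗ[A] A
  pairT : T →ₗ[k] T →ₗ[k] A
  c : T →ₗ[k] T →ₗ[k] Ω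
  γ : A →ₗ[k] T →ₗ[k] Ω
  d_lie : ∀ (τ : T) (a : A), d ⁅τ, a⁆ = ⁅τ, d a⁆
  pair_d : ∀ (τ : T) (a : A), pair τ (d a) = ⁅τ, a⁆
  lie_smul' : ∀ (τ : T) (a : A) (ω : Ω), ⁅τ, a • ω⁆ = ⁅τ, a⁆ • ω + a • ⁅τ, ω⁆
  smul_lie' : ∀ (a : A) (τ : T) (ω : Ω), ⁅a • τ, ω⁆ = a • ⁅τ, ω⁆ + pair τ ω • d a
  lie_pair : ∀ (τ ν : T) (ω : Ω), ⁅τ, pair ν ω⁆ = pair ⁅τ, ν⁆ ω + pair ν ⁅τ, ω⁆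
  pairT_symm : ∀ τ ν : T, pairT τ ν = pairT ν τ
  c_skew : ∀ τ ν : T, c τ ν = -c ν τ
  γ_smul : ∀ (a b : A) (τ : T),
    γ a (b • τ) = γ (a * b) τ - a • γ b τ - ⁅τ, a⁆ • d b - ⁅τ, b⁆ • d a
  pairT_smul : ∀ (a : A) (τ₁ τ₂ : T),
    pairT (a • τ₁) τ₂ = a * pairT τ₁ τ₂ + pair τ₂ (γ a τ₁) - ⁅τ₁, ⁅τ₂, a⁆⁆
  c_smul : ∀ (a : A) (τ₁ τ₂ : T),
    c (a • τ₁) τ₂ = a • c τ₁ τ₂ + γ a ⁅τ₁, τ₂⁆ - γ ⁅τ₂, a⁆ τ₁ + ⁅τ₂, γ a τ₁⁆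
      - (⅟2 : k) • (pairT τ₁ τ₂ • d a) + (⅟2 : k) • d ⁅τ₁, ⁅τ₂, a⁆⁆
      - (⅟2 : k) • d (pair τ₂ (γ a τ₁))
  lie_pairT : ∀ τ₁ τ₂ τ₃ : T,
    pairT ⁅τ₁, τ₂⁆ τ₃ + pairT τ₂ ⁅τ₁, τ₃⁆ =
      ⁅τ₁, pairT τ₂ τ₃⁆ - (⅟2 : k) • ⁅τ₂, pairT τ₁ τ₃⁆ - (⅟2 : k) • ⁅τ₃, pairT τ₁ τ₂⁆
      + pair τ₂ (c τ₁ τ₃) + pair τ₃ (c τ₁ τ₂)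
  /-- The left hand side is the Lie algebra cochain differential of `c`. -/
  lie_c : ∀ τ₁ τ₂ τ₃ : T,
    ⁅τ₁, c τ₂ τ₃⁆ - ⁅τ₂, c τ₁ τ₃⁆ + ⁅τ₃, c τ₁ τ₂⁆
      - c ⁅τ₁, τ₂⁆ τ₃ + c ⁅τ₁, τ₃⁆ τ₂ - c ⁅τ₂, τ₃⁆ τ₁ =
    -(⅟2 : k) • d (pairT ⁅τ₁, τ₂⁆ τ₃ + pairT ⁅τ₁, τ₃⁆ τ₂ - pairT ⁅τ₂, τ₃⁆ τ₁
      - ⁅τ₁, pairT τ₂ τ₃⁆ + ⁅τ₂, pairT τ₁ τ₃⁆ - (2 : k) • pair τ₃ (c τ₁ τ₂))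

namespace VertexAlgebroid

variable {k A T Ω : Type*} [CommRing k] [Invertible (2 : k)]
    [CommRing A] [Algebra k A]
    [LieRing T] [LieAlgebra k T] [Module A T] [LieRingModule T A] [LieRinehartRing A T]
    [LieRinehartAlgebra k A T]
    [AddCommGroup Ω] [Module k Ω] [Module A Ω] [IsScalarTower k A Ω]
    [LieRingModule T Ω] [LieModule k T Ω]

/-! The operations of the `1`-truncated vertex algebra with components `A` (weight `0`) and
`T × Ω` (weight `1`) attached to a vertex algebroid. -/

/-- `∂ : A → T ⊕ Ω`. -/
def del (𝒜 : VertexAlgebroid k A T Ω) (a : A) : T × Ω := (0, 𝒜.d a)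

/-- `a_(-1) x` for `a ∈ A`, `x ∈ T ⊕ Ω`. -/
def nprod (𝒜 : VertexAlgebroid k A T Ω) (a : A) (x : T × Ω) : T × Ω :=
  (a • x.1, a • x.2 - 𝒜.γ a x.1)

/-- `x_(0) a` for `a ∈ A`, `x ∈ T ⊕ Ω`. -/
def act (_𝒜 : VertexAlgebroid k A T Ω) (x : T × Ω) (a : A) : A := ⁅x.1, a⁆

/-- `x_(0) y` for `x, y ∈ T ⊕ Ω`: for `x = τ`, `y = τ'` it is
`[τ, τ'] - c(τ, τ') + ½ ∂⟨τ, τ'⟩`, moreover `τ_(0) ω = τ(ω)`, `ω_(0) τ = -τ(ω) + ∂⟨τ, ω⟩`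
and `ω_(0) ω' = 0`. -/
def bracket (𝒜 : VertexAlgebroid k A T Ω) (x y : T × Ω) : T × Ω :=
  (⁅x.1, y.1⁆, -𝒜.c x.1 y.1 + (⅟2 : k) • 𝒜.d (𝒜.pairT x.1 y.1)
    + ⁅x.1, y.2⁆ - ⁅y.1, x.2⁆ + 𝒜.d (𝒜.pair y.1 x.2))

/-- `x_(1) y = ⟨x, y⟩` for `x, y ∈ T ⊕ Ω`. -/
def form (𝒜 : VertexAlgebroid k A T Ω) (x y : T × Ω) : A :=
  𝒜.pairT x.1 y.1 + 𝒜.pair x.1 y.2 + 𝒜.pair y.1 x.2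

end VertexAlgebroid

/-- If linear maps `p i` restrict to the identity on `S i` and vanish on `S j` for `j ≠ i`, and the
`S i` span the module, then the module is the internal direct sum of the `S i`. -/
theorem isInternal_of_projections {k V : Type*} [CommRing k] [AddCommGroup V] [Module k V]
    (S : ℕ → Submodule k V) (p : ℕ → V →ₗ[k] V)
    (h₁ : ∀ i, ∀ x ∈ S i, p i x = x) (h₂ : ∀ i j, i ≠ j → ∀ x ∈ S j, p i x = 0)
    (h₃ : ⨆ i, S i = ⊤) : DirectSum.IsInternal S := by
  rw [DirectSum.isInternal_submodule_iff_iSupIndep_and_iSup_eq_top]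
  refine ⟨?_, h₃⟩
  intro i
  rw [Submodule.disjoint_def]
  intro x hx hx'
  have : (⨆ j, ⨆ (_ : j ≠ i), S j) ≤ LinearMap.ker (p i) :=
    iSup₂_le fun j hj y hy => LinearMap.mem_ker.2 (h₂ i j hj.symm y hy)
  rw [← h₁ i x hx]
  exact LinearMap.mem_ker.1 (this hx')

/-- Formal nonassociative monomials in generators `X`, the vacuum, and the operations `_(n)`. -/
inductive VTerm (X : Type*) where
  | gen (x : X) : VTerm X
  | vac : VTerm X
  | op (n : ℤ) (s t : VTerm X) : VTerm X

namespace VTerm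

variable {X : Type*}

/-- The conformal weight of a formal monomial, for given weights of the generators. -/
def wt (w : X → ℤ) : VTerm X → ℤ
  | gen x => w x
  | vac => 0
  | op n s t => wt w s + wt w t - n - 1

variable (k : Type*) [CommRing k]

/-- The operations `_(n)` on formal linear combinations of monomials. -/
noncomputable def fop (n : ℤ) : (VTerm X →₀ k) →ₗ[k] (VTerm X →₀ k) →ₗ[k] (VTerm X →₀ k) :=
  Finsupp.linearCombination k fun s =>
    Finsupp.linearCombination k fun t => Finsupp.single (op n s t) (1 : k)

theorem fop_single (n : ℤ) (s t : VTerm X) (a b : k) :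
    fop k n (Finsupp.single s a) (Finsupp.single t b) = Finsupp.single (op n s t) (a * b) := by
  simp [fop]

/-- The component of weight `i` of a formal linear combination of monomials. -/
noncomputable def proj (w : X → ℤ) (i : ℤ) : (VTerm X →₀ k) →ₗ[k] (VTerm X →₀ k) :=
  Finsupp.linearCombination k fun s => if wt w s = i then Finsupp.single s (1 : k) else 0

theorem proj_single (w : X → ℤ) (i : ℤ) (s : VTerm X) (a : k) :
    proj k w i (Finsupp.single s a) = if wt w s = i then Finsupp.single s a else 0 := by
  simp [proj]

theorem proj_fop (w : X → ℤ) (i n : ℤ) (x : VTerm X →₀ k) (t : VTerm X) (b : k) :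
    proj k w i (fop k n x (Finsupp.single t b)) =
      fop k n (proj k w (i - wt w t + n + 1) x) (Finsupp.single t b) := by
  induction x using Finsupp.induction_linear with
  | zero => simp
  | add x y hx hy => simp only [map_add, LinearMap.add_apply, hx, hy]
  | single s a =>
    rw [fop_single, proj_single, proj_single]
    have : wt w (op n s t) = i ↔ wt w s = i - wt w t + n + 1 := by
      simp only [wt]; omega
    by_cases h : wt w s = i - wt w t + n + 1
    · rw [if_pos h, if_pos (this.2 h), fop_single]
    · rw [if_neg h, if_neg (fun h' => h (this.1 h'))]; simp

theorem proj_fop' (w : X → ℤ) (i n : ℤ) (x : VTerm X →₀ k) (t : VTerm X) (b : k) :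
    proj k w i (fop k n (Finsupp.single t b) x) =
      fop k n (Finsupp.single t b) (proj k w (i - wt w t + n + 1) x) := by
  induction x using Finsupp.induction_linear with
  | zero => simp
  | add x y hx hy => simp only [map_add, hx, hy]
  | single s a =>
    rw [fop_single, proj_single, proj_single]
    have : wt w (op n t s) = i ↔ wt w s = i - wt w t + n + 1 := by
      simp only [wt]; omega
    by_cases h : wt w s = i - wt w t + n + 1
    · rw [if_pos h, if_pos (this.2 h), fop_single]
    · rw [if_neg h, if_neg (fun h' => h (this.1 h'))]; simp

end VTerm

namespace VertexAlgebroid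

open VTerm

variable {k A T Ω : Type*} [CommRing k] [Invertible (2 : k)]
    [CommRing A] [Algebra k A]
    [LieRing T] [LieAlgebra k T] [Module A T] [LieRingModule T A] [LieRinehartRing A T]
    [LieRinehartAlgebra k A T]
    [AddCommGroup Ω] [Module k Ω] [Module A Ω] [IsScalarTower k A Ω]
    [LieRingModule T Ω] [LieModule k T Ω]

/-- Generators of the vertex envelope: `A` in weight `0` and `T × Ω` in weight `1`. -/
abbrev Gen (_𝒜 : VertexAlgebroid k A T Ω) := A ⊕ (T × Ω)

/-- The weight of a generator. -/
def genWt (𝒜 : VertexAlgebroid k A T Ω) : 𝒜.Gen → ℤ := Sum.elim (fun _ => 0) (fun _ => 1)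

/-- Formal linear combinations of monomials in the generators. -/
abbrev FreeV (𝒜 : VertexAlgebroid k A T Ω) := VTerm 𝒜.Gen →₀ k

/-- A formal monomial as an element of `FreeV`. -/
noncomputable abbrev mon (𝒜 : VertexAlgebroid k A T Ω) (t : VTerm 𝒜.Gen) : 𝒜.FreeV :=
  Finsupp.single t 1

/-- The generator `a ∈ A`. -/
noncomputable abbrev g₀ (𝒜 : VertexAlgebroid k A T Ω) (a : A) : 𝒜.FreeV :=
  𝒜.mon (gen (Sum.inl a))

/-- The generator `x ∈ T ⊕ Ω`. -/
noncomputable abbrev g₁ (𝒜 : VertexAlgebroid k A T Ω) (x : T × Ω) : 𝒜.FreeV :=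
  𝒜.mon (gen (Sum.inr x))

/-- Left hand side of the Borcherds identity, truncated to `j < N`. -/
noncomputable def borL (𝒜 : VertexAlgebroid k A T Ω) (N : ℕ) (m n l : ℤ) (x y z : 𝒜.FreeV) :
    𝒜.FreeV :=
  ∑ j ∈ Finset.range N, Ring.choose m j • fop k (m + l - j) (fop k (n + j) x y) z

/-- Right hand side of the Borcherds identity, truncated to `j < N`. -/
noncomputable def borR (𝒜 : VertexAlgebroid k A T Ω) (N : ℕ) (m n l : ℤ) (x y z : 𝒜.FreeV) :
    𝒜.FreeV :=
  ∑ j ∈ Finset.range N, ((-1 : ℤ) ^ j * Ring.choose n j) •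
    (fop k (m + n - j) x (fop k (l + j) y z) -
      (n.negOnePow : ℤ) • fop k (n + l - j) y (fop k (m + j) x z))

/-- The defining relations of the vertex envelope: the axioms of a `ℤ≥0`-graded vertex algebra
(in the Borcherds identity for monomials `s, t, u` all terms with `j ≥ N` have a factor of negative
weight), and the relations expressing that the generators form the `1`-truncated vertex algebra
of the vertex algebroid. -/
inductive Rel (𝒜 : VertexAlgebroid k A T Ω) : 𝒜.FreeV → Prop
  | neg_wt (t : VTerm 𝒜.Gen) : wt 𝒜.genWt t < 0 → Rel 𝒜 (𝒜.mon t)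
  | vac_op (t : VTerm 𝒜.Gen) : Rel 𝒜 (𝒜.mon (op (-1) vac t) - 𝒜.mon t)
  | vac_op_ne (n : ℤ) (t : VTerm 𝒜.Gen) : n ≠ -1 → Rel 𝒜 (𝒜.mon (op n vac t))
  | op_vac (t : VTerm 𝒜.Gen) : Rel 𝒜 (𝒜.mon (op (-1) t vac) - 𝒜.mon t)
  | op_vac_of_nonneg (n : ℤ) (t : VTerm 𝒜.Gen) : 0 ≤ n → Rel 𝒜 (𝒜.mon (op n t vac))
  | borcherds (m n l : ℤ) (s t u : VTerm 𝒜.Gen) (N : ℕ)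
      (h₁ : wt 𝒜.genWt s + wt 𝒜.genWt t - n ≤ N)
      (h₂ : wt 𝒜.genWt t + wt 𝒜.genWt u - l ≤ N)
      (h₃ : wt 𝒜.genWt s + wt 𝒜.genWt u - m ≤ N) :
      Rel 𝒜 (𝒜.borL N m n l (𝒜.mon s) (𝒜.mon t) (𝒜.mon u)
        - 𝒜.borR N m n l (𝒜.mon s) (𝒜.mon t) (𝒜.mon u))
  | add₀ (a b : A) : Rel 𝒜 (𝒜.g₀ (a + b) - 𝒜.g₀ a - 𝒜.g₀ b)
  | smul₀ (r : k) (a : A) : Rel 𝒜 (𝒜.g₀ (r • a) - r • 𝒜.g₀ a)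
  | add₁ (x y : T × Ω) : Rel 𝒜 (𝒜.g₁ (x + y) - 𝒜.g₁ x - 𝒜.g₁ y)
  | smul₁ (r : k) (x : T × Ω) : Rel 𝒜 (𝒜.g₁ (r • x) - r • 𝒜.g₁ x)
  | one : Rel 𝒜 (𝒜.g₀ 1 - 𝒜.mon vac)
  | mul (a b : A) : Rel 𝒜 (fop k (-1) (𝒜.g₀ a) (𝒜.g₀ b) - 𝒜.g₀ (a * b))
  | nprod (a : A) (x : T × Ω) : Rel 𝒜 (fop k (-1) (𝒜.g₀ a) (𝒜.g₁ x) - 𝒜.g₁ (𝒜.nprod a x))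
  | del (a : A) : Rel 𝒜 (fop k (-2) (𝒜.g₀ a) (𝒜.mon vac) - 𝒜.g₁ (𝒜.del a))
  | act (x : T × Ω) (a : A) : Rel 𝒜 (fop k 0 (𝒜.g₁ x) (𝒜.g₀ a) - 𝒜.g₀ (𝒜.act x a))
  | bracket (x y : T × Ω) :
      Rel 𝒜 (fop k 0 (𝒜.g₁ x) (𝒜.g₁ y) - 𝒜.g₁ (𝒜.bracket x y))
  | form (x y : T × Ω) : Rel 𝒜 (fop k 1 (𝒜.g₁ x) (𝒜.g₁ y) - 𝒜.g₀ (𝒜.form x y))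

/-- Membership in the smallest vertex ideal (submodule closed under all operations with arbitrary
elements, on both sides) containing the defining relations. -/
inductive IdealMem (𝒜 : VertexAlgebroid k A T Ω) : 𝒜.FreeV → Prop
  | of_rel (x : 𝒜.FreeV) : 𝒜.Rel x → IdealMem 𝒜 x
  | zero : IdealMem 𝒜 0
  | add (x y : 𝒜.FreeV) : IdealMem 𝒜 x → IdealMem 𝒜 y → IdealMem 𝒜 (x + y)
  | smul (r : k) (x : 𝒜.FreeV) : IdealMem 𝒜 x → IdealMem 𝒜 (r • x)
  | fop_left (n : ℤ) (x y : 𝒜.FreeV) : IdealMem 𝒜 x → IdealMem 𝒜 (fop k n x y)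
  | fop_right (n : ℤ) (x y : 𝒜.FreeV) : IdealMem 𝒜 y → IdealMem 𝒜 (fop k n x y)

/-- The vertex ideal generated by the defining relations. -/
def relIdeal (𝒜 : VertexAlgebroid k A T Ω) : Submodule k 𝒜.FreeV where
  carrier := {x | 𝒜.IdealMem x}
  add_mem' hx hy := .add _ _ hx hy
  zero_mem' := .zero
  smul_mem' r _ hx := .smul r _ hx

/-- The vertex envelope `U𝒜` of a vertex algebroid: the vertex algebra generated by the
`1`-truncated vertex algebra `(A, T ⊕ Ω)` of the vertex algebroid, i.e. the value at `𝒜` of the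
left adjoint of the truncation of vertex algebras to weights `0, 1`
(see `Envelope.lift`). -/
abbrev Envelope (𝒜 : VertexAlgebroid k A T Ω) := 𝒜.FreeV ⧸ 𝒜.relIdeal

namespace Envelope

theorem genWt_inl (𝒜 : VertexAlgebroid k A T Ω) (a : A) : 𝒜.genWt (Sum.inl a) = 0 := rfl

theorem genWt_inr (𝒜 : VertexAlgebroid k A T Ω) (x : T × Ω) : 𝒜.genWt (Sum.inr x) = 1 := rfl

variable (𝒜 : VertexAlgebroid k A T Ω)

/-- The class of a formal combination of monomials in the envelope. -/
noncomputable def mk : 𝒜.FreeV →ₗ[k] 𝒜.Envelope := 𝒜.relIdeal.mkQ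

theorem mk_surjective : Function.Surjective (mk 𝒜) := 𝒜.relIdeal.mkQ_surjective

theorem mk_eq_zero {x : 𝒜.FreeV} : mk 𝒜 x = 0 ↔ 𝒜.IdealMem x :=
  Submodule.Quotient.mk_eq_zero _

theorem mk_rel {x : 𝒜.FreeV} (h : 𝒜.Rel x) : mk 𝒜 x = 0 := (mk_eq_zero 𝒜).2 (.of_rel _ h)

theorem mk_rel_sub {x y : 𝒜.FreeV} (h : 𝒜.Rel (x - y)) : mk 𝒜 x = mk 𝒜 y := by
  rw [← sub_eq_zero, ← map_sub]; exact mk_rel 𝒜 h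

/-- The operations `_(n)` on the envelope. -/
noncomputable def op (n : ℤ) : 𝒜.Envelope →ₗ[k] 𝒜.Envelope →ₗ[k] 𝒜.Envelope :=
  𝒜.relIdeal.liftQ
    (LinearMap.mk₂ k (fun x y => 𝒜.relIdeal.mapQ 𝒜.relIdeal (fop k n x)
        (fun z hz => IdealMem.fop_right n x z hz) y)
      (by
        intro x x' y
        obtain ⟨y, rfl⟩ := mk_surjective 𝒜 y
        exact congrArg (mk 𝒜) (by simp))
      (by
        intro r x y
        obtain ⟨y, rfl⟩ := mk_surjective 𝒜 y
        exact congrArg (mk 𝒜) (by simp))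
      (by intro x y y'; exact map_add _ _ _)
      (by intro r x y; exact map_smul _ _ _))
    (by
      intro x hx
      rw [LinearMap.mem_ker]
      ext y
      exact (mk_eq_zero 𝒜).2 (IdealMem.fop_left n x _ hx))

theorem op_mk (n : ℤ) (x y : 𝒜.FreeV) : op 𝒜 n (mk 𝒜 x) (mk 𝒜 y) = mk 𝒜 (fop k n x y) := rfl

theorem op_mon (n : ℤ) (s t : VTerm 𝒜.Gen) :
    op 𝒜 n (mk 𝒜 (𝒜.mon s)) (mk 𝒜 (𝒜.mon t)) = mk 𝒜 (𝒜.mon (.op n s t)) := by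
  rw [op_mk, fop_single, mul_one]

theorem mon_neg {t : VTerm 𝒜.Gen} (h : wt 𝒜.genWt t < 0) : mk 𝒜 (𝒜.mon t) = 0 :=
  mk_rel 𝒜 (.neg_wt t h)

/-- Induction over the spanning set of monomials. -/
theorem induction {P : 𝒜.Envelope → Prop} (zero : P 0) (add : ∀ x y, P x → P y → P (x + y))
    (smul : ∀ (r : k) x, P x → P (r • x)) (mon : ∀ t, P (mk 𝒜 (𝒜.mon t)))
    (x : 𝒜.Envelope) : P x := by
  obtain ⟨x, rfl⟩ := mk_surjective 𝒜 x
  induction x using Finsupp.induction_linear with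
  | zero => simpa using zero
  | add x y hx hy => rw [map_add]; exact add _ _ hx hy
  | single t r =>
    have : Finsupp.single t r = r • 𝒜.mon t := by simp
    rw [this, map_smul]; exact smul r _ (mon t)

/-- The weight `i` part of the envelope, `i ∈ ℤ≥0`. -/
noncomputable def wtSpace (i : ℕ) : Submodule k 𝒜.Envelope :=
  Submodule.span k {x | ∃ t : VTerm 𝒜.Gen, VTerm.wt 𝒜.genWt t = i ∧ x = mk 𝒜 (𝒜.mon t)}

/-- Homogeneous elements of weight `d`. -/
def IsHomog (d : ℤ) (x : 𝒜.FreeV) : Prop :=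
  ∀ i : ℤ, proj k 𝒜.genWt i x = if d = i then x else 0

variable {𝒜}

theorem IsHomog.mon {t : VTerm 𝒜.Gen} {d : ℤ} (h : wt 𝒜.genWt t = d) :
    IsHomog 𝒜 d (𝒜.mon t) := by
  subst h; exact fun i => proj_single _ _ _ _ _

theorem IsHomog.g₀ (a : A) : IsHomog 𝒜 0 (𝒜.g₀ a) := .mon rfl

theorem IsHomog.g₁ (x : T × Ω) : IsHomog 𝒜 1 (𝒜.g₁ x) := .mon rfl

theorem IsHomog.zero {d : ℤ} : IsHomog 𝒜 d 0 := fun i => by simp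

theorem IsHomog.add {d : ℤ} {x y : 𝒜.FreeV} (hx : IsHomog 𝒜 d x) (hy : IsHomog 𝒜 d y) :
    IsHomog 𝒜 d (x + y) := fun i => by rw [map_add, hx i, hy i]; split_ifs <;> simp

theorem IsHomog.sub {d : ℤ} {x y : 𝒜.FreeV} (hx : IsHomog 𝒜 d x) (hy : IsHomog 𝒜 d y) :
    IsHomog 𝒜 d (x - y) := fun i => by rw [map_sub, hx i, hy i]; split_ifs <;> simp

theorem IsHomog.smul {d : ℤ} {x : 𝒜.FreeV} (hx : IsHomog 𝒜 d x) (r : k) :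
    IsHomog 𝒜 d (r • x) := fun i => by rw [map_smul, hx i]; split_ifs <;> simp

theorem IsHomog.zsmul {d : ℤ} {x : 𝒜.FreeV} (hx : IsHomog 𝒜 d x) (r : ℤ) :
    IsHomog 𝒜 d (r • x) := fun i => by rw [map_zsmul, hx i]; split_ifs <;> simp

theorem IsHomog.sum {d : ℤ} {N : ℕ} {f : ℕ → 𝒜.FreeV} (h : ∀ j, IsHomog 𝒜 d (f j)) :
    IsHomog 𝒜 d (∑ j ∈ Finset.range N, f j) :=
  Finset.sum_induction _ _ (fun _ _ => IsHomog.add) IsHomog.zero fun j _ => h j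

theorem IsHomog.fop {n d : ℤ} {s t : VTerm 𝒜.Gen}
    (h : wt 𝒜.genWt s + wt 𝒜.genWt t - n - 1 = d) :
    IsHomog 𝒜 d (fop k n (𝒜.mon s) (𝒜.mon t)) := by
  rw [fop_single, mul_one]; exact .mon h

theorem exists_isHomog_of_rel {x : 𝒜.FreeV} (h : 𝒜.Rel x) : ∃ d, IsHomog 𝒜 d x := by
  induction h with
  | neg_wt t h => exact ⟨_, .mon rfl⟩
  | vac_op t => exact ⟨wt 𝒜.genWt t, (IsHomog.mon (by simp [wt])).sub (.mon rfl)⟩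
  | vac_op_ne n t h => exact ⟨_, .mon rfl⟩
  | op_vac t => exact ⟨wt 𝒜.genWt t, (IsHomog.mon (by simp [wt])).sub (.mon rfl)⟩
  | op_vac_of_nonneg n t h => exact ⟨_, .mon rfl⟩
  | borcherds m n l s t u N h₁ h₂ h₃ =>
    refine ⟨wt 𝒜.genWt s + wt 𝒜.genWt t + wt 𝒜.genWt u - m - n - l - 2, ?_⟩
    simp only [borL, borR, fop_single, mul_one]
    refine (IsHomog.sum fun j => (IsHomog.mon ?_).zsmul _).sub
      (IsHomog.sum fun j => ((IsHomog.mon ?_).sub ((IsHomog.mon ?_).zsmul _)).zsmul _) <;>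
    · simp only [wt]; ring
  | add₀ a b => exact ⟨0, ((IsHomog.g₀ _).sub (.g₀ _)).sub (.g₀ _)⟩
  | smul₀ r a => exact ⟨0, (IsHomog.g₀ _).sub ((IsHomog.g₀ _).smul r)⟩
  | add₁ x y => exact ⟨1, ((IsHomog.g₁ _).sub (.g₁ _)).sub (.g₁ _)⟩
  | smul₁ r x => exact ⟨1, (IsHomog.g₁ _).sub ((IsHomog.g₁ _).smul r)⟩
  | one => exact ⟨0, (IsHomog.g₀ _).sub (.mon rfl)⟩
  | mul a b => exact ⟨0, (IsHomog.fop rfl).sub (.g₀ _)⟩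
  | nprod a x => exact ⟨1, (IsHomog.fop rfl).sub (.g₁ _)⟩
  | del a => exact ⟨1, (IsHomog.fop rfl).sub (.g₁ _)⟩
  | act x a => exact ⟨0, (IsHomog.fop rfl).sub (.g₀ _)⟩
  | bracket x y => exact ⟨1, (IsHomog.fop rfl).sub (.g₁ _)⟩
  | form x y => exact ⟨0, (IsHomog.fop rfl).sub (.g₀ _)⟩

variable (𝒜)

theorem proj_mem {x : 𝒜.FreeV} (h : 𝒜.IdealMem x) :
    ∀ i : ℤ, 𝒜.IdealMem (proj k 𝒜.genWt i x) := by
  induction h with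
  | of_rel x h =>
    intro i
    obtain ⟨d, hd⟩ := exists_isHomog_of_rel h
    rw [hd i]
    split_ifs
    · exact .of_rel _ h
    · exact .zero
  | zero => intro i; rw [map_zero]; exact .zero
  | add x y _ _ hx hy => intro i; rw [map_add]; exact .add _ _ (hx i) (hy i)
  | smul r x _ hx => intro i; rw [map_smul]; exact .smul r _ (hx i)
  | fop_left n x y _ hx =>
    intro i
    induction y using Finsupp.induction_linear with
    | zero => rw [map_zero, map_zero]; exact .zero
    | add y z hy hz => rw [map_add, map_add]; exact .add _ _ hy hz
    | single t b => rw [proj_fop]; exact .fop_left _ _ _ (hx _)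
  | fop_right n x y _ hy =>
    intro i
    induction x using Finsupp.induction_linear with
    | zero => rw [map_zero, LinearMap.zero_apply, map_zero]; exact .zero
    | add x z hx hz => rw [map_add, LinearMap.add_apply, map_add]; exact .add _ _ hx hz
    | single t b => rw [proj_fop']; exact .fop_right _ _ _ (hy _)

/-- The projection of the envelope to its weight `i` part. -/
noncomputable def wtProj (i : ℕ) : 𝒜.Envelope →ₗ[k] 𝒜.Envelope :=
  𝒜.relIdeal.mapQ 𝒜.relIdeal (proj k 𝒜.genWt i) fun _ hx => proj_mem 𝒜 hx i

theorem wtProj_mon (i : ℕ) (t : VTerm 𝒜.Gen) :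
    wtProj 𝒜 i (mk 𝒜 (𝒜.mon t)) = if wt 𝒜.genWt t = i then mk 𝒜 (𝒜.mon t) else 0 := by
  change mk 𝒜 (proj k 𝒜.genWt i (𝒜.mon t)) = _
  rw [proj_single]; split_ifs <;> simp

theorem isInternal : DirectSum.IsInternal (wtSpace 𝒜) := by
  refine isInternal_of_projections _ (wtProj 𝒜) ?_ ?_ ?_
  · intro i x hx
    induction hx using Submodule.span_induction with
    | mem x h => obtain ⟨t, ht, rfl⟩ := h; rw [wtProj_mon, if_pos ht]
    | zero => simp
    | add x y _ _ hx hy => rw [map_add, hx, hy]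
    | smul r x _ hx => rw [map_smul, hx]
  · intro i j hij x hx
    induction hx using Submodule.span_induction with
    | mem x h =>
      obtain ⟨t, ht, rfl⟩ := h
      rw [wtProj_mon, if_neg]
      rw [ht]; exact_mod_cast hij.symm
    | zero => simp
    | add x y _ _ hx hy => rw [map_add, hx, hy, add_zero]
    | smul r x _ hx => rw [map_smul, hx, smul_zero]
  · rw [eq_top_iff]
    rintro x -
    refine induction 𝒜 (zero_mem _) (fun _ _ => add_mem)
      (fun r _ => Submodule.smul_mem _ r) (fun t => ?_) x
    by_cases h : wt 𝒜.genWt t < 0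
    · rw [mon_neg 𝒜 h]; exact zero_mem _
    · obtain ⟨i, hi⟩ := Int.eq_ofNat_of_zero_le (not_lt.1 h)
      exact Submodule.mem_iSup_of_mem i (Submodule.subset_span ⟨t, hi, rfl⟩)

theorem op_mem_aux {i j : ℕ} {n : ℤ} {a b : 𝒜.Envelope} (S : Submodule k 𝒜.Envelope)
    (ha : a ∈ wtSpace 𝒜 i) (hb : b ∈ wtSpace 𝒜 j)
    (h : ∀ t : VTerm 𝒜.Gen, wt 𝒜.genWt t = i + j - n - 1 → mk 𝒜 (𝒜.mon t) ∈ S) :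
    op 𝒜 n a b ∈ S := by
  induction ha using Submodule.span_induction with
  | mem a ha =>
    obtain ⟨s, hs, rfl⟩ := ha
    induction hb using Submodule.span_induction with
    | mem b hb =>
      obtain ⟨t, ht, rfl⟩ := hb
      rw [op_mon]
      exact h _ (by simp [wt, hs, ht])
    | zero => simp
    | add x y _ _ hx hy => rw [map_add]; exact add_mem hx hy
    | smul r x _ hx => rw [map_smul]; exact Submodule.smul_mem _ _ hx
  | zero => simp
  | add x y _ _ hx hy => rw [map_add]; exact add_mem hx hy
  | smul r x _ hx => rw [map_smul]; exact Submodule.smul_mem _ _ hx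

theorem op_mem {i j m : ℕ} {n : ℤ} {a b : 𝒜.Envelope}
    (ha : a ∈ wtSpace 𝒜 i) (hb : b ∈ wtSpace 𝒜 j) (hm : (m : ℤ) = i + j - n - 1) :
    op 𝒜 n a b ∈ wtSpace 𝒜 m :=
  op_mem_aux 𝒜 _ ha hb fun t ht => Submodule.subset_span ⟨t, by rw [ht, hm], rfl⟩

theorem op_eq_zero {i j : ℕ} {n : ℤ} {a b : 𝒜.Envelope}
    (ha : a ∈ wtSpace 𝒜 i) (hb : b ∈ wtSpace 𝒜 j) (hm : (i : ℤ) + j - n - 1 < 0) :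
    op 𝒜 n a b = 0 := by
  have := op_mem_aux 𝒜 (n := n) ⊥ ha hb fun t ht => by
    rw [mon_neg 𝒜 (by rw [ht]; exact hm)]; exact zero_mem _
  simpa using this

/-- `x_(n) y = 0` for `n` large. -/
theorem op_eventually_zero (x y : 𝒜.Envelope) : ∃ N : ℤ, ∀ n, N ≤ n → op 𝒜 n x y = 0 := by
  induction x using induction 𝒜 with
  | zero => exact ⟨0, by simp⟩
  | add x x' hx hx' =>
    obtain ⟨N, hN⟩ := hx
    obtain ⟨N', hN'⟩ := hx'
    exact ⟨max N N', fun n hn => by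
      rw [map_add, LinearMap.add_apply, hN n (le_trans (le_max_left _ _) hn),
        hN' n (le_trans (le_max_right _ _) hn), add_zero]⟩
  | smul r x hx =>
    obtain ⟨N, hN⟩ := hx
    exact ⟨N, fun n hn => by rw [map_smul, LinearMap.smul_apply, hN n hn, smul_zero]⟩
  | mon s =>
    induction y using induction 𝒜 with
    | zero => exact ⟨0, by simp⟩
    | add x x' hx hx' =>
      obtain ⟨N, hN⟩ := hx
      obtain ⟨N', hN'⟩ := hx'
      exact ⟨max N N', fun n hn => by
        rw [map_add, hN n (le_trans (le_max_left _ _) hn),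
          hN' n (le_trans (le_max_right _ _) hn), add_zero]⟩
    | smul r x hx =>
      obtain ⟨N, hN⟩ := hx
      exact ⟨N, fun n hn => by rw [map_smul, hN n hn, smul_zero]⟩
    | mon t =>
      refine ⟨wt 𝒜.genWt s + wt 𝒜.genWt t, fun n hn => ?_⟩
      rw [op_mon, mon_neg]
      simp only [wt]; omega

/-- The difference of the `j`-th terms of the two sides of the Borcherds identity. -/
noncomputable def borTerm (m n l : ℤ) (j : ℕ) (x y z : 𝒜.Envelope) : 𝒜.Envelope :=
  Ring.choose m j • op 𝒜 (m + l - j) (op 𝒜 (n + j) x y) z -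
    ((-1 : ℤ) ^ j * Ring.choose n j) •
      (op 𝒜 (m + n - j) x (op 𝒜 (l + j) y z) -
        (n.negOnePow : ℤ) • op 𝒜 (n + l - j) y (op 𝒜 (m + j) x z))

open Filter in
theorem borTerm_eventually (x y z : 𝒜.Envelope) (m n l : ℤ) : ∀ᶠ N : ℕ in atTop,
    ∑ j ∈ Finset.range N, borTerm 𝒜 m n l j x y z = 0 := by
  have add_case : ∀ (u v w : ℕ → 𝒜.Envelope), (∀ j, w j = u j + v j) →
      (∀ᶠ N : ℕ in atTop, ∑ j ∈ Finset.range N, u j = 0) →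
      (∀ᶠ N : ℕ in atTop, ∑ j ∈ Finset.range N, v j = 0) →
      ∀ᶠ N : ℕ in atTop, ∑ j ∈ Finset.range N, w j = 0 := by
    intro u v w h hu hv
    filter_upwards [hu, hv] with N hu hv
    rw [Finset.sum_congr rfl fun j _ => h j, Finset.sum_add_distrib, hu, hv, add_zero]
  have smul_case : ∀ (r : k) (u w : ℕ → 𝒜.Envelope), (∀ j, w j = r • u j) →
      (∀ᶠ N : ℕ in atTop, ∑ j ∈ Finset.range N, u j = 0) →
      ∀ᶠ N : ℕ in atTop, ∑ j ∈ Finset.range N, w j = 0 := by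
    intro r u w h hu
    filter_upwards [hu] with N hu
    rw [Finset.sum_congr rfl fun j _ => h j, ← Finset.smul_sum, hu, smul_zero]
  induction x using induction 𝒜 with
  | zero => simp [borTerm]
  | add x x' hx hx' =>
    refine add_case _ _ _ (fun j => ?_) hx hx'
    simp only [borTerm, map_add, LinearMap.add_apply]; module
  | smul r x hx =>
    refine smul_case r _ _ (fun j => ?_) hx
    simp only [borTerm, map_smul, LinearMap.smul_apply]; module
  | mon s =>
    induction y using induction 𝒜 with
    | zero => simp [borTerm]
    | add y y' hx hx' =>
      refine add_case _ _ _ (fun j => ?_) hx hx'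
      simp only [borTerm, map_add, LinearMap.add_apply]; module
    | smul r x hx =>
      refine smul_case r _ _ (fun j => ?_) hx
      simp only [borTerm, map_smul, LinearMap.smul_apply]; module
    | mon t =>
      induction z using induction 𝒜 with
      | zero => simp [borTerm]
      | add y y' hx hx' =>
        refine add_case _ _ _ (fun j => ?_) hx hx'
        simp only [borTerm, map_add]; module
      | smul r x hx =>
        refine smul_case r _ _ (fun j => ?_) hx
        simp only [borTerm, map_smul]; module
      | mon u =>
        filter_upwards [eventually_ge_atTop (wt 𝒜.genWt s + wt 𝒜.genWt t - n).toNat,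
          eventually_ge_atTop (wt 𝒜.genWt t + wt 𝒜.genWt u - l).toNat,
          eventually_ge_atTop (wt 𝒜.genWt s + wt 𝒜.genWt u - m).toNat] with N h₁ h₂ h₃
        have := mk_rel_sub 𝒜 (Rel.borcherds m n l s t u N (by omega) (by omega) (by omega))
        simp only [borL, borR, map_sum, map_zsmul, map_sub, ← op_mk] at this
        simp only [borTerm]
        rw [Finset.sum_sub_distrib, this, sub_self]

end Envelope

end VertexAlgebroid

/-- A sum over `ℕ` with finitely many nonzero terms is the value of all large partial sums. -/
theorem finsum_eq_sum_range_of_le {M : Type*} [AddCommMonoid M] (f : ℕ → M) (N : ℕ)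
    (h : ∀ j, N ≤ j → f j = 0) : ∑ᶠ j, f j = ∑ j ∈ Finset.range N, f j :=
  finsum_eq_finsetSum_of_support_subset f fun j hj => by
    simp only [Finset.coe_range, Set.mem_Iio]
    by_contra hN
    exact hj (h j (not_lt.1 hN))

namespace VertexAlgebroid.Envelope

open VTerm

variable {k A T Ω : Type*} [CommRing k] [Invertible (2 : k)]
    [CommRing A] [Algebra k A]
    [LieRing T] [LieAlgebra k T] [Module A T] [LieRingModule T A] [LieRinehartRing A T]
    [LieRinehartAlgebra k A T]
    [AddCommGroup Ω] [Module k Ω] [Module A Ω] [IsScalarTower k A Ω]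
    [LieRingModule T Ω] [LieModule k T Ω]
    (𝒜 : VertexAlgebroid k A T Ω)

theorem borcherds (x y z : 𝒜.Envelope) (m n l : ℤ) :
    ∑ᶠ j : ℕ, Ring.choose m j • op 𝒜 (m + l - j) (op 𝒜 (n + j) x y) z =
    ∑ᶠ j : ℕ, ((-1 : ℤ) ^ j * Ring.choose n j) •
      (op 𝒜 (m + n - j) x (op 𝒜 (l + j) y z) -
        (n.negOnePow : ℤ) • op 𝒜 (n + l - j) y (op 𝒜 (m + j) x z)) := by
  obtain ⟨N₁, h₁⟩ := op_eventually_zero 𝒜 x y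
  obtain ⟨N₂, h₂⟩ := op_eventually_zero 𝒜 y z
  obtain ⟨N₃, h₃⟩ := op_eventually_zero 𝒜 x z
  obtain ⟨N₀, h₀⟩ := Filter.eventually_atTop.1 (borTerm_eventually 𝒜 x y z m n l)
  set N : ℕ := N₀ + (N₁ - n).toNat + (N₂ - l).toNat + (N₃ - m).toNat with hN
  rw [finsum_eq_sum_range_of_le _ N, finsum_eq_sum_range_of_le _ N, ← sub_eq_zero,
    ← Finset.sum_sub_distrib]
  · exact h₀ N (by omega)
  · intro j hj
    rw [h₂ _ (by omega), h₃ _ (by omega)]; simp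
  · intro j hj
    rw [h₁ _ (by omega)]; simp

/-- The vertex algebra structure of the vertex envelope. -/
noncomputable def vertexAlgebra : VertexAlgebra k 𝒜.Envelope where
  wt := wtSpace 𝒜
  isInternal := isInternal 𝒜
  vac := mk 𝒜 (𝒜.mon vac)
  vac_mem := Submodule.subset_span ⟨vac, by simp [VTerm.wt], rfl⟩
  op := op 𝒜
  op_mem := op_mem 𝒜
  op_eq_zero := op_eq_zero 𝒜
  vac_op n x := by
    induction x using induction 𝒜 with
    | zero => simp
    | add x y hx hy => rw [map_add, hx, hy]; split_ifs <;> simp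
    | smul r x hx => rw [map_smul, hx]; split_ifs <;> simp
    | mon t =>
      rw [op_mon]
      split_ifs with h
      · subst h; exact mk_rel_sub 𝒜 (.vac_op t)
      · exact mk_rel 𝒜 (.vac_op_ne n t h)
  op_vac x := by
    induction x using induction 𝒜 with
    | zero => simp
    | add x y hx hy => rw [map_add, LinearMap.add_apply, hx, hy]
    | smul r x hx => rw [map_smul, LinearMap.smul_apply, hx]
    | mon t => rw [op_mon]; exact mk_rel_sub 𝒜 (.op_vac t)
  op_vac_of_nonneg n x hn := by
    induction x using induction 𝒜 with
    | zero => simp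
    | add x y hx hy => rw [map_add, LinearMap.add_apply, hx, hy, add_zero]
    | smul r x hx => rw [map_smul, LinearMap.smul_apply, hx, smul_zero]
    | mon t => rw [op_mon]; exact mk_rel 𝒜 (.op_vac_of_nonneg n t hn)
  borcherds x y z m n l := borcherds 𝒜 x y z m n l

/-- The generators of weight `0`. -/
noncomputable def gen₀ : A →ₗ[k] 𝒜.Envelope where
  toFun a := mk 𝒜 (𝒜.g₀ a)
  map_add' a b := by
    rw [← map_add, ← sub_eq_zero, ← map_sub, ← sub_sub]; exact mk_rel 𝒜 (.add₀ a b)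
  map_smul' r a := by rw [RingHom.id_apply, ← map_smul]; exact mk_rel_sub 𝒜 (.smul₀ r a)

/-- The generators of weight `1`. -/
noncomputable def gen₁ : T × Ω →ₗ[k] 𝒜.Envelope where
  toFun x := mk 𝒜 (𝒜.g₁ x)
  map_add' a b := by
    rw [← map_add, ← sub_eq_zero, ← map_sub, ← sub_sub]; exact mk_rel 𝒜 (.add₁ a b)
  map_smul' r a := by rw [RingHom.id_apply, ← map_smul]; exact mk_rel_sub 𝒜 (.smul₁ r a)

end VertexAlgebroid.Envelope

namespace VertexAlgebroid

open VTerm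

variable {k A T Ω : Type*} [CommRing k] [Invertible (2 : k)]
    [CommRing A] [Algebra k A]
    [LieRing T] [LieAlgebra k T] [Module A T] [LieRingModule T A] [LieRinehartRing A T]
    [LieRinehartAlgebra k A T]
    [AddCommGroup Ω] [Module k Ω] [Module A Ω] [IsScalarTower k A Ω]
    [LieRingModule T Ω] [LieModule k T Ω]
    {W : Type*} [AddCommGroup W] [Module k W]

/-- A morphism from the `1`-truncated vertex algebra `(A, T ⊕ Ω)` of a vertex algebroid to the
weight `0` and `1` parts of a vertex algebra. -/
structure IsTruncatedHom (𝒜 : VertexAlgebroid k A T Ω) (𝒲 : VertexAlgebra k W)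
    (f₀ : A →ₗ[k] W) (f₁ : T × Ω →ₗ[k] W) : Prop where
  mem₀ : ∀ a, f₀ a ∈ 𝒲.wt 0
  mem₁ : ∀ x, f₁ x ∈ 𝒲.wt 1
  map_one : f₀ 1 = 𝒲.vac
  map_mul : ∀ a b, 𝒲.op (-1) (f₀ a) (f₀ b) = f₀ (a * b)
  map_nprod : ∀ a x, 𝒲.op (-1) (f₀ a) (f₁ x) = f₁ (𝒜.nprod a x)
  map_del : ∀ a, 𝒲.der 1 (f₀ a) = f₁ (𝒜.del a)
  map_act : ∀ x a, 𝒲.op 0 (f₁ x) (f₀ a) = f₀ (𝒜.act x a)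
  map_bracket : ∀ x y, 𝒲.op 0 (f₁ x) (f₁ y) = f₁ (𝒜.bracket x y)
  map_form : ∀ x y, 𝒲.op 1 (f₁ x) (f₁ y) = f₀ (𝒜.form x y)

namespace Envelope

/-- Evaluation of formal monomials in a vertex algebra. -/
def monValue (𝒜 : VertexAlgebroid k A T Ω) (𝒲 : VertexAlgebra k W)
    (f₀ : A →ₗ[k] W) (f₁ : T × Ω →ₗ[k] W) : VTerm 𝒜.Gen → W
  | gen (Sum.inl a) => f₀ a
  | gen (Sum.inr x) => f₁ x
  | vac => 𝒲.vac
  | .op n s t => 𝒲.op n (monValue 𝒜 𝒲 f₀ f₁ s) (monValue 𝒜 𝒲 f₀ f₁ t)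

/-- Evaluation of formal linear combinations of monomials in a vertex algebra. -/
noncomputable def eval (𝒜 : VertexAlgebroid k A T Ω) (𝒲 : VertexAlgebra k W)
    (f₀ : A →ₗ[k] W) (f₁ : T × Ω →ₗ[k] W) : 𝒜.FreeV →ₗ[k] W :=
  Finsupp.linearCombination k (monValue 𝒜 𝒲 f₀ f₁)

variable {𝒜 : VertexAlgebroid k A T Ω} {𝒲 : VertexAlgebra k W}
    {f₀ : A →ₗ[k] W} {f₁ : T × Ω →ₗ[k] W}

theorem eval_mon (t : VTerm 𝒜.Gen) : eval 𝒜 𝒲 f₀ f₁ (𝒜.mon t) = monValue 𝒜 𝒲 f₀ f₁ t := by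
  simp [eval]

theorem eval_fop (n : ℤ) (x y : 𝒜.FreeV) :
    eval 𝒜 𝒲 f₀ f₁ (fop k n x y) = 𝒲.op n (eval 𝒜 𝒲 f₀ f₁ x) (eval 𝒜 𝒲 f₀ f₁ y) := by
  induction x using Finsupp.induction_linear with
  | zero => simp
  | add x x' hx hx' => simp only [map_add, LinearMap.add_apply, hx, hx']
  | single s a =>
    induction y using Finsupp.induction_linear with
    | zero => simp
    | add x x' hx hx' => simp only [map_add, hx, hx']
    | single t b =>
      rw [fop_single]
      simp only [eval, Finsupp.linearCombination_single, monValue, map_smul,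
        LinearMap.smul_apply, smul_smul, mul_comm a b]

theorem monValue_mem (h : 𝒜.IsTruncatedHom 𝒲 f₀ f₁) (t : VTerm 𝒜.Gen) :
    (∀ i : ℕ, (i : ℤ) = VTerm.wt 𝒜.genWt t → monValue 𝒜 𝒲 f₀ f₁ t ∈ 𝒲.wt i) ∧
      (VTerm.wt 𝒜.genWt t < 0 → monValue 𝒜 𝒲 f₀ f₁ t = 0) := by
  induction t with
  | gen x =>
    rcases x with a | x
    · simp only [VTerm.wt, genWt_inl, monValue]
      exact ⟨fun i hi => by obtain rfl : i = 0 := by omega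
                            exact h.mem₀ a, by omega⟩
    · simp only [VTerm.wt, genWt_inr, monValue]
      exact ⟨fun i hi => by obtain rfl : i = 1 := by omega
                            exact h.mem₁ x, by omega⟩
  | vac =>
    simp only [VTerm.wt, monValue]
    exact ⟨fun i hi => by obtain rfl : i = 0 := by omega
                          exact 𝒲.vac_mem, by omega⟩
  | op n s t hs ht =>
    simp only [VTerm.wt, monValue]
    by_cases hs' : VTerm.wt 𝒜.genWt s < 0
    · rw [hs.2 hs', map_zero, LinearMap.zero_apply]; exact ⟨fun _ _ => zero_mem _, fun _ => rfl⟩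
    by_cases ht' : VTerm.wt 𝒜.genWt t < 0
    · rw [ht.2 ht', map_zero]; exact ⟨fun _ _ => zero_mem _, fun _ => rfl⟩
    obtain ⟨i, hi⟩ := Int.eq_ofNat_of_zero_le (not_lt.1 hs')
    obtain ⟨j, hj⟩ := Int.eq_ofNat_of_zero_le (not_lt.1 ht')
    exact ⟨fun m hm => 𝒲.op_mem (hs.1 i hi.symm) (ht.1 j hj.symm) (by rw [hm, hi, hj]),
      fun hm => 𝒲.op_eq_zero (hs.1 i hi.symm) (ht.1 j hj.symm) (by rw [hi, hj] at hm; exact hm)⟩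

theorem monValue_op_eq_zero (h : 𝒜.IsTruncatedHom 𝒲 f₀ f₁) (n : ℤ) (s t : VTerm 𝒜.Gen)
    (hn : VTerm.wt 𝒜.genWt s + VTerm.wt 𝒜.genWt t ≤ n) :
    𝒲.op n (monValue 𝒜 𝒲 f₀ f₁ s) (monValue 𝒜 𝒲 f₀ f₁ t) = 0 :=
  (monValue_mem h (.op n s t)).2 (by simp only [VTerm.wt]; omega)

theorem eval_rel (h : 𝒜.IsTruncatedHom 𝒲 f₀ f₁) {x : 𝒜.FreeV} (hx : 𝒜.Rel x) :
    eval 𝒜 𝒲 f₀ f₁ x = 0 := by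
  induction hx with
  | neg_wt t ht => rw [eval_mon]; exact (monValue_mem h t).2 ht
  | vac_op t => rw [map_sub, eval_mon, eval_mon, monValue, monValue, 𝒲.vac_op]; simp
  | vac_op_ne n t hn => rw [eval_mon, monValue, monValue, 𝒲.vac_op, if_neg hn]
  | op_vac t => rw [map_sub, eval_mon, eval_mon, monValue, monValue, 𝒲.op_vac, sub_self]
  | op_vac_of_nonneg n t hn => rw [eval_mon, monValue, monValue, 𝒲.op_vac_of_nonneg _ _ hn]
  | borcherds m n l s t u N h₁ h₂ h₃ =>
    have := 𝒲.borcherds (monValue 𝒜 𝒲 f₀ f₁ s) (monValue 𝒜 𝒲 f₀ f₁ t)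
      (monValue 𝒜 𝒲 f₀ f₁ u) m n l
    rw [finsum_eq_sum_range_of_le _ N, finsum_eq_sum_range_of_le _ N] at this
    · simp only [borL, borR, map_sub, map_sum, map_zsmul, eval_fop, eval_mon, this, sub_self]
    · intro j hj
      rw [monValue_op_eq_zero h (l + j) t u (by omega),
        monValue_op_eq_zero h (m + j) s u (by omega)]
      simp
    · intro j hj
      rw [monValue_op_eq_zero h (n + j) s t (by omega)]
      simp
  | add₀ a b => simp only [map_sub, eval_mon, monValue, map_add]; abel
  | smul₀ r a => simp only [map_sub, map_smul, eval_mon, monValue, sub_self]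
  | add₁ x y => simp only [map_sub, eval_mon, monValue, map_add]; abel
  | smul₁ r x => simp only [map_sub, map_smul, eval_mon, monValue, sub_self]
  | one => simp only [map_sub, eval_mon, monValue, h.map_one, sub_self]
  | mul a b => simp only [map_sub, eval_fop, eval_mon, monValue, h.map_mul, sub_self]
  | nprod a x => simp only [map_sub, eval_fop, eval_mon, monValue, h.map_nprod, sub_self]
  | del a =>
    have := h.map_del a
    simp only [VertexAlgebra.der, LinearMap.flip_apply] at this
    simp only [map_sub, eval_fop, eval_mon, monValue, ← this]
    exact sub_self _
  | act x a => simp only [map_sub, eval_fop, eval_mon, monValue, h.map_act, sub_self]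
  | bracket x y => simp only [map_sub, eval_fop, eval_mon, monValue, h.map_bracket, sub_self]
  | form x y => simp only [map_sub, eval_fop, eval_mon, monValue, h.map_form, sub_self]

theorem eval_idealMem (h : 𝒜.IsTruncatedHom 𝒲 f₀ f₁) {x : 𝒜.FreeV} (hx : 𝒜.IdealMem x) :
    eval 𝒜 𝒲 f₀ f₁ x = 0 := by
  induction hx with
  | of_rel x hx => exact eval_rel h hx
  | zero => exact map_zero _
  | add x y _ _ hx hy => rw [map_add, hx, hy, add_zero]
  | smul r x _ hx => rw [map_smul, hx, smul_zero]
  | fop_left n x y _ hx => rw [eval_fop, hx, map_zero, LinearMap.zero_apply]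
  | fop_right n x y _ hy => rw [eval_fop, hy, map_zero]

/-- The universal property of the vertex envelope: a morphism of `1`-truncated vertex algebras
to a vertex algebra extends (uniquely, see `lift_unique`) to the vertex envelope. -/
noncomputable def lift (h : 𝒜.IsTruncatedHom 𝒲 f₀ f₁) : 𝒜.Envelope →ₗ[k] W :=
  𝒜.relIdeal.liftQ (eval 𝒜 𝒲 f₀ f₁) fun _ hx => eval_idealMem h hx

theorem lift_mk (h : 𝒜.IsTruncatedHom 𝒲 f₀ f₁) (x : 𝒜.FreeV) :
    lift h (mk 𝒜 x) = eval 𝒜 𝒲 f₀ f₁ x := rfl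

theorem lift_gen₀ (h : 𝒜.IsTruncatedHom 𝒲 f₀ f₁) (a : A) : lift h (gen₀ 𝒜 a) = f₀ a :=
  eval_mon _

theorem lift_gen₁ (h : 𝒜.IsTruncatedHom 𝒲 f₀ f₁) (x : T × Ω) : lift h (gen₁ 𝒜 x) = f₁ x :=
  eval_mon _

theorem lift_isHom (h : 𝒜.IsTruncatedHom 𝒲 f₀ f₁) :
    (vertexAlgebra 𝒜).IsHom 𝒲 (lift h) where
  map_vac := eval_mon _
  map_op n x y := by
    obtain ⟨x, rfl⟩ := mk_surjective 𝒜 x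
    obtain ⟨y, rfl⟩ := mk_surjective 𝒜 y
    exact eval_fop n x y
  map_wt i x hx := by
    induction hx using Submodule.span_induction with
    | mem x hx =>
      obtain ⟨t, ht, rfl⟩ := hx
      rw [lift_mk, eval_mon]; exact (monValue_mem h t).1 i ht.symm
    | zero => rw [map_zero]; exact zero_mem _
    | add x y _ _ hx hy => rw [map_add]; exact add_mem hx hy
    | smul r x _ hx => rw [map_smul]; exact Submodule.smul_mem _ _ hx

theorem lift_unique (h : 𝒜.IsTruncatedHom 𝒲 f₀ f₁) (g : 𝒜.Envelope →ₗ[k] W)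
    (hg : (vertexAlgebra 𝒜).IsHom 𝒲 g) (hg₀ : ∀ a, g (gen₀ 𝒜 a) = f₀ a)
    (hg₁ : ∀ x, g (gen₁ 𝒜 x) = f₁ x) : g = lift h := by
  have key : ∀ t : VTerm 𝒜.Gen, g (mk 𝒜 (𝒜.mon t)) = lift h (mk 𝒜 (𝒜.mon t)) := by
    intro t
    induction t with
    | gen x =>
      rcases x with a | x
      · exact (hg₀ a).trans (lift_gen₀ h a).symm
      · exact (hg₁ x).trans (lift_gen₁ h x).symm
    | vac => exact hg.map_vac.trans (lift_isHom h).map_vac.symm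
    | op n s t hs ht =>
      rw [← op_mon]
      refine (hg.map_op n _ _).trans (Eq.trans ?_ ((lift_isHom h).map_op n _ _).symm)
      rw [hs, ht]
  ext x
  exact key x

/-- The canonical map from the `1`-truncated vertex algebra of `𝒜` to its vertex envelope. -/
theorem isTruncatedHom_gen (𝒜 : VertexAlgebroid k A T Ω) :
    𝒜.IsTruncatedHom (vertexAlgebra 𝒜) (gen₀ 𝒜) (gen₁ 𝒜) where
  mem₀ _ := Submodule.subset_span ⟨_, rfl, rfl⟩
  mem₁ _ := Submodule.subset_span ⟨_, rfl, rfl⟩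
  map_one := mk_rel_sub 𝒜 .one
  map_mul a b := mk_rel_sub 𝒜 (.mul a b)
  map_nprod a x := mk_rel_sub 𝒜 (.nprod a x)
  map_del a := mk_rel_sub 𝒜 (.del a)
  map_act x a := mk_rel_sub 𝒜 (.act x a)
  map_bracket x y := mk_rel_sub 𝒜 (.bracket x y)
  map_form x y := mk_rel_sub 𝒜 (.form x y)

end Envelope

/-- A morphism of vertex algebroids `𝒜 → 𝒜'`: a morphism of the associated `1`-truncated vertex
algebras which maps `Ω` to `Ω'`. -/
structure Hom {A' T' Ω' : Type*}
    [CommRing A'] [Algebra k A']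
    [LieRing T'] [LieAlgebra k T'] [Module A' T'] [LieRingModule T' A'] [LieRinehartRing A' T']
    [LieRinehartAlgebra k A' T']
    [AddCommGroup Ω'] [Module k Ω'] [Module A' Ω'] [IsScalarTower k A' Ω']
    [LieRingModule T' Ω'] [LieModule k T' Ω']
    (𝒜 : VertexAlgebroid k A T Ω) (𝒜' : VertexAlgebroid k A' T' Ω') where
  map₀ : A →ₐ[k] A'
  map₁ : T × Ω →ₗ[k] T' × Ω'
  map_Ω : ∀ ω : Ω, (map₁ (0, ω)).1 = 0
  map_del : ∀ a, map₁ (𝒜.del a) = 𝒜'.del (map₀ a)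
  map_nprod : ∀ a x, map₁ (𝒜.nprod a x) = 𝒜'.nprod (map₀ a) (map₁ x)
  map_act : ∀ x a, map₀ (𝒜.act x a) = 𝒜'.act (map₁ x) (map₀ a)
  map_bracket : ∀ x y, map₁ (𝒜.bracket x y) = 𝒜'.bracket (map₁ x) (map₁ y)
  map_form : ∀ x y, map₀ (𝒜.form x y) = 𝒜'.form (map₁ x) (map₁ y)

variable {A' T' Ω' : Type*}
    [CommRing A'] [Algebra k A']
    [LieRing T'] [LieAlgebra k T'] [Module A' T'] [LieRingModule T' A'] [LieRinehartRing A' T']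
    [LieRinehartAlgebra k A' T']
    [AddCommGroup Ω'] [Module k Ω'] [Module A' Ω'] [IsScalarTower k A' Ω']
    [LieRingModule T' Ω'] [LieModule k T' Ω']
    {𝒜 : VertexAlgebroid k A T Ω} {𝒜' : VertexAlgebroid k A' T' Ω'}

theorem Hom.isTruncatedHom (g : 𝒜.Hom 𝒜') :
    𝒜.IsTruncatedHom (Envelope.vertexAlgebra 𝒜')
      (Envelope.gen₀ 𝒜' ∘ₗ g.map₀.toLinearMap) (Envelope.gen₁ 𝒜' ∘ₗ g.map₁) where
  mem₀ _ := (Envelope.isTruncatedHom_gen 𝒜').mem₀ _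
  mem₁ _ := (Envelope.isTruncatedHom_gen 𝒜').mem₁ _
  map_one := by simpa using (Envelope.isTruncatedHom_gen 𝒜').map_one
  map_mul a b := by simpa using (Envelope.isTruncatedHom_gen 𝒜').map_mul _ _
  map_nprod a x := by simpa [g.map_nprod] using (Envelope.isTruncatedHom_gen 𝒜').map_nprod _ _
  map_del a := by simpa [g.map_del] using (Envelope.isTruncatedHom_gen 𝒜').map_del _
  map_act x a := by simpa [g.map_act] using (Envelope.isTruncatedHom_gen 𝒜').map_act _ _
  map_bracket x y := by
    simpa [g.map_bracket] using (Envelope.isTruncatedHom_gen 𝒜').map_bracket _ _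
  map_form x y := by simpa [g.map_form] using (Envelope.isTruncatedHom_gen 𝒜').map_form _ _

/-- The morphism of vertex envelopes induced by a morphism of vertex algebroids. -/
noncomputable def Hom.envelopeMap (g : 𝒜.Hom 𝒜') : 𝒜.Envelope →ₗ[k] 𝒜'.Envelope :=
  Envelope.lift g.isTruncatedHom

end VertexAlgebroid

/-- A `∂`-algebra (commutative `ℤ≥0`-graded algebra over `k` with a family of operators `∂^(j)` of
degree `j`, the divided powers of a derivation) with underlying module `B`. -/
structure DAlgebra (k B : Type*) [CommRing k] [AddCommGroup B] [Module k B] where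
  one : B
  mul : B →ₗ[k] B →ₗ[k] B
  mul_comm : ∀ a b, mul a b = mul b a
  mul_assoc : ∀ a b c, mul (mul a b) c = mul a (mul b c)
  one_mul : ∀ a, mul one a = a
  wt : ℕ → Submodule k B
  isInternal : DirectSum.IsInternal wt
  one_mem : one ∈ wt 0
  mul_mem : ∀ {i j : ℕ} {a b : B}, a ∈ wt i → b ∈ wt j → mul a b ∈ wt (i + j)
  der : ℕ → B →ₗ[k] B
  der_mem : ∀ {i : ℕ} (j : ℕ) {a : B}, a ∈ wt i → der j a ∈ wt (i + j)
  der_zero : ∀ a, der 0 a = a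
  der_der : ∀ (i j : ℕ) (a : B), der i (der j a) = (i + j).choose i • der (i + j) a
  der_mul : ∀ (n : ℕ) (a b : B),
    der n (mul a b) = ∑ p ∈ Finset.HasAntidiagonal.antidiagonal n, mul (der p.1 a) (der p.2 b)

/-- Morphisms of `∂`-algebras. -/
structure DAlgebra.IsHom {k B C : Type*} [CommRing k] [AddCommGroup B] [Module k B]
    [AddCommGroup C] [Module k C] (ℬ : DAlgebra k B) (𝒞 : DAlgebra k C) (f : B →ₗ[k] C) :
    Prop where
  map_one : f ℬ.one = 𝒞.one
  map_mul : ∀ a b, f (ℬ.mul a b) = 𝒞.mul (f a) (f b)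
  map_wt : ∀ (i : ℕ) (a : B), a ∈ ℬ.wt i → f a ∈ 𝒞.wt i
  map_der : ∀ (n : ℕ) (a : B), f (ℬ.der n a) = 𝒞.der n (f a)

namespace Jet

open MvPolynomial

variable {k A M : Type*} [CommRing k]

/-- Polynomials in variables `∂^(j) y` for `j ≥ 0` and `y` in `A` or `M`; the variable `∂^(j) y`
is the variable with index `(j, y)`. -/
abbrev Poly (k A M : Type*) [CommRing k] := MvPolynomial (ℕ × (A ⊕ M)) k

/-- The weight of the variable `∂^(j) y` is `j` for `y ∈ A`, and `j + 1` for `y ∈ M`. -/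
def varWt : ℕ × (A ⊕ M) → ℕ
  | (j, Sum.inl _) => j
  | (j, Sum.inr _) => j + 1

/-- The generating series `x ↦ ∑ₙ ∂^(n)(x) tⁿ`; on variables it is given by
`∂^(n) ∂^(j) y = binom(n + j, n) ∂^(n + j) y`. -/
noncomputable def polyHasse : Poly k A M →ₐ[k] PowerSeries (Poly k A M) :=
  aeval fun v => PowerSeries.mk fun n => ((n + v.1).choose n : ℕ) • X (n + v.1, v.2)

/-- The operators `∂^(n)` on polynomials. -/
noncomputable def polyDer (n : ℕ) : Poly k A M →ₗ[k] Poly k A M :=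
  ((PowerSeries.coeff n).restrictScalars k) ∘ₗ polyHasse.toLinearMap

theorem polyDer_apply (n : ℕ) (x : Poly k A M) :
    polyDer n x = PowerSeries.coeff n (polyHasse x) := rfl

theorem polyDer_X (n : ℕ) (v : ℕ × (A ⊕ M)) :
    polyDer n (X v : Poly k A M) = ((n + v.1).choose n : ℕ) • X (n + v.1, v.2) := by
  simp only [polyDer_apply, polyHasse, aeval_X, PowerSeries.coeff_mk]

theorem polyDer_mul (n : ℕ) (x y : Poly k A M) :
    polyDer n (x * y) = ∑ p ∈ Finset.HasAntidiagonal.antidiagonal n, polyDer p.1 x * polyDer p.2 y := by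
  simp only [polyDer_apply, map_mul, PowerSeries.coeff_mul]

theorem polyDer_C (n : ℕ) (r : k) :
    polyDer n (C r : Poly k A M) = if n = 0 then C r else 0 := by
  have : (C r : Poly k A M) = algebraMap k _ r := rfl
  rw [polyDer_apply, this, AlgHom.commutes, IsScalarTower.algebraMap_apply k (Poly k A M),
    PowerSeries.algebraMap_apply, PowerSeries.coeff_C]
  rfl

theorem polyDer_zero (x : Poly k A M) : polyDer 0 x = x := by
  induction x using MvPolynomial.induction_on with
  | C r => rw [polyDer_C, if_pos rfl]
  | add x y hx hy => rw [map_add, hx, hy]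
  | mul_X x v hx => simp [polyDer_mul, polyDer_X, hx]

/-- The Vandermonde identity, in the form needed to compose the operators `∂^(n)`. -/
theorem sum_choose_mul_choose {R : Type*} [CommRing R] (f g : ℕ → R) (i j : ℕ) :
    ∑ q ∈ Finset.HasAntidiagonal.antidiagonal j, ∑ p ∈ Finset.HasAntidiagonal.antidiagonal i,
      ((p.1 + q.1).choose p.1 • f (p.1 + q.1)) * ((p.2 + q.2).choose p.2 • g (p.2 + q.2)) =
    (i + j).choose i • ∑ r ∈ Finset.HasAntidiagonal.antidiagonal (i + j), f r.1 * g r.2 := by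
  rw [← Finset.sum_product', Finset.smul_sum,
    ← Finset.sum_fiberwise_of_maps_to (t := Finset.HasAntidiagonal.antidiagonal (i + j))
      (g := fun z : (ℕ × ℕ) × (ℕ × ℕ) => (z.2.1 + z.1.1, z.2.2 + z.1.2))]
  · refine Finset.sum_congr rfl fun r hr => ?_
    rw [Finset.HasAntidiagonal.mem_antidiagonal] at hr
    rw [← hr, Nat.add_choose_eq, Finset.sum_smul]
    symm
    have : ∀ p ∈ Finset.HasAntidiagonal.antidiagonal i, (r.1 < p.1 ∨ r.2 < p.2) →
        (r.1.choose p.1 * r.2.choose p.2) • (f r.1 * g r.2) = 0 := by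
      rintro p - (h | h) <;> simp [Nat.choose_eq_zero_of_lt h]
    refine Finset.sum_bij_ne_zero (fun p _ _ => ((r.1 - p.1, r.2 - p.2), p)) ?_ ?_ ?_ ?_
    · intro p hp h0
      have h1 : ¬ (r.1 < p.1 ∨ r.2 < p.2) := fun h => h0 (this p hp h)
      rw [Finset.HasAntidiagonal.mem_antidiagonal] at hp
      simp only [Finset.mem_filter, Finset.mem_product, Finset.HasAntidiagonal.mem_antidiagonal, Prod.ext_iff]
      omega
    · intro p _ _ p' _ _ h
      exact congrArg Prod.snd h
    · rintro ⟨q, p⟩ hz h0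
      simp only [Finset.mem_filter, Finset.mem_product, Finset.HasAntidiagonal.mem_antidiagonal, Prod.ext_iff]
        at hz
      refine ⟨p, Finset.HasAntidiagonal.mem_antidiagonal.2 hz.1.2, ?_, ?_⟩
      · rw [← hz.2.1, ← hz.2.2]
        intro h
        apply h0
        rw [smul_mul_smul_comm]; exact h
      · ext <;> simp <;> omega
    · intro p hp h0
      have h1 : ¬ (r.1 < p.1 ∨ r.2 < p.2) := fun h => h0 (this p hp h)
      have e1 : p.1 + (r.1 - p.1) = r.1 := by omega
      have e2 : p.2 + (r.2 - p.2) = r.2 := by omega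
      simp only [e1, e2, smul_mul_smul_comm]
  · rintro ⟨q, p⟩ hz
    simp only [Finset.mem_product, Finset.HasAntidiagonal.mem_antidiagonal] at hz ⊢
    omega

theorem polyDer_polyDer (i j : ℕ) (x : Poly k A M) :
    polyDer i (polyDer j x) = (i + j).choose i • polyDer (i + j) x := by
  induction x using MvPolynomial.induction_on generalizing i j with
  | C r =>
    rcases Nat.eq_zero_or_pos j with rfl | hj
    · simp [polyDer_C]
    · simp [polyDer_C, hj.ne']
  | add x y hx hy => simp only [map_add, hx, hy, smul_add]
  | mul_X x v hx =>
    have hX : ∀ a b : ℕ, polyDer a (polyDer b (X v : Poly k A M)) =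
        (a + b).choose a • polyDer (a + b) (X v : Poly k A M) := by
      intro a b
      simp only [polyDer_X, map_nsmul, smul_smul, ← add_assoc]
      congr 1
      have := Nat.choose_mul (n := a + b + v.1) (k := a + b) (s := a) (by omega)
      have e1 : a + b + v.1 - a = b + v.1 := by omega
      have e2 : a + b - a = b := by omega
      rw [e1, e2] at this
      rw [mul_comm, ← this, mul_comm]
    simp only [polyDer_mul, map_sum, hx, hX]
    exact sum_choose_mul_choose (fun n => polyDer n x) (fun n => polyDer n (X v)) i j

theorem polyDer_homog (n : ℕ) {i : ℕ} {x : Poly k A M}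
    (hx : IsWeightedHomogeneous varWt x i) :
    IsWeightedHomogeneous varWt (polyDer n x) (i + n) := by
  have key : ∀ (s : (ℕ × (A ⊕ M)) →₀ ℕ) (c : k) (n : ℕ),
      IsWeightedHomogeneous varWt (polyDer n (monomial s c : Poly k A M))
        (Finsupp.weight varWt s + n) := by
    intro s
    induction s using Finsupp.induction_linear with
    | zero =>
      intro c n
      change IsWeightedHomogeneous varWt (polyDer n (C c : Poly k A M)) _
      rw [polyDer_C]
      split_ifs with h
      · subst h; simpa using isWeightedHomogeneous_C varWt c
      · exact isWeightedHomogeneous_zero _ _ _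
    | add s t hs ht =>
      intro c n
      have : (monomial (s + t) c : Poly k A M) = monomial s c * monomial t 1 := by
        rw [monomial_mul, mul_one]
      rw [this, polyDer_mul]
      refine IsWeightedHomogeneous.sum _ _ _ fun p hp => ?_
      have := (hs c p.1).mul (ht 1 p.2)
      rw [Finset.HasAntidiagonal.mem_antidiagonal] at hp
      convert this using 1
      rw [map_add]; omega
    | single v m =>
      induction m with
      | zero =>
        intro c n
        rw [Finsupp.single_zero]
        change IsWeightedHomogeneous varWt (polyDer n (C c : Poly k A M)) _
        rw [polyDer_C]
        split_ifs with h
        · subst h; simpa using isWeightedHomogeneous_C varWt c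
        · exact isWeightedHomogeneous_zero _ _ _
      | succ m hm =>
        intro c n
        have : (monomial (Finsupp.single v (m + 1)) c : Poly k A M) =
            monomial (Finsupp.single v m) c * X v := by
          rw [X, monomial_mul, mul_one, Finsupp.single_add]
        rw [this, polyDer_mul]
        refine IsWeightedHomogeneous.sum _ _ _ fun p hp => ?_
        have hX : IsWeightedHomogeneous varWt (polyDer p.2 (X v : Poly k A M))
            (varWt v + p.2) := by
          rw [polyDer_X]
          refine (weightedHomogeneousSubmodule k varWt _).smul_of_tower_mem _ ?_
          rw [mem_weightedHomogeneousSubmodule]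
          convert isWeightedHomogeneous_X k varWt (p.2 + v.1, v.2) using 1
          rcases v with ⟨j, y | y⟩ <;> simp only [varWt] <;> omega
        have := (hm c p.1).mul hX
        rw [Finset.HasAntidiagonal.mem_antidiagonal] at hp
        convert this using 1
        simp only [Finsupp.single_add, map_add, Finsupp.weight_apply,
          Finsupp.sum_single_index, zero_smul, one_smul]
        omega
  rw [← support_sum_monomial_coeff x, map_sum]
  refine IsWeightedHomogeneous.sum _ _ _ fun s hs => ?_
  rw [← hx (mem_support_iff.1 hs)]
  exact key _ _ _

variable [CommRing A] [Algebra k A] [AddCommGroup M] [Module k M] [Module A M]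

/-- The relations of the jet algebra: `y ↦ ∂^(0) y` is `k`-linear, the products with elements of `A`
are those in `A` and `M`, and `∂^(1) a = ∂^(0) (d a)` for `a ∈ A`. -/
inductive Rel (d : Derivation k A M) : Poly k A M → Prop
  | add₀ (a b : A) : Rel d (X (0, Sum.inl (a + b)) - X (0, Sum.inl a) - X (0, Sum.inl b))
  | smul₀ (r : k) (a : A) : Rel d (X (0, Sum.inl (r • a)) - r • X (0, Sum.inl a))
  | add₁ (x y : M) : Rel d (X (0, Sum.inr (x + y)) - X (0, Sum.inr x) - X (0, Sum.inr y))
  | smul₁ (r : k) (x : M) : Rel d (X (0, Sum.inr (r • x)) - r • X (0, Sum.inr x))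
  | one : Rel d (X (0, Sum.inl 1) - 1)
  | mul (a b : A) : Rel d (X (0, Sum.inl (a * b)) - X (0, Sum.inl a) * X (0, Sum.inl b))
  | smul (a : A) (x : M) : Rel d (X (0, Sum.inr (a • x)) - X (0, Sum.inl a) * X (0, Sum.inr x))
  | der (a : A) : Rel d (X (1, Sum.inl a) - X (0, Sum.inr (d a)))

/-- The ideal generated by all `∂^(n) r` for relations `r`; this is the smallest `∂`-ideal
containing the relations (see `polyDer_mem`). -/
noncomputable def relIdeal (d : Derivation k A M) : Ideal (Poly k A M) :=
  Ideal.span {x | ∃ (n : ℕ) (r : Poly k A M), Rel d r ∧ x = polyDer n r}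

theorem polyDer_mem (d : Derivation k A M) (n : ℕ) {x : Poly k A M} (hx : x ∈ relIdeal d) :
    polyDer n x ∈ relIdeal d := by
  induction hx using Submodule.span_induction generalizing n with
  | mem x h =>
    obtain ⟨m, r, hr, rfl⟩ := h
    rw [polyDer_polyDer]
    exact (relIdeal d).smul_of_tower_mem _ (Submodule.subset_span ⟨_, r, hr, rfl⟩)
  | zero => rw [map_zero]; exact zero_mem _
  | add x y _ _ hx hy => rw [map_add]; exact add_mem (hx n) (hy n)
  | smul a x _ hx =>
    rw [smul_eq_mul, polyDer_mul]
    exact sum_mem fun p _ => Ideal.mul_mem_left _ _ (hx p.2)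

theorem exists_homog_of_rel {d : Derivation k A M} {r : Poly k A M} (h : Rel d r) :
    ∃ i, IsWeightedHomogeneous varWt r i := by
  have hX : ∀ v : ℕ × (A ⊕ M), (X v : Poly k A M) ∈
      weightedHomogeneousSubmodule k varWt (varWt v) := fun v => isWeightedHomogeneous_X k _ v
  have h₀ : ∀ a : A, (X (0, Sum.inl a) : Poly k A M) ∈ weightedHomogeneousSubmodule k varWt 0 :=
    fun a => hX _
  have h₁ : ∀ x : M, (X (0, Sum.inr x) : Poly k A M) ∈ weightedHomogeneousSubmodule k varWt 1 :=
    fun a => hX _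
  induction h with
  | add₀ a b => exact ⟨0, sub_mem (sub_mem (h₀ _) (h₀ _)) (h₀ _)⟩
  | smul₀ r a => exact ⟨0, sub_mem (h₀ _) (Submodule.smul_mem _ _ (h₀ _))⟩
  | add₁ x y => exact ⟨1, sub_mem (sub_mem (h₁ _) (h₁ _)) (h₁ _)⟩
  | smul₁ r x => exact ⟨1, sub_mem (h₁ _) (Submodule.smul_mem _ _ (h₁ _))⟩
  | one => exact ⟨0, sub_mem (h₀ _) (isWeightedHomogeneous_one k _)⟩
  | mul a b => exact ⟨0, sub_mem (h₀ _)
      (IsWeightedHomogeneous.mul (m := 0) (n := 0) (h₀ a) (h₀ b))⟩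
  | smul a x => exact ⟨1, sub_mem (h₁ _)
      (IsWeightedHomogeneous.mul (m := 0) (n := 1) (h₀ a) (h₁ x))⟩
  | der a => exact ⟨1, sub_mem (hX _) (h₁ _)⟩

theorem component_mem (d : Derivation k A M) (i : ℕ) {x : Poly k A M} (hx : x ∈ relIdeal d) :
    weightedHomogeneousComponent varWt i x ∈ relIdeal d := by
  let _ := weightedGradedAlgebra k (varWt : ℕ × (A ⊕ M) → ℕ)
  have := Ideal.homogeneous_span (weightedHomogeneousSubmodule k (varWt : ℕ × (A ⊕ M) → ℕ))
    {x | ∃ (n : ℕ) (r : Poly k A M), Rel d r ∧ x = polyDer n r} (by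
      rintro _ ⟨n, r, hr, rfl⟩
      obtain ⟨i, hi⟩ := exists_homog_of_rel hr
      exact ⟨i + n, polyDer_homog n hi⟩) i hx
  have e := weightedDecomposition.decompose'_apply k (varWt : ℕ × (A ⊕ M) → ℕ) x i
  rw [← e]
  exact this

end Jet

/-- The jet algebra `J(A, M, d)` of a commutative algebra `A` with a derivation `d : A → M`: the
`∂`-algebra generated by `A` in weight `0` and `M` in weight `1`. -/
abbrev Jet {k A M : Type*} [CommRing k] [CommRing A] [Algebra k A] [AddCommGroup M] [Module k M]
    [Module A M] (d : Derivation k A M) := Jet.Poly k A M ⧸ Jet.relIdeal d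

namespace Jet

open MvPolynomial

variable {k A M : Type*} [CommRing k] [CommRing A] [Algebra k A] [AddCommGroup M] [Module k M]
  [Module A M] (d : Derivation k A M)

/-- The class of a polynomial in the jet algebra. -/
noncomputable def mk : Poly k A M →ₐ[k] Jet d := Ideal.Quotient.mkₐ k (relIdeal d)

theorem mk_surjective : Function.Surjective (mk d) := Ideal.Quotient.mkₐ_surjective k _

theorem mk_eq_zero {x : Poly k A M} : mk d x = 0 ↔ x ∈ relIdeal d :=
  Ideal.Quotient.eq_zero_iff_mem

/-- A `k`-linear endomorphism of polynomials preserving the relations acts on the jet algebra. -/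
noncomputable def descend (f : Poly k A M →ₗ[k] Poly k A M)
    (hf : ∀ x ∈ relIdeal d, f x ∈ relIdeal d) : Jet d →ₗ[k] Jet d where
  toFun := Quotient.lift (fun x => mk d (f x)) (by
    intro x y hxy
    have h : x - y ∈ relIdeal d := (Submodule.quotientRel_def _).1 hxy
    rw [← sub_eq_zero, ← map_sub, ← map_sub]
    exact (mk_eq_zero d).2 (hf _ h))
  map_add' x y := by
    obtain ⟨x, rfl⟩ := mk_surjective d x
    obtain ⟨y, rfl⟩ := mk_surjective d y
    change mk d (f (x + y)) = mk d (f x) + mk d (f y)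
    rw [map_add, map_add]
  map_smul' r x := by
    obtain ⟨x, rfl⟩ := mk_surjective d x
    change mk d (f (r • x)) = r • mk d (f x)
    rw [map_smul, map_smul]

theorem descend_mk (f : Poly k A M →ₗ[k] Poly k A M)
    (hf : ∀ x ∈ relIdeal d, f x ∈ relIdeal d) (x : Poly k A M) :
    descend d f hf (mk d x) = mk d (f x) := rfl

/-- The operators `∂^(n)` on the jet algebra. -/
noncomputable def der (n : ℕ) : Jet d →ₗ[k] Jet d :=
  descend d (polyDer n) fun _ => polyDer_mem d n

/-- The weight `i` part of the jet algebra. -/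
noncomputable def wt (i : ℕ) : Submodule k (Jet d) :=
  (weightedHomogeneousSubmodule k varWt i).map (mk d).toLinearMap

theorem isInternal : DirectSum.IsInternal (wt d) := by
  refine isInternal_of_projections _
    (fun i => descend d (weightedHomogeneousComponent varWt i) fun _ => component_mem d i) ?_ ?_ ?_
  · rintro i _ ⟨x, hx, rfl⟩
    exact congrArg (mk d) (IsWeightedHomogeneous.weightedHomogeneousComponent_same hx)
  · rintro i j hij _ ⟨x, hx, rfl⟩
    refine (congrArg (mk d)
      (IsWeightedHomogeneous.weightedHomogeneousComponent_ne i hx hij)).trans (map_zero _)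
  · rw [eq_top_iff]
    rintro x -
    obtain ⟨x, rfl⟩ := mk_surjective d x
    induction x using MvPolynomial.induction_on' with
    | monomial s c =>
      exact Submodule.mem_iSup_of_mem (Finsupp.weight varWt s)
        ⟨_, isWeightedHomogeneous_monomial _ _ _ rfl, rfl⟩
    | add x y hx hy => rw [map_add]; exact add_mem hx hy

/-- The `∂`-algebra structure of the jet algebra. -/
noncomputable def dAlgebra : DAlgebra k (Jet d) where
  one := 1
  mul := LinearMap.mul k (Jet d)
  mul_comm a b := mul_comm a b
  mul_assoc a b c := mul_assoc a b c
  one_mul a := one_mul a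
  wt := wt d
  isInternal := isInternal d
  one_mem := ⟨1, isWeightedHomogeneous_one k _, map_one (mk d)⟩
  mul_mem := by
    rintro i j _ _ ⟨x, hx, rfl⟩ ⟨y, hy, rfl⟩
    exact ⟨x * y, IsWeightedHomogeneous.mul hx hy, map_mul (mk d) _ _⟩
  der := der d
  der_mem := by
    rintro i j _ ⟨x, hx, rfl⟩
    exact ⟨polyDer j x, polyDer_homog j hx, rfl⟩
  der_zero a := by
    obtain ⟨x, rfl⟩ := mk_surjective d a
    exact congrArg (mk d) (polyDer_zero x)
  der_der i j a := by
    obtain ⟨x, rfl⟩ := mk_surjective d a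
    exact (congrArg (mk d) (polyDer_polyDer i j x)).trans (map_nsmul _ _ _)
  der_mul n a b := by
    obtain ⟨x, rfl⟩ := mk_surjective d a
    obtain ⟨y, rfl⟩ := mk_surjective d b
    refine (congrArg (mk d) (polyDer_mul n x y)).trans ?_
    rw [map_sum]
    exact Finset.sum_congr rfl fun p _ => map_mul _ _ _

/-- The map `A → J(A, M, d)`. -/
noncomputable def inA (a : A) : Jet d := mk d (X (0, Sum.inl a))

/-- The map `M → J(A, M, d)`. -/
noncomputable def inM (x : M) : Jet d := mk d (X (0, Sum.inr x))

/-- The augmentation ideal `J⁺ = ⨁_{i ≥ 1} Jᵢ`. -/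
noncomputable def augIdeal : Ideal (Jet d) := Ideal.span {x | ∃ i, 1 ≤ i ∧ x ∈ wt d i}

end Jet

/-- The associated graded module `⨁ S i / S' i` of a family of submodules `S i` with
"predecessors" `S' i`. -/
def Gr {ι k U : Type*} [CommRing k] [AddCommGroup U] [Module k U] (S S' : ι → Submodule k U) :=
  DirectSum ι fun i => S i ⧸ (S' i).comap (S i).subtype

namespace Gr

variable {ι k U : Type*} [CommRing k] [AddCommGroup U] [Module k U]

instance (S S' : ι → Submodule k U) : AddCommGroup (Gr S S') :=
  inferInstanceAs (AddCommGroup (DirectSum ι fun i => S i ⧸ (S' i).comap (S i).subtype))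

instance (S S' : ι → Submodule k U) : Module k (Gr S S') :=
  inferInstanceAs (Module k (DirectSum ι fun i => S i ⧸ (S' i).comap (S i).subtype))

variable [DecidableEq ι]

/-- The class of an element of `S i` in the associated graded module. -/
noncomputable def symb (S S' : ι → Submodule k U) (i : ι) : S i →ₗ[k] Gr S S' :=
  DirectSum.lof k ι (fun i => S i ⧸ (S' i).comap (S i).subtype) i ∘ₗ
    ((S' i).comap (S i).subtype).mkQ

/-- A `∂`-algebra structure on the associated graded module is induced by a vertex algebra
structure if its unit, product, operators `∂^(n)` and grading are induced by the vacuum, the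
operation `_(-1)`, the operators `∂^(n)` and the grading of the vertex algebra. -/
structure IsInduced [AddMonoid ι] (𝒱 : VertexAlgebra k U) (S S' : ι → Submodule k U)
    (D : DAlgebra k (Gr S S')) : Prop where
  one : ∃ h : 𝒱.vac ∈ S 0, D.one = symb S S' 0 ⟨𝒱.vac, h⟩
  mul : ∀ (i j : ι) (x : S i) (y : S j), ∃ h : 𝒱.op (-1) x y ∈ S (i + j),
    D.mul (symb S S' i x) (symb S S' j y) = symb S S' (i + j) ⟨_, h⟩
  der : ∀ (n : ℕ) (i : ι) (x : S i), ∃ h : 𝒱.der n x ∈ S i,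
    D.der n (symb S S' i x) = symb S S' i ⟨_, h⟩
  wt : ∀ n : ℕ, D.wt n =
    Submodule.span k {z | ∃ (i : ι) (x : S i), (x : U) ∈ 𝒱.wt n ∧ z = symb S S' i x}

end Gr

namespace VertexAlgebroid

open Envelope

variable {k A T Ω : Type*} [CommRing k] [Invertible (2 : k)]
    [CommRing A] [Algebra k A]
    [LieRing T] [LieAlgebra k T] [Module A T] [LieRingModule T A] [LieRinehartRing A T]
    [LieRinehartAlgebra k A T]
    [AddCommGroup Ω] [Module k Ω] [Module A Ω] [IsScalarTower k A Ω]
    [LieRingModule T Ω] [LieModule k T Ω]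

/-- The derivation `a ↦ (0, d a)` of `A` with values in `T ⊕ Ω`, i.e. the abelian vertex algebroid
`𝒜^ab = (A, T ⊕ Ω, ∂)`. -/
noncomputable def abDer (𝒜 : VertexAlgebroid k A T Ω) : Derivation k A (T × Ω) :=
  (LinearMap.inr A T Ω).compDer 𝒜.d

/-- `IsMonomial 𝒜 i p u`: `u` is a monomial `x¹ · (x² · (⋯ · 1))`, where `x · y = x_(-1) y` and each
letter `xʲ` is of the form `∂^(j) a`, `∂^(j) ω` or `∂^(j) τ` with `a ∈ A`, `ω ∈ Ω`, `τ ∈ T`, having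
exactly `i` letters of the form `∂^(j) τ`, and exactly `p` letters which are not of the form
`∂^(0) a`, i.e. `p` letters of positive weight. -/
inductive IsMonomial (𝒜 : VertexAlgebroid k A T Ω) : ℕ → ℕ → 𝒜.Envelope → Prop
  | vac : IsMonomial 𝒜 0 0 (vertexAlgebra 𝒜).vac
  | letter_A₀ (i p : ℕ) (a : A) (u : 𝒜.Envelope) : IsMonomial 𝒜 i p u →
      IsMonomial 𝒜 i p ((vertexAlgebra 𝒜).op (-1) (gen₀ 𝒜 a) u)
  | letter_A (i p j : ℕ) (a : A) (u : 𝒜.Envelope) : IsMonomial 𝒜 i p u →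
      IsMonomial 𝒜 i (p + 1)
        ((vertexAlgebra 𝒜).op (-1) ((vertexAlgebra 𝒜).der (j + 1) (gen₀ 𝒜 a)) u)
  | letter_Ω (i p j : ℕ) (ω : Ω) (u : 𝒜.Envelope) : IsMonomial 𝒜 i p u →
      IsMonomial 𝒜 i (p + 1)
        ((vertexAlgebra 𝒜).op (-1) ((vertexAlgebra 𝒜).der j (gen₁ 𝒜 (0, ω))) u)
  | letter_T (i p j : ℕ) (τ : T) (u : 𝒜.Envelope) : IsMonomial 𝒜 i p u →
      IsMonomial 𝒜 (i + 1) (p + 1)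
        ((vertexAlgebra 𝒜).op (-1) ((vertexAlgebra 𝒜).der j (gen₁ 𝒜 (τ, 0))) u)

/-- The filtration `F` of the vertex envelope: `F i` is spanned by the monomials having at most `i`
letters of the form `∂^(j) τ`. -/
noncomputable def filF (𝒜 : VertexAlgebroid k A T Ω) (i : ℕ) : Submodule k 𝒜.Envelope :=
  Submodule.span k {u | ∃ i' ≤ i, ∃ p, 𝒜.IsMonomial i' p u}

/-- The predecessor `F (i - 1)` of `F i`, where `F (-1) = 0`. -/
noncomputable def filF' (𝒜 : VertexAlgebroid k A T Ω) : ℕ → Submodule k 𝒜.Envelope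
  | 0 => ⊥
  | i + 1 => 𝒜.filF i

/-- The refinement `H` of the filtration `F`, indexed by pairs: `F (i - 1) ⊆ H (i, p) ⊆ F i`, and
`H (i, p)` is spanned modulo `F (i - 1)` by the monomials having `i` letters of the form `∂^(j) τ`
and at least `p` letters of positive weight. Thus `H (i, 0) = F i`, and `H (i, p)` decreases
in `p`. -/
noncomputable def filH (𝒜 : VertexAlgebroid k A T Ω) (q : ℕ × ℕ) : Submodule k 𝒜.Envelope :=
  𝒜.filF' q.1 ⊔ Submodule.span k {u | ∃ p' ≥ q.2, 𝒜.IsMonomial q.1 p' u}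

/-- The predecessor of `H (i, p)` in the filtration is `H (i, p + 1)`. -/
noncomputable def filH' (𝒜 : VertexAlgebroid k A T Ω) (q : ℕ × ℕ) : Submodule k 𝒜.Envelope :=
  𝒜.filH (q.1, q.2 + 1)

/-- The associated graded module of the filtration `F`. -/
abbrev GrF (𝒜 : VertexAlgebroid k A T Ω) := Gr 𝒜.filF 𝒜.filF'

/-- The associated graded module of the filtration `H`. -/
abbrev GrH (𝒜 : VertexAlgebroid k A T Ω) := Gr 𝒜.filH 𝒜.filH'

/-- The canonical morphism of `∂`-algebras `J(𝒜^ab) → gr_F U𝒜`: it extends the maps sending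
`a`, `ω`, `τ` to their classes in `gr⁰`, `gr⁰` and `gr¹`. -/
structure IsCanonicalF (𝒜 : VertexAlgebroid k A T Ω) (D : DAlgebra k 𝒜.GrF)
    (φ : Jet 𝒜.abDer →ₗ[k] 𝒜.GrF) : Prop where
  isHom : (Jet.dAlgebra 𝒜.abDer).IsHom D φ
  map_A : ∀ a : A, ∃ h, φ (Jet.inA 𝒜.abDer a) = Gr.symb 𝒜.filF 𝒜.filF' 0 ⟨gen₀ 𝒜 a, h⟩
  map_Ω : ∀ ω : Ω, ∃ h,
    φ (Jet.inM 𝒜.abDer (0, ω)) = Gr.symb 𝒜.filF 𝒜.filF' 0 ⟨gen₁ 𝒜 (0, ω), h⟩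
  map_T : ∀ τ : T, ∃ h,
    φ (Jet.inM 𝒜.abDer (τ, 0)) = Gr.symb 𝒜.filF 𝒜.filF' 1 ⟨gen₁ 𝒜 (τ, 0), h⟩

/-- The symmetric algebra `Sym_A((⨁_{i ≥ 1} T^(i)) ⊕ (⨁_{i ≥ 1} Ω^(i)))`. -/
abbrev SymTΩ (_𝒜 : VertexAlgebroid k A T Ω) := SymmetricAlgebra A ((ℕ+ →₀ T) × (ℕ+ →₀ Ω))

/-- The element `τ^(i) ∈ T^(i)` of the symmetric algebra. -/
noncomputable def symT (𝒜 : VertexAlgebroid k A T Ω) (i : ℕ+) (τ : T) : 𝒜.SymTΩ :=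
  SymmetricAlgebra.ι A _ (Finsupp.single i τ, 0)

/-- The element `ω^(i) ∈ Ω^(i)` of the symmetric algebra. -/
noncomputable def symΩ (𝒜 : VertexAlgebroid k A T Ω) (i : ℕ+) (ω : Ω) : 𝒜.SymTΩ :=
  SymmetricAlgebra.ι A _ (0, Finsupp.single i ω)

/-- The canonical morphism `Sym_A((⨁_{i ≥ 1} T^(i)) ⊕ (⨁_{i ≥ 1} Ω^(i))) → gr_H U𝒜` of `∂`-algebras
over `A`: it maps `a`, `τ^(i)`, `ω^(i)` to the classes of `a`, `∂^(i-1) τ`, `∂^(i-1) ω` in the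
components of degree `(0, 0)`, `(1, 1)`, `(0, 1)`. The symmetric algebra is a `∂`-algebra with
`∂^(j) a = 0` and `∂^(j) x^(i) = binom(i + j - 1, j) x^(i + j)` for `j ≥ 1`. -/
structure IsCanonicalH (𝒜 : VertexAlgebroid k A T Ω) (D : DAlgebra k 𝒜.GrH)
    (φ : 𝒜.SymTΩ →ₗ[k] 𝒜.GrH) : Prop where
  map_one : φ 1 = D.one
  map_mul : ∀ x y, φ (x * y) = D.mul (φ x) (φ y)
  map_A : ∀ a : A, ∃ h,
    φ (algebraMap A _ a) = Gr.symb 𝒜.filH 𝒜.filH' (0, 0) ⟨gen₀ 𝒜 a, h⟩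
  map_T : ∀ (i : ℕ+) (τ : T), ∃ h,
    φ (𝒜.symT i τ) = Gr.symb 𝒜.filH 𝒜.filH' (1, 1)
      ⟨(vertexAlgebra 𝒜).der (i - 1) (gen₁ 𝒜 (τ, 0)), h⟩
  map_Ω : ∀ (i : ℕ+) (ω : Ω), ∃ h,
    φ (𝒜.symΩ i ω) = Gr.symb 𝒜.filH 𝒜.filH' (0, 1)
      ⟨(vertexAlgebra 𝒜).der (i - 1) (gen₁ 𝒜 (0, ω)), h⟩
  der_A : ∀ (j : ℕ) (a : A), 0 < j → D.der j (φ (algebraMap A _ a)) = 0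
  der_T : ∀ (i j : ℕ+) (τ : T),
    D.der j (φ (𝒜.symT i τ)) = ((i + j - 1 : ℕ).choose j) • φ (𝒜.symT (i + j) τ)
  der_Ω : ∀ (i j : ℕ+) (ω : Ω),
    D.der j (φ (𝒜.symΩ i ω)) = ((i + j - 1 : ℕ).choose j) • φ (𝒜.symΩ (i + j) ω)

end VertexAlgebroid

set_option linter.unusedSectionVars false

namespace VertexAlgebroid

variable {k A T Ω : Type*} [CommRing k] [Invertible (2 : k)]
    [CommRing A] [Algebra k A]
    [LieRing T] [LieAlgebra k T] [Module A T] [LieRingModule T A] [LieRinehartRing A T]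
    [LieRinehartAlgebra k A T]
    [AddCommGroup Ω] [Module k Ω] [Module A Ω] [IsScalarTower k A Ω]
    [LieRingModule T Ω] [LieModule k T Ω]
    (𝒜 : VertexAlgebroid k A T Ω)

theorem invOf_two_smul_add_self {M : Type*} [AddCommGroup M] [Module k M] (x : M) :
    (⅟2 : k) • x + (⅟2 : k) • x = x := by
  rw [← add_smul, ← mul_two, invOf_mul_self, one_smul]

theorem smul_eq_of_two_smul {M : Type*} [AddCommGroup M] [Module k M] {x y : M}
    (h : (2 : k) • x = (2 : k) • y) : x = y := by
  have := congrArg (fun z => (⅟2 : k) • z) h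
  simpa [smul_smul] using this

/-! ### The identities of a `1`-truncated vertex algebra -/

theorem act_del (a b : A) : 𝒜.act (𝒜.del a) b = 0 := by simp [act, del]

theorem bracket_del (x : T × Ω) (a : A) : 𝒜.bracket x (𝒜.del a) = 𝒜.del (𝒜.act x a) := by
  simp [bracket, del, act, 𝒜.d_lie]

theorem del_bracket (x : T × Ω) (a : A) : 𝒜.bracket (𝒜.del a) x = 0 := by
  simp [bracket, del, 𝒜.d_lie, 𝒜.pair_d]

theorem form_comm (x y : T × Ω) : 𝒜.form x y = 𝒜.form y x := by
  simp only [form, 𝒜.pairT_symm x.1 y.1]; ring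

theorem form_del (x : T × Ω) (a : A) : 𝒜.form x (𝒜.del a) = 𝒜.act x a := by
  simp [form, del, act, 𝒜.pair_d]

theorem bracket_add_bracket (x y : T × Ω) :
    𝒜.bracket x y + 𝒜.bracket y x = 𝒜.del (𝒜.form x y) := by
  ext
  · simp only [bracket, del, Prod.fst_add]
    rw [← lie_skew x.1 y.1, neg_add_cancel]
  · simp only [bracket, del, form, map_add, Prod.snd_add, 𝒜.c_skew y.1 x.1,
      𝒜.pairT_symm y.1 x.1]
    nth_rewrite 3 [← invOf_two_smul_add_self (k := k) (𝒜.d (𝒜.pairT x.1 y.1))]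
    abel

theorem act_mul (x : T × Ω) (a b : A) :
    𝒜.act x (a * b) = a * 𝒜.act x b + 𝒜.act x a * b := by
  simp [act]

theorem act_nprod (a b : A) (x : T × Ω) : 𝒜.act (𝒜.nprod a x) b = a * 𝒜.act x b := by
  simp [act, nprod]

theorem del_mul (a b : A) : 𝒜.del (a * b) = 𝒜.nprod a (𝒜.del b) + 𝒜.nprod b (𝒜.del a) := by
  simp [del, nprod]

theorem γ_one (τ : T) : 𝒜.γ 1 τ = 0 := by
  have := 𝒜.γ_smul 1 1 τ
  simp at this
  exact this

theorem one_nprod (x : T × Ω) : 𝒜.nprod 1 x = x := by simp [nprod, γ_one]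

theorem nprod_nprod (a b : A) (x : T × Ω) :
    𝒜.nprod a (𝒜.nprod b x) = 𝒜.nprod (a * b) x + 𝒜.nprod (𝒜.act x a) (𝒜.del b) +
      𝒜.nprod (𝒜.act x b) (𝒜.del a) := by
  ext
  · simp [nprod, del, smul_smul]
  · simp only [nprod, del, act, Prod.snd_add, 𝒜.γ_smul, smul_sub, smul_smul, map_zero]
    module

theorem form_nprod (a : A) (x y : T × Ω) :
    𝒜.form (𝒜.nprod a x) y = a * 𝒜.form x y - 𝒜.act x (𝒜.act y a) := by
  simp only [nprod, form, act, 𝒜.pairT_smul, map_sub, map_smul, LinearMap.smul_apply, smul_eq_mul]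
  ring

theorem act_bracket (x y : T × Ω) (a : A) :
    𝒜.act (𝒜.bracket x y) a = 𝒜.act x (𝒜.act y a) - 𝒜.act y (𝒜.act x a) := by
  simp [act, bracket]

theorem act_form (x y z : T × Ω) :
    𝒜.act x (𝒜.form y z) = 𝒜.form (𝒜.bracket x y) z + 𝒜.form y (𝒜.bracket x z) := by
  have h := 𝒜.lie_pairT x.1 y.1 z.1
  have h3 := 𝒜.lie_pair z.1 y.1 x.2
  have h4 : ⁅y.1, 𝒜.pair z.1 x.2⁆ = -𝒜.pair ⁅z.1, y.1⁆ x.2 + 𝒜.pair z.1 ⁅y.1, x.2⁆ := by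
    rw [𝒜.lie_pair, ← lie_skew y.1 z.1, map_neg, LinearMap.neg_apply]
  simp only [act, form, bracket, lie_add, map_add, map_sub, map_neg, 𝒜.pair_d,
    𝒜.lie_pair x.1 y.1 z.2, 𝒜.lie_pair x.1 z.1 y.2, LinearMap.map_smul_of_tower]
  rw [h4, h3]
  linear_combination -h

theorem bracket_nprod (a : A) (x y : T × Ω) :
    𝒜.bracket x (𝒜.nprod a y) = 𝒜.nprod a (𝒜.bracket x y) + 𝒜.nprod (𝒜.act x a) y := by
  ext
  · simp [nprod, bracket, act]
  · have h := 𝒜.c_smul a y.1 x.1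
    simp only [nprod, bracket, act, Prod.snd_add, 𝒜.c_skew x.1, 𝒜.pairT_symm x.1, h,
      𝒜.pairT_smul, lie_sub, 𝒜.lie_smul', 𝒜.smul_lie', map_sub, map_add, map_smul,
      LinearMap.smul_apply, Derivation.leibniz, smul_eq_mul, smul_add, smul_sub, smul_neg,
      ← lie_skew y.1 x.1, map_neg, smul_comm a (⅟2 : k)]
    rw [← invOf_two_smul_add_self (k := k) (𝒜.pairT y.1 x.1 • 𝒜.d a)]
    module

theorem bracket_bracket (x y z : T × Ω) :
    𝒜.bracket x (𝒜.bracket y z) =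
      𝒜.bracket (𝒜.bracket x y) z + 𝒜.bracket y (𝒜.bracket x z) := by
  ext
  · simp [bracket]
  · have h := 𝒜.lie_c x.1 y.1 z.1
    apply smul_eq_of_two_smul (k := k)
    replace h := congrArg (fun u => (2 : k) • u) h
    simp only [bracket, Prod.snd_add, lie_add, lie_sub, lie_neg, lie_smul, map_add, map_sub,
      map_neg, ← 𝒜.d_lie, 𝒜.pair_d, lie_lie, smul_add, smul_sub, smul_neg, neg_smul,
      smul_smul, mul_invOf_self, one_smul, 𝒜.lie_pair, LinearMap.map_smul_of_tower,
      𝒜.c_skew x.1 ⁅y.1, z.1⁆, 𝒜.c_skew y.1 ⁅x.1, z.1⁆, 𝒜.pairT_symm x.1 ⁅y.1, z.1⁆,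
      𝒜.pairT_symm y.1 ⁅x.1, z.1⁆, ← lie_skew z.1 y.1,
      LinearMap.neg_apply, Derivation.map_smul, neg_mul, invOf_mul_self] at h ⊢
    linear_combination (norm := module) -h

end VertexAlgebroid

/-- A `1`-truncated vertex algebra with components `A` (a commutative algebra) in weight `0` and `E`
in weight `1`. -/
structure OneTruncated (k A E : Type*) [CommRing k] [CommRing A] [Algebra k A] [AddCommGroup E]
    [Module k E] where
  del : A →ₗ[k] E
  mul : A →ₗ[k] E →ₗ[k] E
  act : E →ₗ[k] A →ₗ[k] A
  br : E →ₗ[k] E →ₗ[k] E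
  form : E →ₗ[k] E →ₗ[k] A
  act_del : ∀ a b, act (del a) b = 0
  br_del : ∀ x a, br x (del a) = del (act x a)
  del_br : ∀ x a, br (del a) x = 0
  form_comm : ∀ x y, form x y = form y x
  form_del : ∀ x a, form x (del a) = act x a
  br_add_br : ∀ x y, br x y + br y x = del (form x y)
  act_mul : ∀ x a b, act x (a * b) = a * act x b + act x a * b
  mul_act : ∀ a b x, act (mul a x) b = a * act x b
  del_mul : ∀ a b, del (a * b) = mul a (del b) + mul b (del a)
  one_mul : ∀ x, mul 1 x = x
  mul_mul : ∀ a b x, mul a (mul b x) = mul (a * b) x + mul (act x a) (del b) + mul (act x b) (del a)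
  form_mul : ∀ a x y, form (mul a x) y = a * form x y - act x (act y a)
  act_br : ∀ x y a, act (br x y) a = act x (act y a) - act y (act x a)
  act_form : ∀ x y z, act x (form y z) = form (br x y) z + form y (br x z)
  br_mul : ∀ a x y, br x (mul a y) = mul a (br x y) + mul (act x a) y
  br_br : ∀ x y z, br x (br y z) = br (br x y) z + br y (br x z)

/-- The `1`-truncated vertex algebra of a vertex algebroid. -/
def VertexAlgebroid.oneTruncated {k A T Ω : Type*} [CommRing k] [Invertible (2 : k)]
    [CommRing A] [Algebra k A]
    [LieRing T] [LieAlgebra k T] [Module A T] [LieRingModule T A] [LieRinehartRing A T]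
    [LieRinehartAlgebra k A T]
    [AddCommGroup Ω] [Module k Ω] [Module A Ω] [IsScalarTower k A Ω]
    [LieRingModule T Ω] [LieModule k T Ω]
    (𝒜 : VertexAlgebroid k A T Ω) : OneTruncated k A (T × Ω) where
  del := LinearMap.inr k T Ω ∘ₗ 𝒜.d.toLinearMap
  mul := LinearMap.mk₂ k 𝒜.nprod
    (by intros; ext <;> simp [nprod, add_smul]; abel)
    (by intros; ext <;> simp [nprod, smul_sub])
    (by intros; ext <;> simp [nprod]; abel)
    (by intro c a x; ext <;> simp [nprod, smul_sub, smul_comm a c])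
  act := LinearMap.mk₂ k 𝒜.act
    (by intros; simp [act]) (by intros; simp [act]) (by intros; simp [act])
    (by intros; simp [act])
  br := LinearMap.mk₂ k 𝒜.bracket
    (by intros; ext <;> simp [bracket]; abel)
    (by intros; ext <;> simp [bracket]; module)
    (by intros; ext <;> simp [bracket]; abel)
    (by intros; ext <;> simp [bracket]; module)
  form := LinearMap.mk₂ k 𝒜.form
    (by intros; simp [form]; abel) (by intros; simp [form])
    (by intros; simp [form]; abel) (by intros; simp [form])
  act_del := 𝒜.act_del
  br_del := 𝒜.bracket_del
  del_br := 𝒜.del_bracket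
  form_comm := 𝒜.form_comm
  form_del := 𝒜.form_del
  br_add_br := 𝒜.bracket_add_bracket
  act_mul := 𝒜.act_mul
  mul_act := 𝒜.act_nprod
  del_mul := 𝒜.del_mul
  one_mul := 𝒜.one_nprod
  mul_mul := 𝒜.nprod_nprod
  form_mul := 𝒜.form_nprod
  act_br := 𝒜.act_bracket
  act_form := 𝒜.act_form
  br_mul := 𝒜.bracket_nprod
  br_br := 𝒜.bracket_bracket

/-- Data for a relative Poincaré–Birkhoff–Witt theorem: a module `M` of operators with a bracket,
which satisfies the axioms of a Lie algebra modulo a submodule `N` of operators acting by zero, a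
family `e` of creation operators indexed by `ι`, and the action `x · b = ∑ eᵢ · sᵢ(x) b + r(x) b`
of operators `x` on the base module `B`. -/
structure PBWData (k M B ι : Type*) [CommRing k] [AddCommGroup M] [Module k M] [AddCommGroup B]
    [Module k B] where
  br : M →ₗ[k] M →ₗ[k] M
  e : ι → M
  s : M →ₗ[k] B →ₗ[k] (ι →₀ B)
  r : M →ₗ[k] B →ₗ[k] B
  N : Submodule k M
  s_e : ∀ i b, s (e i) b = Finsupp.single i b
  r_e : ∀ i b, r (e i) b = 0
  s_N : ∀ x ∈ N, s x = 0
  r_N : ∀ x ∈ N, r x = 0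
  br_N : ∀ x ∈ N, ∀ j, br x (e j) ∈ N
  br_self : ∀ i, br (e i) (e i) ∈ N
  skew : ∀ x j, br x (e j) + br (e j) x ∈ N
  jacobi : ∀ x y j, br (br x y) (e j) - br x (br y (e j)) + br y (br x (e j)) ∈ N

namespace PBWData

open Finsupp

variable {k M B ι : Type*} [CommRing k] [AddCommGroup M] [Module k M] [AddCommGroup B]
    [Module k B] [LinearOrder ι] (P : PBWData k M B ι)

/-- The module with basis over `B` the ordered monomials in the creation operators. -/
abbrev Mod (_P : PBWData k M B ι) := Multiset ι →₀ B

/-- The action of an operator on the base module. -/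
noncomputable def base : M →ₗ[k] B →ₗ[k] P.Mod :=
  (LinearMap.llcomp k B B P.Mod (lsingle 0)) ∘ₗ P.r +
  (LinearMap.llcomp k B (ι →₀ B) P.Mod (lmapDomain B k fun i => {i})) ∘ₗ P.s

theorem base_apply (x : M) (b : B) :
    P.base x b = single 0 (P.r x b) + mapDomain (fun i => {i}) (P.s x b) := rfl

/-- The leading part of the action of an operator on a monomial. -/
noncomputable def top (N : Multiset ι) (x : M) : B →ₗ[k] P.Mod :=
  (lmapDomain B k fun i => i ::ₘ N) ∘ₗ P.s x

theorem top_apply (N : Multiset ι) (x : M) (b : B) :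
    P.top N x b = mapDomain (fun i => i ::ₘ N) (P.s x b) := rfl

/-- The correction terms from moving creation operators past `e j`. -/
noncomputable def corr (F : M →ₗ[k] P.Mod →ₗ[k] P.Mod) (j : ι) (N : Multiset ι) :
    (ι →₀ B) →ₗ[k] P.Mod :=
  lsum k fun i => if i < j then F (P.br (P.e j) (P.e i)) ∘ₗ lsingle N else 0

/-- The action on the monomial `e j · N`, given the action on monomials of smaller degree. -/
noncomputable def step (F : M →ₗ[k] P.Mod →ₗ[k] P.Mod) (j : ι) (N : Multiset ι) :
    M →ₗ[k] B →ₗ[k] P.Mod where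
  toFun x := P.top (j ::ₘ N) x + P.corr F j N ∘ₗ P.s x
    + F (P.e j) ∘ₗ (F x ∘ₗ lsingle N - P.top N x) + F (P.br x (P.e j)) ∘ₗ lsingle N
  map_add' x y := by
    ext1 b
    simp only [top, map_add, LinearMap.add_apply, LinearMap.comp_apply, LinearMap.sub_apply]
    simp only [map_add, map_sub]
    abel
  map_smul' c x := by
    ext1 b
    simp only [top, map_smul, LinearMap.add_apply, LinearMap.smul_apply, LinearMap.comp_apply,
      LinearMap.sub_apply, smul_add, RingHom.id_apply]
    simp only [map_smul, map_sub, smul_sub]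

/-- The action on the monomial `L`, given the action on monomials of smaller degree. -/
noncomputable def stepAt (F : M →ₗ[k] P.Mod →ₗ[k] P.Mod) (L : Multiset ι) :
    M →ₗ[k] B →ₗ[k] P.Mod :=
  match L.sort (· ≤ ·) with
  | [] => P.base
  | j :: l => P.step F j l

/-- Assemble an operator from its values on monomials. -/
noncomputable def assemble (f : Multiset ι → M →ₗ[k] B →ₗ[k] P.Mod) :
    M →ₗ[k] P.Mod →ₗ[k] P.Mod where
  toFun x := lsum k fun L => f L x
  map_add' x y := by ext; simp
  map_smul' c x := by ext; simp

theorem assemble_single (f : Multiset ι → M →ₗ[k] B →ₗ[k] P.Mod) (x : M) (L : Multiset ι) (b : B) :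
    P.assemble f x (single L b) = f L x b := by simp [assemble]

/-- Approximations of the action, correct on monomials of degree `< n`. -/
noncomputable def approx : ℕ → M →ₗ[k] P.Mod →ₗ[k] P.Mod
  | 0 => 0
  | n + 1 => P.assemble (P.stepAt (approx n))

/-- The action of operators on the module of ordered monomials. -/
noncomputable def act : M →ₗ[k] P.Mod →ₗ[k] P.Mod :=
  P.assemble fun L => P.stepAt (P.approx (Multiset.card L)) L

/-- The span of the monomials of degree at most `d`. -/
noncomputable def deg (_P : PBWData k M B ι) (d : ℕ) : Submodule k (Multiset ι →₀ B) :=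
  supported B k {L | Multiset.card L ≤ d}

theorem single_mem_deg {d : ℕ} {L : Multiset ι} (h : Multiset.card L ≤ d) (b : B) :
    single L b ∈ P.deg d := single_mem_supported k b h

theorem deg_mono {d d' : ℕ} (h : d ≤ d') : P.deg d ≤ P.deg d' :=
  supported_mono fun _ h' => le_trans h' h

theorem deg_induction {d : ℕ} {p : P.Mod → Prop} (zero : p 0)
    (add : ∀ v w, p v → p w → p (v + w))
    (single : ∀ L b, Multiset.card L ≤ d → p (single L b)) {v : P.Mod} (hv : v ∈ P.deg d) :
    p v := by
  classical
  rw [← Finsupp.sum_single v]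
  refine Finset.sum_induction _ p add zero fun L hL => single L _ ?_
  exact (mem_supported k v).1 hv hL

theorem mapDomain_mem_deg {d : ℕ} (f : ι → Multiset ι) (h : ∀ i, Multiset.card (f i) ≤ d)
    (c : ι →₀ B) : mapDomain f c ∈ P.deg d := by
  induction c using Finsupp.induction_linear with
  | zero => simp
  | add c c' hc hc' => rw [mapDomain_add]; exact add_mem hc hc'
  | single i b => rw [mapDomain_single]; exact P.single_mem_deg (h i) b

theorem sort_cons {j : ι} {N : Multiset ι} (h : ∀ i ∈ N, j ≤ i) :
    (j ::ₘ N).sort (· ≤ ·) = j :: N.sort (· ≤ ·) := Multiset.sort_cons _ _ _ h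

theorem exists_cons {n : ℕ} {L : Multiset ι} (h : Multiset.card L = n + 1) :
    ∃ j N, L = j ::ₘ N ∧ (∀ i ∈ N, j ≤ i) ∧ Multiset.card N = n := by
  have hs := Multiset.sort_eq L (· ≤ ·)
  have hp := Multiset.pairwise_sort L (· ≤ ·)
  match hl : L.sort (· ≤ ·) with
  | [] => rw [hl] at hs; rw [← hs] at h; simp at h
  | j :: l =>
    rw [hl] at hs hp
    refine ⟨j, l, hs.symm, fun i hi => (List.pairwise_cons.1 hp).1 i hi, ?_⟩
    rw [← hs] at h
    simpa using h

theorem stepAt_zero (F : M →ₗ[k] P.Mod →ₗ[k] P.Mod) : P.stepAt F 0 = P.base := by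
  simp [stepAt]

theorem stepAt_cons (F : M →ₗ[k] P.Mod →ₗ[k] P.Mod) {j : ι} {N : Multiset ι}
    (h : ∀ i ∈ N, j ≤ i) : P.stepAt F (j ::ₘ N) = P.step F j N := by
  rw [stepAt, sort_cons h]
  simp

theorem step_apply (F : M →ₗ[k] P.Mod →ₗ[k] P.Mod) (j : ι) (N : Multiset ι) (x : M) (b : B) :
    P.step F j N x b = P.top (j ::ₘ N) x b + P.corr F j N (P.s x b)
      + F (P.e j) (F x (single N b) - P.top N x b) + F (P.br x (P.e j)) (single N b) := rfl

theorem corr_congr {F G : M →ₗ[k] P.Mod →ₗ[k] P.Mod} {j : ι} {N : Multiset ι}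
    (h : ∀ x b, F x (single N b) = G x (single N b)) : P.corr F j N = P.corr G j N := by
  ext i b : 2
  simp only [corr, LinearMap.comp_apply, lsingle_apply, lsum_single]
  split_ifs
  · exact h _ _
  · rfl

theorem corr_mem {F : M →ₗ[k] P.Mod →ₗ[k] P.Mod} {j : ι} {N : Multiset ι} {d : ℕ}
    (h : ∀ x b, F x (single N b) ∈ P.deg d) (c : ι →₀ B) : P.corr F j N c ∈ P.deg d := by
  induction c using Finsupp.induction_linear with
  | zero => simp
  | add c c' hc hc' => rw [map_add]; exact add_mem hc hc'
  | single i b =>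
    simp only [corr, lsum_single]
    split_ifs
    · exact h _ _
    · simp

theorem act_single (x : M) (L : Multiset ι) (b : B) :
    P.act x (single L b) = P.stepAt (P.approx (Multiset.card L)) L x b :=
  P.assemble_single _ _ _ _

theorem approx_spec (n : ℕ) : ∀ (L : Multiset ι), Multiset.card L < n → ∀ (x : M) (b : B),
    P.approx n x (single L b) = P.act x (single L b) ∧
      P.act x (single L b) - P.top L x b ∈ P.deg (Multiset.card L) := by
  induction n using Nat.strong_induction_on with
  | _ n ih =>
  intro L hL x b
  obtain _ | n := n
  · simp at hL
  rw [act_single]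
  simp only [approx, assemble_single]
  rcases hm : Multiset.card L with _ | m
  · rw [Multiset.card_eq_zero] at hm
    subst hm
    rw [stepAt_zero, stepAt_zero, base_apply, top_apply]
    refine ⟨rfl, ?_⟩
    have : mapDomain (fun i => ({i} : Multiset ι)) (P.s x b) =
      mapDomain (fun i => i ::ₘ 0) (P.s x b) := rfl
    rw [this, add_sub_cancel_right]
    exact P.single_mem_deg (by simp) _
  · obtain ⟨j, N, rfl, hj, hN⟩ := exists_cons hm
    rw [stepAt_cons _ _ hj, stepAt_cons _ _ hj, step_apply, step_apply]
    have h1 := fun x b => (ih n (by omega) N (by omega) x b).1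
    have h2 := fun x b => (ih (m + 1) (by omega) N (by omega) x b).1
    have h3 := fun x b => (ih (m + 1) (by omega) N (by omega) x b).2
    rw [hN] at h3
    have e1 : ∀ v ∈ P.deg m, ∀ y, P.approx n y v = P.act y v := by
      intro v hv y
      refine P.deg_induction (p := fun v => P.approx n y v = P.act y v) (by simp)
        (fun v w hv hw => by rw [map_add, map_add, hv, hw]) (fun L c hL => ?_) hv
      exact (ih n (by omega) L (by omega) y c).1
    have e2 : ∀ v ∈ P.deg m, ∀ y, P.approx (m + 1) y v = P.act y v := by
      intro v hv y
      refine P.deg_induction (p := fun v => P.approx (m + 1) y v = P.act y v) (by simp)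
        (fun v w hv hw => by rw [map_add, map_add, hv, hw]) (fun L c hL => ?_) hv
      exact (ih (m + 1) (by omega) L (by omega) y c).1
    have e3 : ∀ v ∈ P.deg m, ∀ y, P.act y v ∈ P.deg (m + 1) := by
      intro v hv y
      refine P.deg_induction (p := fun v => P.act y v ∈ P.deg (m + 1)) (by simp)
        (fun v w hv hw => by rw [map_add]; exact add_mem hv hw) (fun L c hL => ?_) hv
      have := (ih (m + 1) (by omega) L (by omega) y c).2
      have h4 := P.mapDomain_mem_deg (d := m + 1) (fun i => i ::ₘ L) (fun _ => by simpa using hL) (P.s y c)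
      have := add_mem (P.deg_mono (by omega) this) h4
      rwa [← top_apply, sub_add_cancel] at this
    have e4 : ∀ y c, P.act y (single N c) ∈ P.deg (m + 1) := fun y c =>
      e3 _ (P.single_mem_deg hN.le c) y
    rw [h1, h2, h1, h2, e1 _ (h3 x b), e2 _ (h3 x b),
      P.corr_congr (G := P.act) h1, P.corr_congr (F := P.approx (m + 1)) (G := P.act) h2]
    refine ⟨rfl, ?_⟩
    have : ∀ a b c d : P.Mod, a + b + c + d - a = b + c + d := by intros; abel
    rw [this]
    exact add_mem (add_mem (P.corr_mem e4 _) (e3 _ (h3 x b) _)) (e4 _ _)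

theorem act_sub_top_mem (x : M) (L : Multiset ι) (b : B) :
    P.act x (single L b) - P.top L x b ∈ P.deg (Multiset.card L) :=
  (P.approx_spec _ L (Nat.lt_succ_self _) x b).2

theorem act_mem_deg {d : ℕ} (x : M) {v : P.Mod} (hv : v ∈ P.deg d) : P.act x v ∈ P.deg (d + 1) := by
  refine P.deg_induction (p := fun v => P.act x v ∈ P.deg (d + 1)) (by simp) (fun v w hv hw => by rw [map_add]; exact add_mem hv hw)
    (fun L c hL => ?_) hv
  have h4 := P.mapDomain_mem_deg (d := d + 1) (fun i => i ::ₘ L) (fun _ => by simpa using hL) (P.s x c)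
  have := add_mem (P.deg_mono (by omega) (P.act_sub_top_mem x L c)) h4
  rwa [← top_apply, sub_add_cancel] at this

theorem act_zero_single (x : M) (b : B) : P.act x (single 0 b) = P.base x b := by
  rw [act_single, stepAt_zero]

theorem act_cons_single {j : ι} {N : Multiset ι} (h : ∀ i ∈ N, j ≤ i) (x : M) (b : B) :
    P.act x (single (j ::ₘ N) b) = P.step P.act j N x b := by
  rw [act_single, stepAt_cons _ _ h, step_apply, step_apply]
  have h1 := fun x b => (P.approx_spec (Multiset.card (j ::ₘ N)) N (by simp) x b).1
  rw [h1, h1, P.corr_congr h1]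
  have : ∀ v ∈ P.deg (Multiset.card N), ∀ y,
      P.approx (Multiset.card (j ::ₘ N)) y v = P.act y v := by
    intro v hv y
    refine P.deg_induction (p := fun v => P.approx (Multiset.card (j ::ₘ N)) y v = P.act y v)
      (by simp only [map_zero]) (fun v w hv hw => by rw [map_add, map_add, hv, hw])
      (fun L c hL => ?_) hv
    exact (P.approx_spec _ L (by simpa using Nat.lt_succ_of_le hL) y c).1
  rw [this _ (P.act_sub_top_mem x N b)]

theorem act_of_mem_N {x : M} (hx : x ∈ P.N) (v : P.Mod) : P.act x v = 0 := by
  suffices H : ∀ n : ℕ, ∀ x ∈ P.N, ∀ (L : Multiset ι) (b : B), Multiset.card L = n →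
      P.act x (single L b) = 0 by
    induction v using Finsupp.induction_linear with
    | zero => simp
    | add v w hv hw => rw [map_add, hv, hw, add_zero]
    | single L b => exact H _ x hx L b rfl
  intro n
  induction n with
  | zero =>
    intro x hx L b hL
    rw [Multiset.card_eq_zero] at hL
    subst hL
    rw [act_zero_single, base_apply, P.s_N x hx, P.r_N x hx]
    simp
  | succ n ih =>
    intro x hx L b hL
    obtain ⟨j, N, rfl, hj, hN⟩ := exists_cons hL
    rw [P.act_cons_single hj, step_apply, top_apply, top_apply, P.s_N x hx, ih x hx N b hN,
      ih _ (P.br_N x hx j) N b hN]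
    simp

theorem act_e_single {j : ι} {N : Multiset ι} (h : ∀ i ∈ N, j ≤ i) (b : B) :
    P.act (P.e j) (single N b) = single (j ::ₘ N) b := by
  induction hn : Multiset.card N generalizing N b with
  | zero =>
    rw [Multiset.card_eq_zero] at hn
    subst hn
    rw [act_zero_single, base_apply, P.r_e, P.s_e]
    simp
  | succ n ih =>
    obtain ⟨i, L, rfl, hi, hL⟩ := exists_cons hn
    have hij : j ≤ i := h i (by simp)
    have hjL : ∀ l ∈ L, j ≤ l := fun l hl => h l (by simp [hl])
    rw [P.act_cons_single hi, step_apply, top_apply, top_apply, P.s_e, mapDomain_single,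
      mapDomain_single, ih hjL b hL, sub_self, map_zero, add_zero, corr, lsum_single, add_assoc,
      add_eq_left]
    rcases hij.lt_or_eq with hlt | rfl
    · rw [if_pos hlt, LinearMap.comp_apply, lsingle_apply, ← LinearMap.add_apply, ← map_add]
      exact P.act_of_mem_N (P.skew _ _) _
    · rw [if_neg (lt_irrefl _), P.act_of_mem_N (P.br_self j)]
      simp

theorem act_single_cons {j : ι} {N : Multiset ι} (h : ∀ i ∈ N, j ≤ i) (x : M) (b : B) :
    P.act x (single (j ::ₘ N) b) =
      P.act (P.e j) (P.act x (single N b)) + P.act (P.br x (P.e j)) (single N b) := by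
  rw [P.act_cons_single h, step_apply, map_sub, top_apply, top_apply]
  suffices H : ∀ c : ι →₀ B, mapDomain (fun i => i ::ₘ j ::ₘ N) c + P.corr P.act j N c =
      P.act (P.e j) (mapDomain (fun i => i ::ₘ N) c) by
    rw [H]; abel
  intro c
  induction c using Finsupp.induction_linear with
  | zero => simp
  | add c c' hc hc' =>
    rw [mapDomain_add, mapDomain_add, map_add, map_add, ← hc, ← hc']; abel
  | single i c =>
    rw [mapDomain_single, mapDomain_single, corr, lsum_single]
    by_cases hij : i < j
    · have hi : ∀ l ∈ N, i ≤ l := fun l hl => hij.le.trans (h l hl)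
      rw [if_pos hij, LinearMap.comp_apply, lsingle_apply, P.act_cons_single hi, step_apply,
        top_apply, top_apply, P.s_e, mapDomain_single, mapDomain_single, P.act_e_single h, corr,
        lsum_single, if_neg hij.le.not_gt, Multiset.cons_swap]
      simp
    · rw [if_neg hij, Multiset.cons_swap, P.act_e_single]
      · simp
      · intro l hl
        rcases Multiset.mem_cons.1 hl with rfl | hl
        exacts [not_lt.1 hij, h l hl]

/-- The defect of the commutation relation of two operators. -/
noncomputable def defect (x y : M) : P.Mod →ₗ[k] P.Mod :=
  P.act x ∘ₗ P.act y - P.act y ∘ₗ P.act x - P.act (P.br x y)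

theorem defect_apply (x y : M) (v : P.Mod) :
    P.defect x y v = P.act x (P.act y v) - P.act y (P.act x v) - P.act (P.br x y) v := rfl

theorem defect_add_left (x x' y : M) (v : P.Mod) :
    P.defect (x + x') y v = P.defect x y v + P.defect x' y v := by
  simp only [defect_apply, map_add, LinearMap.add_apply]; abel

theorem defect_add_right (x y y' : M) (v : P.Mod) :
    P.defect x (y + y') v = P.defect x y v + P.defect x y' v := by
  simp only [defect_apply, map_add, LinearMap.add_apply]; abel

theorem defect_cons {j : ι} {N : Multiset ι} (h : ∀ i ∈ N, j ≤ i) (x : M) (b : B) :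
    P.defect x (P.e j) (single N b) = 0 := by
  rw [defect_apply, P.act_e_single h, P.act_single_cons h]; abel

theorem defect_expand (x y : M) (j : ι) (v : P.Mod) :
    P.defect x y (P.act (P.e j) v) = P.act (P.e j) (P.defect x y v)
      + P.defect x (P.br y (P.e j)) v - P.defect y (P.br x (P.e j)) v
      + P.act x (P.defect y (P.e j) v) - P.act y (P.defect x (P.e j) v)
      + P.defect x (P.e j) (P.act y v) - P.defect y (P.e j) (P.act x v)
      - P.defect (P.br x y) (P.e j) v := by
  have h := P.act_of_mem_N (P.jacobi x y j) v
  simp only [defect_apply, map_add, map_sub, LinearMap.add_apply, LinearMap.sub_apply] at h ⊢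
  linear_combination (norm := abel) -h

theorem defect_eq_zero_of_deg {d : ℕ} {x y : M}
    (h : ∀ L b, Multiset.card L ≤ d → P.defect x y (single L b) = 0) {v : P.Mod}
    (hv : v ∈ P.deg d) : P.defect x y v = 0 :=
  P.deg_induction (p := fun v => P.defect x y v = 0) (map_zero _)
    (fun v w hv hw => by rw [map_add, hv, hw, add_zero]) h hv

/-- The operators satisfy the commutation relations if they do so on the base module. -/
theorem defect_eq_zero (h : ∀ x y b, P.defect x y (single 0 b) = 0) (x y : M) (v : P.Mod) :
    P.defect x y v = 0 := by
  suffices H : ∀ d : ℕ, ∀ x y L b, Multiset.card L ≤ d → P.defect x y (single L b) = 0 by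
    induction v using Finsupp.induction_linear with
    | zero => simp
    | add v w hv hw => rw [map_add, hv, hw, add_zero]
    | single L b => exact H _ x y L b le_rfl
  intro d
  induction d with
  | zero =>
    intro x y L b hL
    rw [Nat.le_zero, Multiset.card_eq_zero] at hL
    subst hL
    exact h x y b
  | succ d ih =>
    intro x y L b hL
    rcases hL.lt_or_eq with hL | hL
    · exact ih x y L b (Nat.lt_succ_iff.1 hL)
    obtain ⟨j, N, rfl, hj, hN⟩ := exists_cons hL
    have ih' : ∀ x y, ∀ v ∈ P.deg d, P.defect x y v = 0 := fun x y v hv =>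
      P.defect_eq_zero_of_deg (fun L b => ih x y L b) hv
    have hs : ∀ b, single N b ∈ P.deg d := P.single_mem_deg hN.le
    have key : ∀ x i l b, P.defect x (P.e i) (P.act (P.e l) (single N b)) =
        P.defect x (P.e l) (P.act (P.e i) (single N b)) -
          P.defect (P.e i) (P.e l) (P.act x (single N b)) := by
      intro x i l b
      rw [P.defect_expand]
      simp only [ih' _ _ _ (hs b), map_zero]
      abel
    have top : ∀ x i, (∀ l c, P.defect x (P.e i) (single (l ::ₘ N) c) = 0) → ∀ y b,
        P.defect x (P.e i) (P.act y (single N b)) = 0 := by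
      intro x i hx y b
      have h1 := P.act_sub_top_mem y N b
      rw [hN] at h1
      have h2 := ih' x (P.e i) _ h1
      rw [map_sub, sub_eq_zero] at h2
      rw [h2, top_apply]
      induction P.s y b using Finsupp.induction_linear with
      | zero => simp
      | add c c' hc hc' => rw [mapDomain_add, map_add, hc, hc', add_zero]
      | single l c => rw [mapDomain_single]; exact hx l c
    have cons : ∀ i, (∀ l ∈ N, i ≤ l) → ∀ x l, i ≤ l → ∀ c,
        P.defect x (P.e i) (single (l ::ₘ N) c) = 0 := fun i hi x l hl c =>
      P.defect_cons (fun l' hl' => by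
        rcases Multiset.mem_cons.1 hl' with rfl | hl'
        exacts [hl, hi _ hl']) x c
    have lower : ∀ i ≤ j, ∀ l c, P.defect (P.e j) (P.e i) (single (l ::ₘ N) c) = 0 := by
      intro i hij l c
      have hi : ∀ l ∈ N, i ≤ l := fun l hl => hij.trans (hj l hl)
      rcases le_or_gt i l with hl | hl
      · exact cons i hi _ l hl c
      · have hl' : ∀ l' ∈ N, l ≤ l' := fun l' h => hl.le.trans (hi l' h)
        rw [← P.act_e_single hl', key, P.act_e_single hi, P.act_e_single hj,
          cons l hl' _ i hl.le, cons l hl' _ j (hl.le.trans hij), sub_zero]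
    have main : ∀ x l c, P.defect x (P.e j) (single (l ::ₘ N) c) = 0 := by
      intro x l c
      rcases le_or_gt j l with hl | hl
      · exact cons j hj _ l hl c
      · have hl' : ∀ l' ∈ N, l ≤ l' := fun l' h => hl.le.trans (hj l' h)
        rw [← P.act_e_single hl', key, P.act_e_single hj, cons l hl' _ j hl.le,
          top _ _ (lower l hl.le), sub_zero]
    rw [← P.act_e_single hj, P.defect_expand]
    simp only [ih' _ _ _ (hs b), map_zero, top _ _ (main _)]
    abel

end PBWData

/-! ### Modes of a `1`-truncated vertex algebra -/

namespace OneTruncated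

variable {k A E : Type*} [CommRing k] [CommRing A] [Algebra k A] [AddCommGroup E] [Module k E]

theorem form_del' (O : OneTruncated k A E) (x : E) (a : A) : O.form (O.del a) x = O.act x a := by
  rw [O.form_comm, O.form_del]

/-- The module of modes `aₙ`, `xₙ` (`a ∈ A`, `x ∈ E`, `n ∈ ℤ`), extended by a derivation `D`. -/
def Modes (_O : OneTruncated k A E) := (ℤ →₀ A) × (ℤ →₀ E) × k

noncomputable instance (O : OneTruncated k A E) : AddCommGroup O.Modes :=
  inferInstanceAs (AddCommGroup ((ℤ →₀ A) × (ℤ →₀ E) × k))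

noncomputable instance (O : OneTruncated k A E) : Module k O.Modes :=
  inferInstanceAs (Module k ((ℤ →₀ A) × (ℤ →₀ E) × k))

variable (O : OneTruncated k A E)

/-- The mode `aₙ`. -/
noncomputable def modeA (n : ℤ) : A →ₗ[k] O.Modes :=
  (LinearMap.inl k (ℤ →₀ A) ((ℤ →₀ E) × k) ∘ₗ Finsupp.lsingle n :)

/-- The mode `xₙ`. -/
noncomputable def modeE (n : ℤ) : E →ₗ[k] O.Modes :=
  (LinearMap.inr k (ℤ →₀ A) ((ℤ →₀ E) × k) ∘ₗ LinearMap.inl k (ℤ →₀ E) k ∘ₗ Finsupp.lsingle n :)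

/-- The derivation `D`. -/
noncomputable def modeD : O.Modes := ((0, 0, 1) : (ℤ →₀ A) × (ℤ →₀ E) × k)

variable {X : Type*} [AddCommGroup X] [Module k X]

/-- A linear map on modes, given its values on generators. -/
noncomputable def elim (f : ℤ → A →ₗ[k] X) (g : ℤ → E →ₗ[k] X) (d : X) : O.Modes →ₗ[k] X :=
  (Finsupp.lsum k f).coprod ((Finsupp.lsum k g).coprod (LinearMap.toSpanSingleton k X d))

@[simp] theorem elim_modeA (f : ℤ → A →ₗ[k] X) (g : ℤ → E →ₗ[k] X) (d : X) (n : ℤ) (a : A) :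
    O.elim f g d (O.modeA n a) = f n a := by
  change ((Finsupp.lsum k f).coprod ((Finsupp.lsum k g).coprod (LinearMap.toSpanSingleton k X d)))
    (Finsupp.single n a, 0) = f n a
  simp

@[simp] theorem elim_modeE (f : ℤ → A →ₗ[k] X) (g : ℤ → E →ₗ[k] X) (d : X) (n : ℤ) (x : E) :
    O.elim f g d (O.modeE n x) = g n x := by
  change ((Finsupp.lsum k f).coprod ((Finsupp.lsum k g).coprod (LinearMap.toSpanSingleton k X d)))
    (0, Finsupp.single n x, 0) = g n x
  simp

@[simp] theorem elim_modeD (f : ℤ → A →ₗ[k] X) (g : ℤ → E →ₗ[k] X) (d : X) :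
    O.elim f g d O.modeD = d := by
  change ((Finsupp.lsum k f).coprod ((Finsupp.lsum k g).coprod (LinearMap.toSpanSingleton k X d)))
    (0, 0, 1) = d
  simp

theorem modes_induction {p : O.Modes → Prop} (x : O.Modes) (add : ∀ x y, p x → p y → p (x + y))
    (smul : ∀ (c : k) x, p x → p (c • x)) (hA : ∀ n a, p (O.modeA n a))
    (hE : ∀ n x, p (O.modeE n x)) (hD : p O.modeD) : p x := by
  suffices H : (⊤ : Submodule k O.Modes) ≤
      Submodule.span k ({x | ∃ n a, x = O.modeA n a} ∪ {x | ∃ n y, x = O.modeE n y} ∪ {O.modeD}) by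
    refine Submodule.span_induction (p := fun x _ => p x) ?_ ?_ (fun x y _ _ => add x y)
      (fun c x _ => smul c x) (H (Submodule.mem_top (x := x)))
    · rintro x ((⟨n, a, rfl⟩ | ⟨n, y, rfl⟩) | rfl)
      exacts [hA n a, hE n y, hD]
    · have := hA 0 0
      rwa [map_zero] at this
  rintro ⟨f, g, c⟩ -
  have h : ((f, g, c) : O.Modes) = (f.sum fun n a => O.modeA n a) + (g.sum fun n y => O.modeE n y)
      + c • O.modeD := by
    have h1 : (f.sum fun n a => O.modeA n a) = LinearMap.inl k (ℤ →₀ A) ((ℤ →₀ E) × k) f := by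
      conv_rhs => rw [← f.sum_single, map_finsuppSum]
      rfl
    have h2 : (g.sum fun n y => O.modeE n y) = LinearMap.inr k (ℤ →₀ A) ((ℤ →₀ E) × k)
        (LinearMap.inl k (ℤ →₀ E) k g) := by
      conv_rhs => rw [← g.sum_single, map_finsuppSum, map_finsuppSum]
      rfl
    rw [h1, h2]
    have h3 : ((f, g, c) : (ℤ →₀ A) × (ℤ →₀ E) × k) = (f, 0, 0) + (0, g, 0) + c • (0, 0, 1) := by
      simp
    exact h3
  rw [h]
  refine add_mem (add_mem (sum_mem fun n _ => ?_) (sum_mem fun n _ => ?_))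
    (Submodule.smul_mem _ _ ?_) <;> refine Submodule.subset_span ?_
  · exact Or.inl (Or.inl ⟨_, _, rfl⟩)
  · exact Or.inl (Or.inr ⟨_, _, rfl⟩)
  · exact Or.inr rfl

/-- The bracket of modes: `[xₘ, yₙ] = (x₀y)ₘ₊ₙ + m ⟨x, y⟩ₘ₊ₙ₋₁`, `[xₘ, aₙ] = (x₀a)ₘ₊ₙ`,
`[D, xₙ] = -n xₙ₋₁`. -/
noncomputable def lie : O.Modes →ₗ[k] O.Modes →ₗ[k] O.Modes :=
  O.elim
    (fun m => (O.elim (fun _ => 0) (fun n => -O.act.compr₂ (O.modeA (m + n)))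
      (m • O.modeA (m - 1))).flip)
    (fun m => (O.elim (fun n => O.act.flip.compr₂ (O.modeA (m + n)))
      (fun n => O.br.flip.compr₂ (O.modeE (m + n)) + m • O.form.flip.compr₂ (O.modeA (m + n - 1)))
      (m • O.modeE (m - 1))).flip)
    (O.elim (fun n => -n • O.modeA (n - 1)) (fun n => -n • O.modeE (n - 1)) 0)

@[simp] theorem lie_A_A (m n : ℤ) (a b : A) : O.lie (O.modeA m a) (O.modeA n b) = 0 := by
  simp [lie]

@[simp] theorem lie_A_E (m n : ℤ) (a : A) (y : E) :
    O.lie (O.modeA m a) (O.modeE n y) = -O.modeA (m + n) (O.act y a) := by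
  simp [lie]

@[simp] theorem lie_A_D (m : ℤ) (a : A) :
    O.lie (O.modeA m a) O.modeD = m • O.modeA (m - 1) a := by
  simp [lie]

@[simp] theorem lie_E_A (m n : ℤ) (x : E) (a : A) :
    O.lie (O.modeE m x) (O.modeA n a) = O.modeA (m + n) (O.act x a) := by
  simp [lie]

@[simp] theorem lie_E_E (m n : ℤ) (x y : E) : O.lie (O.modeE m x) (O.modeE n y) =
    O.modeE (m + n) (O.br x y) + m • O.modeA (m + n - 1) (O.form x y) := by
  simp [lie]

@[simp] theorem lie_E_D (m : ℤ) (x : E) :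
    O.lie (O.modeE m x) O.modeD = m • O.modeE (m - 1) x := by
  simp [lie]

@[simp] theorem lie_D_A (m : ℤ) (a : A) :
    O.lie O.modeD (O.modeA m a) = -m • O.modeA (m - 1) a := by
  simp [lie]

@[simp] theorem lie_D_E (m : ℤ) (x : E) :
    O.lie O.modeD (O.modeE m x) = -m • O.modeE (m - 1) x := by
  simp [lie]

@[simp] theorem lie_D_D : O.lie O.modeD O.modeD = 0 := by
  simp [lie]

/-- The submodule of modes generated by the relations `(∂a)ₙ = -n aₙ₋₁`. -/
noncomputable def nullModes : Submodule k O.Modes :=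
  Submodule.span k {x | ∃ (n : ℤ) (a : A), x = O.modeE n (O.del a) + n • O.modeA (n - 1) a}

theorem lie_null (x : O.Modes) (hx : x ∈ O.nullModes) (n : ℤ) (y : E) :
    O.lie x (O.modeE n y) = 0 := by
  induction hx using Submodule.span_induction with
  | mem x hx =>
    obtain ⟨m, a, rfl⟩ := hx
    have e : m + n - 1 = m - 1 + n := by ring
    rw [map_add, LinearMap.add_apply, lie_E_E, O.del_br, form_del', map_zero, zero_add, map_zsmul,
      LinearMap.smul_apply, lie_A_E, e, smul_neg, add_neg_cancel]
  | zero => rw [map_zero, LinearMap.zero_apply]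
  | add x y _ _ hx hy => rw [map_add, LinearMap.add_apply, hx, hy, add_zero]
  | smul c x _ hx => rw [map_smul, LinearMap.smul_apply, hx, smul_zero]

theorem lie_skew (x : O.Modes) (n : ℤ) (y : E) :
    O.lie x (O.modeE n y) + O.lie (O.modeE n y) x ∈ O.nullModes := by
  induction x using O.modes_induction with
  | add x x' h h' =>
    rw [map_add, map_add, LinearMap.add_apply, add_add_add_comm]
    exact add_mem h h'
  | smul c x h =>
    rw [map_smul, map_smul, LinearMap.smul_apply, ← smul_add]
    exact Submodule.smul_mem _ _ h
  | hA m a => simp [add_comm m n]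
  | hE m x =>
    refine Submodule.subset_span ⟨m + n, O.form x y, ?_⟩
    rw [lie_E_E, lie_E_E, ← O.br_add_br, O.form_comm y x, add_comm n m, map_add, add_smul]
    abel
  | hD => simp

theorem lie_self [Invertible (2 : k)] (n : ℤ) (y : E) :
    O.lie (O.modeE n y) (O.modeE n y) ∈ O.nullModes := by
  have h := O.nullModes.smul_mem (⅟2 : k) (O.lie_skew (O.modeE n y) n y)
  rwa [smul_add, VertexAlgebroid.invOf_two_smul_add_self] at h

theorem lie_jacobi_A (m : ℤ) (a : A) (y : O.Modes) (n : ℤ) (z : E) :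
    O.lie (O.lie (O.modeA m a) y) (O.modeE n z) - O.lie (O.modeA m a) (O.lie y (O.modeE n z))
      + O.lie y (O.lie (O.modeA m a) (O.modeE n z)) = 0 := by
  induction y using O.modes_induction with
  | add x x' h h' =>
    simp only [map_add, LinearMap.add_apply]
    linear_combination (norm := abel) h + h'
  | smul c x h =>
    simp only [map_smul, LinearMap.smul_apply, ← smul_sub, ← smul_add, h, smul_zero]
  | hA m' a' => simp
  | hE m' y =>
    have e : m' + n - 1 = m' - 1 + n := by ring
    simp only [lie_A_E, lie_E_E, lie_E_A, map_neg, map_add, map_zsmul, lie_A_A, smul_zero,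
      LinearMap.neg_apply, O.act_br, map_sub, add_assoc, add_left_comm m']
    abel
  | hD =>
    have e : m + (n - 1) = m + n - 1 := by ring
    have e' : m - 1 + n = m + n - 1 := by ring
    simp only [lie_A_E, lie_A_D, lie_D_A, lie_D_E, map_neg, map_zsmul, LinearMap.smul_apply, e, e']
    module

theorem lie_jacobi_E (m : ℤ) (x : E) (y : O.Modes) (n : ℤ) (z : E) :
    O.lie (O.lie (O.modeE m x) y) (O.modeE n z) - O.lie (O.modeE m x) (O.lie y (O.modeE n z))
      + O.lie y (O.lie (O.modeE m x) (O.modeE n z)) = 0 := by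
  induction y using O.modes_induction with
  | add x x' h h' =>
    simp only [map_add, LinearMap.add_apply]
    linear_combination (norm := abel) h + h'
  | smul c x h =>
    simp only [map_smul, LinearMap.smul_apply, ← smul_sub, ← smul_add, h, smul_zero]
  | hA m' a' =>
    simp only [lie_A_E, lie_E_E, lie_E_A, map_neg, map_add, map_zsmul, lie_A_A, smul_zero,
      O.act_br, map_sub, add_assoc, add_left_comm m']
    abel
  | hE m' y =>
    have h1 := O.act_form x y z
    have h2 := O.act_form y x z
    have h3 := O.form_del' z (O.form x y)
    have h4 : O.form (O.br y x) z = O.form (O.del (O.form x y)) z - O.form (O.br x y) z := by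
      rw [← O.br_add_br, map_add, LinearMap.add_apply]; abel
    rw [h4, h3] at h2
    have e3 : m + (m' + n - 1) = m + m' + n - 1 := by ring
    have e4 : m' + (m + n - 1) = m + m' + n - 1 := by ring
    have e5 : m + m' - 1 + n = m + m' + n - 1 := by ring
    have e6 : m' + (m + n) = m + m' + n := by ring
    simp only [lie_E_E, lie_E_A, map_add, map_zsmul, lie_A_E, LinearMap.add_apply,
      LinearMap.smul_apply, e3, e4, e5, e6, O.br_br x y z, h1, h2, map_sub, ← add_assoc]
    module
  | hD =>
    have e1 : m - 1 + n = m + n - 1 := by ring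
    have e2 : m + (n - 1) = m + n - 1 := by ring
    simp only [lie_E_D, lie_D_E, lie_E_E, map_zsmul, map_add, LinearMap.smul_apply,
      lie_D_A, e1, e2]
    module

theorem lie_jacobi_D (y : O.Modes) (n : ℤ) (z : E) :
    O.lie (O.lie O.modeD y) (O.modeE n z) - O.lie O.modeD (O.lie y (O.modeE n z))
      + O.lie y (O.lie O.modeD (O.modeE n z)) = 0 := by
  induction y using O.modes_induction with
  | add x x' h h' =>
    simp only [map_add, LinearMap.add_apply]
    linear_combination (norm := abel) h + h'
  | smul c x h =>
    simp only [map_smul, LinearMap.smul_apply, ← smul_sub, ← smul_add, h, smul_zero]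
  | hA m a =>
    have e : m + (n - 1) = m + n - 1 := by ring
    have e' : m - 1 + n = m + n - 1 := by ring
    simp only [lie_A_E, lie_D_A, lie_D_E, map_neg, map_zsmul, LinearMap.smul_apply, e, e']
    module
  | hE m y =>
    have e1 : m - 1 + n = m + n - 1 := by ring
    have e2 : m + (n - 1) = m + n - 1 := by ring
    simp only [lie_D_E, lie_E_E, map_zsmul, map_add, LinearMap.smul_apply,
      lie_D_A, e1, e2]
    module
  | hD => simp


theorem lie_jacobi (x y : O.Modes) (n : ℤ) (z : E) :
    O.lie (O.lie x y) (O.modeE n z) - O.lie x (O.lie y (O.modeE n z))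
      + O.lie y (O.lie x (O.modeE n z)) = 0 := by
  induction x using O.modes_induction with
  | add x x' h h' =>
    simp only [map_add, LinearMap.add_apply]
    linear_combination (norm := abel) h + h'
  | smul c x h =>
    simp only [map_smul, LinearMap.smul_apply, ← smul_sub, ← smul_add, h, smul_zero]
  | hA m a => exact O.lie_jacobi_A m a y n z
  | hE m x => exact O.lie_jacobi_E m x y n z
  | hD => exact O.lie_jacobi_D y n z

end OneTruncated

/-! ### Sums with finitely many nonzero terms -/

/-- `EvSum f s`: the partial sums of `f` are eventually equal to `s`. -/
def EvSum {M : Type*} [AddCommGroup M] (f : ℕ → M) (s : M) : Prop :=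
  ∃ K, ∀ P ≥ K, ∑ j ∈ Finset.range P, f j = s

namespace EvSum

variable {M N : Type*} [AddCommGroup M] [AddCommGroup N] {f g : ℕ → M} {s t : M}

theorem unique (hf : EvSum f s) (hg : EvSum f t) : s = t := by
  obtain ⟨K, hK⟩ := hf
  obtain ⟨L, hL⟩ := hg
  rw [← hK _ (le_max_left K L), hL _ (le_max_right K L)]

theorem add (hf : EvSum f s) (hg : EvSum g t) : EvSum (fun j => f j + g j) (s + t) := by
  obtain ⟨K, hK⟩ := hf
  obtain ⟨L, hL⟩ := hg
  refine ⟨max K L, fun P hP => ?_⟩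
  rw [Finset.sum_add_distrib, hK P (le_of_max_le_left hP), hL P (le_of_max_le_right hP)]

theorem map {F : Type*} [FunLike F M N] [AddMonoidHomClass F M N] (φ : F) (hf : EvSum f s) :
    EvSum (fun j => φ (f j)) (φ s) := by
  obtain ⟨K, hK⟩ := hf
  exact ⟨K, fun P hP => by rw [← map_sum, hK P hP]⟩

theorem neg (hf : EvSum f s) : EvSum (fun j => -f j) (-s) := hf.map (negAddMonoidHom : M →+ M)

theorem sub (hf : EvSum f s) (hg : EvSum g t) : EvSum (fun j => f j - g j) (s - t) := by
  simpa only [sub_eq_add_neg] using hf.add hg.neg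

theorem zsmul (c : ℤ) (hf : EvSum f s) : EvSum (fun j => c • f j) (c • s) :=
  hf.map (zsmulAddGroupHom c : M →+ M)

theorem zero : EvSum (fun _ => (0 : M)) 0 := ⟨0, fun P _ => by simp⟩

theorem congr (hf : EvSum f s) (h : ∀ j, f j = g j) : EvSum g s := by
  rwa [show g = f from funext fun j => (h j).symm]

theorem conv (hf : EvSum f s) (h : ∀ j, f j = g j) (hs : s = t) : EvSum g t := hs ▸ hf.congr h

theorem of_eventually_zero {K : ℕ} (h : ∀ j ≥ K, f j = 0) :
    EvSum f (∑ j ∈ Finset.range K, f j) := by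
  refine ⟨K, fun P hP => ?_⟩
  rw [← Finset.sum_subset (Finset.range_subset_range.2 hP)]
  intro j _ hj
  exact h j (by simpa using hj)

theorem eventually_zero (hf : EvSum f s) : ∃ K, ∀ j ≥ K, f j = 0 := by
  obtain ⟨K, hK⟩ := hf
  refine ⟨K, fun j hj => ?_⟩
  have := hK (j + 1) (by omega)
  rw [Finset.sum_range_succ, hK j hj] at this
  simpa using this

theorem of_succ (hf : EvSum (fun j => f (j + 1)) s) : EvSum f (f 0 + s) := by
  obtain ⟨K, hK⟩ := hf
  refine ⟨K + 1, fun P hP => ?_⟩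
  obtain ⟨P, rfl⟩ := Nat.exists_eq_add_of_le' (show 1 ≤ P by omega)
  rw [Finset.sum_range_succ', hK P (by omega), add_comm]

theorem succ (hf : EvSum f s) : EvSum (fun j => f (j + 1)) (s - f 0) := by
  obtain ⟨K, hK⟩ := hf
  refine ⟨K, fun P hP => ?_⟩
  rw [eq_sub_iff_add_eq, ← hK (P + 1) (by omega), Finset.sum_range_succ']

theorem single_zero (h : ∀ j, f (j + 1) = 0) : EvSum f (f 0) := by
  simpa using of_succ (EvSum.zero.congr fun j => (h j).symm)

end EvSum

theorem zsmul_cancel (k : Type*) {M : Type*} [CommRing k] [Algebra ℚ k] [AddCommGroup M]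
    [Module k M] {n : ℤ} (hn : n ≠ 0) {v w : M} (h : n • v = n • w) : v = w := by
  have h1 : ∀ v : M, (algebraMap ℚ k (n : ℚ)⁻¹) • n • v = v := by
    intro v
    rw [← Int.cast_smul_eq_zsmul k n v, smul_smul, ← map_intCast (algebraMap ℚ k) n, ← map_mul,
      inv_mul_cancel₀ (by exact_mod_cast hn), map_one, one_smul]
  rw [← h1 v, h, h1]

/-! ### Divided powers of an endomorphism -/

section divPow

variable {k M : Type*} [CommRing k] [Algebra ℚ k] [AddCommGroup M] [Module k M]

/-- The divided power `Dⁱ / i!`, which is zero for `i < 0`. -/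
noncomputable def divPow (D : M →ₗ[k] M) (i : ℤ) : M →ₗ[k] M :=
  if 0 ≤ i then algebraMap ℚ k ((i.toNat.factorial : ℚ)⁻¹) • (D ^ i.toNat : Module.End k M) else 0

theorem divPow_of_neg (D : M →ₗ[k] M) {i : ℤ} (h : i < 0) : divPow D i = 0 := if_neg (not_le.2 h)

theorem divPow_zero (D : M →ₗ[k] M) (v : M) : divPow D 0 v = v := by simp [divPow]

theorem divPow_natCast (D : M →ₗ[k] M) (n : ℕ) :
    divPow D n = algebraMap ℚ k ((n.factorial : ℚ)⁻¹) • (D ^ n : Module.End k M) := by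
  simp [divPow]

theorem apply_divPow (D : M →ₗ[k] M) (i : ℤ) (v : M) :
    D (divPow D i v) = (i + 1) • divPow D (i + 1) v := by
  rcases lt_or_ge i 0 with hi | hi
  · rw [divPow_of_neg D hi]
    rcases (show i + 1 < 0 ∨ i + 1 = 0 by omega) with h | h
    · rw [divPow_of_neg D h]; simp
    · rw [h]; simp
  · obtain ⟨n, rfl⟩ := Int.eq_ofNat_of_zero_le hi
    rw [show ((n : ℤ) + 1) = ((n + 1 : ℕ) : ℤ) by simp, divPow_natCast, divPow_natCast,
      LinearMap.smul_apply, LinearMap.smul_apply, map_smul, pow_succ', Module.End.mul_apply,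
      ← Int.cast_smul_eq_zsmul k, smul_smul]
    congr 1
    rw [← map_intCast (algebraMap ℚ k), ← map_mul]
    congr 1
    have := Nat.factorial_ne_zero n
    push_cast [Nat.factorial_succ]
    field_simp

theorem divPow_apply (D : M →ₗ[k] M) (i : ℤ) (v : M) :
    divPow D i (D v) = (i + 1) • divPow D (i + 1) v := by
  rw [← apply_divPow]
  rcases lt_or_ge i 0 with hi | hi
  · simp [divPow_of_neg D hi]
  · obtain ⟨n, rfl⟩ := Int.eq_ofNat_of_zero_le hi
    rw [divPow_natCast, LinearMap.smul_apply, LinearMap.smul_apply, map_smul,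
      ← Module.End.mul_apply, ← pow_succ, pow_succ', Module.End.mul_apply]

/-- Induction for identities involving divided powers. -/
theorem divPow_induction {p : ℤ → Prop} (neg : ∀ i < 0, p i) (zero : p 0)
    (succ : ∀ i ≥ 0, p i → p (i + 1)) (i : ℤ) : p i := by
  rcases lt_or_ge i 0 with hi | hi
  · exact neg i hi
  · exact Int.leInduction zero (fun n hn => succ n hn) i hi

end divPow

section Leibniz

variable {k B : Type*} [CommRing k] [Algebra ℚ k] [CommRing B] [Algebra k B] (D : Derivation k B B)

/-- The Leibniz rule for divided powers of a derivation. -/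
theorem divPow_mul (i : ℤ) (f g : B) :
    EvSum (fun j : ℕ => divPow (D : B →ₗ[k] B) j f * divPow (D : B →ₗ[k] B) (i - j) g)
      (divPow (D : B →ₗ[k] B) i (f * g)) := by
  induction i using divPow_induction with
  | neg i hi =>
    rw [divPow_of_neg _ hi]
    exact EvSum.zero.congr fun j => by rw [divPow_of_neg _ (show i - (j : ℤ) < 0 by omega)]; simp
  | zero =>
    have := EvSum.single_zero (f := fun j : ℕ => divPow (D : B →ₗ[k] B) j f *
      divPow (D : B →ₗ[k] B) (0 - j) g) fun j => by
        rw [divPow_of_neg _ (show (0 : ℤ) - (j + 1 : ℕ) < 0 by push_cast; omega)]; simp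
    simpa [divPow_zero] using this
  | succ i hi ih =>
    set d := divPow (D : B →ₗ[k] B) with hd
    have hD : ∀ i f, D (d i f) = (i + 1) • d (i + 1) f := apply_divPow (D : B →ₗ[k] B)
    have hz : ∀ j : ℕ, j ≥ (i + 2).toNat → d (i + 1 - j) g = 0 := fun j hj => by
      rw [hd, divPow_of_neg _ (show i + 1 - (j : ℤ) < 0 by omega), LinearMap.zero_apply]
    have h0 := EvSum.of_eventually_zero (f := fun j : ℕ => d j f * d (i + 1 - j) g)
      (K := (i + 2).toNat) fun j hj => by rw [hz j hj, mul_zero]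
    have h1 := EvSum.of_eventually_zero (f := fun j : ℕ => (j : ℤ) • (d j f * d (i + 1 - j) g))
      (K := (i + 2).toNat) fun j hj => by rw [hz j hj, mul_zero, smul_zero]
    have h2 := EvSum.of_eventually_zero
      (f := fun j : ℕ => (i + 1 - j : ℤ) • (d j f * d (i + 1 - j) g))
      (K := (i + 2).toNat) fun j hj => by rw [hz j hj, mul_zero, smul_zero]
    have h3 := (h1.succ.add h2).unique ((ih.map D).congr fun j => ?_)
    · simp only [Nat.cast_zero, zero_smul, sub_zero, hD] at h3
      have h4 := ((h1.add h2).congr (g := fun j : ℕ => (i + 1) • (d j f * d (i + 1 - j) g))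
        fun j => by rw [← add_smul]; congr 1; ring).unique (h0.zsmul (i + 1))
      rw [h3] at h4
      rw [zsmul_cancel k (by omega) h4]
      exact h0
    · have e : i + 1 - (j + 1 : ℕ) = i - j := by push_cast; ring
      have e' : i - j + 1 = i + 1 - j := by ring
      rw [Derivation.leibniz, hD, hD, smul_eq_mul, smul_eq_mul, mul_smul_comm, mul_smul_comm, e, e',
        add_comm, mul_comm (d _ g)]
      push_cast
      rfl

end Leibniz

/-! ### Derivations of polynomial algebras -/

namespace MvPolynomial

variable {k A σ : Type*} [CommRing k] [CommRing A] [Algebra k A]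

/-- The homomorphism to the dual numbers corresponding to a derivation. -/
noncomputable def dualHom (δ : Derivation k A (MvPolynomial σ A)) (y : σ → MvPolynomial σ A) :
    MvPolynomial σ A →+* TrivSqZeroExt (MvPolynomial σ A) (MvPolynomial σ A) :=
  eval₂Hom
    { toFun := fun a => TrivSqZeroExt.inl (C a) + TrivSqZeroExt.inr (δ a)
      map_one' := by refine TrivSqZeroExt.ext ?_ ?_ <;> simp
      map_zero' := by refine TrivSqZeroExt.ext ?_ ?_ <;> simp
      map_add' := fun a b => by refine TrivSqZeroExt.ext ?_ ?_ <;> simp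
      map_mul' := fun a b => by
        refine TrivSqZeroExt.ext ?_ ?_
        · simp
        · simp only [TrivSqZeroExt.snd_mul, TrivSqZeroExt.snd_add, TrivSqZeroExt.fst_add,
            TrivSqZeroExt.snd_inl, TrivSqZeroExt.snd_inr, TrivSqZeroExt.fst_inl,
            TrivSqZeroExt.fst_inr, zero_add, add_zero, Derivation.leibniz, op_smul_eq_smul,
            smul_eq_mul, smul_eq_C_mul] }
    fun i => TrivSqZeroExt.inl (X i) + TrivSqZeroExt.inr (y i)

theorem fst_dualHom (δ : Derivation k A (MvPolynomial σ A)) (y : σ → MvPolynomial σ A)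
    (p : MvPolynomial σ A) : (dualHom δ y p).fst = p := by
  induction p using MvPolynomial.induction_on with
  | C a => simp [dualHom]
  | add p q hp hq => rw [map_add, TrivSqZeroExt.fst_add, hp, hq]
  | mul_X p i hp => rw [map_mul, TrivSqZeroExt.fst_mul, hp]; simp [dualHom]

/-- The `k`-derivation of a polynomial algebra over a `k`-algebra with given values on the
coefficients and the variables. -/
noncomputable def extendDerivation (δ : Derivation k A (MvPolynomial σ A))
    (y : σ → MvPolynomial σ A) : Derivation k (MvPolynomial σ A) (MvPolynomial σ A) :=
  Derivation.mk'
    { toFun := fun p => (dualHom δ y p).snd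
      map_add' := fun p q => by simp
      map_smul' := fun c p => by
        rw [← algebraMap_smul A c p, smul_eq_C_mul, map_mul, TrivSqZeroExt.snd_mul, fst_dualHom,
          fst_dualHom]
        simp [dualHom, Algebra.smul_def] }
    fun p q => by
      simp [fst_dualHom, mul_comm]

@[simp] theorem extendDerivation_C (δ : Derivation k A (MvPolynomial σ A))
    (y : σ → MvPolynomial σ A) (a : A) : extendDerivation δ y (C a) = δ a := by
  simp [extendDerivation, dualHom]

@[simp] theorem extendDerivation_X (δ : Derivation k A (MvPolynomial σ A))
    (y : σ → MvPolynomial σ A) (i : σ) : extendDerivation δ y (X i) = y i := by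
  simp [extendDerivation, dualHom]

theorem derivation_hom_ext {D D' : Derivation k (MvPolynomial σ A) (MvPolynomial σ A)}
    (hC : ∀ a, D (C a) = D' (C a)) (hX : ∀ i, D (X i) = D' (X i)) : D = D' := by
  ext1 p
  induction p using MvPolynomial.induction_on with
  | C a => exact hC a
  | add p q hp hq => rw [map_add, map_add, hp, hq]
  | mul_X p i hp => rw [Derivation.leibniz, Derivation.leibniz, hp, hX]

end MvPolynomial

namespace VertexAlgebroid

open MvPolynomial

variable {k A T Ω : Type*} [CommRing k] [Algebra ℚ k] [Invertible (2 : k)]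
    [CommRing A] [Algebra k A]
    [LieRing T] [LieAlgebra k T] [Module A T] [LieRingModule T A] [LieRinehartRing A T]
    [LieRinehartAlgebra k A T]
    [AddCommGroup Ω] [Module k Ω] [Module A Ω] [IsScalarTower k A Ω]
    [LieRingModule T Ω] [LieModule k T Ω]
    (𝒜 : VertexAlgebroid k A T Ω) {Λ : Type*} (bΩ : Module.Basis Λ A Ω)

/-! ### The commutative vertex algebra generated by `A` and `Ω` -/

/-- The inclusion of `Ω` in the polynomial algebra in the variables `∂^(m) ω`, where `ω` runs
through a basis of `Ω`. -/
noncomputable def inΩ : Ω →ₗ[A] MvPolynomial (Λ × ℕ) A := bΩ.constr A fun l => X (l, 0)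

@[simp] theorem inΩ_basis (l : Λ) : inΩ bΩ (bΩ l) = X (l, 0) := bΩ.constr_basis _ _ _

/-- The derivation `∂` of the polynomial algebra. -/
noncomputable def totalDer : Derivation k (MvPolynomial (Λ × ℕ) A) (MvPolynomial (Λ × ℕ) A) :=
  extendDerivation ((inΩ bΩ).compDer 𝒜.d) fun p => ((p.2 : ℤ) + 1) • X (p.1, p.2 + 1)

/-- The operators `∂^(i)`, which are zero for `i < 0`. -/
noncomputable abbrev dp (i : ℤ) : MvPolynomial (Λ × ℕ) A →ₗ[k] MvPolynomial (Λ × ℕ) A :=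
  divPow (𝒜.totalDer bΩ : MvPolynomial (Λ × ℕ) A →ₗ[k] MvPolynomial (Λ × ℕ) A) i

@[simp] theorem totalDer_C (a : A) : 𝒜.totalDer bΩ (C a) = inΩ bΩ (𝒜.d a) := by simp [totalDer]

@[simp] theorem totalDer_X (p : Λ × ℕ) :
    𝒜.totalDer bΩ (X p) = ((p.2 : ℤ) + 1) • X (p.1, p.2 + 1) := by simp [totalDer]

theorem totalDer_dp (i : ℤ) (b : MvPolynomial (Λ × ℕ) A) :
    𝒜.totalDer bΩ (𝒜.dp bΩ i b) = (i + 1) • 𝒜.dp bΩ (i + 1) b := apply_divPow _ i b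

theorem dp_totalDer (i : ℤ) (b : MvPolynomial (Λ × ℕ) A) :
    𝒜.dp bΩ i (𝒜.totalDer bΩ b) = (i + 1) • 𝒜.dp bΩ (i + 1) b := divPow_apply _ i b

theorem dp_of_neg {i : ℤ} (hi : i < 0) (b : MvPolynomial (Λ × ℕ) A) : 𝒜.dp bΩ i b = 0 := by
  rw [dp, divPow_of_neg _ hi, LinearMap.zero_apply]

theorem dp_zero (b : MvPolynomial (Λ × ℕ) A) : 𝒜.dp bΩ 0 b = b := divPow_zero _ b

theorem dp_X (l : Λ) (m : ℕ) : 𝒜.dp bΩ m (X (l, 0)) = X (l, m) := by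
  induction m with
  | zero => exact 𝒜.dp_zero bΩ _
  | succ m ih =>
    have h := 𝒜.totalDer_dp bΩ m (X (l, 0))
    rw [ih, totalDer_X] at h
    push_cast
    exact (zsmul_cancel k (by omega) h).symm

theorem dp_one (i : ℤ) (hi : i ≠ 0) : 𝒜.dp bΩ i 1 = 0 := by
  have h := 𝒜.dp_totalDer bΩ (i - 1) 1
  rw [Derivation.map_one_eq_zero, map_zero, sub_add_cancel, ← smul_zero i] at h
  exact (zsmul_cancel k hi h).symm

/-- The value on the coefficients of the derivation `τ_(n)`. -/
noncomputable def tderCoeff (n : ℤ) (τ : T) : Derivation k A (MvPolynomial (Λ × ℕ) A) :=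
  Derivation.mk'
    { toFun := fun a => if n = 0 then C ⁅τ, a⁆ else 0
      map_add' := fun a b => by split_ifs <;> simp
      map_smul' := fun c a => by
        split_ifs
        · rw [lie_smul, ← algebraMap_smul A c ⁅τ, a⁆, smul_eq_mul, C_mul, ← smul_eq_C_mul,
            algebraMap_smul]; rfl
        · simp }
    fun a b => by
      simp only [LinearMap.coe_mk, AddHom.coe_mk]
      split_ifs
      · simp [smul_eq_C_mul, mul_comm]
      · simp

theorem tderCoeff_apply (n : ℤ) (τ : T) (a : A) :
    (tderCoeff n τ : Derivation k A (MvPolynomial (Λ × ℕ) A)) a = if n = 0 then C ⁅τ, a⁆ else 0 :=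
  rfl

/-- The operators `τ_(n)`, `n ≥ 0`, on the polynomial algebra. -/
noncomputable def tder (n : ℤ) :
    T →ₗ[k] Derivation k (MvPolynomial (Λ × ℕ) A) (MvPolynomial (Λ × ℕ) A) where
  toFun τ := extendDerivation (tderCoeff n τ) fun p =>
    𝒜.dp bΩ (p.2 - n) (inΩ bΩ ⁅τ, bΩ p.1⁆) + n • 𝒜.dp bΩ (p.2 - n + 1) (C (𝒜.pair τ (bΩ p.1)))
  map_add' τ ν := by
    refine derivation_hom_ext (fun a => ?_) fun p => ?_
    · simp only [extendDerivation_C, Derivation.add_apply]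
      simp only [tderCoeff_apply]
      split_ifs <;> simp
    · simp only [extendDerivation_X, Derivation.add_apply, add_lie, map_add, LinearMap.add_apply,
        smul_add]
      abel
  map_smul' c τ := by
    have hc : ∀ a : A, (C (c • a) : MvPolynomial (Λ × ℕ) A) = c • C a := fun a => by
      rw [← algebraMap_smul A c a, smul_eq_mul, C_mul, ← smul_eq_C_mul, algebraMap_smul]
    refine derivation_hom_ext (fun a => ?_) fun p => ?_
    · simp only [extendDerivation_C, Derivation.smul_apply, RingHom.id_apply]
      simp only [tderCoeff_apply]
      split_ifs <;> simp [hc]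
    · simp only [extendDerivation_X, Derivation.smul_apply, smul_lie, LinearMap.map_smul_of_tower,
        LinearMap.smul_apply, RingHom.id_apply, smul_add, hc]
      rw [smul_comm]

theorem tder_C (n : ℤ) (τ : T) (a : A) :
    𝒜.tder bΩ n τ (C a) = if n = 0 then C ⁅τ, a⁆ else 0 :=
  extendDerivation_C _ _ _

theorem tder_X (n : ℤ) (τ : T) (p : Λ × ℕ) : 𝒜.tder bΩ n τ (X p) =
    𝒜.dp bΩ (p.2 - n) (inΩ bΩ ⁅τ, bΩ p.1⁆) + n • 𝒜.dp bΩ (p.2 - n + 1) (C (𝒜.pair τ (bΩ p.1))) :=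
  extendDerivation_X _ _ _

theorem tder_inΩ {n : ℤ} (hn : 0 ≤ n) (τ : T) (ω : Ω) : 𝒜.tder bΩ n τ (inΩ bΩ ω) =
    𝒜.dp bΩ (-n) (inΩ bΩ ⁅τ, ω⁆) + n • 𝒜.dp bΩ (1 - n) (C (𝒜.pair τ ω)) := by
  induction bΩ.mem_span ω using Submodule.span_induction with
  | mem ω h =>
    obtain ⟨l, rfl⟩ := h
    rw [inΩ_basis, tder_X]
    simp [add_comm, sub_eq_add_neg]
  | zero => simp
  | add ω ω' _ _ h h' =>
    simp only [map_add, lie_add, smul_add, h, h']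
    abel
  | smul a ω _ h =>
    rw [map_smul, smul_eq_C_mul, Derivation.leibniz, h, tder_C, 𝒜.lie_smul', map_smul, map_add,
      map_smul, map_smul, smul_eq_C_mul, smul_eq_C_mul, smul_eq_mul, smul_eq_mul, smul_eq_mul, C_mul]
    rcases hn.lt_or_eq with h0 | rfl
    · rw [if_neg h0.ne', 𝒜.dp_of_neg bΩ (by omega : -n < 0), 𝒜.dp_of_neg bΩ (by omega : -n < 0)]
      rcases (show n = 1 ∨ 1 < n by omega) with rfl | h1
      · rw [sub_self, dp_zero, dp_zero]; simp
      · rw [𝒜.dp_of_neg bΩ (by omega : 1 - n < 0), 𝒜.dp_of_neg bΩ (by omega : 1 - n < 0)]; simp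
    · rw [neg_zero, dp_zero, dp_zero]
      simp only [if_true, zero_smul, add_zero]
      ring

theorem totalDer_tder {n : ℤ} (hn : 0 ≤ n) (τ : T) (b : MvPolynomial (Λ × ℕ) A) :
    𝒜.totalDer bΩ (𝒜.tder bΩ n τ b) =
      𝒜.tder bΩ n τ (𝒜.totalDer bΩ b) - n • 𝒜.tder bΩ (n - 1) τ b := by
  have h : ⁅𝒜.totalDer bΩ, 𝒜.tder bΩ n τ⁆ = -n • 𝒜.tder bΩ (n - 1) τ := by
    refine derivation_hom_ext (fun a => ?_) fun p => ?_
    · rw [Derivation.commutator_apply, totalDer_C, 𝒜.tder_inΩ bΩ hn, tder_C, Derivation.smul_apply,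
        tder_C, 𝒜.pair_d, ← 𝒜.d_lie]
      rcases (show n = 0 ∨ n = 1 ∨ 1 < n by omega) with rfl | rfl | h
      · simp [dp_zero]
      · simp [dp_zero, 𝒜.dp_of_neg bΩ]
      · rw [𝒜.dp_of_neg bΩ (by omega : -n < 0), 𝒜.dp_of_neg bΩ (by omega : 1 - n < 0), if_neg (by omega),
          if_neg (by omega)]
        simp
    · rw [Derivation.commutator_apply, totalDer_X, tder_X, map_add, map_zsmul, map_zsmul,
        totalDer_dp, totalDer_dp, tder_X, Derivation.smul_apply, tder_X]
      have e1 : ((p.2 + 1 : ℕ) : ℤ) - n = p.2 - n + 1 := by push_cast; ring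
      have e2 : (p.2 : ℤ) - (n - 1) = p.2 - n + 1 := by ring
      simp only [e1, e2]
      module
  have h' := congrArg (fun D => D b) h
  simp only [Derivation.commutator_apply, Derivation.smul_apply] at h'
  rw [sub_eq_iff_eq_add] at h'
  rw [h']
  module

theorem tder_dp_of {τ : T} {z w u : MvPolynomial (Λ × ℕ) A}
    (h : ∀ n : ℤ, 0 ≤ n → 𝒜.tder bΩ n τ z = 𝒜.dp bΩ (-n) w + n • 𝒜.dp bΩ (1 - n) u) (i : ℤ) :
    ∀ n : ℤ, 0 ≤ n →
      𝒜.tder bΩ n τ (𝒜.dp bΩ i z) = 𝒜.dp bΩ (i - n) w + n • 𝒜.dp bΩ (i - n + 1) u := by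
  induction i using divPow_induction with
  | neg i hi =>
    intro n hn
    rw [𝒜.dp_of_neg bΩ hi, 𝒜.dp_of_neg bΩ (by omega : i - n < 0)]
    rcases hn.lt_or_eq with h0 | rfl
    · rw [𝒜.dp_of_neg bΩ (by omega : i - n + 1 < 0)]; simp
    · simp
  | zero =>
    intro n hn
    rw [dp_zero, h n hn, zero_sub, neg_add_eq_sub]
  | succ i hi ih =>
    intro n hn
    refine zsmul_cancel k (n := i + 1) (by omega) ?_
    rw [← map_zsmul, ← totalDer_dp, ← sub_add_cancel (𝒜.tder bΩ n τ (𝒜.totalDer bΩ (𝒜.dp bΩ i z)))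
      (n • 𝒜.tder bΩ (n - 1) τ (𝒜.dp bΩ i z)), ← 𝒜.totalDer_tder bΩ hn, ih n hn, map_add, map_zsmul,
      totalDer_dp, totalDer_dp]
    have e3 : i + 1 - n = i - n + 1 := by ring
    rw [e3]
    rcases hn.lt_or_eq with h0 | rfl
    · have e2 : i - (n - 1) = i - n + 1 := by ring
      rw [ih (n - 1) (by omega), e2]
      module
    · module

theorem tder_dp_C {n : ℤ} (hn : 0 ≤ n) (τ : T) (i : ℤ) (a : A) :
    𝒜.tder bΩ n τ (𝒜.dp bΩ i (C a)) = 𝒜.dp bΩ (i - n) (C ⁅τ, a⁆) := by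
  rw [𝒜.tder_dp_of bΩ (w := C ⁅τ, a⁆) (u := 0) _ i n hn, map_zero, smul_zero, add_zero]
  intro n hn
  rw [tder_C, map_zero, smul_zero, add_zero]
  rcases hn.lt_or_eq with h0 | rfl
  · rw [if_neg h0.ne', 𝒜.dp_of_neg bΩ (by omega)]
  · rw [neg_zero, dp_zero, if_pos rfl]

theorem tder_dp_inΩ {n : ℤ} (hn : 0 ≤ n) (τ : T) (i : ℤ) (ω : Ω) :
    𝒜.tder bΩ n τ (𝒜.dp bΩ i (inΩ bΩ ω)) =
      𝒜.dp bΩ (i - n) (inΩ bΩ ⁅τ, ω⁆) + n • 𝒜.dp bΩ (i - n + 1) (C (𝒜.pair τ ω)) :=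
  𝒜.tder_dp_of bΩ (fun _ hn => 𝒜.tder_inΩ bΩ hn τ ω) i n hn

theorem tder_tder {m n : ℤ} (hm : 0 ≤ m) (hn : 0 ≤ n) (τ ν : T) (b : MvPolynomial (Λ × ℕ) A) :
    𝒜.tder bΩ m τ (𝒜.tder bΩ n ν b) =
      𝒜.tder bΩ n ν (𝒜.tder bΩ m τ b) + 𝒜.tder bΩ (m + n) ⁅τ, ν⁆ b := by
  have h : ⁅𝒜.tder bΩ m τ, 𝒜.tder bΩ n ν⁆ = 𝒜.tder bΩ (m + n) ⁅τ, ν⁆ := by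
    refine derivation_hom_ext (fun a => ?_) fun p => ?_
    · rw [Derivation.commutator_apply]
      simp only [tder_C]
      rcases hm.lt_or_eq with h0 | rfl
      · rw [if_neg h0.ne', if_neg (by omega : m + n ≠ 0)]
        split_ifs <;> simp [tder_C, h0.ne']
      · rcases hn.lt_or_eq with h0 | rfl
        · rw [if_neg h0.ne', if_neg (by omega : 0 + n ≠ 0)]
          simp [tder_C, h0.ne']
        · simp [tder_C]
    · have h1 := 𝒜.lie_pair τ ν (bΩ p.1)
      have h2 := 𝒜.lie_pair ν τ (bΩ p.1)
      rw [Derivation.commutator_apply, tder_X, tder_X, tder_X, map_add, map_zsmul,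
        𝒜.tder_dp_inΩ bΩ hm, 𝒜.tder_dp_C bΩ hm, map_add, map_zsmul,
        𝒜.tder_dp_inΩ bΩ hn, 𝒜.tder_dp_C bΩ hn, h1, h2, lie_lie, ← lie_skew τ ν]
      have e1 : (p.2 : ℤ) - n - m = p.2 - (m + n) := by ring
      have e2 : (p.2 : ℤ) - m - n = p.2 - (m + n) := by ring
      have e3 : (p.2 : ℤ) - n + 1 - m = p.2 - (m + n) + 1 := by ring
      have e4 : (p.2 : ℤ) - m + 1 - n = p.2 - (m + n) + 1 := by ring
      simp only [e1, e2, e3, e4, map_sub, map_add, map_neg, LinearMap.neg_apply]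
      module
  have h' := congrArg (fun D => D b) h
  simp only [Derivation.commutator_apply] at h'
  rw [← h']; abel

theorem tder_eventually_zero (τ : T) (b : MvPolynomial (Λ × ℕ) A) :
    ∃ K : ℕ, ∀ n : ℤ, n ≥ K → 𝒜.tder bΩ n τ b = 0 := by
  induction b using MvPolynomial.induction_on with
  | C a => exact ⟨1, fun n hn => by rw [tder_C, if_neg (by push_cast at hn; omega)]⟩
  | add p q hp hq =>
    obtain ⟨K, hK⟩ := hp
    obtain ⟨L, hL⟩ := hq
    exact ⟨max K L, fun n hn => by rw [map_add, hK n (by omega), hL n (by omega), add_zero]⟩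
  | mul_X p i hp =>
    obtain ⟨K, hK⟩ := hp
    refine ⟨max K (i.2 + 2), fun n hn => ?_⟩
    rw [Derivation.leibniz, hK n (by omega), tder_X, 𝒜.dp_of_neg bΩ (by omega),
      𝒜.dp_of_neg bΩ (by omega)]
    simp

theorem dp_mul (i : ℤ) (f g : MvPolynomial (Λ × ℕ) A) :
    EvSum (fun j : ℕ => 𝒜.dp bΩ j f * 𝒜.dp bΩ (i - j) g) (𝒜.dp bΩ i (f * g)) :=
  divPow_mul (𝒜.totalDer bΩ) i f g

theorem dp_mul_weighted (i : ℤ) (f g : MvPolynomial (Λ × ℕ) A) :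
    EvSum (fun j : ℕ => (j : ℤ) • (𝒜.dp bΩ j f * 𝒜.dp bΩ (i - j) g))
      (𝒜.dp bΩ (i - 1) (𝒜.totalDer bΩ f * g)) := by
  have h := 𝒜.dp_mul bΩ (i - 1) (𝒜.totalDer bΩ f) g
  have h' := EvSum.of_succ (f := fun j : ℕ => (j : ℤ) • (𝒜.dp bΩ j f * 𝒜.dp bΩ (i - j) g))
    (h.congr fun j => ?_)
  · simpa using h'
  · have e : i - 1 - j = i - (j + 1 : ℕ) := by push_cast; ring
    rw [dp_totalDer, e, smul_mul_assoc]
    push_cast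
    rfl

theorem tder_smul {n : ℤ} (hn : 0 ≤ n) (a : A) (τ : T) (b : MvPolynomial (Λ × ℕ) A) :
    EvSum (fun j : ℕ => 𝒜.dp bΩ j (C a) * 𝒜.tder bΩ (n + j) τ b) (𝒜.tder bΩ n (a • τ) b) := by
  induction b using MvPolynomial.induction_on with
  | C c =>
    have h := EvSum.single_zero
      (f := fun j : ℕ => 𝒜.dp bΩ j (C a) * 𝒜.tder bΩ (n + j) τ (C c)) fun j => by
        rw [tder_C, if_neg (by push_cast; omega), mul_zero]
    refine h.conv (fun j => rfl) ?_
    rw [tder_C, Nat.cast_zero, add_zero, dp_zero, tder_C]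
    split_ifs <;> simp
  | add p q hp hq =>
    rw [map_add]
    exact (hp.add hq).congr fun j => by rw [map_add, mul_add]
  | mul_X p i hp =>
    have hX : EvSum (fun j : ℕ => 𝒜.dp bΩ j (C a) * 𝒜.tder bΩ (n + j) τ (X i))
        (𝒜.tder bΩ n (a • τ) (X i)) := by
      have h1 := 𝒜.dp_mul bΩ (i.2 - n) (C a) (inΩ bΩ ⁅τ, bΩ i.1⁆)
      have h2 := (𝒜.dp_mul bΩ (i.2 - n + 1) (C a) (C (𝒜.pair τ (bΩ i.1)))).zsmul n
      have h3 := 𝒜.dp_mul_weighted bΩ (i.2 - n + 1) (C a) (C (𝒜.pair τ (bΩ i.1)))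
      refine ((h1.add h2).add h3).conv (fun j => ?_) ?_
      · have e : (i.2 : ℤ) - (n + j) = i.2 - n - j := by ring
        have e' : (i.2 : ℤ) - n - j + 1 = i.2 - n + 1 - j := by ring
        rw [tder_X, e, e', mul_add, mul_smul_comm, add_smul]
        abel
      · rw [tder_X, 𝒜.smul_lie', map_smul, LinearMap.smul_apply, map_add, map_smul, map_smul,
          totalDer_C]
        simp only [smul_eq_C_mul, map_add, smul_eq_mul, C_mul, add_sub_cancel_right]
        rw [mul_comm (inΩ bΩ (𝒜.d a))]
        abel
    have h1 := hX.map (AddMonoidHom.mulLeft p)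
    have h2 := hp.map (AddMonoidHom.mulLeft (X i))
    refine (h1.add h2).conv (fun j => ?_) ?_
    · simp only [AddMonoidHom.coe_mulLeft, Derivation.leibniz, smul_eq_mul]
      ring
    · simp only [AddMonoidHom.coe_mulLeft, Derivation.leibniz, smul_eq_mul]

end VertexAlgebroid

namespace EvSum

variable {M : Type*} [AddCommGroup M]

theorem finset_sum {ι : Type*} (S : Finset ι) {f : ι → ℕ → M} {s : ι → M}
    (h : ∀ i ∈ S, EvSum (f i) (s i)) : EvSum (fun j => ∑ i ∈ S, f i j) (∑ i ∈ S, s i) := by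
  classical
  induction S using Finset.induction_on with
  | empty => simpa using EvSum.zero
  | insert i S hi ih =>
    simp only [Finset.sum_insert hi]
    exact (h i (by simp)).add (ih fun j hj => h j (by simp [hj]))

theorem sum_triangle (N : ℕ) (h : ℕ → M) :
    ∑ j ∈ Finset.range N, ∑ p ∈ Finset.range (N - j), h p =
      ∑ p ∈ Finset.range N, ((N : ℤ) - p) • h p := by
  induction N with
  | zero => simp
  | succ N ih =>
    rw [Finset.sum_range_succ', Finset.sum_range_succ _ N]
    simp only [Nat.add_sub_add_right, ih, Nat.sub_zero]
    rw [Finset.sum_range_succ _ N, ← add_assoc, ← Finset.sum_add_distrib]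
    congr 1
    · refine Finset.sum_congr rfl fun p _ => ?_
      push_cast
      module
    · push_cast
      module

/-- The sum of a locally finite family of bilinear maps. -/
noncomputable def bilin {k X Y Z : Type*} [CommRing k] [AddCommGroup X] [Module k X]
    [AddCommGroup Y] [Module k Y] [AddCommGroup Z] [Module k Z] (L : ℕ → X →ₗ[k] Y →ₗ[k] Z)
    (h : ∀ x y, ∃ K : ℕ, ∀ j ≥ K, L j x y = 0) : X →ₗ[k] Y →ₗ[k] Z :=
  have H : ∀ x y, EvSum (fun j => L j x y) (∑ j ∈ Finset.range (h x y).choose, L j x y) :=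
    fun x y => EvSum.of_eventually_zero (h x y).choose_spec
  LinearMap.mk₂ k (fun x y => ∑ j ∈ Finset.range (h x y).choose, L j x y)
    (fun x x' y => (H _ _).unique (((H x y).add (H x' y)).congr fun j => by simp))
    (fun c x y => (H _ _).unique (((H x y).map (c • LinearMap.id : Z →ₗ[k] Z)).congr
      fun j => by simp))
    (fun x y y' => (H _ _).unique (((H x y).add (H x y')).congr fun j => by simp))
    (fun c x y => (H _ _).unique (((H x y).map (c • LinearMap.id : Z →ₗ[k] Z)).congr
      fun j => by simp))

theorem bilin_spec {k X Y Z : Type*} [CommRing k] [AddCommGroup X] [Module k X]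
    [AddCommGroup Y] [Module k Y] [AddCommGroup Z] [Module k Z] (L : ℕ → X →ₗ[k] Y →ₗ[k] Z)
    (h : ∀ x y, ∃ K : ℕ, ∀ j ≥ K, L j x y = 0) (x : X) (y : Y) :
    EvSum (fun j => L j x y) (bilin L h x y) :=
  EvSum.of_eventually_zero (h x y).choose_spec

end EvSum

/-- Indices of the creation operators `∂^(m) τᵢ`. -/
@[ext] structure CreationIndex (I : Type*) where
  gen : I
  ord : ℕ

open Classical in
noncomputable instance (I : Type*) : LinearOrder (CreationIndex I) :=
  linearOrderOfSTO WellOrderingRel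

namespace VertexAlgebroid

open MvPolynomial

/-- The inclusion of the coefficients of a polynomial algebra as a `k`-linear map. -/
noncomputable def coeffC (k A Λ : Type*) [CommRing k] [CommRing A] [Algebra k A] :
    A →ₗ[k] MvPolynomial (Λ × ℕ) A :=
  (Algebra.linearMap A (MvPolynomial (Λ × ℕ) A)).restrictScalars k

@[simp] theorem coeffC_apply (k A Λ : Type*) [CommRing k] [CommRing A] [Algebra k A] (a : A) :
    coeffC k A Λ a = C a := rfl

variable {k A T Ω : Type*} [CommRing k] [Algebra ℚ k] [Invertible (2 : k)]
    [CommRing A] [Algebra k A]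
    [LieRing T] [LieAlgebra k T] [Module A T] [LieRingModule T A] [LieRinehartRing A T]
    [LieRinehartAlgebra k A T]
    [AddCommGroup Ω] [Module k Ω] [Module A Ω] [IsScalarTower k A Ω]
    [LieRingModule T Ω] [LieModule k T Ω]
    (𝒜 : VertexAlgebroid k A T Ω) {I Λ : Type*} (bT : Module.Basis I A T)
    (bΩ : Module.Basis Λ A Ω)

/-- Multiplication by `aₙ = ∂^(-1-n) a`. -/
noncomputable def mulMode (n : ℤ) :
    MvPolynomial (Λ × ℕ) A →ₗ[k] MvPolynomial (Λ × ℕ) A →ₗ[k] MvPolynomial (Λ × ℕ) A :=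
  LinearMap.mul k _ ∘ₗ 𝒜.dp bΩ (-1 - n)

@[simp] theorem mulMode_apply (n : ℤ) (f b : MvPolynomial (Λ × ℕ) A) :
    𝒜.mulMode bΩ n f b = 𝒜.dp bΩ (-1 - n) f * b := rfl

/-- The terms of the lower part of the action of `(g · τᵢ)ₙ` on polynomials. -/
noncomputable def tailTerm (n : ℤ) (i : I) (j : ℕ) :
    A →ₗ[k] MvPolynomial (Λ × ℕ) A →ₗ[k] MvPolynomial (Λ × ℕ) A :=
  LinearMap.mk₂ k (fun (g : A) b => 𝒜.dp bΩ (j - n) (C g) * 𝒜.tder bΩ j (bT i) b)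
    (fun g g' b => by simp [add_mul])
    (fun c g b => by rw [← coeffC_apply k, map_smul, map_smul, smul_mul_assoc]; rfl)
    (fun g b b' => by simp [mul_add])
    (fun c g b => by simp)

theorem tailTerm_apply (n : ℤ) (i : I) (j : ℕ) (g : A) (b : MvPolynomial (Λ × ℕ) A) :
    𝒜.tailTerm bT bΩ n i j g b = 𝒜.dp bΩ (j - n) (C g) * 𝒜.tder bΩ j (bT i) b := rfl

theorem tailTerm_eventually_zero (n : ℤ) (i : I) (g : A) (b : MvPolynomial (Λ × ℕ) A) :
    ∃ K : ℕ, ∀ j ≥ K, 𝒜.tailTerm bT bΩ n i j g b = 0 := by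
  obtain ⟨K, hK⟩ := 𝒜.tder_eventually_zero bΩ (bT i) b
  exact ⟨K, fun j hj => by rw [tailTerm_apply, hK j (by exact_mod_cast hj), mul_zero]⟩

/-- The lower part of the action of `(g · τᵢ)ₙ` on polynomials. -/
noncomputable def lowerTail (n : ℤ) (i : I) :
    A →ₗ[k] MvPolynomial (Λ × ℕ) A →ₗ[k] MvPolynomial (Λ × ℕ) A :=
  EvSum.bilin (𝒜.tailTerm bT bΩ n i) (𝒜.tailTerm_eventually_zero bT bΩ n i)

theorem lowerTail_spec (n : ℤ) (i : I) (g : A) (b : MvPolynomial (Λ × ℕ) A) :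
    EvSum (fun j : ℕ => 𝒜.dp bΩ (j - n) (C g) * 𝒜.tder bΩ j (bT i) b)
      (𝒜.lowerTail bT bΩ n i g b) :=
  EvSum.bilin_spec (𝒜.tailTerm bT bΩ n i) (𝒜.tailTerm_eventually_zero bT bΩ n i) g b

/-- The part of degree zero of the action of `(g · τᵢ)ₙ` on polynomials. -/
noncomputable def lower (n : ℤ) (i : I) :
    A →ₗ[k] MvPolynomial (Λ × ℕ) A →ₗ[k] MvPolynomial (Λ × ℕ) A :=
  𝒜.lowerTail bT bΩ n i +
    n • 𝒜.mulMode bΩ (n - 1) ∘ₗ coeffC k A Λ ∘ₗ 𝒜.oneTruncated.act (bT i, 0)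

theorem lower_apply (n : ℤ) (i : I) (g : A) (b : MvPolynomial (Λ × ℕ) A) :
    𝒜.lower bT bΩ n i g b =
      𝒜.lowerTail bT bΩ n i g b + n • (𝒜.dp bΩ (-n) (C ⁅bT i, g⁆) * b) := by
  have : -1 - (n - 1) = -n := by ring
  simp [lower, this]
  rfl

/-- The part of degree one of the action of `(g · τᵢ)ₙ` on polynomials. -/
noncomputable def upper (n : ℤ) (i : I) :
    A →ₗ[k] MvPolynomial (Λ × ℕ) A →ₗ[k] (CreationIndex I →₀ MvPolynomial (Λ × ℕ) A) :=
  ∑ j ∈ Finset.range (-n).toNat, (𝒜.mulMode bΩ (-1 - j) ∘ₗ coeffC k A Λ).compr₂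
    (Finsupp.lsingle (⟨i, (-n).toNat - 1 - j⟩ : CreationIndex I))

theorem upper_apply (n : ℤ) (i : I) (g : A) (b : MvPolynomial (Λ × ℕ) A) :
    𝒜.upper bΩ n i g b = ∑ j ∈ Finset.range (-n).toNat,
      Finsupp.single (⟨i, (-n).toNat - 1 - j⟩ : CreationIndex I) (𝒜.dp bΩ j (C g) * b) := by
  simp only [upper, LinearMap.sum_apply, LinearMap.compr₂_apply, LinearMap.comp_apply,
    coeffC_apply, mulMode_apply, Finsupp.lsingle_apply]
  refine Finset.sum_congr rfl fun j _ => ?_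
  rw [show -1 - (-1 - (j : ℤ)) = j by ring]

/-- `∑ γ(gᵢ, τᵢ)` for `τ = ∑ gᵢ τᵢ`. -/
noncomputable def γSum : T →ₗ[k] Ω :=
  (Finsupp.lsum k fun i => 𝒜.γ.flip (bT i)) ∘ₗ (bT.repr.toLinearMap.restrictScalars k)

theorem γSum_smul (g : A) (i : I) : 𝒜.γSum bT (g • bT i) = 𝒜.γ g (bT i) := by
  simp [γSum]

/-- The degree one part of the action of modes on polynomials. -/
noncomputable def modeTop : 𝒜.oneTruncated.Modes →ₗ[k] MvPolynomial (Λ × ℕ) A →ₗ[k]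
    (CreationIndex I →₀ MvPolynomial (Λ × ℕ) A) :=
  𝒜.oneTruncated.elim
    (X := MvPolynomial (Λ × ℕ) A →ₗ[k] (CreationIndex I →₀ MvPolynomial (Λ × ℕ) A)) (fun _ => 0)
    (fun n => (Finsupp.lsum k fun i : I => 𝒜.upper bΩ n i) ∘ₗ
      (bT.repr.toLinearMap.restrictScalars k) ∘ₗ LinearMap.fst k T Ω) 0

/-- The degree zero part of the action of modes on polynomials. -/
noncomputable def modeBot : 𝒜.oneTruncated.Modes →ₗ[k] MvPolynomial (Λ × ℕ) A →ₗ[k]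
    MvPolynomial (Λ × ℕ) A :=
  𝒜.oneTruncated.elim (fun n => 𝒜.mulMode bΩ n ∘ₗ coeffC k A Λ)
    (fun n => (Finsupp.lsum k fun i : I => 𝒜.lower bT bΩ n i) ∘ₗ
        (bT.repr.toLinearMap.restrictScalars k) ∘ₗ LinearMap.fst k T Ω
      + 𝒜.mulMode bΩ n ∘ₗ ((inΩ bΩ).restrictScalars k) ∘ₗ
        (LinearMap.snd k T Ω + 𝒜.γSum bT ∘ₗ LinearMap.fst k T Ω))
    (𝒜.totalDer bΩ : MvPolynomial (Λ × ℕ) A →ₗ[k] MvPolynomial (Λ × ℕ) A)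

/-- `g · τᵢ` in the notation of vertex algebras. -/
noncomputable abbrev gT (g : A) (i : I) : T × Ω := 𝒜.nprod g (bT i, 0)

theorem modeTop_gT (n : ℤ) (g : A) (i : I) (b : MvPolynomial (Λ × ℕ) A) :
    𝒜.modeTop bT bΩ (𝒜.oneTruncated.modeE n (𝒜.gT bT g i)) b = 𝒜.upper bΩ n i g b := by
  simp [modeTop, gT, nprod]

theorem modeBot_gT (n : ℤ) (g : A) (i : I) (b : MvPolynomial (Λ × ℕ) A) :
    𝒜.modeBot bT bΩ (𝒜.oneTruncated.modeE n (𝒜.gT bT g i)) b = 𝒜.lower bT bΩ n i g b := by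
  simp [modeBot, gT, nprod, γSum_smul]

theorem modeTop_Ω (n : ℤ) (ω : Ω) (b : MvPolynomial (Λ × ℕ) A) :
    𝒜.modeTop bT bΩ (𝒜.oneTruncated.modeE n (0, ω)) b = 0 := by
  simp [modeTop]

theorem modeBot_Ω (n : ℤ) (ω : Ω) (b : MvPolynomial (Λ × ℕ) A) :
    𝒜.modeBot bT bΩ (𝒜.oneTruncated.modeE n (0, ω)) b = 𝒜.dp bΩ (-1 - n) (inΩ bΩ ω) * b := by
  simp [modeBot]

theorem modeTop_A (n : ℤ) (a : A) (b : MvPolynomial (Λ × ℕ) A) :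
    𝒜.modeTop bT bΩ (𝒜.oneTruncated.modeA n a) b = 0 := by
  simp [modeTop]

theorem modeBot_A (n : ℤ) (a : A) (b : MvPolynomial (Λ × ℕ) A) :
    𝒜.modeBot bT bΩ (𝒜.oneTruncated.modeA n a) b = 𝒜.dp bΩ (-1 - n) (C a) * b := by
  simp [modeBot]

theorem modeTop_D (b : MvPolynomial (Λ × ℕ) A) :
    𝒜.modeTop bT bΩ 𝒜.oneTruncated.modeD b = 0 := by
  simp [modeTop]

theorem modeBot_D (b : MvPolynomial (Λ × ℕ) A) :
    𝒜.modeBot bT bΩ 𝒜.oneTruncated.modeD b = 𝒜.totalDer bΩ b := by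
  simp [modeBot]

/-- The elements `g · τᵢ` and `ω` generate `T ⊕ Ω` additively. -/
theorem generator_induction {p : T × Ω → Prop} (y : T × Ω) (add : ∀ x y, p x → p y → p (x + y))
    (hT : ∀ g i, p (𝒜.gT bT g i)) (hΩ : ∀ ω, p (0, ω)) : p y := by
  suffices H : ∀ τ : T, ∃ ω, p (τ, ω) by
    obtain ⟨ω, h⟩ := H y.1
    have := add _ _ h (hΩ (y.2 - ω))
    simpa using this
  intro τ
  rw [← bT.linearCombination_repr τ]
  induction bT.repr τ using Finsupp.induction_linear with
  | zero => exact ⟨0, by simpa using hΩ 0⟩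
  | add f g hf hg =>
    obtain ⟨ω, h⟩ := hf
    obtain ⟨ω', h'⟩ := hg
    exact ⟨ω + ω', by rw [map_add]; exact add _ _ h h'⟩
  | single i g => exact ⟨_, by rw [Finsupp.linearCombination_single]; exact hT g i⟩

theorem gT_one (i : I) : 𝒜.gT bT 1 i = (bT i, 0) := 𝒜.one_nprod _

/-- For `n ≥ 0` modes act on polynomials by derivations. -/
theorem modeBot_nonneg {n : ℤ} (hn : 0 ≤ n) (y : T × Ω) (b : MvPolynomial (Λ × ℕ) A) :
    𝒜.modeBot bT bΩ (𝒜.oneTruncated.modeE n y) b = 𝒜.tder bΩ n y.1 b := by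
  induction y using 𝒜.generator_induction bT with
  | add x y hx hy =>
    rw [map_add, map_add, LinearMap.add_apply, hx, hy, Prod.fst_add, map_add, Derivation.add_apply]
  | hT g i =>
    rw [modeBot_gT, lower_apply]
    have h0 : n • (𝒜.dp bΩ (-n) (C ⁅bT i, g⁆) * b) = 0 := by
      rcases hn.lt_or_eq with h | rfl
      · rw [𝒜.dp_of_neg bΩ (by omega), zero_mul, smul_zero]
      · rw [zero_smul]
    rw [h0, add_zero]
    obtain ⟨n, rfl⟩ := Int.eq_ofNat_of_zero_le hn
    have h1 := 𝒜.lowerTail_spec bT bΩ n i g b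
    have h2 := 𝒜.tder_smul bΩ (n := n) (by omega) g (bT i) b
    obtain ⟨K, hK⟩ := h1
    obtain ⟨L, hL⟩ := h2
    change _ = 𝒜.tder bΩ n (g • bT i) b
    rw [← hK (n + max K L) (by omega), ← hL (max K L) (by omega), Finset.sum_range_add,
      Finset.sum_eq_zero, zero_add]
    · refine Finset.sum_congr rfl fun j _ => ?_
      push_cast
      rw [add_sub_cancel_left]
    · intro j hj
      rw [𝒜.dp_of_neg bΩ (by have := Finset.mem_range.1 hj; omega), zero_mul]
  | hΩ ω =>
    rw [modeBot_Ω, 𝒜.dp_of_neg bΩ (by omega)]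
    simp

theorem modeTop_nonneg {n : ℤ} (hn : 0 ≤ n) (y : T × Ω) (b : MvPolynomial (Λ × ℕ) A) :
    𝒜.modeTop bT bΩ (𝒜.oneTruncated.modeE n y) b = 0 := by
  induction y using 𝒜.generator_induction bT with
  | add x y hx hy => rw [map_add, map_add, LinearMap.add_apply, hx, hy, add_zero]
  | hT g i => rw [modeTop_gT, upper_apply, Int.toNat_of_nonpos (by omega)]; rfl
  | hΩ ω => rw [modeTop_Ω]

/-- The creation operator `∂^(m) τᵢ`. -/
noncomputable def creation (p : CreationIndex I) : 𝒜.oneTruncated.Modes :=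
  𝒜.oneTruncated.modeE (-1 - (p.2 : ℤ)) (bT p.1, 0)

theorem modeTop_creation (p : CreationIndex I) (b : MvPolynomial (Λ × ℕ) A) :
    𝒜.modeTop bT bΩ (𝒜.creation bT p) b = Finsupp.single p b := by
  have e : (-(-1 - (p.2 : ℤ))).toNat = p.2 + 1 := by omega
  rw [creation, ← 𝒜.gT_one bT p.gen, modeTop_gT, upper_apply, e, Finset.sum_range_succ', Finset.sum_eq_zero]
  · simp only [Nat.cast_zero, dp_zero, C_1, one_mul, Nat.add_sub_cancel, Nat.sub_zero, zero_add]
  · intro j _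
    rw [C_1, 𝒜.dp_one bΩ _ (by omega), zero_mul, Finsupp.single_zero]

theorem modeBot_creation (p : CreationIndex I) (b : MvPolynomial (Λ × ℕ) A) :
    𝒜.modeBot bT bΩ (𝒜.creation bT p) b = 0 := by
  rw [creation, ← 𝒜.gT_one bT p.gen, modeBot_gT, lower_apply]
  have h := 𝒜.lowerTail_spec bT bΩ (-1 - (p.2 : ℤ)) p.1 1 b
  rw [h.unique (EvSum.zero.congr fun j => ?_)]
  · have h1 := LieRinehartRing.leibniz_mul_right (bT p.1) (1 : A) 1
    simp only [mul_one, one_mul, smul_eq_mul] at h1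
    simp [show ⁅bT p.1, (1 : A)⁆ = 0 by simpa using h1]
  · rw [C_1, 𝒜.dp_one bΩ _ (by omega), zero_mul]

theorem modeTop_null {x : 𝒜.oneTruncated.Modes} (hx : x ∈ 𝒜.oneTruncated.nullModes) :
    𝒜.modeTop bT bΩ x = 0 := by
  induction hx using Submodule.span_induction with
  | mem x hx =>
    obtain ⟨m, a, rfl⟩ := hx
    refine LinearMap.ext fun b => ?_
    rw [map_add, map_zsmul, LinearMap.add_apply, LinearMap.smul_apply, modeTop_A]
    exact (add_eq_left.2 (smul_zero _)).trans (𝒜.modeTop_Ω bT bΩ m (𝒜.d a) b)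
  | zero => rw [map_zero]
  | add x y _ _ hx hy => rw [map_add, hx, hy, add_zero]
  | smul c x _ hx => rw [map_smul, hx, smul_zero]

theorem modeBot_null {x : 𝒜.oneTruncated.Modes} (hx : x ∈ 𝒜.oneTruncated.nullModes) :
    𝒜.modeBot bT bΩ x = 0 := by
  induction hx using Submodule.span_induction with
  | mem x hx =>
    obtain ⟨m, a, rfl⟩ := hx
    refine LinearMap.ext fun b => ?_
    rw [map_add, map_zsmul, LinearMap.add_apply, LinearMap.smul_apply, modeBot_A]
    have h := 𝒜.modeBot_Ω bT bΩ m (𝒜.d a) b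
    rw [← totalDer_C, dp_totalDer] at h
    refine (congrArg (· + _) h).trans ?_
    have e1 : -1 - m + 1 = -m := by ring
    have e2 : -1 - (m - 1) = -m := by ring
    rw [e1, e2, LinearMap.zero_apply, smul_mul_assoc]
    module
  | zero => rw [map_zero]
  | add x y _ _ hx hy => rw [map_add, hx, hy, add_zero]
  | smul c x _ hx => rw [map_smul, hx, smul_zero]

/-- The data for the action of modes on the module spanned by ordered monomials in the creation
operators. -/
noncomputable def pbw :
    PBWData k 𝒜.oneTruncated.Modes (MvPolynomial (Λ × ℕ) A) (CreationIndex I) where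
  br := 𝒜.oneTruncated.lie
  e := 𝒜.creation bT
  s := 𝒜.modeTop bT bΩ
  r := 𝒜.modeBot bT bΩ
  N := 𝒜.oneTruncated.nullModes
  s_e := 𝒜.modeTop_creation bT bΩ
  r_e := 𝒜.modeBot_creation bT bΩ
  s_N _ hx := 𝒜.modeTop_null bT bΩ hx
  r_N _ hx := 𝒜.modeBot_null bT bΩ hx
  br_N x hx j := by rw [creation, 𝒜.oneTruncated.lie_null x hx]; exact zero_mem _
  br_self _ := 𝒜.oneTruncated.lie_self _ _
  skew x _ := 𝒜.oneTruncated.lie_skew x _ _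
  jacobi x y _ := by rw [creation, 𝒜.oneTruncated.lie_jacobi]; exact zero_mem _

end VertexAlgebroid

/-! ### Normally ordered products -/

namespace EvSum

variable {M : Type*} [AddCommGroup M]

theorem telescope {z : ℕ → M} {K : ℕ} (h : ∀ j ≥ K, z j = 0) :
    EvSum (fun j => z j - z (j + 1)) (z 0) :=
  ⟨K, fun P hP => by rw [Finset.sum_range_sub', h P hP, sub_zero]⟩

end EvSum

section NormalProduct

variable {k V : Type*} [CommRing k] [AddCommGroup V] [Module k V]

/-- `s` is the value at `v` of the `n`-th mode of the normally ordered product of the fields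
`α` and `φ`. -/
def NormalProduct (α φ : ℤ → V →ₗ[k] V) (n : ℤ) (v s : V) : Prop :=
  EvSum (fun j : ℕ => α (-1 - j) (φ (n + j) v) + φ (n - 1 - j) (α j v)) s

namespace NormalProduct

variable {α φ α' φ' : ℤ → V →ₗ[k] V} {n : ℤ} {v w s t : V}

theorem add_vec (h : NormalProduct α φ n v s) (h' : NormalProduct α φ n w t) :
    NormalProduct α φ n (v + w) (s + t) :=
  (EvSum.add h h').congr fun j => by simp only [map_add]; abel

theorem add_right (h : NormalProduct α φ n v s) (h' : NormalProduct α φ' n v t) :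
    NormalProduct α (fun n => φ n + φ' n) n v (s + t) :=
  (EvSum.add h h').congr fun j => by simp only [map_add, LinearMap.add_apply]; abel

theorem zsmul_right (c : ℤ) (h : NormalProduct α φ n v s) :
    NormalProduct α (fun n => c • φ n) n v (c • s) :=
  (EvSum.zsmul c h).congr fun j => by
    simp only [LinearMap.smul_apply, map_zsmul, smul_add]

theorem shift_right (m : ℤ) (h : NormalProduct α φ (m + n) v s) :
    NormalProduct α (fun n => φ (m + n)) n v s :=
  EvSum.congr h fun j => by
    rw [show m + n + j = m + (n + j) by ring, show m + n - 1 - j = m + (n - 1 - j) by ring]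

/-- The commutator of an operator `X` with a normally ordered product. -/
theorem apply (X : V →ₗ[k] V) {t' t'' : V}
    (h₁ : ∀ p q, X (α p (φ q v)) = α p (X (φ q v)) + α' p (φ q v))
    (h₂ : ∀ p q, X (φ q (α p v)) = φ q (X (α p v)) + φ' q (α p v))
    (h₃ : ∀ q, X (φ q v) = φ q (X v) + φ' q v) (h₄ : ∀ p, X (α p v) = α p (X v) + α' p v)
    (hs : NormalProduct α φ n v s) (ht' : NormalProduct α φ' n v t')
    (ht'' : NormalProduct α' φ n v t'') : NormalProduct α φ n (X v) (X s - t' - t'') :=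
  (((EvSum.map X hs).sub ht').sub ht'').congr fun j => by
    rw [map_add, h₁, h₂, h₃, h₄, map_add, map_add]; abel

/-- Shifting the modes of the first factor. -/
theorem shift_left {ξ : ℤ → V} {s : ℤ → V} (hα : ∃ K : ℕ, ∀ p ≥ (K : ℤ), α p v = 0)
    (hφ : ∃ K : ℕ, ∀ p ≥ (K : ℤ), φ p v = 0)
    (hξ : ∀ p q, α p (φ q v) = φ q (α p v) + ξ (p + q))
    (h : ∀ n, NormalProduct α φ n v (s n)) (m n : ℤ) :
    NormalProduct (fun p => α (m + p)) φ n v (s (m + n) + m • ξ (m + n - 1)) := by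
  have key : ∀ m n t, NormalProduct (fun p => α (m + p)) φ (n + 1) v t ↔
      NormalProduct (fun p => α (m + 1 + p)) φ n v (t + ξ (m + n)) := by
    intro m n t
    obtain ⟨K, hK⟩ := hα
    obtain ⟨L, hL⟩ := hφ
    have hz := EvSum.telescope (K := (m.natAbs + n.natAbs + K + L))
      (z := fun j : ℕ => α (m - j) (φ (n + j) v) - φ (n - j) (α (m + j) v)) fun j hj => by
        rw [hK _ (by omega), hL _ (by omega)]; simp
    have e0 : α (m - (0 : ℕ)) (φ (n + (0 : ℕ)) v) - φ (n - (0 : ℕ)) (α (m + (0 : ℕ)) v)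
        = ξ (m + n) := by
      rw [hξ]; simp
    rw [e0] at hz
    have e1 : ∀ j : ℕ, m + (-1 - j) = m - (j + 1 : ℕ) := fun j => by push_cast; ring
    have e2 : ∀ j : ℕ, m + 1 + (-1 - j) = m - j := fun j => by ring
    have e3 : ∀ j : ℕ, n + 1 + j = n + (j + 1 : ℕ) := fun j => by push_cast; ring
    have e4 : ∀ j : ℕ, n + 1 - 1 - j = n - j := fun j => by ring
    have e5 : ∀ j : ℕ, n - 1 - j = n - (j + 1 : ℕ) := fun j => by push_cast; ring
    have e6 : ∀ j : ℕ, m + 1 + j = m + (j + 1 : ℕ) := fun j => by push_cast; ring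
    constructor
    · intro h
      refine (EvSum.add h hz).congr fun j => ?_
      simp only [e1, e2, e3, e4, e5, e6]
      abel
    · intro h
      refine (EvSum.sub h hz).conv (fun j => ?_) (by abel)
      simp only [e1, e2, e3, e4, e5, e6]
      abel
  induction m using Int.induction_on generalizing n with
  | zero => simpa using h n
  | succ m ih =>
    have h1 := (key m n _).1 (ih (n + 1))
    convert h1 using 1
    rw [show (m : ℤ) + (n + 1) = m + 1 + n by ring, show (m : ℤ) + 1 + n - 1 = m + n by ring]
    module
  | pred m ih =>
    have h1 := (key (-m - 1) (n - 1) (s (-m - 1 + n) + (-m - 1 : ℤ) • ξ (-m - 1 + n - 1))).2 (by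
      have h2 := ih (n - 1)
      rw [show -(m : ℤ) - 1 + 1 = -m by ring]
      convert h2 using 1
      rw [show -(m : ℤ) + (n - 1) = -m - 1 + n by ring, show -(m : ℤ) - 1 + (n - 1) = -m - 1 + n - 1
        by ring]
      module)
    rwa [sub_add_cancel] at h1

end NormalProduct

end NormalProduct

namespace VertexAlgebroid

open MvPolynomial

variable {k A T Ω : Type*} [CommRing k] [Algebra ℚ k] [Invertible (2 : k)]
    [CommRing A] [Algebra k A]
    [LieRing T] [LieAlgebra k T] [Module A T] [LieRingModule T A] [LieRinehartRing A T]
    [LieRinehartAlgebra k A T]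
    [AddCommGroup Ω] [Module k Ω] [Module A Ω] [IsScalarTower k A Ω]
    [LieRingModule T Ω] [LieModule k T Ω]
    (𝒜 : VertexAlgebroid k A T Ω) {I Λ : Type*} (bT : Module.Basis I A T)
    (bΩ : Module.Basis Λ A Ω)

/-- The module spanned by ordered monomials in the creation operators. -/
abbrev Fock := (𝒜.pbw bT bΩ).Mod

/-- The vector of degree zero of the Fock module given by a polynomial. -/
noncomputable def vec : MvPolynomial (Λ × ℕ) A →ₗ[k] 𝒜.Fock bT bΩ := Finsupp.lsingle 0

/-- The operator `aₙ` on the Fock module. -/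
noncomputable def opA (n : ℤ) : A →ₗ[k] 𝒜.Fock bT bΩ →ₗ[k] 𝒜.Fock bT bΩ :=
  (𝒜.pbw bT bΩ).act ∘ₗ 𝒜.oneTruncated.modeA n

/-- The operator `xₙ` on the Fock module. -/
noncomputable def opE (n : ℤ) : T × Ω →ₗ[k] 𝒜.Fock bT bΩ →ₗ[k] 𝒜.Fock bT bΩ :=
  (𝒜.pbw bT bΩ).act ∘ₗ 𝒜.oneTruncated.modeE n

/-- The translation operator on the Fock module. -/
noncomputable def opD : 𝒜.Fock bT bΩ →ₗ[k] 𝒜.Fock bT bΩ :=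
  (𝒜.pbw bT bΩ).act 𝒜.oneTruncated.modeD

variable {n : ℤ}

theorem base_vec (x : 𝒜.oneTruncated.Modes) (b : MvPolynomial (Λ × ℕ) A) :
    (𝒜.pbw bT bΩ).act x (𝒜.vec bT bΩ b) = 𝒜.vec bT bΩ (𝒜.modeBot bT bΩ x b) +
      Finsupp.mapDomain (fun i => {i}) (𝒜.modeTop bT bΩ x b) :=
  (𝒜.pbw bT bΩ).act_zero_single x b

theorem opA_vec (n : ℤ) (a : A) (b : MvPolynomial (Λ × ℕ) A) :
    𝒜.opA bT bΩ n a (𝒜.vec bT bΩ b) = 𝒜.vec bT bΩ (𝒜.dp bΩ (-1 - n) (C a) * b) := by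
  refine (𝒜.base_vec bT bΩ _ b).trans ?_
  rw [modeBot_A, modeTop_A, Finsupp.mapDomain_zero, add_zero]

theorem opD_vec (b : MvPolynomial (Λ × ℕ) A) :
    𝒜.opD bT bΩ (𝒜.vec bT bΩ b) = 𝒜.vec bT bΩ (𝒜.totalDer bΩ b) := by
  refine (𝒜.base_vec bT bΩ _ b).trans ?_
  rw [modeBot_D, modeTop_D, Finsupp.mapDomain_zero, add_zero]

theorem opE_Ω_vec (n : ℤ) (ω : Ω) (b : MvPolynomial (Λ × ℕ) A) :
    𝒜.opE bT bΩ n (0, ω) (𝒜.vec bT bΩ b) = 𝒜.vec bT bΩ (𝒜.dp bΩ (-1 - n) (inΩ bΩ ω) * b) := by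
  refine (𝒜.base_vec bT bΩ _ b).trans ?_
  rw [modeBot_Ω, modeTop_Ω, Finsupp.mapDomain_zero, add_zero]

theorem opE_nonneg_vec (hn : 0 ≤ n) (x : T × Ω) (b : MvPolynomial (Λ × ℕ) A) :
    𝒜.opE bT bΩ n x (𝒜.vec bT bΩ b) = 𝒜.vec bT bΩ (𝒜.tder bΩ n x.1 b) := by
  refine (𝒜.base_vec bT bΩ _ b).trans ?_
  rw [𝒜.modeBot_nonneg bT bΩ hn, 𝒜.modeTop_nonneg bT bΩ hn, Finsupp.mapDomain_zero, add_zero]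

/-- The vector `∂^(m) τᵢ b`. -/
noncomputable def vec₁ (i : I) (m : ℕ) : MvPolynomial (Λ × ℕ) A →ₗ[k] 𝒜.Fock bT bΩ :=
  Finsupp.lsingle {⟨i, m⟩}

theorem opE_creation_vec (i : I) (m : ℕ) (b : MvPolynomial (Λ × ℕ) A) :
    𝒜.opE bT bΩ (-1 - m) (bT i, 0) (𝒜.vec bT bΩ b) = 𝒜.vec₁ bT bΩ i m b :=
  (𝒜.pbw bT bΩ).act_e_single (j := ⟨i, m⟩) (N := 0) (by simp) b

theorem opE_gT_vec (n : ℤ) (g : A) (i : I) (b : MvPolynomial (Λ × ℕ) A) :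
    𝒜.opE bT bΩ n (𝒜.gT bT g i) (𝒜.vec bT bΩ b) = 𝒜.vec bT bΩ (𝒜.lower bT bΩ n i g b) +
      ∑ j ∈ Finset.range (-n).toNat,
        𝒜.vec₁ bT bΩ i ((-n).toNat - 1 - j) (𝒜.dp bΩ j (C g) * b) := by
  refine (𝒜.base_vec bT bΩ _ b).trans ?_
  rw [modeBot_gT, modeTop_gT, upper_apply, ← Finsupp.lmapDomain_apply _ k, map_sum]
  congr 1
  exact Finset.sum_congr rfl fun j _ => by
    rw [Finsupp.lmapDomain_apply, Finsupp.mapDomain_single]; rfl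

/-- The commutation relation of two modes at a vector. -/
def Commute (x y : 𝒜.oneTruncated.Modes) (v : 𝒜.Fock bT bΩ) : Prop :=
  (𝒜.pbw bT bΩ).defect x y v = 0

variable {𝒜 bT bΩ} in
theorem Commute.eq {x y : 𝒜.oneTruncated.Modes} {v : 𝒜.Fock bT bΩ}
    (h : 𝒜.Commute bT bΩ x y v) : (𝒜.pbw bT bΩ).act x ((𝒜.pbw bT bΩ).act y v) =
      (𝒜.pbw bT bΩ).act y ((𝒜.pbw bT bΩ).act x v) +
        (𝒜.pbw bT bΩ).act (𝒜.oneTruncated.lie x y) v := by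
  rw [Commute, PBWData.defect_apply, sub_sub, sub_eq_zero] at h
  exact h

variable {𝒜 bT bΩ} in
theorem Commute.of_eq {x y : 𝒜.oneTruncated.Modes} {v : 𝒜.Fock bT bΩ}
    (h : (𝒜.pbw bT bΩ).act x ((𝒜.pbw bT bΩ).act y v) =
      (𝒜.pbw bT bΩ).act y ((𝒜.pbw bT bΩ).act x v) +
        (𝒜.pbw bT bΩ).act (𝒜.oneTruncated.lie x y) v) : 𝒜.Commute bT bΩ x y v := by
  rw [Commute, PBWData.defect_apply, sub_sub, sub_eq_zero]
  exact h

theorem commute_add_vec {x y : 𝒜.oneTruncated.Modes} {v w : 𝒜.Fock bT bΩ}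
    (h : 𝒜.Commute bT bΩ x y v) (h' : 𝒜.Commute bT bΩ x y w) : 𝒜.Commute bT bΩ x y (v + w) := by
  rw [Commute] at h h' ⊢
  rw [map_add, h, h', add_zero]

theorem commute_add_left {x x' y : 𝒜.oneTruncated.Modes} {v : 𝒜.Fock bT bΩ}
    (h : 𝒜.Commute bT bΩ x y v) (h' : 𝒜.Commute bT bΩ x' y v) : 𝒜.Commute bT bΩ (x + x') y v := by
  rw [Commute] at h h' ⊢
  rw [PBWData.defect_add_left, h, h', add_zero]

theorem commute_add_right {x y y' : 𝒜.oneTruncated.Modes} {v : 𝒜.Fock bT bΩ}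
    (h : 𝒜.Commute bT bΩ x y v) (h' : 𝒜.Commute bT bΩ x y' v) : 𝒜.Commute bT bΩ x (y + y') v := by
  rw [Commute] at h h' ⊢
  rw [PBWData.defect_add_right, h, h', add_zero]

theorem commute_smul_left (c : k) {x y : 𝒜.oneTruncated.Modes} {v : 𝒜.Fock bT bΩ}
    (h : 𝒜.Commute bT bΩ x y v) : 𝒜.Commute bT bΩ (c • x) y v := by
  rw [Commute, PBWData.defect_apply] at h ⊢
  simp only [map_smul, LinearMap.smul_apply, ← smul_sub, h, smul_zero]

theorem commute_smul_right (c : k) {x y : 𝒜.oneTruncated.Modes} {v : 𝒜.Fock bT bΩ}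
    (h : 𝒜.Commute bT bΩ x y v) : 𝒜.Commute bT bΩ x (c • y) v := by
  rw [Commute, PBWData.defect_apply] at h ⊢
  simp only [map_smul, LinearMap.smul_apply, ← smul_sub, h, smul_zero]

theorem commute_zsmul_right (c : ℤ) {x y : 𝒜.oneTruncated.Modes} {v : 𝒜.Fock bT bΩ}
    (h : 𝒜.Commute bT bΩ x y v) : 𝒜.Commute bT bΩ x (c • y) v := by
  rw [← Int.cast_smul_eq_zsmul k]; exact 𝒜.commute_smul_right bT bΩ _ h

/-- Commutation relations with the modes of `A` are symmetric. -/
theorem Commute.symm {x y : 𝒜.oneTruncated.Modes} {v : 𝒜.Fock bT bΩ}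
    (h : 𝒜.Commute bT bΩ x y v) (hxy : 𝒜.oneTruncated.lie x y + 𝒜.oneTruncated.lie y x ∈
      𝒜.oneTruncated.nullModes) : 𝒜.Commute bT bΩ y x v := by
  have h1 := (𝒜.pbw bT bΩ).act_of_mem_N hxy v
  rw [Commute, PBWData.defect_apply] at h ⊢
  rw [map_add, LinearMap.add_apply] at h1
  have h2 : (𝒜.pbw bT bΩ).act ((𝒜.pbw bT bΩ).br y x) v =
    - (𝒜.pbw bT bΩ).act ((𝒜.pbw bT bΩ).br x y) v := eq_neg_of_add_eq_zero_right h1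
  rw [h2]
  rw [← neg_eq_zero, ← h]
  abel

theorem commute_creation (x : 𝒜.oneTruncated.Modes) (p : CreationIndex I)
    (b : MvPolynomial (Λ × ℕ) A) : 𝒜.Commute bT bΩ x (𝒜.creation bT p) (𝒜.vec bT bΩ b) :=
  (𝒜.pbw bT bΩ).defect_cons (N := 0) (by simp) x b

theorem creation_commute (x : 𝒜.oneTruncated.Modes) (p : CreationIndex I)
    (b : MvPolynomial (Λ × ℕ) A) : 𝒜.Commute bT bΩ (𝒜.creation bT p) x (𝒜.vec bT bΩ b) :=
  Commute.symm 𝒜 bT bΩ (𝒜.commute_creation bT bΩ x p b) (𝒜.oneTruncated.lie_skew _ _ _)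

/-- The commutation relation of two modes at `e b` follows from commutation relations at `b`. -/
theorem commute_vec₁ {x y : 𝒜.oneTruncated.Modes} {b : MvPolynomial (Λ × ℕ) A}
    (p : CreationIndex I) (h : 𝒜.Commute bT bΩ x y (𝒜.vec bT bΩ b))
    (h₁ : 𝒜.Commute bT bΩ x (𝒜.oneTruncated.lie y (𝒜.creation bT p)) (𝒜.vec bT bΩ b))
    (h₂ : 𝒜.Commute bT bΩ y (𝒜.oneTruncated.lie x (𝒜.creation bT p)) (𝒜.vec bT bΩ b))
    (h₃ : 𝒜.Commute bT bΩ x (𝒜.creation bT p) ((𝒜.pbw bT bΩ).act y (𝒜.vec bT bΩ b)))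
    (h₄ : 𝒜.Commute bT bΩ y (𝒜.creation bT p) ((𝒜.pbw bT bΩ).act x (𝒜.vec bT bΩ b))) :
    𝒜.Commute bT bΩ x y ((𝒜.pbw bT bΩ).act (𝒜.creation bT p) (𝒜.vec bT bΩ b)) := by
  have e1 := 𝒜.commute_creation bT bΩ x p b
  have e2 := 𝒜.commute_creation bT bΩ y p b
  have e3 := 𝒜.commute_creation bT bΩ (𝒜.oneTruncated.lie x y) p b
  have e4 := (𝒜.pbw bT bΩ).defect_expand x y p (𝒜.vec bT bΩ b)
  rw [Commute] at *
  refine e4.trans ?_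
  change _ + (𝒜.pbw bT bΩ).defect x (𝒜.oneTruncated.lie y (𝒜.creation bT p)) _ -
    (𝒜.pbw bT bΩ).defect y (𝒜.oneTruncated.lie x (𝒜.creation bT p)) _ +
    (𝒜.pbw bT bΩ).act x ((𝒜.pbw bT bΩ).defect y (𝒜.creation bT p) _) -
    (𝒜.pbw bT bΩ).act y ((𝒜.pbw bT bΩ).defect x (𝒜.creation bT p) _) +
    (𝒜.pbw bT bΩ).defect x (𝒜.creation bT p) _ - (𝒜.pbw bT bΩ).defect y (𝒜.creation bT p) _ -
    (𝒜.pbw bT bΩ).defect (𝒜.oneTruncated.lie x y) (𝒜.creation bT p) _ = 0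
  rw [h, h₁, h₂, h₃, h₄, e1, e2, e3]
  simp

end VertexAlgebroid

theorem EvSum.mul_const {R : Type*} [Ring R] {f : ℕ → R} {s : R} (h : EvSum f s) (b : R) :
    EvSum (fun j => f j * b) (s * b) := EvSum.map (AddMonoidHom.mulRight b) h

namespace VertexAlgebroid

open MvPolynomial

variable {k A T Ω : Type*} [CommRing k] [Algebra ℚ k] [Invertible (2 : k)]
    [CommRing A] [Algebra k A]
    [LieRing T] [LieAlgebra k T] [Module A T] [LieRingModule T A] [LieRinehartRing A T]
    [LieRinehartAlgebra k A T]
    [AddCommGroup Ω] [Module k Ω] [Module A Ω] [IsScalarTower k A Ω]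
    [LieRingModule T Ω] [LieModule k T Ω]
    (𝒜 : VertexAlgebroid k A T Ω) {I Λ : Type*} (bT : Module.Basis I A T)
    (bΩ : Module.Basis Λ A Ω) {n : ℤ}

theorem evSum_lowerTail (n : ℤ) (i : I) (a g : A) (b : MvPolynomial (Λ × ℕ) A) :
    EvSum (fun j : ℕ => 𝒜.dp bΩ j (C a) * 𝒜.lowerTail bT bΩ (n + j) i g b)
      (𝒜.lowerTail bT bΩ n i (a * g) b) := by
  obtain ⟨K, hK⟩ := 𝒜.tder_eventually_zero bΩ (bT i) b
  have h : ∀ (m : ℤ) (g : A), 𝒜.lowerTail bT bΩ m i g b =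
      ∑ l ∈ Finset.range K, 𝒜.dp bΩ (l - m) (C g) * 𝒜.tder bΩ l (bT i) b := fun m g =>
    (𝒜.lowerTail_spec bT bΩ m i g b).unique (EvSum.of_eventually_zero fun l hl => by
      rw [hK l (by exact_mod_cast hl), mul_zero])
  simp only [h, Finset.mul_sum]
  refine EvSum.finset_sum _ fun l _ => ?_
  have h1 := (𝒜.dp_mul bΩ (l - n) (C a) (C g)).mul_const
    (𝒜.tder bΩ l (bT i) b)
  refine h1.conv (fun j => ?_) ?_
  · rw [mul_assoc, show (l : ℤ) - n - j = l - (n + j) by ring]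
  · rw [C_mul]

theorem dp_mul_linear (n : ℤ) (a g : MvPolynomial (Λ × ℕ) A) :
    EvSum (fun j : ℕ => (n + j) • (𝒜.dp bΩ j a * 𝒜.dp bΩ (-n - j) g))
      (n • 𝒜.dp bΩ (-n) (a * g) + 𝒜.dp bΩ (-n - 1) (𝒜.totalDer bΩ a * g)) :=
  (((𝒜.dp_mul bΩ (-n) a g).zsmul n).add (𝒜.dp_mul_weighted bΩ (-n) a g)).congr fun _ =>
    (add_smul _ _ _).symm

theorem evSum_lower (n : ℤ) (i : I) (a g : A) (b : MvPolynomial (Λ × ℕ) A) :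
    EvSum (fun j : ℕ => 𝒜.dp bΩ j (C a) * 𝒜.lower bT bΩ (n + j) i g b)
      (𝒜.lowerTail bT bΩ n i (a * g) b + (n • 𝒜.dp bΩ (-n) (C a * C ⁅bT i, g⁆) +
        𝒜.dp bΩ (-n - 1) (𝒜.totalDer bΩ (C a) * C ⁅bT i, g⁆)) * b) := by
  have h1 := (𝒜.dp_mul_linear bΩ n (C a) (C ⁅bT i, g⁆)).mul_const b
  refine ((𝒜.evSum_lowerTail bT bΩ n i a g b).add h1).congr fun j => ?_
  rw [lower_apply, mul_add, neg_add, ← sub_eq_add_neg, mul_smul_comm,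
    smul_mul_assoc, mul_assoc]

theorem evSum_correction (n : ℤ) (w g b : MvPolynomial (Λ × ℕ) A) :
    EvSum (fun j : ℕ => ∑ p ∈ Finset.range ((-n).toNat - j),
        𝒜.dp bΩ (-n - p) w * (𝒜.dp bΩ p g * b))
      (-((n • 𝒜.dp bΩ (-n) (g * w) + 𝒜.dp bΩ (-n - 1) (𝒜.totalDer bΩ g * w)) * b)) := by
  have h1 := ((𝒜.dp_mul_linear bΩ n g w).mul_const b)
  have h2 := h1.unique (EvSum.of_eventually_zero (K := (-n).toNat) fun j hj => by
    rcases (show n + j = 0 ∨ -n - j < 0 by omega) with h | h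
    · rw [h]; simp
    · rw [𝒜.dp_of_neg bΩ h]; simp)
  rw [h2]
  have h3 := EvSum.of_eventually_zero (K := (-n).toNat) (f := fun j : ℕ =>
    ∑ p ∈ Finset.range ((-n).toNat - j), 𝒜.dp bΩ (-n - p) w * (𝒜.dp bΩ p g * b)) fun j hj => by
      rw [Nat.sub_eq_zero_of_le hj, Finset.sum_range_zero]
  rw [EvSum.sum_triangle] at h3
  refine h3.conv (fun j => rfl) ?_
  rw [← Finset.sum_neg_distrib]
  refine Finset.sum_congr rfl fun p hp => ?_
  have : ((-n).toNat : ℤ) = -n := by have := Finset.mem_range.1 hp; omega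
  rw [this, smul_mul_assoc, ← neg_smul, neg_add, sub_eq_add_neg]
  congr 1
  ring

theorem opA_vec₁ (n : ℤ) (a : A) (i : I) (m : ℕ) (b : MvPolynomial (Λ × ℕ) A) :
    𝒜.opA bT bΩ n a (𝒜.vec₁ bT bΩ i m b) = 𝒜.vec₁ bT bΩ i m (𝒜.dp bΩ (-1 - n) (C a) * b) -
      𝒜.vec bT bΩ (𝒜.dp bΩ (m - n) (C ⁅bT i, a⁆) * b) := by
  have h := (𝒜.commute_creation bT bΩ (𝒜.oneTruncated.modeA n a) ⟨i, m⟩ b).eq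
  rw [creation, 𝒜.oneTruncated.lie_A_E, map_neg, LinearMap.neg_apply, ← sub_eq_add_neg] at h
  have h1 := 𝒜.opA_vec bT bΩ n a b
  have h2 := 𝒜.opA_vec bT bΩ (n + (-1 - m)) ⁅bT i, a⁆ b
  have h3 := 𝒜.opE_creation_vec bT bΩ i m b
  have h4 := 𝒜.opE_creation_vec bT bΩ i m (𝒜.dp bΩ (-1 - n) (C a) * b)
  rw [show -1 - (n + (-1 - m)) = m - n by ring] at h2
  rw [← h3, ← h4, ← h1, ← h2]
  exact h

theorem normalProduct_A_A (n : ℤ) (a c : A) (b : MvPolynomial (Λ × ℕ) A) :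
    NormalProduct (fun n => 𝒜.opA bT bΩ n a) (fun n => 𝒜.opA bT bΩ n c) n (𝒜.vec bT bΩ b)
      (𝒜.opA bT bΩ n (a * c) (𝒜.vec bT bΩ b)) := by
  have h := ((𝒜.dp_mul bΩ (-1 - n) (C a) (C c)).mul_const b).map (𝒜.vec bT bΩ)
  refine h.conv (fun j => ?_) ?_
  · rw [opA_vec, opA_vec, opA_vec, 𝒜.dp_of_neg bΩ (by omega : -1 - (j : ℤ) < 0), zero_mul, map_zero,
      map_zero, add_zero, mul_assoc, sub_sub_cancel,
      show -1 - (n + j) = -1 - n - j by ring]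
  · rw [opA_vec, C_mul]

theorem normalProduct_A_Ω (n : ℤ) (a : A) (ω : Ω) (b : MvPolynomial (Λ × ℕ) A) :
    NormalProduct (fun n => 𝒜.opA bT bΩ n a) (fun n => 𝒜.opE bT bΩ n (0, ω)) n (𝒜.vec bT bΩ b)
      (𝒜.opE bT bΩ n (0, a • ω) (𝒜.vec bT bΩ b)) := by
  have h := ((𝒜.dp_mul bΩ (-1 - n) (C a) (inΩ bΩ ω)).mul_const b).map
    (𝒜.vec bT bΩ)
  refine h.conv (fun j => ?_) ?_
  · rw [opE_Ω_vec, opA_vec, opA_vec, 𝒜.dp_of_neg bΩ (by omega : -1 - (j : ℤ) < 0), zero_mul,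
      map_zero, map_zero, add_zero, mul_assoc, sub_sub_cancel,
      show -1 - (n + j) = -1 - n - j by ring]
  · rw [opE_Ω_vec, map_smul, smul_eq_C_mul]

theorem nprod_gT (a g : A) (i : I) : 𝒜.nprod a (𝒜.gT bT g i) =
    𝒜.gT bT (a * g) i + (0, ⁅bT i, a⁆ • 𝒜.d g + ⁅bT i, g⁆ • 𝒜.d a) := by
  rw [gT, nprod_nprod, add_assoc]
  congr 1
  simp [nprod, act, del]

theorem evSum_upper (N : ℕ) (i : I) (a g b : MvPolynomial (Λ × ℕ) A) :
    EvSum (fun j : ℕ => ∑ p ∈ Finset.range (N - j),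
        𝒜.vec₁ bT bΩ i (N - j - 1 - p) (𝒜.dp bΩ j a * (𝒜.dp bΩ p g * b)))
      (∑ q ∈ Finset.range N, 𝒜.vec₁ bT bΩ i (N - 1 - q) (𝒜.dp bΩ q (a * g) * b)) := by
  have h := EvSum.of_eventually_zero (K := N) (f := fun j : ℕ => ∑ p ∈ Finset.range (N - j),
    𝒜.vec₁ bT bΩ i (N - j - 1 - p) (𝒜.dp bΩ j a * (𝒜.dp bΩ p g * b))) fun j hj => by
      rw [Nat.sub_eq_zero_of_le hj, Finset.sum_range_zero]
  refine h.conv (fun j => rfl) ?_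
  rw [← Finset.sum_range_diag_flip N fun j p =>
    𝒜.vec₁ bT bΩ i (N - j - 1 - p) (𝒜.dp bΩ j a * (𝒜.dp bΩ p g * b))]
  refine Finset.sum_congr rfl fun q _ => ?_
  have h1 := (𝒜.dp_mul bΩ q a g).unique (EvSum.of_eventually_zero (K := q + 1) fun j hj => by
    rw [𝒜.dp_of_neg bΩ (by omega : (q : ℤ) - _ < 0), mul_zero])
  rw [h1, Finset.sum_mul, map_sum]
  refine Finset.sum_congr rfl fun j hj => ?_
  have : j ≤ q := Nat.lt_succ_iff.1 (Finset.mem_range.1 hj)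
  rw [Nat.cast_sub this, mul_assoc]
  congr 2
  omega

theorem normalProduct_A_gT (n : ℤ) (a g : A) (i : I) (b : MvPolynomial (Λ × ℕ) A) :
    NormalProduct (fun n => 𝒜.opA bT bΩ n a) (fun n => 𝒜.opE bT bΩ n (𝒜.gT bT g i)) n
      (𝒜.vec bT bΩ b) (𝒜.opE bT bΩ n (𝒜.nprod a (𝒜.gT bT g i)) (𝒜.vec bT bΩ b)) := by
  have h1 := (𝒜.evSum_lower bT bΩ n i a g b).map (𝒜.vec bT bΩ)
  have h2 := 𝒜.evSum_upper bT bΩ (-n).toNat i (C a) (C g) b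
  have h3 := (𝒜.evSum_correction bΩ n (C ⁅bT i, a⁆) (C g) b).map (𝒜.vec bT bΩ)
  refine ((h1.add h2).sub h3).conv (fun j => ?_) ?_
  · rw [opE_gT_vec, opA_vec, 𝒜.dp_of_neg bΩ (by omega : -1 - (j : ℤ) < 0), zero_mul, map_zero,
      map_zero, add_zero, map_add, opA_vec, map_sum, sub_sub_cancel, add_sub_assoc]
    congr 1
    rw [map_sum, ← Finset.sum_sub_distrib]
    have hN : (-(n + j)).toNat = (-n).toNat - j := by omega
    rw [hN]
    refine Finset.sum_congr rfl fun p hp => ?_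
    rw [opA_vec₁, sub_sub_cancel]
    have : (((-n).toNat - j - 1 - p : ℕ) : ℤ) - (-1 - j) = -n - p := by
      have := Finset.mem_range.1 hp; omega
    rw [this]
  · rw [nprod_gT, (𝒜.opE bT bΩ n).map_add, LinearMap.add_apply, opE_gT_vec, opE_Ω_vec, lower_apply]
    have e : ⁅bT i, a * g⁆ = a * ⁅bT i, g⁆ + g * ⁅bT i, a⁆ := by
      rw [LieRinehartRing.leibniz_mul_right, smul_eq_mul, mul_comm g]
    simp only [e, map_add, map_neg, C_mul, add_mul, smul_add, map_smul, smul_eq_C_mul, totalDer_C,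
      show -1 - n = -n - 1 by ring, mul_comm (C ⁅bT i, a⁆), mul_comm (C ⁅bT i, g⁆), smul_mul_assoc]
    abel

theorem normalProduct_A_E (n : ℤ) (a : A) (y : T × Ω) (b : MvPolynomial (Λ × ℕ) A) :
    NormalProduct (fun n => 𝒜.opA bT bΩ n a) (fun n => 𝒜.opE bT bΩ n y) n (𝒜.vec bT bΩ b)
      (𝒜.opE bT bΩ n (𝒜.oneTruncated.mul a y) (𝒜.vec bT bΩ b)) := by
  induction y using 𝒜.generator_induction bT with
  | add x y hx hy =>
    rw [map_add, map_add, LinearMap.add_apply]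
    simp only [map_add]
    exact hx.add_right hy
  | hT g i => exact 𝒜.normalProduct_A_gT bT bΩ n a g i b
  | hΩ ω =>
    have e : 𝒜.oneTruncated.mul a (0, ω) = (0, a • ω) := by
      change 𝒜.nprod a (0, ω) = _
      simp [nprod]
    rw [e]
    exact 𝒜.normalProduct_A_Ω bT bΩ n a ω b

end VertexAlgebroid

namespace VertexAlgebroid

open MvPolynomial

variable {k A T Ω : Type*} [CommRing k] [Algebra ℚ k] [Invertible (2 : k)]
    [CommRing A] [Algebra k A]
    [LieRing T] [LieAlgebra k T] [Module A T] [LieRingModule T A] [LieRinehartRing A T]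
    [LieRinehartAlgebra k A T]
    [AddCommGroup Ω] [Module k Ω] [Module A Ω] [IsScalarTower k A Ω]
    [LieRingModule T Ω] [LieModule k T Ω]
    (𝒜 : VertexAlgebroid k A T Ω) {I Λ : Type*} (bT : Module.Basis I A T)
    (bΩ : Module.Basis Λ A Ω) {m n p q : ℤ}

section

variable {𝒜 bT bΩ} {v : 𝒜.Fock bT bΩ}

theorem commute_A_A_iff {a c : A} :
    𝒜.Commute bT bΩ (𝒜.oneTruncated.modeA m a) (𝒜.oneTruncated.modeA n c) v ↔
      𝒜.opA bT bΩ m a (𝒜.opA bT bΩ n c v) = 𝒜.opA bT bΩ n c (𝒜.opA bT bΩ m a v) := by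
  have key : (𝒜.pbw bT bΩ).act (𝒜.oneTruncated.lie (𝒜.oneTruncated.modeA m a)
      (𝒜.oneTruncated.modeA n c)) v = 0 := by
    rw [𝒜.oneTruncated.lie_A_A, map_zero, LinearMap.zero_apply]
  constructor
  · intro h
    have := h.eq
    rwa [key, add_zero] at this
  · intro h
    refine Commute.of_eq ?_
    rw [key, add_zero]
    exact h

theorem commute_E_A_iff {x : T × Ω} {a : A} :
    𝒜.Commute bT bΩ (𝒜.oneTruncated.modeE m x) (𝒜.oneTruncated.modeA n a) v ↔
      𝒜.opE bT bΩ m x (𝒜.opA bT bΩ n a v) = 𝒜.opA bT bΩ n a (𝒜.opE bT bΩ m x v) +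
        𝒜.opA bT bΩ (m + n) (𝒜.act x a) v := by
  have key : (𝒜.pbw bT bΩ).act (𝒜.oneTruncated.lie (𝒜.oneTruncated.modeE m x)
      (𝒜.oneTruncated.modeA n a)) v = 𝒜.opA bT bΩ (m + n) (𝒜.act x a) v := by
    rw [𝒜.oneTruncated.lie_E_A]; rfl
  constructor
  · intro h
    have := h.eq
    rwa [key] at this
  · intro h
    refine Commute.of_eq ?_
    rw [key]
    exact h

theorem commute_A_E_iff {x : T × Ω} {a : A} :
    𝒜.Commute bT bΩ (𝒜.oneTruncated.modeA m a) (𝒜.oneTruncated.modeE n x) v ↔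
      𝒜.opA bT bΩ m a (𝒜.opE bT bΩ n x v) = 𝒜.opE bT bΩ n x (𝒜.opA bT bΩ m a v) -
        𝒜.opA bT bΩ (m + n) (𝒜.act x a) v := by
  have key : (𝒜.pbw bT bΩ).act (𝒜.oneTruncated.lie (𝒜.oneTruncated.modeA m a)
      (𝒜.oneTruncated.modeE n x)) v = -𝒜.opA bT bΩ (m + n) (𝒜.act x a) v := by
    rw [𝒜.oneTruncated.lie_A_E, map_neg]; rfl
  constructor
  · intro h
    have := h.eq
    rwa [key, ← sub_eq_add_neg] at this
  · intro h
    refine Commute.of_eq ?_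
    rw [key, ← sub_eq_add_neg]
    exact h

theorem commute_E_E_iff {x y : T × Ω} :
    𝒜.Commute bT bΩ (𝒜.oneTruncated.modeE m x) (𝒜.oneTruncated.modeE n y) v ↔
      𝒜.opE bT bΩ m x (𝒜.opE bT bΩ n y v) = 𝒜.opE bT bΩ n y (𝒜.opE bT bΩ m x v) +
        (𝒜.opE bT bΩ (m + n) (𝒜.oneTruncated.br x y) v +
          m • 𝒜.opA bT bΩ (m + n - 1) (𝒜.oneTruncated.form x y) v) := by
  have key : (𝒜.pbw bT bΩ).act (𝒜.oneTruncated.lie (𝒜.oneTruncated.modeE m x)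
      (𝒜.oneTruncated.modeE n y)) v = 𝒜.opE bT bΩ (m + n) (𝒜.oneTruncated.br x y) v +
          m • 𝒜.opA bT bΩ (m + n - 1) (𝒜.oneTruncated.form x y) v := by
    rw [𝒜.oneTruncated.lie_E_E, map_add, map_zsmul]; rfl
  constructor
  · intro h
    have := h.eq
    rwa [key] at this
  · intro h
    refine Commute.of_eq ?_
    rw [key]
    exact h

theorem Commute.symm_E {x : 𝒜.oneTruncated.Modes} {y : T × Ω}
    (h : 𝒜.Commute bT bΩ x (𝒜.oneTruncated.modeE n y) v) :
    𝒜.Commute bT bΩ (𝒜.oneTruncated.modeE n y) x v :=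
  Commute.symm 𝒜 bT bΩ h (𝒜.oneTruncated.lie_skew _ _ _)

theorem Commute.symm_E' {x : 𝒜.oneTruncated.Modes} {y : T × Ω}
    (h : 𝒜.Commute bT bΩ (𝒜.oneTruncated.modeE n y) x v) :
    𝒜.Commute bT bΩ x (𝒜.oneTruncated.modeE n y) v :=
  Commute.symm 𝒜 bT bΩ h (by rw [add_comm]; exact 𝒜.oneTruncated.lie_skew _ _ _)

end

/-- An additive property of the vectors of degree at most one holds for `x · b`. -/
theorem act_vec_induction {P : 𝒜.Fock bT bΩ → Prop} (add : ∀ v w, P v → P w → P (v + w))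
    (h₀ : ∀ b, P (𝒜.vec bT bΩ b))
    (h₁ : ∀ c b, P ((𝒜.pbw bT bΩ).act (𝒜.creation bT c) (𝒜.vec bT bΩ b)))
    (x : 𝒜.oneTruncated.Modes) (b : MvPolynomial (Λ × ℕ) A) :
    P ((𝒜.pbw bT bΩ).act x (𝒜.vec bT bΩ b)) := by
  rw [base_vec]
  refine add _ _ (h₀ _) ?_
  generalize 𝒜.modeTop bT bΩ x b = c
  induction c using Finsupp.induction_linear with
  | zero =>
    rw [Finsupp.mapDomain_zero, ← map_zero (𝒜.vec bT bΩ)]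
    exact h₀ 0
  | add f g hf hg => rw [Finsupp.mapDomain_add]; exact add _ _ hf hg
  | single i f =>
    rw [Finsupp.mapDomain_single]
    have := (𝒜.pbw bT bΩ).act_e_single (j := i) (N := 0) (by simp) f
    have h2 := h₁ i f
    change P ((𝒜.pbw bT bΩ).act ((𝒜.pbw bT bΩ).e i) (Finsupp.single 0 f)) at h2
    rwa [this] at h2

theorem commute_A_A_vec (m n : ℤ) (a c : A) (b : MvPolynomial (Λ × ℕ) A) :
    𝒜.Commute bT bΩ (𝒜.oneTruncated.modeA m a) (𝒜.oneTruncated.modeA n c) (𝒜.vec bT bΩ b) := by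
  rw [commute_A_A_iff]
  simp only [opA_vec, mul_left_comm]

theorem commute_A_A_act (m n : ℤ) (a c : A) (x : 𝒜.oneTruncated.Modes)
    (b : MvPolynomial (Λ × ℕ) A) :
    𝒜.Commute bT bΩ (𝒜.oneTruncated.modeA m a) (𝒜.oneTruncated.modeA n c)
      ((𝒜.pbw bT bΩ).act x (𝒜.vec bT bΩ b)) := by
  refine 𝒜.act_vec_induction bT bΩ
    (P := fun v => 𝒜.Commute bT bΩ (𝒜.oneTruncated.modeA m a) (𝒜.oneTruncated.modeA n c) v)
    (fun v w => 𝒜.commute_add_vec bT bΩ) (𝒜.commute_A_A_vec bT bΩ m n a c) (fun i b => ?_) x b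
  have h : ∀ (m n : ℤ) (a c : A), 𝒜.Commute bT bΩ (𝒜.oneTruncated.modeA m a)
      (𝒜.oneTruncated.lie (𝒜.oneTruncated.modeA n c) (𝒜.creation bT i)) (𝒜.vec bT bΩ b) := by
    intro m n a c
    rw [creation, 𝒜.oneTruncated.lie_A_E, ← map_neg]
    exact 𝒜.commute_A_A_vec bT bΩ _ _ _ _ _
  have h' : ∀ (m n : ℤ) (a c : A), 𝒜.Commute bT bΩ (𝒜.oneTruncated.modeA m a)
      (𝒜.creation bT i) ((𝒜.pbw bT bΩ).act (𝒜.oneTruncated.modeA n c) (𝒜.vec bT bΩ b)) := by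
    intro m n a c
    have := 𝒜.commute_creation bT bΩ (𝒜.oneTruncated.modeA m a) i
      (𝒜.dp bΩ (-1 - n) (C c) * b)
    rwa [← opA_vec] at this
  exact 𝒜.commute_vec₁ bT bΩ i (𝒜.commute_A_A_vec bT bΩ m n a c b) (h _ _ _ _) (h _ _ _ _)
    (h' _ _ _ _) (h' _ _ _ _)

theorem commute_E_A_nonneg (hn : 0 ≤ n) (y : T × Ω) (p : ℤ) (a : A) (b : MvPolynomial (Λ × ℕ) A) :
    𝒜.Commute bT bΩ (𝒜.oneTruncated.modeE n y) (𝒜.oneTruncated.modeA p a) (𝒜.vec bT bΩ b) := by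
  rw [commute_E_A_iff, opA_vec, 𝒜.opE_nonneg_vec bT bΩ hn, 𝒜.opE_nonneg_vec bT bΩ hn, opA_vec,
    opA_vec, Derivation.leibniz, 𝒜.tder_dp_C bΩ hn, map_add, smul_eq_mul, smul_eq_mul,
    mul_comm b, act, show -1 - p - n = -1 - (n + p) by ring]

theorem commute_A_basis (p q : ℤ) (a : A) (i : I) (b : MvPolynomial (Λ × ℕ) A) :
    𝒜.Commute bT bΩ (𝒜.oneTruncated.modeA p a) (𝒜.oneTruncated.modeE q (bT i, 0))
      (𝒜.vec bT bΩ b) := by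
  rcases lt_or_ge q 0 with h | h
  · have := 𝒜.commute_creation bT bΩ (𝒜.oneTruncated.modeA p a) ⟨i, (-1 - q).toNat⟩ b
    rwa [creation, show -1 - ((-1 - q).toNat : ℤ) = q by omega] at this
  · exact Commute.symm_E' (𝒜.commute_E_A_nonneg bT bΩ h _ p a b)

theorem commute_A_E_vec (p n : ℤ) (a : A) (y : T × Ω) (b : MvPolynomial (Λ × ℕ) A) :
    𝒜.Commute bT bΩ (𝒜.oneTruncated.modeA p a) (𝒜.oneTruncated.modeE n y)
      (𝒜.vec bT bΩ b) := by
  induction y using 𝒜.generator_induction bT with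
  | add x y hx hy => rw [map_add]; exact 𝒜.commute_add_right bT bΩ hx hy
  | hΩ ω =>
    rw [commute_A_E_iff]
    simp only [opA_vec, opE_Ω_vec, mul_left_comm, act, zero_lie, map_zero,
      LinearMap.zero_apply, sub_zero]
  | hT g i =>
    rw [commute_A_E_iff]
    have hs := 𝒜.normalProduct_A_E bT bΩ n g (bT i, 0) b
    have hw := 𝒜.normalProduct_A_E bT bΩ n g (bT i, 0) (𝒜.dp bΩ (-1 - p) (C a) * b)
    rw [← opA_vec] at hw
    have ht := ((𝒜.normalProduct_A_A bT bΩ (p + n) g (𝒜.act (bT i, 0) a) b).shift_right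
      p).zsmul_right (-1)
    have h0 : NormalProduct (0 : ℤ → 𝒜.Fock bT bΩ →ₗ[k] 𝒜.Fock bT bΩ)
        (fun n => 𝒜.opE bT bΩ n (bT i, 0)) n (𝒜.vec bT bΩ b) 0 :=
      EvSum.zero.congr fun j => by simp
    have key := NormalProduct.apply (𝒜.opA bT bΩ p a) (fun r q => ?_) (fun r q => ?_) (fun q => ?_)
      (fun r => ?_) hs ht h0
    · have h1 := hw.unique key
      have e : 𝒜.act (𝒜.gT bT g i) a = g * 𝒜.act (bT i, 0) a := 𝒜.act_nprod _ _ _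
      change 𝒜.opE bT bΩ n (𝒜.gT bT g i) _ = 𝒜.opA bT bΩ p a (𝒜.opE bT bΩ n (𝒜.gT bT g i) _)
        - _ - _ at h1
      rw [h1, e]
      abel_nf
    · rw [Pi.zero_apply, LinearMap.zero_apply, add_zero]
      exact commute_A_A_iff.1 (𝒜.commute_A_A_act bT bΩ p r a g (𝒜.oneTruncated.modeE q (bT i, 0)) b)
    · rw [opA_vec, commute_A_E_iff.1 (𝒜.commute_A_basis bT bΩ p q a i _), LinearMap.smul_apply]
      abel
    · rw [commute_A_E_iff.1 (𝒜.commute_A_basis bT bΩ p q a i _), LinearMap.smul_apply]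
      abel
    · rw [Pi.zero_apply, LinearMap.zero_apply, add_zero]
      exact commute_A_A_iff.1 (𝒜.commute_A_A_vec bT bΩ p r a g b)

theorem commute_A_creation_act (p : ℤ) (a : A) (j : CreationIndex I) (x : 𝒜.oneTruncated.Modes)
    (b : MvPolynomial (Λ × ℕ) A) :
    𝒜.Commute bT bΩ (𝒜.oneTruncated.modeA p a) (𝒜.creation bT j)
      ((𝒜.pbw bT bΩ).act x (𝒜.vec bT bΩ b)) := by
  refine 𝒜.act_vec_induction bT bΩ
    (P := fun v => 𝒜.Commute bT bΩ (𝒜.oneTruncated.modeA p a) (𝒜.creation bT j) v)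
    (fun v w => 𝒜.commute_add_vec bT bΩ) (𝒜.commute_creation bT bΩ _ j) (fun i b => ?_) x b
  rcases le_or_gt j i with h | h
  · have := (𝒜.pbw bT bΩ).defect_cons (j := j) (N := i ::ₘ 0) (by simpa using h)
      (𝒜.oneTruncated.modeA p a) b
    rw [← (𝒜.pbw bT bΩ).act_e_single (j := i) (N := 0) (by simp) b] at this
    exact this
  · refine 𝒜.commute_vec₁ bT bΩ i (𝒜.commute_creation bT bΩ _ j b) ?_ ?_ ?_ ?_
    · rw [creation, creation, 𝒜.oneTruncated.lie_E_E]
      exact 𝒜.commute_add_right bT bΩ (𝒜.commute_A_E_vec bT bΩ _ _ _ _ _)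
        (𝒜.commute_zsmul_right bT bΩ _ (𝒜.commute_A_A_vec bT bΩ _ _ _ _ _))
    · rw [creation, creation, 𝒜.oneTruncated.lie_A_E, ← map_neg]
      exact Commute.symm_E (𝒜.commute_A_E_vec bT bΩ _ _ _ _ _)
    · have := (𝒜.pbw bT bΩ).defect_cons (j := i) (N := j ::ₘ 0) (by simpa using h.le)
        (𝒜.oneTruncated.modeA p a) b
      rw [← (𝒜.pbw bT bΩ).act_e_single (j := j) (N := 0) (by simp) b] at this
      exact this
    · have := 𝒜.commute_creation bT bΩ (𝒜.creation bT j) i (𝒜.dp bΩ (-1 - p) (C a) * b)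
      rwa [← opA_vec] at this

theorem commute_E_A_act (m p : ℤ) (z : T × Ω) (a : A) (x : 𝒜.oneTruncated.Modes)
    (b : MvPolynomial (Λ × ℕ) A) :
    𝒜.Commute bT bΩ (𝒜.oneTruncated.modeE m z) (𝒜.oneTruncated.modeA p a)
      ((𝒜.pbw bT bΩ).act x (𝒜.vec bT bΩ b)) := by
  refine 𝒜.act_vec_induction bT bΩ
    (P := fun v => 𝒜.Commute bT bΩ (𝒜.oneTruncated.modeE m z) (𝒜.oneTruncated.modeA p a) v)
    (fun v w => 𝒜.commute_add_vec bT bΩ)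
    (fun b => Commute.symm_E (𝒜.commute_A_E_vec bT bΩ _ _ _ _ b)) (fun i b => ?_) x b
  refine 𝒜.commute_vec₁ bT bΩ i (Commute.symm_E (𝒜.commute_A_E_vec bT bΩ _ _ _ _ b)) ?_ ?_ ?_ ?_
  · rw [creation, 𝒜.oneTruncated.lie_A_E, ← map_neg]
    exact Commute.symm_E (𝒜.commute_A_E_vec bT bΩ _ _ _ _ _)
  · rw [creation, 𝒜.oneTruncated.lie_E_E]
    exact 𝒜.commute_add_right bT bΩ (𝒜.commute_A_E_vec bT bΩ _ _ _ _ _)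
        (𝒜.commute_zsmul_right bT bΩ _ (𝒜.commute_A_A_vec bT bΩ _ _ _ _ _))
  · have := 𝒜.commute_creation bT bΩ (𝒜.oneTruncated.modeE m z) i (𝒜.dp bΩ (-1 - p) (C a) * b)
    rwa [← opA_vec] at this
  · exact 𝒜.commute_A_creation_act bT bΩ _ _ _ _ _

theorem opA_vec_eventually_zero (a : A) (b : MvPolynomial (Λ × ℕ) A) :
    ∃ K : ℕ, ∀ p : ℤ, p ≥ K → 𝒜.opA bT bΩ p a (𝒜.vec bT bΩ b) = 0 :=
  ⟨0, fun p hp => by rw [opA_vec, 𝒜.dp_of_neg bΩ (by omega), zero_mul, map_zero]⟩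

theorem opE_vec_eventually_zero (x : T × Ω) (b : MvPolynomial (Λ × ℕ) A) :
    ∃ K : ℕ, ∀ p : ℤ, p ≥ K → 𝒜.opE bT bΩ p x (𝒜.vec bT bΩ b) = 0 := by
  obtain ⟨K, hK⟩ := 𝒜.tder_eventually_zero bΩ x.1 b
  exact ⟨K, fun p hp => by rw [𝒜.opE_nonneg_vec bT bΩ (by omega), hK p hp, map_zero]⟩

/-- The commutator of a mode with the modes of a normally ordered product. -/
theorem normalProduct_comm (m n : ℤ) (z y : T × Ω) (g : A) (b : MvPolynomial (Λ × ℕ) A)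
    (h : ∀ q c, 𝒜.Commute bT bΩ (𝒜.oneTruncated.modeE m z) (𝒜.oneTruncated.modeE q y)
      (𝒜.vec bT bΩ c)) :
    NormalProduct (fun n => 𝒜.opA bT bΩ n g) (fun n => 𝒜.opE bT bΩ n y) n
      (𝒜.opE bT bΩ m z (𝒜.vec bT bΩ b))
      (𝒜.opE bT bΩ m z (𝒜.opE bT bΩ n (𝒜.oneTruncated.mul g y) (𝒜.vec bT bΩ b)) -
        (𝒜.opE bT bΩ (m + n) (𝒜.oneTruncated.br z (𝒜.oneTruncated.mul g y)) (𝒜.vec bT bΩ b) +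
          m • 𝒜.opA bT bΩ (m + n - 1) (𝒜.oneTruncated.form z (𝒜.oneTruncated.mul g y))
            (𝒜.vec bT bΩ b))) := by
  have hs := 𝒜.normalProduct_A_E bT bΩ n g y b
  have ht := ((𝒜.normalProduct_A_E bT bΩ (m + n) g (𝒜.oneTruncated.br z y) b).shift_right
    m).add_right (((𝒜.normalProduct_A_A bT bΩ (m - 1 + n) g (𝒜.oneTruncated.form z y)
      b).shift_right (m - 1)).zsmul_right m)
  have ht' := NormalProduct.shift_left (ξ := fun r => -𝒜.opA bT bΩ r
      (𝒜.oneTruncated.act y (𝒜.oneTruncated.act z g)) (𝒜.vec bT bΩ b))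
    (𝒜.opA_vec_eventually_zero bT bΩ (𝒜.oneTruncated.act z g) b)
    (𝒜.opE_vec_eventually_zero bT bΩ y b)
    (fun p q => by
      rw [commute_A_E_iff.1 (𝒜.commute_A_E_vec bT bΩ p q (𝒜.oneTruncated.act z g) y b),
        sub_eq_add_neg]; rfl)
    (fun n => 𝒜.normalProduct_A_E bT bΩ n (𝒜.oneTruncated.act z g) y b) m n
  have key := NormalProduct.apply (𝒜.opE bT bΩ m z) (fun r q => ?_) (fun r q => ?_) (fun q => ?_)
    (fun r => ?_) hs ht ht'
  · convert key using 1
    have e1 := 𝒜.oneTruncated.form_mul g y z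
    rw [𝒜.oneTruncated.form_comm, 𝒜.oneTruncated.form_comm y] at e1
    rw [e1, 𝒜.oneTruncated.br_mul, map_add, map_sub, LinearMap.add_apply, LinearMap.sub_apply,
      show m - 1 + n = m + n - 1 by ring]
    module
  · exact commute_E_A_iff.1 (𝒜.commute_E_A_act bT bΩ m r z g (𝒜.oneTruncated.modeE q y) b)
  · rw [opA_vec, commute_E_E_iff.1 (h q _), show m + q - 1 = m - 1 + q by ring]; rfl
  · rw [commute_E_E_iff.1 (h q _), show m + q - 1 = m - 1 + q by ring]; rfl
  · exact commute_E_A_iff.1 (Commute.symm_E (𝒜.commute_A_E_vec bT bΩ _ _ _ _ _))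

theorem normalProduct_act (n : ℤ) (g : A) (y : T × Ω) (x : 𝒜.oneTruncated.Modes)
    (b : MvPolynomial (Λ × ℕ) A) :
    NormalProduct (fun n => 𝒜.opA bT bΩ n g) (fun n => 𝒜.opE bT bΩ n y) n
      ((𝒜.pbw bT bΩ).act x (𝒜.vec bT bΩ b))
      (𝒜.opE bT bΩ n (𝒜.oneTruncated.mul g y) ((𝒜.pbw bT bΩ).act x (𝒜.vec bT bΩ b))) := by
  refine 𝒜.act_vec_induction bT bΩ (P := fun v =>
    NormalProduct (fun n => 𝒜.opA bT bΩ n g) (fun n => 𝒜.opE bT bΩ n y) n v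
      (𝒜.opE bT bΩ n (𝒜.oneTruncated.mul g y) v))
    (fun v w hv hw => by rw [map_add]; exact hv.add_vec hw)
    (fun b => 𝒜.normalProduct_A_E bT bΩ n g y b) (fun i b => ?_) x b
  have h := 𝒜.normalProduct_comm bT bΩ (-1 - i.ord) n (bT i.gen, 0) y g b fun q c =>
    𝒜.creation_commute bT bΩ _ i c
  have h2 := commute_E_E_iff.1 (𝒜.creation_commute bT bΩ
    (𝒜.oneTruncated.modeE n (𝒜.oneTruncated.mul g y)) i b)
  rw [h2, add_sub_cancel_right] at h
  exact h

theorem commute_E_Ω_nonneg (hm : 0 ≤ m) (n : ℤ) (z : T × Ω) (ω : Ω) (b : MvPolynomial (Λ × ℕ) A) :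
    𝒜.Commute bT bΩ (𝒜.oneTruncated.modeE m z) (𝒜.oneTruncated.modeE n (0, ω))
      (𝒜.vec bT bΩ b) := by
  have e : 𝒜.oneTruncated.br z (0, ω) = (0, ⁅z.1, ω⁆) := by
    change 𝒜.bracket z (0, ω) = _
    simp [bracket]
  have e' : 𝒜.oneTruncated.form z (0, ω) = 𝒜.pair z.1 ω := by
    change 𝒜.form z (0, ω) = _
    simp [form]
  rw [commute_E_E_iff, opE_Ω_vec, 𝒜.opE_nonneg_vec bT bΩ hm, 𝒜.opE_nonneg_vec bT bΩ hm, opE_Ω_vec,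
    e, e', opE_Ω_vec, opA_vec, Derivation.leibniz, 𝒜.tder_dp_inΩ bΩ hm, smul_eq_mul, smul_eq_mul,
    show -1 - n - m + 1 = -1 - (m + n - 1) by ring, show -1 - n - m = -1 - (m + n) by ring,
    mul_comm b, add_mul, map_add, map_add, smul_mul_assoc, map_zsmul]

theorem commute_nonneg_nonneg (hm : 0 ≤ m) (hn : 0 ≤ n) (z y : T × Ω)
    (b : MvPolynomial (Λ × ℕ) A) :
    𝒜.Commute bT bΩ (𝒜.oneTruncated.modeE m z) (𝒜.oneTruncated.modeE n y) (𝒜.vec bT bΩ b) := by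
  have h0 : m • 𝒜.opA bT bΩ (m + n - 1) (𝒜.oneTruncated.form z y) (𝒜.vec bT bΩ b) = 0 := by
    rcases hm.lt_or_eq with h | rfl
    · rw [opA_vec, 𝒜.dp_of_neg bΩ (by omega), zero_mul, map_zero, smul_zero]
    · rw [zero_smul]
  rw [commute_E_E_iff, h0, 𝒜.opE_nonneg_vec bT bΩ hm, 𝒜.opE_nonneg_vec bT bΩ hn,
    𝒜.opE_nonneg_vec bT bΩ hn, 𝒜.opE_nonneg_vec bT bΩ hm,
    𝒜.opE_nonneg_vec bT bΩ (add_nonneg hm hn), 𝒜.tder_tder bΩ hm hn, map_add, add_zero]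
  rfl

theorem commute_E_gT_of {i : I} {z : T × Ω} (n : ℤ) (g : A)
    (h : ∀ q c, 𝒜.Commute bT bΩ (𝒜.oneTruncated.modeE m z) (𝒜.oneTruncated.modeE q (bT i, 0))
      (𝒜.vec bT bΩ c)) (b : MvPolynomial (Λ × ℕ) A) :
    𝒜.Commute bT bΩ (𝒜.oneTruncated.modeE m z) (𝒜.oneTruncated.modeE n (𝒜.gT bT g i))
      (𝒜.vec bT bΩ b) := by
  have h1 := 𝒜.normalProduct_comm bT bΩ m n z (bT i, 0) g b h
  have h2 := 𝒜.normalProduct_act bT bΩ n g (bT i, 0) (𝒜.oneTruncated.modeE m z) b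
  rw [commute_E_E_iff]
  exact (eq_add_of_sub_eq (h1.unique h2))

theorem commute_E_E_nonneg (hm : 0 ≤ m) (n : ℤ) (z y : T × Ω) (b : MvPolynomial (Λ × ℕ) A) :
    𝒜.Commute bT bΩ (𝒜.oneTruncated.modeE m z) (𝒜.oneTruncated.modeE n y) (𝒜.vec bT bΩ b) := by
  induction y using 𝒜.generator_induction bT with
  | add x y hx hy => rw [map_add]; exact 𝒜.commute_add_right bT bΩ hx hy
  | hΩ ω => exact 𝒜.commute_E_Ω_nonneg bT bΩ hm n z ω b
  | hT g i =>
    refine 𝒜.commute_E_gT_of bT bΩ n g (fun q c => ?_) b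
    rcases lt_or_ge q 0 with h | h
    · have := 𝒜.commute_creation bT bΩ (𝒜.oneTruncated.modeE m z) ⟨i, (-1 - q).toNat⟩ c
      rwa [creation, show -1 - ((-1 - q).toNat : ℤ) = q by omega] at this
    · exact 𝒜.commute_nonneg_nonneg bT bΩ hm h _ _ c

theorem commute_E_gT (m n : ℤ) (z : T × Ω) (g : A) (i : I) (b : MvPolynomial (Λ × ℕ) A) :
    𝒜.Commute bT bΩ (𝒜.oneTruncated.modeE m z) (𝒜.oneTruncated.modeE n (𝒜.gT bT g i))
      (𝒜.vec bT bΩ b) := by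
  refine 𝒜.commute_E_gT_of bT bΩ n g (fun q c => ?_) b
  rcases lt_or_ge q 0 with h | h
  · have := 𝒜.commute_creation bT bΩ (𝒜.oneTruncated.modeE m z) ⟨i, (-1 - q).toNat⟩ c
    rwa [creation, show -1 - ((-1 - q).toNat : ℤ) = q by omega] at this
  · exact Commute.symm_E (𝒜.commute_E_E_nonneg bT bΩ h _ _ _ c)

theorem commute_E_E_vec (m n : ℤ) (z y : T × Ω) (b : MvPolynomial (Λ × ℕ) A) :
    𝒜.Commute bT bΩ (𝒜.oneTruncated.modeE m z) (𝒜.oneTruncated.modeE n y) (𝒜.vec bT bΩ b) := by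
  induction y using 𝒜.generator_induction bT with
  | add x y hx hy => rw [map_add]; exact 𝒜.commute_add_right bT bΩ hx hy
  | hT g i => exact 𝒜.commute_E_gT bT bΩ m n z g i b
  | hΩ ω =>
    induction z using 𝒜.generator_induction bT with
    | add x y hx hy => rw [map_add]; exact 𝒜.commute_add_left bT bΩ hx hy
    | hT g i => exact Commute.symm_E (𝒜.commute_E_gT bT bΩ n m (0, ω) g i b)
    | hΩ ω' =>
      have e : 𝒜.oneTruncated.br (0, ω') (0, ω) = 0 := by
        change 𝒜.bracket (0, ω') (0, ω) = _
        simp [bracket]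
      have e' : 𝒜.oneTruncated.form (0, ω') (0, ω) = 0 := by
        change 𝒜.form (0, ω') (0, ω) = _
        simp [form]
      rw [commute_E_E_iff, e, e']
      simp only [opE_Ω_vec, map_zero, LinearMap.zero_apply, smul_zero, add_zero, mul_left_comm]

theorem commute_D_A (n : ℤ) (a : A) (b : MvPolynomial (Λ × ℕ) A) :
    𝒜.Commute bT bΩ 𝒜.oneTruncated.modeD (𝒜.oneTruncated.modeA n a) (𝒜.vec bT bΩ b) := by
  refine Commute.of_eq ?_
  rw [𝒜.oneTruncated.lie_D_A, map_zsmul]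
  change 𝒜.opD bT bΩ (𝒜.opA bT bΩ n a _) = 𝒜.opA bT bΩ n a (𝒜.opD bT bΩ _) +
    -n • 𝒜.opA bT bΩ (n - 1) a _
  simp only [opA_vec, opD_vec]
  rw [Derivation.leibniz, totalDer_dp, map_add, smul_eq_mul, smul_eq_mul, mul_smul_comm, map_zsmul,
    show -1 - (n - 1) = -1 - n + 1 by ring, show -1 - n + 1 = -n by ring, mul_comm b]

theorem opD_comm_Ω (n : ℤ) (ω : Ω) (b : MvPolynomial (Λ × ℕ) A) :
    𝒜.opD bT bΩ (𝒜.opE bT bΩ n (0, ω) (𝒜.vec bT bΩ b)) =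
      𝒜.opE bT bΩ n (0, ω) (𝒜.opD bT bΩ (𝒜.vec bT bΩ b)) +
        -n • 𝒜.opE bT bΩ (n - 1) (0, ω) (𝒜.vec bT bΩ b) := by
  simp only [opE_Ω_vec, opD_vec]
  rw [Derivation.leibniz, totalDer_dp, map_add, smul_eq_mul, smul_eq_mul, mul_smul_comm, map_zsmul,
    show -1 - (n - 1) = -1 - n + 1 by ring, show -1 - n + 1 = -n by ring, mul_comm b]

theorem opD_comm_iff {y : T × Ω} {v : 𝒜.Fock bT bΩ} :
    𝒜.Commute bT bΩ 𝒜.oneTruncated.modeD (𝒜.oneTruncated.modeE n y) v ↔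
      𝒜.opD bT bΩ (𝒜.opE bT bΩ n y v) =
      𝒜.opE bT bΩ n y (𝒜.opD bT bΩ v) + -n • 𝒜.opE bT bΩ (n - 1) y v := by
  have key : (𝒜.pbw bT bΩ).act (𝒜.oneTruncated.lie 𝒜.oneTruncated.modeD
      (𝒜.oneTruncated.modeE n y)) v = -n • 𝒜.opE bT bΩ (n - 1) y v := by
    rw [𝒜.oneTruncated.lie_D_E, map_zsmul]; rfl
  constructor
  · intro h
    have := h.eq
    rwa [key] at this
  · intro h
    refine Commute.of_eq ?_
    rw [key]
    exact h

theorem commute_D_basis (q : ℤ) (i : I) (b : MvPolynomial (Λ × ℕ) A) :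
    𝒜.Commute bT bΩ 𝒜.oneTruncated.modeD (𝒜.oneTruncated.modeE q (bT i, 0))
      (𝒜.vec bT bΩ b) := by
  rcases lt_or_ge q 0 with h | h
  · have := 𝒜.commute_creation bT bΩ 𝒜.oneTruncated.modeD ⟨i, (-1 - q).toNat⟩ b
    rwa [creation, show -1 - ((-1 - q).toNat : ℤ) = q by omega] at this
  · rw [opD_comm_iff, opD_vec, 𝒜.opE_nonneg_vec bT bΩ h, 𝒜.opE_nonneg_vec bT bΩ h, opD_vec,
      𝒜.totalDer_tder bΩ h, map_sub, map_zsmul, neg_smul, sub_eq_add_neg]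
    rcases h.lt_or_eq with h | rfl
    · rw [𝒜.opE_nonneg_vec bT bΩ (by omega)]
    · simp

theorem commute_D_A_act (p : ℤ) (a : A) (x : 𝒜.oneTruncated.Modes)
    (b : MvPolynomial (Λ × ℕ) A) :
    𝒜.Commute bT bΩ 𝒜.oneTruncated.modeD (𝒜.oneTruncated.modeA p a)
      ((𝒜.pbw bT bΩ).act x (𝒜.vec bT bΩ b)) := by
  refine 𝒜.act_vec_induction bT bΩ
    (P := fun v => 𝒜.Commute bT bΩ 𝒜.oneTruncated.modeD (𝒜.oneTruncated.modeA p a) v)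
    (fun v w => 𝒜.commute_add_vec bT bΩ) (𝒜.commute_D_A bT bΩ p a) (fun i b => ?_) x b
  refine 𝒜.commute_vec₁ bT bΩ i (𝒜.commute_D_A bT bΩ p a b) ?_ ?_ ?_ ?_
  · rw [creation, 𝒜.oneTruncated.lie_A_E, ← map_neg]
    exact 𝒜.commute_D_A bT bΩ _ _ _
  · rw [creation, 𝒜.oneTruncated.lie_D_E]
    exact 𝒜.commute_zsmul_right bT bΩ _ (𝒜.commute_A_E_vec bT bΩ _ _ _ _ _)
  · have := 𝒜.commute_creation bT bΩ 𝒜.oneTruncated.modeD i (𝒜.dp bΩ (-1 - p) (C a) * b)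
    rwa [← opA_vec] at this
  · have := 𝒜.commute_creation bT bΩ (𝒜.oneTruncated.modeA p a) i (𝒜.totalDer bΩ b)
    rwa [← opD_vec] at this

end VertexAlgebroid

/-- The derivative of a normally ordered product. -/
theorem NormalProduct.derivative {k V : Type*} [CommRing k] [AddCommGroup V] [Module k V]
    {α φ : ℤ → V →ₗ[k] V} {n : ℤ} {v s s' : V} (D : V →ₗ[k] V)
    (hα : ∃ K : ℕ, ∀ p ≥ (K : ℤ), α p v = 0) (hφ : ∃ K : ℕ, ∀ p ≥ (K : ℤ), φ p v = 0)
    (h₁ : ∀ p q, D (α p (φ q v)) = α p (D (φ q v)) + -p • α (p - 1) (φ q v))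
    (h₂ : ∀ p q, D (φ q (α p v)) = φ q (D (α p v)) + -q • φ (q - 1) (α p v))
    (h₃ : ∀ q, D (φ q v) = φ q (D v) + -q • φ (q - 1) v)
    (h₄ : ∀ p, D (α p v) = α p (D v) + -p • α (p - 1) v)
    (hs : NormalProduct α φ n v s) (hs' : NormalProduct α φ (n - 1) v s') :
    NormalProduct α φ n (D v) (D s + n • s') := by
  obtain ⟨K, hK⟩ := hα
  obtain ⟨L, hL⟩ := hφ
  have hz := EvSum.telescope (K := K + L + n.natAbs + 1) (z := fun j : ℕ =>
      (j : ℤ) • α (-1 - j) (φ (n - 1 + j) v) + (j : ℤ) • φ (n - 1 - j) (α (j - 1) v)) fun j hj => by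
    rw [hK _ (by omega), hL _ (by omega)]; simp
  have e0 : ((0 : ℕ) : ℤ) • α (-1 - (0 : ℕ)) (φ (n - 1 + (0 : ℕ)) v) +
      ((0 : ℕ) : ℤ) • φ (n - 1 - (0 : ℕ)) (α ((0 : ℕ) - 1) v) = 0 := by simp
  rw [e0] at hz
  refine (((EvSum.map D hs).add (EvSum.zsmul n hs')).add hz).conv (fun j => ?_) (add_zero _)
  rw [map_add, h₁, h₂, h₃, h₄]
  have e1 : n + j - 1 = n - 1 + j := by ring
  have e2 : n - 1 - j - 1 = n - 1 - 1 - j := by ring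
  have e3 : (-1 : ℤ) - j - 1 = -1 - (j + 1) := by ring
  have e4 : n - 1 + (j + 1) = n + (j : ℤ) := by ring
  have e5 : n - 1 - ((j : ℤ) + 1) = n - 1 - 1 - j := by ring
  have e6 : (j : ℤ) + 1 - 1 = j := by ring
  simp only [map_add, map_zsmul, Nat.cast_add, Nat.cast_one, e1, e2, e3, e4, e5, e6]
  module

namespace VertexAlgebroid

open MvPolynomial

variable {k A T Ω : Type*} [CommRing k] [Algebra ℚ k] [Invertible (2 : k)]
    [CommRing A] [Algebra k A]
    [LieRing T] [LieAlgebra k T] [Module A T] [LieRingModule T A] [LieRinehartRing A T]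
    [LieRinehartAlgebra k A T]
    [AddCommGroup Ω] [Module k Ω] [Module A Ω] [IsScalarTower k A Ω]
    [LieRingModule T Ω] [LieModule k T Ω]
    (𝒜 : VertexAlgebroid k A T Ω) {I Λ : Type*} (bT : Module.Basis I A T)
    (bΩ : Module.Basis Λ A Ω) {m n p q : ℤ}

theorem commute_D_A_iff {a : A} {v : 𝒜.Fock bT bΩ} :
    𝒜.Commute bT bΩ 𝒜.oneTruncated.modeD (𝒜.oneTruncated.modeA n a) v ↔
      𝒜.opD bT bΩ (𝒜.opA bT bΩ n a v) =
      𝒜.opA bT bΩ n a (𝒜.opD bT bΩ v) + -n • 𝒜.opA bT bΩ (n - 1) a v := by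
  have key : (𝒜.pbw bT bΩ).act (𝒜.oneTruncated.lie 𝒜.oneTruncated.modeD
      (𝒜.oneTruncated.modeA n a)) v = -n • 𝒜.opA bT bΩ (n - 1) a v := by
    rw [𝒜.oneTruncated.lie_D_A, map_zsmul]; rfl
  constructor
  · intro h
    have := h.eq
    rwa [key] at this
  · intro h
    refine Commute.of_eq ?_
    rw [key]
    exact h

theorem commute_D_E (n : ℤ) (y : T × Ω) (b : MvPolynomial (Λ × ℕ) A) :
    𝒜.Commute bT bΩ 𝒜.oneTruncated.modeD (𝒜.oneTruncated.modeE n y) (𝒜.vec bT bΩ b) := by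
  induction y using 𝒜.generator_induction bT with
  | add x y hx hy => rw [map_add]; exact 𝒜.commute_add_right bT bΩ hx hy
  | hΩ ω => exact (𝒜.opD_comm_iff bT bΩ).2 (𝒜.opD_comm_Ω bT bΩ n ω b)
  | hT g i =>
    have key := NormalProduct.derivative (𝒜.opD bT bΩ) (𝒜.opA_vec_eventually_zero bT bΩ g b)
      (𝒜.opE_vec_eventually_zero bT bΩ (bT i, 0) b)
      (fun p q => (𝒜.commute_D_A_iff bT bΩ).1
        (𝒜.commute_D_A_act bT bΩ p g (𝒜.oneTruncated.modeE q (bT i, 0)) b))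
      (fun p q => by
        rw [opA_vec, (𝒜.opD_comm_iff bT bΩ).1 (𝒜.commute_D_basis bT bΩ q i _)])
      (fun q => (𝒜.opD_comm_iff bT bΩ).1 (𝒜.commute_D_basis bT bΩ q i b))
      (fun p => (𝒜.commute_D_A_iff bT bΩ).1 (𝒜.commute_D_A bT bΩ p g b))
      (𝒜.normalProduct_A_E bT bΩ n g (bT i, 0) b)
      (𝒜.normalProduct_A_E bT bΩ (n - 1) g (bT i, 0) b)
    have h2 := 𝒜.normalProduct_act bT bΩ n g (bT i, 0) 𝒜.oneTruncated.modeD b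
    rw [opD_comm_iff, neg_smul, ← sub_eq_add_neg]
    exact eq_sub_of_add_eq (key.unique h2)

/-- The modes satisfy the commutation relations on the Fock module. -/
theorem commute_modes (x y : 𝒜.oneTruncated.Modes) (v : 𝒜.Fock bT bΩ) :
    𝒜.Commute bT bΩ x y v := by
  refine (𝒜.pbw bT bΩ).defect_eq_zero (fun x y b => ?_) x y v
  change 𝒜.Commute bT bΩ x y (𝒜.vec bT bΩ b)
  induction y using 𝒜.oneTruncated.modes_induction with
  | add y y' h h' => exact 𝒜.commute_add_right bT bΩ h h'
  | smul c y h => exact 𝒜.commute_smul_right bT bΩ c h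
  | hA n a =>
    induction x using 𝒜.oneTruncated.modes_induction with
    | add y y' h h' => exact 𝒜.commute_add_left bT bΩ h h'
    | smul c y h => exact 𝒜.commute_smul_left bT bΩ c h
    | hA m c => exact 𝒜.commute_A_A_vec bT bΩ _ _ _ _ _
    | hE m z => exact Commute.symm_E (𝒜.commute_A_E_vec bT bΩ _ _ _ _ _)
    | hD => exact 𝒜.commute_D_A bT bΩ _ _ _
  | hE n y =>
    induction x using 𝒜.oneTruncated.modes_induction with
    | add y y' h h' => exact 𝒜.commute_add_left bT bΩ h h'
    | smul c y h => exact 𝒜.commute_smul_left bT bΩ c h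
    | hA m c => exact 𝒜.commute_A_E_vec bT bΩ _ _ _ _ _
    | hE m z => exact 𝒜.commute_E_E_vec bT bΩ _ _ _ _ _
    | hD => exact 𝒜.commute_D_E bT bΩ _ _ _
  | hD =>
    induction x using 𝒜.oneTruncated.modes_induction with
    | add y y' h h' => exact 𝒜.commute_add_left bT bΩ h h'
    | smul c y h => exact 𝒜.commute_smul_left bT bΩ c h
    | hA m c => exact Commute.symm 𝒜 bT bΩ (𝒜.commute_D_A bT bΩ _ _ _) (by simp)
    | hE m z => exact Commute.symm_E (𝒜.commute_D_E bT bΩ _ _ _)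
    | hD => refine Commute.of_eq ?_; simp

theorem opA_opA (m n : ℤ) (a c : A) (v : 𝒜.Fock bT bΩ) :
    𝒜.opA bT bΩ m a (𝒜.opA bT bΩ n c v) = 𝒜.opA bT bΩ n c (𝒜.opA bT bΩ m a v) :=
  commute_A_A_iff.1 (𝒜.commute_modes bT bΩ _ _ v)

theorem opE_opA (m n : ℤ) (x : T × Ω) (a : A) (v : 𝒜.Fock bT bΩ) :
    𝒜.opE bT bΩ m x (𝒜.opA bT bΩ n a v) = 𝒜.opA bT bΩ n a (𝒜.opE bT bΩ m x v) +
        𝒜.opA bT bΩ (m + n) (𝒜.act x a) v :=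
  commute_E_A_iff.1 (𝒜.commute_modes bT bΩ _ _ v)

theorem opE_opE (m n : ℤ) (x y : T × Ω) (v : 𝒜.Fock bT bΩ) :
    𝒜.opE bT bΩ m x (𝒜.opE bT bΩ n y v) = 𝒜.opE bT bΩ n y (𝒜.opE bT bΩ m x v) +
        (𝒜.opE bT bΩ (m + n) (𝒜.oneTruncated.br x y) v +
          m • 𝒜.opA bT bΩ (m + n - 1) (𝒜.oneTruncated.form x y) v) :=
  commute_E_E_iff.1 (𝒜.commute_modes bT bΩ _ _ v)

theorem opD_opA (n : ℤ) (a : A) (v : 𝒜.Fock bT bΩ) : 𝒜.opD bT bΩ (𝒜.opA bT bΩ n a v) =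
      𝒜.opA bT bΩ n a (𝒜.opD bT bΩ v) + -n • 𝒜.opA bT bΩ (n - 1) a v :=
  (𝒜.commute_D_A_iff bT bΩ).1 (𝒜.commute_modes bT bΩ _ _ v)

theorem opD_opE (n : ℤ) (y : T × Ω) (v : 𝒜.Fock bT bΩ) : 𝒜.opD bT bΩ (𝒜.opE bT bΩ n y v) =
      𝒜.opE bT bΩ n y (𝒜.opD bT bΩ v) + -n • 𝒜.opE bT bΩ (n - 1) y v :=
  (𝒜.opD_comm_iff bT bΩ).1 (𝒜.commute_modes bT bΩ _ _ v)

end VertexAlgebroid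

/-! ### Binomial sums along antidiagonals -/

section BinSum

variable {M M' : Type*} [AddCommGroup M] [AddCommGroup M']

theorem EvSum.finsum_eq {f : ℕ → M} {s : M} (h : EvSum f s) : ∑ᶠ j, f j = s := by
  obtain ⟨K, hK⟩ := h.eventually_zero
  rw [finsum_eq_sum_of_support_subset (s := Finset.range K)]
  · exact (EvSum.of_eventually_zero hK).unique h
  · intro j hj
    by_contra hj'
    exact hj (hK j (by simpa using hj'))

/-- The double sequence vanishes far out on each antidiagonal. -/
def DiagFinite (u : ℤ → ℤ → M) : Prop := ∀ p q, ∃ K : ℕ, ∀ j : ℕ, K ≤ j → u (p - j) (q + j) = 0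

/-- The sum `∑ εʲ (n choose j) u(p - j, q + j)`. -/
noncomputable def binSum (ε n : ℤ) (u : ℤ → ℤ → M) (p q : ℤ) : M :=
  ∑ᶠ j : ℕ, (ε ^ j * Ring.choose n j) • u (p - j) (q + j)

variable {ε n : ℤ} {u w : ℤ → ℤ → M}

theorem binSum_spec (hu : DiagFinite u) (ε n p q : ℤ) :
    EvSum (fun j : ℕ => (ε ^ j * Ring.choose n j) • u (p - j) (q + j)) (binSum ε n u p q) := by
  obtain ⟨K, hK⟩ := hu p q
  have h := EvSum.of_eventually_zero (K := K)
    (f := fun j : ℕ => (ε ^ j * Ring.choose n j) • u (p - j) (q + j))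
    fun j hj => by rw [hK j hj, smul_zero]
  rw [binSum, h.finsum_eq]
  exact h

theorem binSum_eq (hu : DiagFinite u) {p q : ℤ} {s : M}
    (h : EvSum (fun j : ℕ => (ε ^ j * Ring.choose n j) • u (p - j) (q + j)) s) :
    binSum ε n u p q = s := (binSum_spec hu ε n p q).unique h

theorem binSum_add (hu : DiagFinite u) (hw : DiagFinite w) (p q : ℤ) :
    binSum ε n (fun p q => u p q + w p q) p q = binSum ε n u p q + binSum ε n w p q :=
  (((binSum_spec hu ε n p q).add (binSum_spec hw ε n p q)).congr fun _ =>
    (smul_add _ _ _).symm).finsum_eq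

theorem binSum_map (hu : DiagFinite u) (φ : M →+ M') (p q : ℤ) :
    binSum ε n (fun p q => φ (u p q)) p q = φ (binSum ε n u p q) :=
  (((binSum_spec hu ε n p q).map φ).congr fun j => by rw [map_zsmul]).finsum_eq

theorem binSum_zero (u : ℤ → ℤ → M) (ε p q : ℤ) : binSum ε 0 u p q = u p q := by
  have h := EvSum.single_zero (f := fun j : ℕ => (ε ^ j * Ring.choose (0 : ℤ) j) •
    u (p - j) (q + j)) fun j => by rw [Ring.choose_zero_succ, mul_zero, zero_smul]
  rw [binSum, h.finsum_eq]
  simp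

theorem binSum_succ (hu : DiagFinite u) (ε n p q : ℤ) :
    binSum ε (n + 1) u (p + 1) q = binSum ε n u (p + 1) q + ε • binSum ε n u p (q + 1) := by
  refine binSum_eq hu ?_
  have h1 := binSum_spec hu ε n (p + 1) q
  have h2 := EvSum.of_succ (f := fun j : ℕ => (ε ^ j * (Ring.choose (n + 1) j - Ring.choose n j)) •
      u (p + 1 - j) (q + j)) (((binSum_spec hu ε n p (q + 1)).zsmul ε).congr fun j => by
    rw [Ring.choose_succ_succ, add_sub_cancel_right, smul_smul,
      show q + 1 + j = q + (j + 1 : ℕ) by push_cast; ring,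
      show p + 1 - (j + 1 : ℕ) = p - j by push_cast; ring, pow_succ]
    congr 1; ring)
  refine (h1.add h2).conv (fun j => ?_) ?_
  · rw [← add_smul]; congr 1; ring
  · simp

theorem choose_succ_mul (n : ℤ) (j : ℕ) :
    ((j : ℤ) + 1) * Ring.choose n (j + 1) = (n - j) * Ring.choose n j := by
  have h := Ring.choose_smul_choose n (Nat.le_succ j)
  rw [Nat.succ_eq_add_one, Nat.choose_succ_self_right, Nat.add_sub_cancel_left,
    Ring.choose_one_right, nsmul_eq_mul] at h
  push_cast at h
  rw [h]; ring

/-- The derivative of a binomial sum. -/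
theorem binSum_derivative (hu : DiagFinite u) {u' : ℤ → ℤ → M} (hu' : DiagFinite u')
    (D : M →+ M) (h : ∀ p q, D (u p q) = u' p q - p • u (p - 1) q - q • u p (q - 1))
    (n p q : ℤ) : D (binSum (-1) n u p q) = binSum (-1) n u' p q -
      ((p - n) • binSum (-1) n u (p - 1) q + q • binSum (-1) n u p (q - 1)) := by
  rw [← binSum_map hu]
  obtain ⟨K, hK⟩ := hu p (q - 1)
  have hz := EvSum.telescope (K := K) (z := fun j : ℕ =>
    ((-1) ^ j * (j * Ring.choose n j)) • u (p - j) (q - 1 + j)) fun j hj => by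
      rw [hK j hj, smul_zero]
  have e0 : ((-1 : ℤ) ^ 0 * ((0 : ℕ) * Ring.choose n 0)) • u (p - (0 : ℕ)) (q - 1 + (0 : ℕ)) = 0 := by
    simp
  rw [e0] at hz
  have h1 := ((binSum_spec hu (-1) n (p - 1) q).zsmul (p - n)).add
    ((binSum_spec hu (-1) n p (q - 1)).zsmul q)
  refine (((binSum_spec hu' (-1) n p q).sub (h1.add hz)).conv (fun j => ?_)
    (by rw [add_zero])).finsum_eq
  beta_reduce
  rw [h, Nat.cast_succ, choose_succ_mul, show p - (j + 1 : ℤ) = p - j - 1 by ring,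
    show q - 1 + ((j : ℤ) + 1) = q + j by ring, show p - 1 - j = p - j - 1 by ring,
    show q - 1 + (j : ℤ) = q + j - 1 by ring, pow_succ]
  module

end BinSum

/-! ### Differences of double sequences -/

section Difference

variable {M M' : Type*} [AddCommGroup M] [AddCommGroup M']

/-- The operator `f(p, q) ↦ f(p + 1, q) - f(p, q + 1)` on double sequences, i.e. multiplication by
`z - w` on generating functions. -/
def diff (M : Type*) [AddCommGroup M] : Module.End ℤ (ℤ → ℤ → M) where
  toFun f p q := f (p + 1) q - f p (q + 1)
  map_add' f g := by ext; simp only [Pi.add_apply]; abel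
  map_smul' c f := by ext; simp [smul_sub]

theorem diff_apply (f : ℤ → ℤ → M) (p q : ℤ) : diff M f p q = f (p + 1) q - f p (q + 1) := rfl

theorem diff_pow_map (N : ℕ) (f : ℤ → ℤ → M) (φ : M →+ M') :
    (diff M' ^ N) (fun p q => φ (f p q)) = fun p q => φ ((diff M ^ N) f p q) := by
  induction N with
  | zero => rfl
  | succ N ih =>
    rw [pow_succ', Module.End.mul_apply, ih, pow_succ', Module.End.mul_apply]
    ext p q
    rw [diff_apply, diff_apply, map_sub]

theorem diff_pow_swap (N : ℕ) (f : ℤ → ℤ → M) :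
    (diff M ^ N) (fun p q => f q p) = fun p q => (-1 : ℤ) ^ N • (diff M ^ N) f q p := by
  induction N with
  | zero => simp
  | succ N ih =>
    rw [pow_succ', Module.End.mul_apply, ih, pow_succ', Module.End.mul_apply]
    ext p q
    rw [diff_apply, diff_apply]
    module

theorem diff_pow_zero_of_le {N K : ℕ} (h : N ≤ K) {f : ℤ → ℤ → M} (hf : (diff M ^ N) f = 0) :
    (diff M ^ K) f = 0 := by
  obtain ⟨L, rfl⟩ := Nat.exists_eq_add_of_le' h
  rw [pow_add, Module.End.mul_apply, hf, map_zero]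

theorem eq_zero_of_diff_pow {N : ℕ} {f : ℤ → ℤ → M} (hf : (diff M ^ N) f = 0) {K : ℤ}
    (hK : ∀ p q, K ≤ q → f p q = 0) : f = 0 := by
  induction N generalizing f with
  | zero => exact hf
  | succ N ih =>
    rw [pow_succ, Module.End.mul_apply] at hf
    have h := ih hf fun p q hq => by
      rw [diff_apply, hK _ _ hq, hK _ _ (by omega), sub_zero]
    have h1 : ∀ (s : ℕ) p q, f p q = f (p - s) (q + s) := by
      intro s
      induction s with
      | zero => simp
      | succ s ihs =>
        intro p q
        rw [ihs]
        have h2 := congrFun (congrFun h (p - s - 1)) (q + s)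
        rw [diff_apply, sub_add_cancel] at h2
        rw [sub_eq_zero.1 h2]
        push_cast
        congr 1 <;> ring_nf
    ext p q
    rw [h1 (K - q).toNat p q]
    exact hK _ _ (by omega)

end Difference

/-! ### Fields -/

section Fields

variable {k V : Type*} [CommRing k] [AddCommGroup V] [Module k V]

/-- Sequences of endomorphisms `αₙ` such that `αₙ v = 0` for large `n`. -/
def Fld (k V : Type*) [CommRing k] [AddCommGroup V] [Module k V] :
    Submodule k (ℤ → V →ₗ[k] V) where
  carrier := {α | ∀ v, ∃ K : ℤ, ∀ n ≥ K, α n v = 0}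
  add_mem' {α β} hα hβ v := by
    obtain ⟨K, hK⟩ := hα v
    obtain ⟨L, hL⟩ := hβ v
    refine ⟨max K L, fun n hn => ?_⟩
    rw [Pi.add_apply, LinearMap.add_apply, hK n (le_of_max_le_left hn),
      hL n (le_of_max_le_right hn), add_zero]
  zero_mem' v := ⟨0, fun n _ => rfl⟩
  smul_mem' c α hα v := by
    obtain ⟨K, hK⟩ := hα v
    exact ⟨K, fun n hn => by rw [Pi.smul_apply, LinearMap.smul_apply, hK n hn, smul_zero]⟩

namespace Fld

/-- The modes of a field. -/
def mode (n : ℤ) : Fld k V →ₗ[k] V →ₗ[k] V := LinearMap.proj n ∘ₗ (Fld k V).subtype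

theorem trunc (α : Fld k V) (v : V) : ∃ K : ℤ, ∀ n ≥ K, mode n α v = 0 := α.2 v

@[ext] theorem ext {α β : Fld k V} (h : ∀ n v, mode n α v = mode n β v) : α = β :=
  Subtype.ext (funext fun n => LinearMap.ext fun v => h n v)

/-- The products `αₚ β_q v`. -/
def comp (α β : Fld k V) (v : V) (p q : ℤ) : V := mode p α (mode q β v)

theorem comp_finite (α β : Fld k V) (v : V) : DiagFinite (comp α β v) := by
  obtain ⟨K, hK⟩ := trunc β v
  intro p q
  exact ⟨(K - q).toNat, fun j hj => by rw [comp, hK _ (by omega), map_zero]⟩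

/-- The right hand side of the Borcherds identity. -/
noncomputable def bor (α β : Fld k V) (m n l : ℤ) (v : V) : V :=
  binSum (-1) n (comp α β v) (m + n) l - (n.negOnePow : ℤ) • binSum (-1) n (comp β α v) (n + l) m

variable (α β : Fld k V)

theorem bor_zero (m l : ℤ) (v : V) :
    bor α β m 0 l v = mode m α (mode l β v) - mode l β (mode m α v) := by
  simp [bor, binSum_zero, comp]

theorem bor_succ (m n l : ℤ) (v : V) :
    bor α β m (n + 1) l v = bor α β (m + 1) n l v - bor α β m n (l + 1) v := by
  have h1 := binSum_succ (comp_finite α β v) (-1) n (m + n) l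
  have h2 := binSum_succ (comp_finite β α v) (-1) n (n + l) m
  simp only [bor, Int.negOnePow_succ, Units.val_neg]
  rw [← add_assoc m n 1, h1, show n + 1 + l = n + l + 1 by ring, h2,
    show m + 1 + n = m + n + 1 by ring, ← add_assoc n l 1]
  module

theorem bor_spec (m n l : ℤ) (v : V) :
    EvSum (fun j : ℕ => ((-1) ^ j * Ring.choose n j) • (comp α β v (m + n - j) (l + j) -
      (n.negOnePow : ℤ) • comp β α v (n + l - j) (m + j))) (bor α β m n l v) :=
  ((binSum_spec (comp_finite α β v) (-1) n (m + n) l).sub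
    ((binSum_spec (comp_finite β α v) (-1) n (n + l) m).zsmul n.negOnePow)).congr fun j => by
      module

variable {α β}

theorem bor_map {α' β' : Fld k V} {v v' : V} (φ : V →+ V)
    (h : ∀ p q, φ (comp α β v p q) = comp α' β' v' p q)
    (h' : ∀ p q, φ (comp β α v p q) = comp β' α' v' p q) (m n l : ℤ) :
    φ (bor α β m n l v) = bor α' β' m n l v' := by
  rw [bor, map_sub, map_zsmul, ← binSum_map (comp_finite _ _ _),
    ← binSum_map (comp_finite _ _ _)]
  simp only [h, h']
  rfl

theorem bor_add {α₁ α₂ β₁ β₂ α₃ β₃ : Fld k V} {v₁ v₂ v₃ : V}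
    (h : ∀ p q, comp α₃ β₃ v₃ p q = comp α₁ β₁ v₁ p q + comp α₂ β₂ v₂ p q)
    (h' : ∀ p q, comp β₃ α₃ v₃ p q = comp β₁ α₁ v₁ p q + comp β₂ α₂ v₂ p q) (m n l : ℤ) :
    bor α₃ β₃ m n l v₃ = bor α₁ β₁ m n l v₁ + bor α₂ β₂ m n l v₂ := by
  rw [bor, show comp α₃ β₃ v₃ = fun p q => _ from funext fun p => funext fun q => h p q,
    show comp β₃ α₃ v₃ = fun p q => _ from funext fun p => funext fun q => h' p q,
    binSum_add (comp_finite _ _ _) (comp_finite _ _ _),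
    binSum_add (comp_finite _ _ _) (comp_finite _ _ _), bor, bor]
  module

/-- The `n`-th product of fields. -/
noncomputable def prodFun (n : ℤ) (α β : Fld k V) : Fld k V :=
  ⟨fun l =>
    { toFun := fun v => bor α β 0 n l v
      map_add' := fun v w => bor_add (fun p q => by simp [comp]) (fun p q => by simp [comp]) 0 n l
      map_smul' := fun c v => (bor_map (c • LinearMap.id : V →ₗ[k] V).toAddMonoidHom
        (fun p q => by simp [comp]) (fun p q => by simp [comp]) 0 n l).symm }, by
    intro v
    obtain ⟨K, hK⟩ := trunc β v
    obtain ⟨L, hL⟩ := trunc α v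
    have : ∃ P : ℤ, ∀ j : ℕ, (j : ℤ) < L → ∀ q ≥ P, mode q β (mode j α v) = 0 := by
      choose f hf using fun j : ℕ => trunc β (mode j α v)
      obtain ⟨P, hP⟩ := ((Finset.range L.toNat).image f).bddAbove
      exact ⟨P, fun j hj q hq => hf j q (le_trans (hP (by
        simp only [Finset.coe_image, Finset.coe_range]
        exact ⟨j, by simp only [Set.mem_Iio]; omega, rfl⟩)) hq)⟩
    obtain ⟨P, hP⟩ := this
    refine ⟨max K (P + L - n), fun l hl => ?_⟩
    refine (bor_spec α β 0 n l v).unique (EvSum.zero.congr fun j => ?_)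
    have h1 : comp α β v (0 + n - j) (l + j) = 0 := by
      rw [comp, hK _ (by omega), map_zero]
    have h2 : comp β α v (n + l - j) (0 + j) = 0 := by
      rw [comp, zero_add]
      rcases lt_or_ge (j : ℤ) L with h | h
      · exact hP j h _ (by omega)
      · rw [hL _ h, map_zero]
    rw [h1, h2, smul_zero, sub_zero, smul_zero]⟩

theorem mode_prodFun (n l : ℤ) (α β : Fld k V) (v : V) :
    mode l (prodFun n α β) v = bor α β 0 n l v := rfl

/-- The `n`-th product of fields as a bilinear map. -/
noncomputable def prod (n : ℤ) : Fld k V →ₗ[k] Fld k V →ₗ[k] Fld k V :=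
  LinearMap.mk₂ k (prodFun n)
    (fun α α' β => Fld.ext fun l v =>
      bor_add (fun p q => by simp [comp]) (fun p q => by simp [comp]) 0 n l)
    (fun c α β => Fld.ext fun l v => by
      rw [map_smul, LinearMap.smul_apply, mode_prodFun, mode_prodFun]
      exact (bor_map (α := α) (β := β) (v := v)
        (α' := c • α) (β' := β) (v' := v) (c • LinearMap.id : V →ₗ[k] V).toAddMonoidHom
        (fun p q => by simp [comp]) (fun p q => by simp [comp]) 0 n l).symm)
    (fun α β β' => Fld.ext fun l v =>
      bor_add (fun p q => by simp [comp]) (fun p q => by simp [comp]) 0 n l)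
    (fun c α β => Fld.ext fun l v => by
      rw [map_smul, LinearMap.smul_apply, mode_prodFun, mode_prodFun]
      exact (bor_map (α := α) (β := β) (v := v)
        (α' := α) (β' := c • β) (v' := v) (c • LinearMap.id : V →ₗ[k] V).toAddMonoidHom
        (fun p q => by simp [comp]) (fun p q => by simp [comp]) 0 n l).symm)

theorem mode_prod (n l : ℤ) (α β : Fld k V) (v : V) :
    mode l (prod n α β) v = bor α β 0 n l v := rfl

/-! ### Locality -/

/-- Locality of order `N`. -/
def Local (N : ℕ) (α β : Fld k V) : Prop :=
  ∀ v, (diff V ^ N) (fun p q => comp α β v p q - comp β α v q p) = 0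

theorem bor_natCast (n : ℕ) (m l : ℤ) (v : V) :
    bor α β m n l v = (diff V ^ n) (fun p q => comp α β v p q - comp β α v q p) m l := by
  induction n generalizing m l with
  | zero => exact bor_zero α β m l v
  | succ n ih =>
    rw [pow_succ', Module.End.mul_apply, diff_apply, ← ih, ← ih, ← bor_succ]
    rfl

theorem local_iff {N : ℕ} : Local N α β ↔ ∀ m l v, bor α β m N l v = 0 := by
  constructor
  · intro h m l v
    rw [bor_natCast, h v]; rfl
  · intro h v
    ext m l
    rw [← bor_natCast, h]; rfl

theorem Local.mono {N K : ℕ} (h : Local N α β) (hK : N ≤ K) : Local K α β :=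
  fun v => diff_pow_zero_of_le hK (h v)

theorem Local.symm {N : ℕ} (h : Local N α β) : Local N β α := by
  intro v
  have h1 := diff_pow_swap N (fun p q => comp α β v p q - comp β α v q p)
  rw [h v] at h1
  have h2 : (fun p q => comp β α v p q - comp α β v q p) =
      -(fun p q => comp α β v q p - comp β α v p q) := by ext p q; simp
  rw [h2, map_neg, h1]
  ext; simp

theorem Local.bor_eq_zero {N : ℕ} (h : Local N α β) {n : ℤ} (hn : N ≤ n) (m l : ℤ) (v : V) :
    bor α β m n l v = 0 := by
  obtain ⟨n, rfl⟩ := Int.eq_ofNat_of_zero_le (by omega : 0 ≤ n)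
  exact local_iff.1 (h.mono (by omega)) m l v

theorem Local.prod_eq_zero {N : ℕ} (h : Local N α β) {n : ℤ} (hn : N ≤ n) : prod n α β = 0 :=
  Fld.ext fun l v => h.bor_eq_zero hn 0 l v

theorem local_add {N : ℕ} {α' : Fld k V} (h : Local N α β) (h' : Local N α' β) :
    Local N (α + α') β := by
  intro v
  have e : (fun p q => comp (α + α') β v p q - comp β (α + α') v q p) =
    (fun p q => comp α β v p q - comp β α v q p) +
      fun p q => comp α' β v p q - comp β α' v q p := by
    ext p q; simp [comp]; abel
  rw [e, map_add, h v, h' v, add_zero]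

theorem local_smul {N : ℕ} (c : k) (h : Local N α β) : Local N (c • α) β := by
  intro v
  have e : (fun p q => comp (c • α) β v p q - comp β (c • α) v q p) =
    fun p q => (c • LinearMap.id : V →ₗ[k] V).toAddMonoidHom
      (comp α β v p q - comp β α v q p) := by
    ext p q; simp [comp, smul_sub]
  rw [e, diff_pow_map, h v]
  ext; simp

/-- The Borcherds identity for local fields. -/
theorem Local.borcherds {N : ℕ} (h : Local N α β) (m n l : ℤ) (v : V) :
    binSum 1 m (fun p q => mode p (prod q α β) v) (m + l) n = bor α β m n l v := by
  have hf : DiagFinite fun p q => mode p (prod q α β) v := fun p q =>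
    ⟨(N - q).toNat, fun j hj => by beta_reduce; rw [h.prod_eq_zero (by omega), map_zero, LinearMap.zero_apply]⟩
  have hL := fun m n l => binSum_succ hf 1 m (m + l) n
  induction m using Int.induction_on generalizing n l with
  | zero => rw [binSum_zero, zero_add]; rfl
  | succ m ih =>
    have h1 := hL m n l
    rw [show (m : ℤ) + 1 + l = m + l + 1 by ring, h1, one_smul, ih (n + 1) l, bor_succ,
      show (m : ℤ) + l + 1 = m + (l + 1) by ring, ih n (l + 1)]
    abel
  | pred m ih =>
    set g : ℤ → ℤ → V := fun n l => binSum 1 (-m - 1) (fun p q => mode p (prod q α β) v)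
      (-m - 1 + l) n - bor α β (-m - 1) n l v with hg
    have hstep : ∀ n l, g n (l + 1) = -g (n + 1) l := by
      intro n l
      have h1 := hL (-m - 1) n l
      have h2 := bor_succ α β (-m - 1) n l v
      rw [sub_add_cancel, show (-m - 1 + l + 1 : ℤ) = -m + l by ring, one_smul, ih n l] at h1
      rw [sub_add_cancel] at h2
      simp only [hg, h2, h1, show (-m - 1 + (l + 1) : ℤ) = -m + l by ring]
      abel
    have hzero : ∀ n l, (N : ℤ) ≤ n → g n l = 0 := by
      intro n l hn
      simp only [hg]
      rw [h.bor_eq_zero hn, sub_zero]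
      refine binSum_eq hf (EvSum.zero.congr fun j => ?_)
      rw [h.prod_eq_zero (by omega), map_zero, LinearMap.zero_apply, smul_zero]
    have hall : ∀ (s : ℕ) n l, (N : ℤ) ≤ n + s → g n l = 0 := by
      intro s
      induction s with
      | zero => intro n l hn; exact hzero n l (by simpa using hn)
      | succ s ihs =>
        intro n l hn
        have := hstep n (l - 1)
        rw [sub_add_cancel] at this
        rw [this, ihs _ _ (by push_cast at hn; omega), neg_zero]
    exact sub_eq_zero.1 (hall (N - n).toNat n l (by omega))

end Fld

/-! ### Products of local fields are local -/

theorem pow_annihilates {G : Type*} [AddCommGroup G] {x y : Module.End ℤ G} (hxy : x * y = y * x)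
    {H : ℤ → G} (hH : ∀ n, H (n + 1) = x (H n) - y (H n)) {N : ℕ} (h₀ : ∀ n : ℤ, N ≤ n → H n = 0)
    (h₁ : ∀ n : ℤ, (x ^ N) ((y ^ N) (H n)) = 0) (s : ℕ) :
    ∀ (n : ℤ) (b c : ℕ), N + s ≤ c → (N - n).toNat + (N - b) ≤ s →
      (x ^ b) ((y ^ c) (H n)) = 0 := by
  have hc : Commute x y := hxy
  induction s with
  | zero =>
    intro n b c _ hs
    rw [h₀ n (by omega), map_zero, map_zero]
  | succ s ih =>
    intro n b c hc' hs
    rcases le_or_gt (N : ℤ) n with hn | hn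
    · rw [h₀ n hn, map_zero, map_zero]
    rcases le_or_gt N b with hb | hb
    · obtain ⟨b, rfl⟩ := Nat.exists_eq_add_of_le' hb
      obtain ⟨c, rfl⟩ := Nat.exists_eq_add_of_le' (show N ≤ c by omega)
      rw [pow_add, pow_add, Module.End.mul_apply, Module.End.mul_apply]
      have := congrArg (fun f : Module.End ℤ G => f ((y ^ N) (H n)))
        (hc.pow_pow N c).eq
      simp only [Module.End.mul_apply] at this
      rw [this, h₁, map_zero, map_zero]
    · obtain ⟨c, rfl⟩ := Nat.exists_eq_add_of_le' (show 1 ≤ c by omega)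
      have h2 : y (H n) = x (H n) - H (n + 1) := by rw [hH]; abel
      have h3 := ih n (b + 1) c (by omega) (by omega)
      have h4 := ih (n + 1) b c (by omega) (by omega)
      have := congrArg (fun f : Module.End ℤ G => f (H n)) (hc.pow_right c).eq
      simp only [Module.End.mul_apply] at this
      rw [pow_succ, Module.End.mul_apply, h2, map_sub, map_sub, h4, sub_zero, ← this]
      rwa [pow_succ, Module.End.mul_apply] at h3

section Triple

variable (V) in
/-- The difference operator in the first and third variables. -/
def diff₁₃ : Module.End ℤ (ℤ → ℤ → ℤ → V) where
  toFun f p q r := f (p + 1) q r - f p q (r + 1)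
  map_add' f g := by ext; simp only [Pi.add_apply]; abel
  map_smul' c f := by ext; simp [smul_sub]

variable (V) in
/-- The difference operator in the second and third variables. -/
def diff₂₃ : Module.End ℤ (ℤ → ℤ → ℤ → V) where
  toFun f p q r := f p (q + 1) r - f p q (r + 1)
  map_add' f g := by ext; simp only [Pi.add_apply]; abel
  map_smul' c f := by ext; simp [smul_sub]

theorem diff₁₃_apply (f : ℤ → ℤ → ℤ → V) (p q r : ℤ) :
    diff₁₃ V f p q r = f (p + 1) q r - f p q (r + 1) := rfl

theorem diff₂₃_apply (f : ℤ → ℤ → ℤ → V) (p q r : ℤ) :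
    diff₂₃ V f p q r = f p (q + 1) r - f p q (r + 1) := rfl

theorem diff₁₃_mul_diff₂₃ : diff₁₃ V * diff₂₃ V = diff₂₃ V * diff₁₃ V := by
  ext f p q r
  simp only [Module.End.mul_apply, diff₁₃_apply, diff₂₃_apply]
  abel

theorem diff₁₃_pow (N : ℕ) (f : ℤ → ℤ → ℤ → V) (p q r : ℤ) :
    (diff₁₃ V ^ N) f p q r = (diff V ^ N) (fun p r => f p q r) p r := by
  induction N generalizing p r with
  | zero => rfl
  | succ N ih =>
    rw [pow_succ', Module.End.mul_apply, diff₁₃_apply, ih, ih, pow_succ', Module.End.mul_apply,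
      diff_apply]

theorem diff₂₃_pow (N : ℕ) (f : ℤ → ℤ → ℤ → V) (p q r : ℤ) :
    (diff₂₃ V ^ N) f p q r = (diff V ^ N) (f p) q r := by
  induction N generalizing q r with
  | zero => rfl
  | succ N ih =>
    rw [pow_succ', Module.End.mul_apply, diff₂₃_apply, ih, ih, pow_succ', Module.End.mul_apply,
      diff_apply]

/-- An endomorphism of triple sequences commutes with translations in the first two variables and
with locally finite sums. -/
structure IsConvolution (x : Module.End ℤ (ℤ → ℤ → ℤ → V)) : Prop where
  translate : ∀ f s t, x (fun p q r => f (p + s) (q + t) r) = fun p q r => x f (p + s) (q + t) r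
  evSum : ∀ (f : ℕ → ℤ → ℤ → ℤ → V) g, (∀ p q r, EvSum (fun j => f j p q r) (g p q r)) →
    ∀ p q r, EvSum (fun j => x (f j) p q r) (x g p q r)

theorem IsConvolution.pow {x : Module.End ℤ (ℤ → ℤ → ℤ → V)} (h : IsConvolution x) (N : ℕ) :
    IsConvolution (x ^ N) := by
  induction N with
  | zero => exact ⟨fun _ _ _ => rfl, fun _ _ h => h⟩
  | succ N ih =>
    constructor
    · intro f s t
      rw [pow_succ', Module.End.mul_apply, ih.translate, h.translate]; rfl
    · intro f g hfg
      rw [pow_succ']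
      exact h.evSum _ _ (ih.evSum f g hfg)

theorem IsConvolution.mul {x y : Module.End ℤ (ℤ → ℤ → ℤ → V)} (hx : IsConvolution x)
    (hy : IsConvolution y) : IsConvolution (x * y) :=
  ⟨fun f s t => by rw [Module.End.mul_apply, hy.translate, hx.translate]; rfl,
    fun f g h => hx.evSum _ _ (hy.evSum f g h)⟩

theorem IsConvolution.eq_zero {x : Module.End ℤ (ℤ → ℤ → ℤ → V)} (hx : IsConvolution x)
    {f g H : ℤ → ℤ → ℤ → V} (hf : x f = 0) (hg : x g = 0) (c : ℕ → ℤ) (d : ℤ) (s t : ℕ → ℤ)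
    (h : ∀ m l r, EvSum (fun j => c j • (f (m + s j) (l + t j) r - d • g (m + t j) (l + s j) r))
      (H m l r)) : x H = 0 := by
  have h2 := hx.evSum (fun j m l r => c j • (f (m + s j) (l + t j) r -
    d • g (m + t j) (l + s j) r)) H h
  ext m l r
  refine (h2 m l r).unique (EvSum.zero.congr fun j => ?_)
  have e : (fun m l r => c j • (f (m + s j) (l + t j) r - d • g (m + t j) (l + s j) r)) =
    c j • ((fun m l r => f (m + s j) (l + t j) r) - d • fun m l r => g (m + t j) (l + s j) r) := rfl
  rw [e, map_zsmul, map_sub, map_zsmul, hx.translate, hx.translate, hf, hg]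
  simp

theorem isConvolution_diff₁₃ : IsConvolution (diff₁₃ V) :=
  ⟨fun f s t => by ext p q r; simp only [diff₁₃_apply, add_right_comm],
    fun _ _ h p q r => (h (p + 1) q r).sub (h p q (r + 1))⟩

theorem isConvolution_diff₂₃ : IsConvolution (diff₂₃ V) :=
  ⟨fun f s t => by ext p q r; simp only [diff₂₃_apply, add_right_comm],
    fun _ _ h p q r => (h p (q + 1) r).sub (h p q (r + 1))⟩

end Triple

namespace Fld

variable {α β χ : Fld k V} {N : ℕ}

theorem diff_triple (hα : Local N α χ) (hβ : Local N β χ) (v : V) :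
    (diff₁₃ V ^ N) ((diff₂₃ V ^ N) fun p q r =>
      mode p α (mode q β (mode r χ v)) - mode r χ (mode p α (mode q β v))) = 0 := by
  have e : (fun p q r => mode p α (mode q β (mode r χ v)) - mode r χ (mode p α (mode q β v))) =
      (fun p q r => (mode p α).toAddMonoidHom (comp β χ v q r - comp χ β v r q)) +
      fun p q r => comp α χ (mode q β v) p r - comp χ α (mode q β v) r p := by
    ext p q r
    simp [comp]
  have h1 : (diff₂₃ V ^ N) (fun p q r => (mode p α).toAddMonoidHom
      (comp β χ v q r - comp χ β v r q)) = 0 := by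
    ext p q r
    rw [diff₂₃_pow, diff_pow_map, hβ v]
    simp
  have h2 : (diff₁₃ V ^ N) (fun p q r => comp α χ (mode q β v) p r - comp χ α (mode q β v) r p)
      = 0 := by
    ext p q r
    rw [diff₁₃_pow, hα]; rfl
  have hc : Commute (diff₁₃ V) (diff₂₃ V) := diff₁₃_mul_diff₂₃
  rw [e, map_add, h1, zero_add, ← Module.End.mul_apply, (hc.pow_pow N N).eq, Module.End.mul_apply,
    h2, map_zero]

theorem diff_triple' (hα : Local N α χ) (hβ : Local N β χ) (v : V) :
    (diff₁₃ V ^ N) ((diff₂₃ V ^ N) fun p q r =>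
      mode q β (mode p α (mode r χ v)) - mode r χ (mode q β (mode p α v))) = 0 := by
  have e : (fun p q r => mode q β (mode p α (mode r χ v)) - mode r χ (mode q β (mode p α v))) =
      (fun p q r => (mode q β).toAddMonoidHom (comp α χ v p r - comp χ α v r p)) +
      fun p q r => comp β χ (mode p α v) q r - comp χ β (mode p α v) r q := by
    ext p q r
    simp [comp]
  have h1 : (diff₁₃ V ^ N) (fun p q r => (mode q β).toAddMonoidHom
      (comp α χ v p r - comp χ α v r p)) = 0 := by
    ext p q r
    rw [diff₁₃_pow, diff_pow_map, hα v]
    simp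
  have h2 : (diff₂₃ V ^ N) (fun p q r => comp β χ (mode p α v) q r - comp χ β (mode p α v) r q)
      = 0 := by
    ext p q r
    rw [diff₂₃_pow, hβ]; rfl
  have hc : Commute (diff₁₃ V) (diff₂₃ V) := diff₁₃_mul_diff₂₃
  rw [e, map_add, h2, add_zero, ← Module.End.mul_apply, (hc.pow_pow N N).eq, Module.End.mul_apply,
    h1, map_zero]

/-- Dong's lemma. -/
theorem local_prod (hαβ : Local N α β) (hα : Local N α χ) (hβ : Local N β χ) (n : ℤ) :
    Local (N + ((N - n).toNat + N)) (prod n α β) χ := by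
  intro v
  set H : ℤ → ℤ → ℤ → ℤ → V := fun n m l r =>
    bor α β m n l (mode r χ v) - mode r χ (bor α β m n l v) with hH
  have h1 : ∀ n, (diff₁₃ V ^ N) ((diff₂₃ V ^ N) (H n)) = 0 := by
    intro n
    refine ((isConvolution_diff₁₃.pow N).mul (isConvolution_diff₂₃.pow N)).eq_zero
      (diff_triple hα hβ v) (diff_triple' hα hβ v) (fun j => (-1) ^ j * Ring.choose n j)
      n.negOnePow (fun j => n - j) (fun j => j) fun m l r => ?_
    refine ((bor_spec α β m n l (mode r χ v)).sub ((bor_spec α β m n l v).map (mode r χ))).congr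
      fun j => ?_
    simp only [comp, map_sub, map_zsmul, show n + l - (j : ℤ) = l + (n - j) by ring,
      add_sub_assoc]
    module
  have h2 := pow_annihilates diff₁₃_mul_diff₂₃ (H := H) (fun n => by
      ext m l r
      simp only [hH, Pi.sub_apply, diff₁₃_apply, diff₂₃_apply, bor_succ, map_sub]
      abel) (N := N) (fun n hn => by
      ext m l r
      simp only [hH, hαβ.bor_eq_zero hn, map_zero, sub_zero]; rfl) h1 ((N - n).toNat + N) n 0
      (N + ((N - n).toNat + N)) le_rfl (by omega)
  rw [pow_zero, Module.End.one_apply] at h2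
  ext l r
  have h3 := congrFun (congrFun (congrFun h2 0) l) r
  rw [diff₂₃_pow] at h3
  exact h3

end Fld

end Fields

namespace OneTruncated

variable {k A E : Type*} [CommRing k] [CommRing A] [Algebra k A] [AddCommGroup E] [Module k E]

/-- A module generated by a vacuum vector under modes `aₙ`, `xₙ` which satisfy the commutation
relations of a `1`-truncated vertex algebra. -/
structure ModeRep (O : OneTruncated k A E) (V : Type*) [AddCommGroup V] [Module k V] where
  a : ℤ → A →ₗ[k] V →ₗ[k] V
  e : ℤ → E →ₗ[k] V →ₗ[k] V
  D : V →ₗ[k] V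
  one : V
  a_a : ∀ m n x y v, a m x (a n y v) = a n y (a m x v)
  e_a : ∀ m n x y v, e m x (a n y v) = a n y (e m x v) + a (m + n) (O.act x y) v
  e_e : ∀ m n x y v, e m x (e n y v) = e n y (e m x v) +
    (e (m + n) (O.br x y) v + m • a (m + n - 1) (O.form x y) v)
  D_a : ∀ n x v, D (a n x v) = a n x (D v) + -n • a (n - 1) x v
  D_e : ∀ n x v, D (e n x v) = e n x (D v) + -n • e (n - 1) x v
  a_one : ∀ n x, 0 ≤ n → a n x one = 0
  e_one : ∀ n x, 0 ≤ n → e n x one = 0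
  D_one : D one = 0
  unit : a (-1) 1 one = one
  e_del : ∀ x, e (-1) (O.del x) one = a (-2) x one
  a_mul : ∀ x y, a (-1) x (a (-1) y one) = a (-1) (x * y) one
  e_mul : ∀ x y, a (-1) x (e (-1) y one) = e (-1) (O.mul x y) one
  generated : ∀ P : Submodule k V, one ∈ P → (∀ n x, ∀ v ∈ P, a n x v ∈ P) →
    (∀ n x, ∀ v ∈ P, e n x v ∈ P) → P = ⊤

namespace ModeRep

variable {O : OneTruncated k A E} {V : Type*} [AddCommGroup V] [Module k V] (R : O.ModeRep V)

theorem trunc (v : V) : ∃ K : ℤ, ∀ n ≥ K, (∀ x, R.a n x v = 0) ∧ ∀ x, R.e n x v = 0 := by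
  have h := R.generated
    { carrier := {v | ∃ K : ℤ, ∀ n ≥ K, (∀ x, R.a n x v = 0) ∧ ∀ x, R.e n x v = 0}
      add_mem' := by
        rintro v w ⟨K, hK⟩ ⟨L, hL⟩
        refine ⟨max K L, fun n hn => ?_⟩
        obtain ⟨h1, h2⟩ := hK n (le_of_max_le_left hn)
        obtain ⟨h3, h4⟩ := hL n (le_of_max_le_right hn)
        exact ⟨fun x => by rw [map_add, h1, h3, add_zero],
          fun x => by rw [map_add, h2, h4, add_zero]⟩
      zero_mem' := ⟨0, fun n _ => ⟨fun x => map_zero _, fun x => map_zero _⟩⟩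
      smul_mem' := by
        rintro c v ⟨K, hK⟩
        refine ⟨K, fun n hn => ?_⟩
        obtain ⟨h1, h2⟩ := hK n hn
        exact ⟨fun x => by rw [map_smul, h1, smul_zero],
          fun x => by rw [map_smul, h2, smul_zero]⟩ }
    ⟨0, fun n hn => ⟨fun x => R.a_one n x hn, fun x => R.e_one n x hn⟩⟩ ?_ ?_
  · exact (h.symm ▸ Submodule.mem_top : v ∈ _)
  · rintro m y v ⟨K, hK⟩
    refine ⟨max K (K - m), fun n hn => ?_⟩
    obtain ⟨h1, h2⟩ := hK n (le_of_max_le_left hn)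
    obtain ⟨h3, h4⟩ := hK (n + m) (by have := le_of_max_le_right hn; omega)
    exact ⟨fun x => by rw [R.a_a, h1, map_zero],
      fun x => by rw [R.e_a, h2, h3, map_zero, add_zero]⟩
  · rintro m y v ⟨K, hK⟩
    refine ⟨max K (K - m) ⊔ (K - m + 1), fun n hn => ?_⟩
    have hn' := le_of_max_le_left hn
    obtain ⟨h1, h2⟩ := hK n (le_of_max_le_left hn')
    obtain ⟨h3, h4⟩ := hK (n + m) (by have := le_of_max_le_right hn'; omega)
    obtain ⟨h5, h6⟩ := hK (n + m - 1) (by have := le_of_max_le_right hn; omega)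
    constructor
    · intro x
      have h := R.e_a m n y x v
      rw [h1, map_zero, add_comm m n, h3, add_zero] at h
      exact h.symm
    · intro x
      rw [R.e_e, h2, map_zero, h4, h5, smul_zero, add_zero, add_zero]

/-- The field of an element of `A`. -/
def fieldA : A →ₗ[k] Fld k V where
  toFun x := ⟨fun n => R.a n x, fun v => (R.trunc v).imp fun K hK n hn => (hK n hn).1 x⟩
  map_add' x y := Fld.ext fun n v => by
    change R.a n (x + y) v = R.a n x v + R.a n y v
    simp
  map_smul' c x := Fld.ext fun n v => by
    change R.a n (c • x) v = c • R.a n x v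
    simp

/-- The field of an element of `E`. -/
def fieldE : E →ₗ[k] Fld k V where
  toFun x := ⟨fun n => R.e n x, fun v => (R.trunc v).imp fun K hK n hn => (hK n hn).2 x⟩
  map_add' x y := Fld.ext fun n v => by
    change R.e n (x + y) v = R.e n x v + R.e n y v
    simp
  map_smul' c x := Fld.ext fun n v => by
    change R.e n (c • x) v = c • R.e n x v
    simp

variable (k V) in
/-- The field of the vacuum. -/
def vacField : Fld k V :=
  ⟨fun n => if n = -1 then LinearMap.id else 0, fun v => ⟨0, fun n hn => by
    beta_reduce; rw [if_neg (by omega), LinearMap.zero_apply]⟩⟩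

@[simp] theorem mode_fieldA (n : ℤ) (x : A) (v : V) : Fld.mode n (R.fieldA x) v = R.a n x v := rfl

@[simp] theorem mode_fieldE (n : ℤ) (x : E) (v : V) : Fld.mode n (R.fieldE x) v = R.e n x v := rfl

theorem mode_vacField (n : ℤ) (v : V) :
    Fld.mode n (vacField k V) v = if n = -1 then v else 0 := by
  change (if n = -1 then LinearMap.id else 0 : V →ₗ[k] V) v = _
  split_ifs <;> rfl

/-- The fields of the generators. -/
def genField : A ⊕ E → Fld k V := Sum.elim R.fieldA R.fieldE

theorem local_vac (α : Fld k V) : Fld.Local 0 (vacField k V) α := by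
  intro v
  ext p q
  simp only [pow_zero, Module.End.one_apply, Fld.comp, mode_vacField]
  split_ifs <;> simp

theorem local_A_E (x : A) (y : E) : Fld.Local 2 (R.fieldA x) (R.fieldE y) := by
  refine Fld.Local.mono (N := 1) (Fld.local_iff.2 fun m l v => ?_) one_le_two
  have h : ∀ m l, Fld.bor (R.fieldA x) (R.fieldE y) m 0 l v = -R.a (m + l) (O.act y x) v := by
    intro m l
    rw [Fld.bor_zero, mode_fieldA, mode_fieldE, mode_fieldE, mode_fieldA, R.e_a, add_comm l]
    abel
  have h2 := Fld.bor_succ (R.fieldA x) (R.fieldE y) m 0 l v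
  rw [h, h, show m + 1 + l = m + (l + 1) by ring, sub_self] at h2
  exact h2

theorem local_genField (g g' : A ⊕ E) : Fld.Local 2 (R.genField g) (R.genField g') := by
  rcases g with x | x <;> rcases g' with y | y
  · refine Fld.Local.mono (N := 0) (Fld.local_iff.2 fun m l v => ?_) zero_le_two
    exact (Fld.bor_zero _ _ _ _ _).trans (sub_eq_zero.2 (R.a_a _ _ _ _ _))
  · exact R.local_A_E x y
  · exact (R.local_A_E y x).symm
  · refine Fld.local_iff.2 fun m l v => ?_
    have h : ∀ m l, Fld.bor (R.fieldE x) (R.fieldE y) m 0 l v =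
        R.e (m + l) (O.br x y) v + m • R.a (m + l - 1) (O.form x y) v := by
      intro m l
      rw [Fld.bor_zero, mode_fieldE, mode_fieldE, mode_fieldE, mode_fieldE, R.e_e]
      abel
    have h1 : ∀ m l, Fld.bor (R.fieldE x) (R.fieldE y) m 1 l v = R.a (m + l) (O.form x y) v := by
      intro m l
      have h2 := Fld.bor_succ (R.fieldE x) (R.fieldE y) m 0 l v
      rw [h, h, show m + 1 + l = m + (l + 1) by ring,
        show m + (l + 1) - 1 = m + l by ring] at h2
      exact h2.trans (by module)
    have h2 := Fld.bor_succ (R.fieldE x) (R.fieldE y) m 1 l v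
    rw [h1, h1, show m + 1 + l = m + (l + 1) by ring, sub_self] at h2
    exact h2

/-! ### Weights -/

/-- The span of the words of length at most `r` and weight `i` applied to the vacuum. -/
def words : ℕ → ℤ → Submodule k V
  | 0, i => if i = 0 then Submodule.span k {R.one} else ⊥
  | r + 1, i => words r i ⊔
    (Submodule.span k {v | ∃ n x, ∃ u ∈ words r (i + n + 1), v = R.a n x u} ⊔
      Submodule.span k {v | ∃ n x, ∃ u ∈ words r (i + n), v = R.e n x u})

theorem words_le_succ (r : ℕ) (i : ℤ) : R.words r i ≤ R.words (r + 1) i := le_sup_left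

theorem a_mem_words {r : ℕ} {i j : ℤ} {u : V} (hu : u ∈ R.words r j) (n : ℤ) (x : A)
    (h : j = i + n + 1) : R.a n x u ∈ R.words (r + 1) i := by
  subst h
  exact Submodule.mem_sup_right (Submodule.mem_sup_left (Submodule.subset_span ⟨n, x, u, hu, rfl⟩))

theorem e_mem_words {r : ℕ} {i j : ℤ} {u : V} (hu : u ∈ R.words r j) (n : ℤ) (x : E)
    (h : j = i + n) : R.e n x u ∈ R.words (r + 1) i := by
  subst h
  exact Submodule.mem_sup_right (Submodule.mem_sup_right (Submodule.subset_span ⟨n, x, u, hu, rfl⟩))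

theorem words_induction {r : ℕ} {i : ℤ} (P : Submodule k V) (h₀ : ∀ v ∈ R.words r i, v ∈ P)
    (ha : ∀ n x, ∀ u ∈ R.words r (i + n + 1), R.a n x u ∈ P)
    (he : ∀ n x, ∀ u ∈ R.words r (i + n), R.e n x u ∈ P) : R.words (r + 1) i ≤ P := by
  refine sup_le h₀ (sup_le (Submodule.span_le.2 ?_) (Submodule.span_le.2 ?_))
  · rintro _ ⟨n, x, u, hu, rfl⟩
    exact ha n x u hu
  · rintro _ ⟨n, x, u, hu, rfl⟩
    exact he n x u hu

/-- Modes `aₙ`, `xₙ` with `n ≥ 0` do not increase the length of words. -/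
theorem nonneg_mem_words {n : ℤ} (hn : 0 ≤ n) (r : ℕ) (i : ℤ) {u : V} (hu : u ∈ R.words r i) :
    (∀ x, R.a n x u ∈ R.words r (i - n - 1)) ∧ ∀ x, R.e n x u ∈ R.words r (i - n) := by
  induction r generalizing i u with
  | zero =>
    rw [words] at hu
    split_ifs at hu with h
    · obtain ⟨c, rfl⟩ := Submodule.mem_span_singleton.1 hu
      constructor <;> intro x
      · rw [map_smul, R.a_one n x hn, smul_zero]; exact zero_mem _
      · rw [map_smul, R.e_one n x hn, smul_zero]; exact zero_mem _
    · rw [(Submodule.mem_bot k).1 hu]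
      exact ⟨fun x => by rw [map_zero]; exact zero_mem _,
        fun x => by rw [map_zero]; exact zero_mem _⟩
  | succ r ih =>
    constructor <;> intro x
    · refine R.words_induction ((R.words (r + 1) (i - n - 1)).comap (R.a n x)) ?_ ?_ ?_ hu
      · exact fun v hv => R.words_le_succ _ _ ((ih _ hv).1 x)
      · intro m y v hv
        rw [Submodule.mem_comap, R.a_a]
        exact R.a_mem_words ((ih _ hv).1 x) _ _ (by ring)
      · intro m y v hv
        have h := R.e_a m n y x v
        rw [Submodule.mem_comap, ← sub_eq_iff_eq_add.2 h]
        exact sub_mem (R.e_mem_words ((ih _ hv).1 x) _ _ (by ring))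
          (R.a_mem_words hv _ _ (by ring))
    · refine R.words_induction ((R.words (r + 1) (i - n)).comap (R.e n x)) ?_ ?_ ?_ hu
      · exact fun v hv => R.words_le_succ _ _ ((ih _ hv).2 x)
      · intro m y v hv
        rw [Submodule.mem_comap, R.e_a]
        exact add_mem (R.a_mem_words ((ih _ hv).2 x) _ _ (by ring))
          (R.a_mem_words hv _ _ (by ring))
      · intro m y v hv
        rw [Submodule.mem_comap, R.e_e]
        exact add_mem (R.e_mem_words ((ih _ hv).2 x) _ _ (by ring))
          (add_mem (R.e_mem_words hv _ _ (by ring))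
            (zsmul_mem (R.a_mem_words hv _ _ (by ring)) _))

theorem words_eq_bot (r : ℕ) {i : ℤ} (hi : i < 0) : R.words r i = ⊥ := by
  induction r generalizing i with
  | zero => rw [words, if_neg hi.ne]
  | succ r ih =>
    rw [eq_bot_iff, ← ih hi]
    refine R.words_induction _ (fun v hv => hv) (fun n x u hu => ?_) fun n x u hu => ?_
    · rcases lt_or_ge (i + n + 1) 0 with h | h
      · rw [ih h, Submodule.mem_bot] at hu
        rw [hu, map_zero]; exact zero_mem _
      · have := (R.nonneg_mem_words (n := n) (by omega) r _ hu).1 x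
        rwa [show i + n + 1 - n - 1 = i by ring] at this
    · rcases lt_or_ge (i + n) 0 with h | h
      · rw [ih h, Submodule.mem_bot] at hu
        rw [hu, map_zero]; exact zero_mem _
      · have := (R.nonneg_mem_words (n := n) (by omega) r _ hu).2 x
        rwa [show i + n - n = i by ring] at this

/-- The vectors of weight `i`. -/
def wt (i : ℤ) : Submodule k V := ⨆ r, R.words r i

theorem wt_eq_bot {i : ℤ} (hi : i < 0) : R.wt i = ⊥ := by
  simp only [wt, R.words_eq_bot _ hi, iSup_const]

theorem one_mem_wt : R.one ∈ R.wt 0 := by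
  refine Submodule.mem_iSup_of_mem 0 ?_
  rw [words, if_pos rfl]
  exact Submodule.mem_span_singleton_self _

theorem a_mem_wt (n : ℤ) (x : A) {i j : ℤ} {v : V} (hv : v ∈ R.wt i) (h : j = i - n - 1) :
    R.a n x v ∈ R.wt j := by
  have : R.wt i ≤ (R.wt j).comap (R.a n x) := iSup_le fun r u hu =>
    Submodule.mem_iSup_of_mem (r + 1) (R.a_mem_words hu n x (by omega))
  exact this hv

theorem e_mem_wt (n : ℤ) (x : E) {i j : ℤ} {v : V} (hv : v ∈ R.wt i) (h : j = i - n) :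
    R.e n x v ∈ R.wt j := by
  have : R.wt i ≤ (R.wt j).comap (R.e n x) := iSup_le fun r u hu =>
    Submodule.mem_iSup_of_mem (r + 1) (R.e_mem_words hu n x (by omega))
  exact this hv

end ModeRep

end OneTruncated

theorem EvSum.mem {M : Type*} [AddCommGroup M] {f : ℕ → M} {s : M} (h : EvSum f s)
    {S : Type*} [SetLike S M] [AddSubmonoidClass S M] (P : S) (hP : ∀ j, f j ∈ P) : s ∈ P := by
  obtain ⟨K, hK⟩ := h
  rw [← hK K le_rfl]
  exact sum_mem fun j _ => hP j

namespace Fld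

variable {k V : Type*} [CommRing k] [AddCommGroup V] [Module k V]

/-- Fields `α` with `[D, αₙ] = -n αₙ₋₁` and `αₙ 1 = 0` for `n ≥ 0`. -/
def translationCovariant (D : V →ₗ[k] V) (one : V) : Submodule k (Fld k V) where
  carrier := {α | (∀ n v, D (mode n α v) = mode n α (D v) - n • mode (n - 1) α v) ∧
    ∀ n, 0 ≤ n → mode n α one = 0}
  add_mem' {α β} hα hβ := by
    constructor
    · intro n v
      simp only [map_add, LinearMap.add_apply, hα.1, hβ.1]
      module
    · intro n hn
      rw [map_add, LinearMap.add_apply, hα.2 n hn, hβ.2 n hn, add_zero]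
  zero_mem' := ⟨fun n v => by simp, fun n _ => by simp⟩
  smul_mem' c α hα := by
    constructor
    · intro n v
      simp only [map_smul, LinearMap.smul_apply, hα.1]
      module
    · intro n hn
      rw [map_smul, LinearMap.smul_apply, hα.2 n hn, smul_zero]

variable {D : V →ₗ[k] V} {one : V} {α β : Fld k V}

theorem prod_one (hα : α ∈ translationCovariant D one) (hβ : β ∈ translationCovariant D one)
    (n : ℤ) : mode (-1) (prod n α β) one = mode n α (mode (-1) β one) := by
  refine (bor_spec α β 0 n (-1) one).unique ((EvSum.single_zero (f := fun j : ℕ =>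
    ((-1) ^ j * Ring.choose n j) • comp α β one (n - j) (-1 + j)) fun j => ?_).conv
      (fun j => ?_) ?_)
  · rw [comp, hβ.2 _ (by push_cast; omega), map_zero, smul_zero]
  · rw [comp, comp, comp, zero_add, zero_add, hα.2 j (by omega), map_zero, smul_zero, sub_zero]
  · simp [comp]

theorem comp_derivative (hα : α ∈ translationCovariant D one)
    (hβ : β ∈ translationCovariant D one) (v : V) (p q : ℤ) : D.toAddMonoidHom (comp α β v p q) =
      comp α β (D v) p q - p • comp α β v (p - 1) q - q • comp α β v p (q - 1) := by
  change D (mode p α (mode q β v)) = mode p α (mode q β (D v)) - _ - q • mode p α _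
  rw [hα.1, hβ.1, map_sub, map_zsmul]
  simp only [comp]
  abel

theorem prod_mem_translationCovariant (hα : α ∈ translationCovariant D one)
    (hβ : β ∈ translationCovariant D one) (n : ℤ) :
    prod n α β ∈ translationCovariant D one := by
  constructor
  · intro l v
    have h1 := binSum_derivative (comp_finite α β v) (comp_finite α β (D v)) D.toAddMonoidHom
      (comp_derivative hα hβ v) n n l
    have h2 := binSum_derivative (comp_finite β α v) (comp_finite β α (D v)) D.toAddMonoidHom
      (comp_derivative hβ hα v) n (n + l) 0
    rw [sub_self, zero_smul, zero_add] at h1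
    rw [zero_smul, add_zero, add_sub_cancel_left, show n + l - 1 = n + (l - 1) by ring] at h2
    simp only [mode_prod, bor, zero_add]
    rw [map_sub, map_zsmul]
    change D.toAddMonoidHom _ - _ • D.toAddMonoidHom _ = _
    rw [h1, h2]
    module
  · intro l hl
    refine (bor_spec α β 0 n l one).unique (EvSum.zero.congr fun j => ?_)
    rw [comp, comp, hβ.2 _ (by omega), hα.2 _ (by omega), map_zero, map_zero, smul_zero, sub_zero,
      smul_zero]

end Fld

namespace OneTruncated.ModeRep

variable {k A E : Type*} [CommRing k] [CommRing A] [Algebra k A] [AddCommGroup E] [Module k E]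
  {O : OneTruncated k A E} {V : Type*} [AddCommGroup V] [Module k V] (R : O.ModeRep V)

/-- Translation covariant fields which are local with respect to the generators. -/
def good : Submodule k (Fld k V) where
  carrier := {α | α ∈ Fld.translationCovariant R.D R.one ∧ ∀ g, ∃ N, Fld.Local N α (R.genField g)}
  add_mem' {α β} hα hβ := by
    refine ⟨add_mem hα.1 hβ.1, fun g => ?_⟩
    obtain ⟨N, hN⟩ := hα.2 g
    obtain ⟨N', hN'⟩ := hβ.2 g
    exact ⟨_, Fld.local_add (hN.mono (le_max_left N N')) (hN'.mono (le_max_right N N'))⟩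
  zero_mem' := ⟨zero_mem _, fun g => ⟨0, fun v => by ext; simp [Fld.comp]⟩⟩
  smul_mem' c α hα := ⟨Submodule.smul_mem _ _ hα.1, fun g =>
    (hα.2 g).imp fun N hN => Fld.local_smul c hN⟩

theorem eq_zero_of_local {α : Fld k V} (h : ∀ g, ∃ N, Fld.Local N α (R.genField g))
    (h₁ : ∀ n, Fld.mode n α R.one = 0) : α = 0 := by
  have key : ∀ g, ∀ v, (∀ n, Fld.mode n α v = 0) →
      ∀ m n, Fld.mode n α (Fld.mode m (R.genField g) v) = 0 := by
    intro g v hv m n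
    obtain ⟨N, hN⟩ := h g
    have h2 := hN v
    obtain ⟨K, hK⟩ := Fld.trunc (R.genField g) v
    have h3 := eq_zero_of_diff_pow h2 (K := K) fun p q hq => by
      rw [Fld.comp, Fld.comp, hK q hq, hv, map_zero, map_zero, sub_zero]
    have h4 := congrFun (congrFun h3 n) m
    simp only [Fld.comp, hv, map_zero, sub_zero] at h4
    exact h4
  have h2 := R.generated
    { carrier := {v | ∀ n, Fld.mode n α v = 0}
      add_mem' := fun {v w} hv hw n => by rw [map_add, hv, hw, add_zero]
      zero_mem' := fun n => map_zero _
      smul_mem' := fun c v hv n => by rw [map_smul, hv, smul_zero] } h₁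
    (fun m x v hv n => key (Sum.inl x) v hv m n) (fun m x v hv n => key (Sum.inr x) v hv m n)
  ext n v
  have h3 : v ∈ (⊤ : Submodule k V) := Submodule.mem_top
  rw [← h2] at h3
  simpa using h3 n

/-- A translation covariant local field is determined by its value at the vacuum. -/
theorem eq_zero_of_mode [Algebra ℚ k] {α : Fld k V} (h : α ∈ R.good)
    (h₁ : Fld.mode (-1) α R.one = 0) : α = 0 := by
  have h2 : ∀ n : ℕ, Fld.mode (-1 - n) α R.one = 0 := by
    intro n
    induction n with
    | zero => simpa using h₁
    | succ n ih =>
      have h3 := h.1.1 (-1 - n) R.one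
      rw [ih, map_zero, R.D_one, map_zero, zero_sub, ← neg_smul, show -1 - (n : ℤ) - 1 =
        -1 - (n + 1 : ℕ) by push_cast; ring, ← smul_zero (-(-1 - (n : ℤ)))] at h3
      exact (zsmul_cancel k (by omega) h3).symm
  refine R.eq_zero_of_local h.2 fun n => ?_
  rcases lt_or_ge n 0 with hn | hn
  · have := h2 (-1 - n).toNat
    rwa [show -1 - ((-1 - n).toNat : ℤ) = n by omega] at this
  · exact h.1.2 n hn

/-- The field of a formal monomial in the generators. -/
noncomputable def field : VTerm (A ⊕ E) → Fld k V
  | .gen g => R.genField g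
  | .vac => vacField k V
  | .op n s t => Fld.prod n (field s) (field t)

theorem field_translationCovariant (t : VTerm (A ⊕ E)) :
    R.field t ∈ Fld.translationCovariant R.D R.one := by
  induction t with
  | gen g =>
    rcases g with x | x
    · exact ⟨fun n v => by
        change R.D (R.a n x v) = R.a n x _ - n • R.a _ x v
        rw [R.D_a]; module, fun n hn => R.a_one n x hn⟩
    · exact ⟨fun n v => by
        change R.D (R.e n x v) = R.e n x _ - n • R.e _ x v
        rw [R.D_e]; module, fun n hn => R.e_one n x hn⟩
  | vac =>
    constructor
    · intro n v
      simp only [field, mode_vacField]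
      rcases eq_or_ne n 0 with rfl | hn
      · simp
      · rw [if_neg (show ¬ n - 1 = -1 by omega), smul_zero, sub_zero]
        split_ifs <;> simp
    · intro n hn
      simp only [field, mode_vacField]
      rw [if_neg (by omega)]
  | op n s t hs ht => exact Fld.prod_mem_translationCovariant hs ht n

theorem field_local_aux (N : ℕ) : ∀ s t : VTerm (A ⊕ E), sizeOf s + sizeOf t ≤ N →
    ∃ K, Fld.Local K (R.field s) (R.field t) := by
  induction N with
  | zero => intro s t h; cases s <;> simp at h
  | succ N ih =>
    have key : ∀ n s₁ s₂ t, sizeOf (VTerm.op n s₁ s₂ : VTerm (A ⊕ E)) + sizeOf t ≤ N + 1 →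
        ∃ K, Fld.Local K (R.field (.op n s₁ s₂)) (R.field t) := by
      intro n s₁ s₂ t h
      simp only [VTerm.op.sizeOf_spec] at h
      have h0 : 0 < sizeOf t := by cases t <;> simp
      obtain ⟨K₁, h₁⟩ := ih s₁ s₂ (by omega)
      obtain ⟨K₂, h₂⟩ := ih s₁ t (by omega)
      obtain ⟨K₃, h₃⟩ := ih s₂ t (by omega)
      exact ⟨_, Fld.local_prod (h₁.mono (show K₁ ≤ K₁ + K₂ + K₃ by omega)) (h₂.mono (by omega))
        (h₃.mono (by omega)) n⟩
    intro s t h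
    rcases s with g | _ | ⟨n, s₁, s₂⟩
    · rcases t with g' | _ | ⟨n, t₁, t₂⟩
      · exact ⟨2, R.local_genField g g'⟩
      · exact ⟨0, (local_vac _).symm⟩
      · exact (key n t₁ t₂ _ (by omega)).imp fun K hK => hK.symm
    · exact ⟨0, local_vac _⟩
    · exact key n s₁ s₂ t h

theorem field_local (s t : VTerm (A ⊕ E)) : ∃ K, Fld.Local K (R.field s) (R.field t) :=
  R.field_local_aux _ s t le_rfl

theorem field_good (t : VTerm (A ⊕ E)) : R.field t ∈ R.good :=
  ⟨R.field_translationCovariant t, fun g => R.field_local t (.gen g)⟩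

/-- The weights of the generators. -/
def genWt : A ⊕ E → ℤ := Sum.elim (fun _ => 0) (fun _ => 1)

theorem field_mem_wt (t : VTerm (A ⊕ E)) {n i j : ℤ} {v : V} (hv : v ∈ R.wt i)
    (h : j = i + VTerm.wt genWt t - n - 1) : Fld.mode n (R.field t) v ∈ R.wt j := by
  induction t generalizing n i j v with
  | gen g =>
    rcases g with x | x
    · exact R.a_mem_wt n x hv (by rw [h]; simp [VTerm.wt, genWt])
    · exact R.e_mem_wt n x hv (by rw [h]; simp [VTerm.wt, genWt]; ring)
  | vac =>
    simp only [field, mode_vacField]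
    split_ifs with h1
    · subst h1
      rw [h]; simpa [VTerm.wt] using hv
    · exact zero_mem _
  | op m s t hs ht =>
    refine (Fld.bor_spec (R.field s) (R.field t) 0 m n v).mem (R.wt j) fun p => ?_
    refine zsmul_mem (sub_mem ?_ (zsmul_mem ?_ _)) _
    · exact hs (ht hv rfl) (by rw [h, VTerm.wt]; ring)
    · exact ht (hs hv rfl) (by rw [h, VTerm.wt]; ring)

/-- The fields of formal linear combinations of monomials. -/
noncomputable def fieldMap : (VTerm (A ⊕ E) →₀ k) →ₗ[k] Fld k V :=
  Finsupp.linearCombination k R.field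

theorem fieldMap_single (t : VTerm (A ⊕ E)) : R.fieldMap (Finsupp.single t 1) = R.field t := by
  simp [fieldMap]

variable [Algebra ℚ k]

theorem field_eq_zero {t : VTerm (A ⊕ E)} (h : VTerm.wt genWt t < 0) : R.field t = 0 := by
  refine R.eq_zero_of_mode (R.field_good t) ?_
  have := R.field_mem_wt t (n := -1) R.one_mem_wt rfl
  rw [R.wt_eq_bot (by omega)] at this
  exact (Submodule.mem_bot k).1 this

end OneTruncated.ModeRep

namespace VertexAlgebroid

open VTerm OneTruncated.ModeRep

variable {k A T Ω : Type*} [CommRing k] [Algebra ℚ k] [Invertible (2 : k)]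
    [CommRing A] [Algebra k A]
    [LieRing T] [LieAlgebra k T] [Module A T] [LieRingModule T A] [LieRinehartRing A T]
    [LieRinehartAlgebra k A T]
    [AddCommGroup Ω] [Module k Ω] [Module A Ω] [IsScalarTower k A Ω]
    [LieRingModule T Ω] [LieModule k T Ω]

variable {𝒜 : VertexAlgebroid k A T Ω} {V : Type*} [AddCommGroup V] [Module k V]
  (R : 𝒜.oneTruncated.ModeRep V)

theorem fieldMap_fop (n : ℤ) (x y : 𝒜.FreeV) :
    R.fieldMap (fop k n x y) = Fld.prod n (R.fieldMap x) (R.fieldMap y) := by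
  induction x using Finsupp.induction_linear with
  | zero => simp
  | add x x' hx hx' => simp only [map_add, LinearMap.add_apply, hx, hx']
  | single s a =>
    induction y using Finsupp.induction_linear with
    | zero => simp
    | add y y' hy hy' => simp only [map_add, hy, hy']
    | single t b =>
      rw [fop_single]
      simp only [fieldMap, Finsupp.linearCombination_single, field, map_smul, LinearMap.smul_apply,
        smul_smul]
      rw [_root_.mul_comm]

theorem fieldMap_good (x : 𝒜.FreeV) : R.fieldMap x ∈ R.good := by
  induction x using Finsupp.induction_linear with
  | zero => rw [map_zero]; exact zero_mem _
  | add x x' hx hx' => rw [map_add]; exact add_mem hx hx'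
  | single s a =>
    rw [fieldMap, Finsupp.linearCombination_single]
    exact Submodule.smul_mem _ _ (R.field_good s)

theorem mode_fieldMap_fop (n : ℤ) (x y : 𝒜.FreeV) :
    Fld.mode (-1) (R.fieldMap (fop k n x y)) R.one =
      Fld.mode n (R.fieldMap x) (Fld.mode (-1) (R.fieldMap y) R.one) := by
  rw [fieldMap_fop]
  exact Fld.prod_one (fieldMap_good R x).1 (fieldMap_good R y).1 n

theorem fieldMap_g₀ (x : A) : R.fieldMap (𝒜.g₀ x) = R.fieldA x := R.fieldMap_single _

theorem fieldMap_g₁ (x : T × Ω) : R.fieldMap (𝒜.g₁ x) = R.fieldE x := R.fieldMap_single _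

theorem fieldMap_vac : R.fieldMap (𝒜.mon vac) = vacField k V := R.fieldMap_single _

theorem mode_vac_one : Fld.mode (-1) (vacField k V) R.one = R.one := by simp [mode_vacField]

theorem fieldMap_borcherds (m n l : ℤ) (s t u : VTerm 𝒜.Gen) (N : ℕ)
    (h₁ : wt 𝒜.genWt s + wt 𝒜.genWt t - n ≤ N)
    (h₂ : wt 𝒜.genWt t + wt 𝒜.genWt u - l ≤ N)
    (h₃ : wt 𝒜.genWt s + wt 𝒜.genWt u - m ≤ N) :
    Fld.mode (-1) (R.fieldMap (𝒜.borL N m n l (𝒜.mon s) (𝒜.mon t) (𝒜.mon u))) R.one =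
    Fld.mode (-1) (R.fieldMap (𝒜.borR N m n l (𝒜.mon s) (𝒜.mon t) (𝒜.mon u))) R.one := by
  obtain ⟨K, hK⟩ := R.field_local s t
  have hz : ∀ (q : ℤ) (s t : VTerm 𝒜.Gen), wt 𝒜.genWt s + wt 𝒜.genWt t - q ≤ 0 →
      Fld.prod q (R.field s) (R.field t) = 0 := fun q s t hq =>
    R.field_eq_zero (t := .op q s t) (show wt 𝒜.genWt s + wt 𝒜.genWt t - q - 1 < 0 by omega)
  have hz' : ∀ (q : ℤ) (s t : VTerm 𝒜.Gen), wt 𝒜.genWt s + wt 𝒜.genWt t - q ≤ 0 →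
      Fld.mode q (R.field s) (Fld.mode (-1) (R.field t) R.one) = 0 := fun q s t hq => by
    rw [← Fld.prod_one (R.field_translationCovariant s) (R.field_translationCovariant t), hz q s t hq,
      map_zero, LinearMap.zero_apply]
  have hL := binSum_spec (u := fun p q => Fld.mode p (Fld.prod q (R.field s) (R.field t))
      (Fld.mode (-1) (R.field u) R.one)) (fun p q =>
    ⟨(K - q).toNat, fun j hj => by
      beta_reduce; rw [hK.prod_eq_zero (by omega), map_zero, LinearMap.zero_apply]⟩) 1 m (m + l) n
  rw [hK.borcherds] at hL
  have hR := Fld.bor_spec (R.field s) (R.field t) m n l (Fld.mode (-1) (R.field u) R.one)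
  have e1 := (EvSum.of_eventually_zero (K := N) fun j hj => by
    rw [hz _ s t (by omega), map_zero, LinearMap.zero_apply, smul_zero]).unique hL
  have e2 := (EvSum.of_eventually_zero (K := N) fun j hj => by
    rw [Fld.comp, Fld.comp, hz' _ t u (by omega), hz' _ s u (by omega), map_zero, map_zero,
      smul_zero, sub_zero, smul_zero]).unique hR
  have e3 := e1.trans e2.symm
  simp only [one_pow, one_mul] at e3
  have hf : ∀ t : VTerm 𝒜.Gen, R.fieldMap (𝒜.mon t) = R.field t := fun t => R.fieldMap_single t
  rw [borL, borR]
  simp only [map_sum, LinearMap.sum_apply, map_zsmul, LinearMap.smul_apply, map_sub,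
    LinearMap.sub_apply, mode_fieldMap_fop]
  simp only [fieldMap_fop, hf]
  exact e3

theorem mon_op (n : ℤ) (s t : VTerm 𝒜.Gen) :
    𝒜.mon (.op n s t) = fop k n (𝒜.mon s) (𝒜.mon t) := by rw [fop_single, mul_one]

theorem fieldMap_rel {x : 𝒜.FreeV} (h : 𝒜.Rel x) : R.fieldMap x = 0 := by
  refine R.eq_zero_of_mode (fieldMap_good R x) ?_
  induction h with
  | neg_wt t h => rw [R.fieldMap_single, R.field_eq_zero h, map_zero, LinearMap.zero_apply]
  | vac_op t =>
    rw [mon_op, map_sub, map_sub, LinearMap.sub_apply, mode_fieldMap_fop, fieldMap_vac,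
      mode_vacField, if_pos rfl, sub_self]
  | vac_op_ne n t h =>
    rw [mon_op, mode_fieldMap_fop, fieldMap_vac, mode_vacField, if_neg h]
  | op_vac t =>
    rw [mon_op, map_sub, map_sub, LinearMap.sub_apply, mode_fieldMap_fop, fieldMap_vac,
      mode_vac_one, sub_self]
  | op_vac_of_nonneg n t h =>
    rw [mon_op, mode_fieldMap_fop, fieldMap_vac, mode_vac_one, (fieldMap_good R _).1.2 n h]
  | borcherds m n l s t u N h₁ h₂ h₃ =>
    rw [map_sub, map_sub, LinearMap.sub_apply, fieldMap_borcherds R m n l s t u N h₁ h₂ h₃,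
      sub_self]
  | add₀ a b =>
    rw [map_sub R.fieldMap, map_sub R.fieldMap, fieldMap_g₀, fieldMap_g₀, fieldMap_g₀, map_add, add_sub_cancel_left,
      sub_self, map_zero, LinearMap.zero_apply]
  | smul₀ r a =>
    rw [map_sub, map_smul, fieldMap_g₀, fieldMap_g₀, map_smul, sub_self, map_zero,
      LinearMap.zero_apply]
  | add₁ x y =>
    rw [map_sub R.fieldMap, map_sub R.fieldMap, fieldMap_g₁, fieldMap_g₁, fieldMap_g₁, map_add, add_sub_cancel_left,
      sub_self, map_zero, LinearMap.zero_apply]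
  | smul₁ r x =>
    rw [map_sub, map_smul, fieldMap_g₁, fieldMap_g₁, map_smul, sub_self, map_zero,
      LinearMap.zero_apply]
  | one =>
    rw [map_sub, map_sub, LinearMap.sub_apply, fieldMap_g₀, fieldMap_vac, mode_vac_one,
      mode_fieldA, R.unit, sub_self]
  | mul a b =>
    rw [map_sub, map_sub, LinearMap.sub_apply, mode_fieldMap_fop, fieldMap_g₀, fieldMap_g₀,
      fieldMap_g₀, mode_fieldA, mode_fieldA, mode_fieldA, R.a_mul, sub_self]
  | nprod a x =>
    rw [map_sub, map_sub, LinearMap.sub_apply, mode_fieldMap_fop, fieldMap_g₀, fieldMap_g₁,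
      fieldMap_g₁, mode_fieldA, mode_fieldE, mode_fieldE, R.e_mul]
    exact sub_self _
  | del a =>
    rw [map_sub, map_sub, LinearMap.sub_apply, mode_fieldMap_fop, fieldMap_g₀, fieldMap_g₁,
      fieldMap_vac, mode_vac_one, mode_fieldA, mode_fieldE, ← R.e_del]
    exact sub_self _
  | act x a =>
    rw [map_sub, map_sub, LinearMap.sub_apply, mode_fieldMap_fop, fieldMap_g₀, fieldMap_g₀,
      fieldMap_g₁, mode_fieldA, mode_fieldE, mode_fieldA, R.e_a, R.e_one 0 x le_rfl, map_zero,
      zero_add]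
    exact sub_self _
  | bracket x y =>
    rw [map_sub, map_sub, LinearMap.sub_apply, mode_fieldMap_fop, fieldMap_g₁, fieldMap_g₁,
      fieldMap_g₁, mode_fieldE, mode_fieldE, mode_fieldE, R.e_e, R.e_one 0 x le_rfl, map_zero,
      zero_add, zero_smul, add_zero]
    exact sub_self _
  | form x y =>
    rw [map_sub, map_sub, LinearMap.sub_apply, mode_fieldMap_fop, fieldMap_g₁, fieldMap_g₁,
      fieldMap_g₀, mode_fieldE, mode_fieldE, mode_fieldA, R.e_e, R.e_one 1 x zero_le_one, map_zero,
      zero_add, R.e_one _ _ (by norm_num), zero_add, one_smul]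
    exact sub_self _

theorem fieldMap_idealMem {x : 𝒜.FreeV} (h : 𝒜.IdealMem x) : R.fieldMap x = 0 := by
  induction h with
  | of_rel x h => exact fieldMap_rel R h
  | zero => exact map_zero _
  | add x y _ _ hx hy => rw [map_add, hx, hy, add_zero]
  | smul r x _ hx => rw [map_smul, hx, smul_zero]
  | fop_left n x y _ hx => rw [fieldMap_fop, hx, map_zero, LinearMap.zero_apply]
  | fop_right n x y _ hy => rw [fieldMap_fop, hy, map_zero]

namespace Envelope

/-- The action of the vertex envelope on a representation of the generating modes, applied to the
vacuum vector. -/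
noncomputable def toRep : 𝒜.Envelope →ₗ[k] V :=
  𝒜.relIdeal.liftQ ((Fld.mode (-1)).flip R.one ∘ₗ R.fieldMap) fun x hx => by
    rw [LinearMap.mem_ker, LinearMap.comp_apply, fieldMap_idealMem R hx, map_zero]

theorem toRep_mk (x : 𝒜.FreeV) : toRep R (mk 𝒜 x) = Fld.mode (-1) (R.fieldMap x) R.one := rfl

theorem toRep_vac : toRep R (vertexAlgebra 𝒜).vac = R.one :=
  (toRep_mk R _).trans (by rw [fieldMap_vac, mode_vac_one])

theorem toRep_op_gen₀ (n : ℤ) (x : A) (u : 𝒜.Envelope) :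
    toRep R ((vertexAlgebra 𝒜).op n (gen₀ 𝒜 x) u) = R.a n x (toRep R u) := by
  obtain ⟨u, rfl⟩ := mk_surjective 𝒜 u
  refine (toRep_mk R (fop k n (𝒜.g₀ x) u)).trans ?_
  rw [mode_fieldMap_fop, fieldMap_g₀]; rfl

theorem toRep_op_gen₁ (n : ℤ) (x : T × Ω) (u : 𝒜.Envelope) :
    toRep R ((vertexAlgebra 𝒜).op n (gen₁ 𝒜 x) u) = R.e n x (toRep R u) := by
  obtain ⟨u, rfl⟩ := mk_surjective 𝒜 u
  refine (toRep_mk R (fop k n (𝒜.g₁ x) u)).trans ?_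
  rw [mode_fieldMap_fop, fieldMap_g₁]; rfl

end Envelope

end VertexAlgebroid

namespace VertexAlgebroid

open MvPolynomial

variable {k A T Ω : Type*} [CommRing k] [Algebra ℚ k] [Invertible (2 : k)]
    [CommRing A] [Algebra k A]
    [LieRing T] [LieAlgebra k T] [Module A T] [LieRingModule T A] [LieRinehartRing A T]
    [LieRinehartAlgebra k A T]
    [AddCommGroup Ω] [Module k Ω] [Module A Ω] [IsScalarTower k A Ω]
    [LieRingModule T Ω] [LieModule k T Ω]
    (𝒜 : VertexAlgebroid k A T Ω) {I Λ : Type*} (bT : Module.Basis I A T)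
    (bΩ : Module.Basis Λ A Ω)

theorem dp_inΩ_mem (j : ℤ) (ω : Ω) : 𝒜.dp bΩ j (inΩ bΩ ω) ∈ idealOfVars (Λ × ℕ) A := by
  rw [← bΩ.linearCombination_repr ω]
  induction bΩ.repr ω using Finsupp.induction_linear with
  | zero => simp
  | add f g hf hg => simp only [map_add]; exact add_mem hf hg
  | single l g =>
    rw [Finsupp.linearCombination_single, map_smul, inΩ_basis, smul_eq_C_mul]
    refine (𝒜.dp_mul bΩ j _ _).mem (idealOfVars (Λ × ℕ) A) fun p => Ideal.mul_mem_left _ _ ?_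
    rcases lt_or_ge (j - p) 0 with h | h
    · rw [𝒜.dp_of_neg bΩ h]; exact zero_mem _
    · obtain ⟨m, hm⟩ := Int.eq_ofNat_of_zero_le h
      rw [hm, dp_X]
      exact Ideal.subset_span ⟨_, rfl⟩

theorem dp_C_mem (j : ℕ) (a : A) : 𝒜.dp bΩ (j + 1) (C a) ∈ idealOfVars (Λ × ℕ) A := by
  have h := 𝒜.dp_totalDer bΩ j (C a)
  rw [totalDer_C] at h
  have h2 := 𝒜.dp_inΩ_mem bΩ j (𝒜.d a)
  rw [h] at h2
  have h3 := ((idealOfVars (Λ × ℕ) A).restrictScalars k).smul_mem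
    (algebraMap ℚ k ((j + 1 : ℤ) : ℚ)⁻¹) h2
  rw [← Int.cast_smul_eq_zsmul k, smul_smul, ← map_intCast (algebraMap ℚ k), ← map_mul,
    inv_mul_cancel₀ (by exact_mod_cast (by omega : (j + 1 : ℤ) ≠ 0)), map_one, one_smul] at h3
  exact h3

/-! ### The Fock module as a representation of the generating modes -/

theorem opE_creation_single {j : CreationIndex I} {N : Multiset (CreationIndex I)}
    (h : ∀ i ∈ N, j ≤ i) (b : MvPolynomial (Λ × ℕ) A) :
    𝒜.opE bT bΩ (-1 - j.ord) (bT j.gen, 0) (Finsupp.single N b) = Finsupp.single (j ::ₘ N) b :=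
  (𝒜.pbw bT bΩ).act_e_single h b

theorem fock_generated (P : Submodule k (𝒜.Fock bT bΩ)) (h₁ : 𝒜.vec bT bΩ 1 ∈ P)
    (hA : ∀ n x, ∀ v ∈ P, 𝒜.opA bT bΩ n x v ∈ P) (hE : ∀ n x, ∀ v ∈ P, 𝒜.opE bT bΩ n x v ∈ P) :
    P = ⊤ := by
  have hv : ∀ b, 𝒜.vec bT bΩ b ∈ P := by
    intro b
    induction b using MvPolynomial.induction_on with
    | C a =>
      have := hA (-1) a _ h₁
      rw [opA_vec, show (-1 - (-1) : ℤ) = 0 by norm_num, dp_zero, mul_one] at this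
      exact this
    | add f g hf hg => rw [map_add]; exact add_mem hf hg
    | mul_X f i hf =>
      have := hE (-1 - i.2) (0, bΩ i.1) _ hf
      rw [opE_Ω_vec, show (-1 - (-1 - i.2) : ℤ) = i.2 by ring, inΩ_basis, dp_X, mul_comm] at this
      exact this
  suffices H : ∀ (n : ℕ) (L : Multiset (CreationIndex I)), Multiset.card L = n → ∀ b,
      Finsupp.single L b ∈ P by
    rw [eq_top_iff]
    rintro v -
    induction v using Finsupp.induction_linear with
    | zero => exact zero_mem _
    | add v w hv hw => exact add_mem hv hw
    | single L b => exact H _ L rfl b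
  intro n
  induction n with
  | zero =>
    intro L hL b
    rw [Multiset.card_eq_zero] at hL
    subst hL
    exact hv b
  | succ n ih =>
    intro L hL b
    obtain ⟨j, N, rfl, hj, hN⟩ := PBWData.exists_cons hL
    rw [← 𝒜.opE_creation_single bT bΩ hj]
    exact hE _ _ _ (ih N hN b)

/-- The Fock module as a representation of the generating modes. -/
noncomputable def fockRep : 𝒜.oneTruncated.ModeRep (𝒜.Fock bT bΩ) where
  a := 𝒜.opA bT bΩ
  e := 𝒜.opE bT bΩ
  D := 𝒜.opD bT bΩ
  one := 𝒜.vec bT bΩ 1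
  a_a := 𝒜.opA_opA bT bΩ
  e_a := 𝒜.opE_opA bT bΩ
  e_e := 𝒜.opE_opE bT bΩ
  D_a := 𝒜.opD_opA bT bΩ
  D_e := 𝒜.opD_opE bT bΩ
  a_one n x hn := by rw [opA_vec, 𝒜.dp_of_neg bΩ (by omega), zero_mul, map_zero]
  e_one n x hn := by rw [𝒜.opE_nonneg_vec bT bΩ hn, Derivation.map_one_eq_zero, map_zero]
  D_one := by rw [opD_vec, Derivation.map_one_eq_zero, map_zero]
  unit := by
    rw [opA_vec, show (-1 - (-1) : ℤ) = 0 by norm_num, dp_zero, C_1, mul_one]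
  e_del x := by
    refine (𝒜.opE_Ω_vec bT bΩ (-1) (𝒜.d x) 1).trans ?_
    rw [opA_vec, ← totalDer_C, dp_totalDer]
    norm_num
  a_mul x y := by
    rw [opA_vec, opA_vec, opA_vec, show (-1 - (-1) : ℤ) = 0 by norm_num, dp_zero, dp_zero, dp_zero,
      C_mul, mul_assoc]
  e_mul x y := by
    refine ((EvSum.single_zero (f := fun j : ℕ => 𝒜.opA bT bΩ (-1 - j) x
      (𝒜.opE bT bΩ (-1 + j) y (𝒜.vec bT bΩ 1))) fun j => ?_).conv (fun j => ?_) ?_).unique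
      (𝒜.normalProduct_A_E bT bΩ (-1) x y 1)
    · rw [𝒜.opE_nonneg_vec bT bΩ (by push_cast; omega), Derivation.map_one_eq_zero, map_zero,
        map_zero]
    · beta_reduce
      rw [𝒜.opA_vec bT bΩ j, 𝒜.dp_of_neg bΩ (by omega), zero_mul, map_zero, map_zero, add_zero]
    · simp
  generated := 𝒜.fock_generated bT bΩ

/-! ### Bounds for the action of modes -/

/-- The modes of `A` and `Ω`. -/
noncomputable def baseModes : Submodule k 𝒜.oneTruncated.Modes :=
  Submodule.span k ({x | ∃ n a, x = 𝒜.oneTruncated.modeA n a} ∪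
    {x | ∃ n ω, x = 𝒜.oneTruncated.modeE n ((0, ω) : T × Ω)})

theorem modeA_mem_baseModes (n : ℤ) (a : A) : 𝒜.oneTruncated.modeA n a ∈ 𝒜.baseModes :=
  Submodule.subset_span (Or.inl ⟨n, a, rfl⟩)

theorem modeE_mem_baseModes (n : ℤ) (ω : Ω) :
    𝒜.oneTruncated.modeE n ((0, ω) : T × Ω) ∈ 𝒜.baseModes :=
  Submodule.subset_span (Or.inr ⟨n, ω, rfl⟩)

theorem modeTop_baseModes {x : 𝒜.oneTruncated.Modes} (hx : x ∈ 𝒜.baseModes)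
    (b : MvPolynomial (Λ × ℕ) A) : 𝒜.modeTop bT bΩ x b = 0 := by
  induction hx using Submodule.span_induction with
  | mem x hx =>
    rcases hx with ⟨n, a, rfl⟩ | ⟨n, ω, rfl⟩
    · exact 𝒜.modeTop_A bT bΩ n a b
    · exact 𝒜.modeTop_Ω bT bΩ n ω b
  | zero => simp
  | add x y _ _ hx hy => rw [map_add, LinearMap.add_apply, hx, hy, add_zero]
  | smul c x _ hx => rw [map_smul, LinearMap.smul_apply, hx, smul_zero]

theorem lie_creation_mem_baseModes {x : 𝒜.oneTruncated.Modes} (hx : x ∈ 𝒜.baseModes)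
    (j : CreationIndex I) : 𝒜.oneTruncated.lie x (𝒜.creation bT j) ∈ 𝒜.baseModes := by
  induction hx using Submodule.span_induction with
  | mem x hx =>
    rcases hx with ⟨n, a, rfl⟩ | ⟨n, ω, rfl⟩
    · rw [creation, 𝒜.oneTruncated.lie_A_E]
      exact neg_mem (𝒜.modeA_mem_baseModes _ _)
    · rw [creation, 𝒜.oneTruncated.lie_E_E]
      refine add_mem ?_ (zsmul_mem (𝒜.modeA_mem_baseModes _ _) _)
      have : 𝒜.oneTruncated.br (0, ω) (bT j.gen, 0) =
          (0, (𝒜.bracket (0, ω) (bT j.gen, 0)).2) := by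
        change 𝒜.bracket _ _ = _
        ext <;> simp [bracket]
      rw [this]
      exact 𝒜.modeE_mem_baseModes _ _
  | zero => rw [map_zero]; exact zero_mem _
  | add x y _ _ hx hy => rw [map_add, LinearMap.add_apply]; exact add_mem hx hy
  | smul c x _ hx => rw [map_smul, LinearMap.smul_apply]; exact Submodule.smul_mem _ _ hx

/-- The span of the monomials of degree less than `d`. -/
noncomputable def fockLT (d : ℕ) : Submodule k (𝒜.Fock bT bΩ) :=
  Finsupp.supported _ k {L | Multiset.card L < d}

theorem fockLT_succ (d : ℕ) : 𝒜.fockLT bT bΩ (d + 1) = (𝒜.pbw bT bΩ).deg d := by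
  simp only [fockLT, PBWData.deg, Nat.lt_succ_iff]

theorem act_mem_fockLT (x : 𝒜.oneTruncated.Modes) {d : ℕ} {v : 𝒜.Fock bT bΩ}
    (hv : v ∈ 𝒜.fockLT bT bΩ d) : (𝒜.pbw bT bΩ).act x v ∈ 𝒜.fockLT bT bΩ (d + 1) := by
  rcases d with _ | d
  · have : v = 0 := by
      simpa [fockLT, Finsupp.supported_empty] using hv
    rw [this, map_zero]
    exact zero_mem _
  · rw [fockLT_succ] at hv ⊢
    exact (𝒜.pbw bT bΩ).act_mem_deg x hv

theorem act_baseModes_sub_mem {d : ℕ} {x : 𝒜.oneTruncated.Modes} (hx : x ∈ 𝒜.baseModes)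
    {L : Multiset (CreationIndex I)} (hL : Multiset.card L = d) (b : MvPolynomial (Λ × ℕ) A) :
    (𝒜.pbw bT bΩ).act x (Finsupp.single L b) -
      (Finsupp.single L (𝒜.modeBot bT bΩ x b) : 𝒜.Fock bT bΩ) ∈ 𝒜.fockLT bT bΩ d := by
  induction d generalizing x L b with
  | zero =>
    rw [Multiset.card_eq_zero] at hL
    subst hL
    have h := 𝒜.base_vec bT bΩ x b
    rw [𝒜.modeTop_baseModes bT bΩ hx, Finsupp.mapDomain_zero, add_zero] at h
    exact (sub_eq_zero.2 h) ▸ zero_mem _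
  | succ d ih =>
    obtain ⟨j, N, rfl, hj, hN⟩ := PBWData.exists_cons hL
    have h1 := 𝒜.act_mem_fockLT bT bΩ (𝒜.creation bT j) (ih hx hN b)
    have h2 := ih (𝒜.lie_creation_mem_baseModes bT hx j) hN b
    have h3 := (𝒜.pbw bT bΩ).act_single_cons hj x b
    have h4 := (𝒜.pbw bT bΩ).act_e_single hj (𝒜.modeBot bT bΩ x b)
    rw [map_sub] at h1
    have h5 : 𝒜.fockLT bT bΩ d ≤ 𝒜.fockLT bT bΩ (d + 1) :=
      Finsupp.supported_mono fun L (hL : _ < _) => Nat.lt_succ_of_lt hL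
    have h6 : (Finsupp.single N (𝒜.modeBot bT bΩ (𝒜.oneTruncated.lie x (𝒜.creation bT j)) b) :
        𝒜.Fock bT bΩ) ∈ 𝒜.fockLT bT bΩ (d + 1) :=
      Finsupp.single_mem_supported k _ (show Multiset.card N < d + 1 by omega)
    have h7 := add_mem h1 (add_mem (h5 h2) h6)
    rw [h3]
    change _ - (𝒜.pbw bT bΩ).act ((𝒜.pbw bT bΩ).e j) _ + _ ∈ _ at h7
    rw [h4, sub_add_cancel] at h7
    rw [add_sub_right_comm]
    exact h7

/-- Vectors of degree at most `i`, whose components of degree `i` have order at least `p - i`. -/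
noncomputable def fockFil (i p : ℕ) : Submodule k (𝒜.Fock bT bΩ) :=
  𝒜.fockLT bT bΩ i ⊔ Submodule.span k {v | ∃ (L : Multiset (CreationIndex I)) (b : _),
    Multiset.card L = i ∧ b ∈ idealOfVars (Λ × ℕ) A ^ (p - i) ∧ v = Finsupp.single L b}

theorem fockFil_induction {i p : ℕ} {S : Submodule k (𝒜.Fock bT bΩ)}
    (f : 𝒜.Fock bT bΩ →ₗ[k] 𝒜.Fock bT bΩ) (h₁ : ∀ v ∈ 𝒜.fockLT bT bΩ i, f v ∈ S)
    (h₂ : ∀ (L : Multiset (CreationIndex I)) b, Multiset.card L = i →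
      b ∈ idealOfVars (Λ × ℕ) A ^ (p - i) → f (Finsupp.single L b) ∈ S) :
    ∀ v ∈ 𝒜.fockFil bT bΩ i p, f v ∈ S := by
  suffices H : 𝒜.fockFil bT bΩ i p ≤ S.comap f from H
  refine sup_le h₁ (Submodule.span_le.2 ?_)
  rintro _ ⟨L, b, hL, hb, rfl⟩
  exact h₂ L b hL hb

theorem single_mem_fockFil {i p : ℕ} {L : Multiset (CreationIndex I)} (hL : Multiset.card L = i)
    {b : MvPolynomial (Λ × ℕ) A} (hb : b ∈ idealOfVars (Λ × ℕ) A ^ (p - i)) :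
    (Finsupp.single L b : 𝒜.Fock bT bΩ) ∈ 𝒜.fockFil bT bΩ i p :=
  Submodule.mem_sup_right (Submodule.subset_span ⟨L, b, hL, hb, rfl⟩)

theorem act_baseModes_mem_fockLT {x : 𝒜.oneTruncated.Modes} (hx : x ∈ 𝒜.baseModes) {i : ℕ}
    {v : 𝒜.Fock bT bΩ} (hv : v ∈ 𝒜.fockLT bT bΩ i) :
    (𝒜.pbw bT bΩ).act x v ∈ 𝒜.fockLT bT bΩ i := by
  rcases i with _ | i
  · have : v = 0 := by
      simpa [fockLT, Finsupp.supported_empty] using hv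
    rw [this, map_zero]
    exact zero_mem _
  · rw [fockLT_succ] at hv
    refine (𝒜.pbw bT bΩ).deg_induction
      (p := fun v => (𝒜.pbw bT bΩ).act x v ∈ 𝒜.fockLT bT bΩ (i + 1))
      (by rw [map_zero]; exact zero_mem _)
      (fun v w hv hw => by rw [map_add]; exact add_mem hv hw) (fun L b hL => ?_) hv
    have h := 𝒜.act_baseModes_sub_mem bT bΩ hx rfl b (L := L)
    have h2 : 𝒜.fockLT bT bΩ (Multiset.card L) ≤ 𝒜.fockLT bT bΩ (i + 1) :=
      Finsupp.supported_mono fun L' (hL' : Multiset.card L' < _) =>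
        show Multiset.card L' < i + 1 by omega
    have h3 := add_mem (h2 h)
      (Finsupp.single_mem_supported k (𝒜.modeBot bT bΩ x b) (show Multiset.card L < i + 1 by omega))
    rwa [sub_add_cancel] at h3

theorem act_baseModes_mem_fockFil {x : 𝒜.oneTruncated.Modes} (hx : x ∈ 𝒜.baseModes) {e : ℕ}
    (he : ∀ q, ∀ b ∈ idealOfVars (Λ × ℕ) A ^ q,
      𝒜.modeBot bT bΩ x b ∈ idealOfVars (Λ × ℕ) A ^ (q + e)) {i p : ℕ} :
    ∀ v ∈ 𝒜.fockFil bT bΩ i p, (𝒜.pbw bT bΩ).act x v ∈ 𝒜.fockFil bT bΩ i (p + e) := by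
  refine 𝒜.fockFil_induction bT bΩ _
    (fun v hv => Submodule.mem_sup_left (𝒜.act_baseModes_mem_fockLT bT bΩ hx hv))
    fun L b hL hb => ?_
  have h := add_mem (Submodule.mem_sup_left (𝒜.act_baseModes_sub_mem bT bΩ hx hL b))
    (𝒜.single_mem_fockFil bT bΩ hL (p := p + e) (Ideal.pow_le_pow_right (by omega) (he _ b hb)))
  rwa [sub_add_cancel] at h

theorem modeTop_mem_pow (x : 𝒜.oneTruncated.Modes) {q : ℕ} {b : MvPolynomial (Λ × ℕ) A}
    (hb : b ∈ idealOfVars (Λ × ℕ) A ^ q) (j : CreationIndex I) :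
    𝒜.modeTop bT bΩ x b j ∈ idealOfVars (Λ × ℕ) A ^ q := by
  induction x using 𝒜.oneTruncated.modes_induction with
  | add x y hx hy =>
    rw [map_add, LinearMap.add_apply, Finsupp.add_apply]
    exact add_mem hx hy
  | smul c x hx =>
    rw [map_smul, LinearMap.smul_apply, Finsupp.smul_apply]
    exact ((idealOfVars (Λ × ℕ) A ^ q).restrictScalars k).smul_mem c hx
  | hA n a => rw [modeTop_A]; exact zero_mem _
  | hE n y =>
    induction y using 𝒜.generator_induction bT with
    | add x y hx hy =>
      rw [map_add, map_add, LinearMap.add_apply, Finsupp.add_apply]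
      exact add_mem hx hy
    | hT g i =>
      rw [modeTop_gT, upper_apply, Finsupp.finsetSum_apply]
      refine sum_mem fun l _ => ?_
      rw [Finsupp.single_apply]
      split_ifs
      · exact Ideal.mul_mem_left _ _ hb
      · exact zero_mem _
    | hΩ ω => rw [modeTop_Ω]; exact zero_mem _
  | hD => rw [modeTop_D]; exact zero_mem _

theorem act_mem_fockFil (x : 𝒜.oneTruncated.Modes) {i p : ℕ} :
    ∀ v ∈ 𝒜.fockFil bT bΩ i p, (𝒜.pbw bT bΩ).act x v ∈ 𝒜.fockFil bT bΩ (i + 1) (p + 1) := by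
  refine 𝒜.fockFil_induction bT bΩ _
    (fun v hv => Submodule.mem_sup_left (𝒜.act_mem_fockLT bT bΩ x hv)) fun L b hL hb => ?_
  have h1 := (𝒜.pbw bT bΩ).act_sub_top_mem x L b
  rw [hL, ← fockLT_succ] at h1
  have h2 : (𝒜.pbw bT bΩ).top L x b ∈ 𝒜.fockFil bT bΩ (i + 1) (p + 1) := by
    rw [PBWData.top_apply, Finsupp.mapDomain]
    refine sum_mem fun j _ => 𝒜.single_mem_fockFil bT bΩ (by rw [Multiset.card_cons, hL]) ?_
    rw [show p + 1 - (i + 1) = p - i by omega]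
    exact 𝒜.modeTop_mem_pow bT bΩ x hb j
  have h := add_mem (Submodule.mem_sup_left h1) h2
  rwa [sub_add_cancel] at h

theorem coeff_eq_zero_of_mem_fockFil {i p : ℕ} {v : 𝒜.Fock bT bΩ}
    (hv : v ∈ 𝒜.fockFil bT bΩ i p) {N : Multiset (CreationIndex I)} {M : Λ × ℕ →₀ ℕ}
    (h : i < Multiset.card N ∨ (i = Multiset.card N ∧ Multiset.card N + M.degree < p)) :
    MvPolynomial.coeff M (v N) = 0 := by
  suffices H : 𝒜.fockFil bT bΩ i p ≤ LinearMap.ker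
      ((MvPolynomial.lcoeff A M).restrictScalars k ∘ₗ Finsupp.lapply N) from H hv
  refine sup_le (fun v hv => ?_) (Submodule.span_le.2 ?_)
  · have : v N = 0 := by
      by_contra h0
      have h2 : Multiset.card N < i := hv (Finsupp.mem_support_iff.2 h0)
      omega
    simp [this]
  · rintro _ ⟨L, b, hL, hb, rfl⟩
    rcases eq_or_ne L N with rfl | hN
    · have := (mem_pow_idealOfVars_iff' _ _).1 hb M (by omega)
      simpa using this
    · simp [Finsupp.single_eq_of_ne' hN]

end VertexAlgebroid

namespace VertexAlgebra

variable {k V : Type*} [CommRing k] [AddCommGroup V] [Module k V] (𝒱 : VertexAlgebra k V)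

theorem op_eventually_zero (x y : V) : ∃ N : ℤ, ∀ n ≥ N, 𝒱.op n x y = 0 := by
  have hV : ⨆ i, 𝒱.wt i = ⊤ := 𝒱.isInternal.submodule_iSup_eq_top
  have hx : x ∈ ⨆ i, 𝒱.wt i := hV ▸ Submodule.mem_top
  have hy : y ∈ ⨆ i, 𝒱.wt i := hV ▸ Submodule.mem_top
  induction hx using Submodule.iSup_induction' with
  | zero => exact ⟨0, fun n _ => by simp⟩
  | add x x' _ _ hx hx' =>
    obtain ⟨N, hN⟩ := hx
    obtain ⟨N', hN'⟩ := hx'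
    exact ⟨max N N', fun n hn => by
      rw [map_add, LinearMap.add_apply, hN n (le_of_max_le_left hn),
        hN' n (le_of_max_le_right hn), add_zero]⟩
  | mem i x hx =>
    induction hy using Submodule.iSup_induction' with
    | zero => exact ⟨0, fun n _ => by simp⟩
    | add y y' _ _ hy hy' =>
      obtain ⟨N, hN⟩ := hy
      obtain ⟨N', hN'⟩ := hy'
      exact ⟨max N N', fun n hn => by
        rw [map_add, hN n (le_of_max_le_left hn), hN' n (le_of_max_le_right hn), add_zero]⟩
    | mem j y hy => exact ⟨i + j, fun n hn => 𝒱.op_eq_zero hx hy (by omega)⟩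

theorem evSum_finsum {f : ℕ → V} (h : ∃ K : ℤ, ∀ j : ℕ, K ≤ j → f j = 0) :
    EvSum f (∑ᶠ j, f j) := by
  obtain ⟨K, hK⟩ := h
  have h2 := EvSum.of_eventually_zero (K := K.toNat) (f := f) fun j hj => hK j (by omega)
  rwa [h2.finsum_eq]

/-- The commutator formula. -/
theorem commutator (a b c : V) (m l : ℤ) :
    EvSum (fun j : ℕ => Ring.choose m j • 𝒱.op (m + l - j) (𝒱.op j a b) c)
      (𝒱.op m a (𝒱.op l b c) - 𝒱.op l b (𝒱.op m a c)) := by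
  have h := 𝒱.borcherds a b c m 0 l
  have h1 : EvSum (fun j : ℕ => ((-1 : ℤ) ^ j * Ring.choose (0 : ℤ) j) •
      (𝒱.op (m + 0 - j) a (𝒱.op (l + j) b c) -
        ((0 : ℤ).negOnePow : ℤ) • 𝒱.op (0 + l - j) b (𝒱.op (m + j) a c))) _ :=
    EvSum.single_zero fun j => by rw [Ring.choose_zero_succ, mul_zero, zero_smul]
  rw [h1.finsum_eq] at h
  obtain ⟨N, hN⟩ := 𝒱.op_eventually_zero a b
  have h2 := evSum_finsum (f := fun j : ℕ => Ring.choose m j •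
    𝒱.op (m + l - j) (𝒱.op (0 + j) a b) c) ⟨N, fun j hj => by
      rw [hN _ (by omega), map_zero, LinearMap.zero_apply, smul_zero]⟩
  rw [h] at h2
  exact h2.conv (fun j => by rw [zero_add]) (by simp)

/-- The associativity formula. -/
theorem associator (a b c : V) (n l : ℤ) :
    EvSum (fun j : ℕ => ((-1 : ℤ) ^ j * Ring.choose n j) • (𝒱.op (n - j) a (𝒱.op (l + j) b c) -
      (n.negOnePow : ℤ) • 𝒱.op (n + l - j) b (𝒱.op j a c))) (𝒱.op l (𝒱.op n a b) c) := by
  have h := 𝒱.borcherds a b c 0 n l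
  have h1 : EvSum (fun j : ℕ => Ring.choose (0 : ℤ) j •
      𝒱.op (0 + l - j) (𝒱.op (n + j) a b) c) _ :=
    EvSum.single_zero fun j => by rw [Ring.choose_zero_succ, zero_smul]
  rw [h1.finsum_eq] at h
  obtain ⟨N, hN⟩ := 𝒱.op_eventually_zero b c
  obtain ⟨N', hN'⟩ := 𝒱.op_eventually_zero a c
  have h2 := evSum_finsum (f := fun j : ℕ => ((-1 : ℤ) ^ j * Ring.choose n j) •
      (𝒱.op (0 + n - j) a (𝒱.op (l + j) b c) -
        (n.negOnePow : ℤ) • 𝒱.op (n + l - j) b (𝒱.op (0 + j) a c)))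
    ⟨max (N - l) N', fun j hj => by
      rw [hN _ (by omega), hN' _ (by omega), map_zero, map_zero, smul_zero, sub_zero, smul_zero]⟩
  rw [← h] at h2
  exact h2.conv (fun j => by rw [zero_add, zero_add]) (by simp)

theorem der_apply (j : ℕ) (x : V) : 𝒱.der j x = 𝒱.op (-1 - j) x 𝒱.vac := rfl

theorem der_zero (x : V) : 𝒱.der 0 x = x := by
  rw [der_apply, Nat.cast_zero, sub_zero, 𝒱.op_vac]

theorem der_mem {n : ℕ} {x : V} (hx : x ∈ 𝒱.wt n) (j : ℕ) : 𝒱.der j x ∈ 𝒱.wt (n + j) :=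
  𝒱.op_mem hx 𝒱.vac_mem (by push_cast; ring)

theorem op_der (j : ℕ) (x y : V) : 𝒱.op (-1) (𝒱.der j x) y = 𝒱.op (-1 - j) x y := by
  have h := 𝒱.associator x 𝒱.vac y (-1 - j) (-1)
  have h1 : EvSum (fun i : ℕ => ((-1 : ℤ) ^ i * Ring.choose (-1 - (j : ℤ)) i) •
      (𝒱.op (-1 - j - i) x (𝒱.op (-1 + i) 𝒱.vac y) - ((-1 - (j : ℤ)).negOnePow : ℤ) •
        𝒱.op (-1 - j + -1 - i) 𝒱.vac (𝒱.op i x y))) _ :=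
    EvSum.single_zero fun i => by
      rw [𝒱.vac_op, if_neg (by push_cast; omega), 𝒱.vac_op, if_neg (by push_cast; omega), map_zero,
        smul_zero, sub_zero, smul_zero]
  rw [der_apply, h.unique h1, 𝒱.vac_op, 𝒱.vac_op, if_pos (by simp), if_neg (by push_cast; omega)]
  simp

theorem op_nonneg_vac {n : ℤ} (hn : 0 ≤ n) (x : V) : 𝒱.op n x 𝒱.vac = 0 :=
  𝒱.op_vac_of_nonneg n x hn

theorem negOnePow_mul_choose (i j : ℕ) :
    (-1 : ℤ) ^ i * Ring.choose (-1 - (j : ℤ)) i = (i + j).choose i := by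
  have h := Ring.choose_neg (R := ℤ) (j + 1) i
  rw [show -((j : ℤ) + 1) = -1 - j by ring, show (j : ℤ) + 1 + i - 1 = (i + j : ℕ) by
    push_cast; ring, Ring.choose_natCast, Units.smul_def, Int.coe_negOnePow_natCast,
    smul_eq_mul] at h
  rw [h, ← mul_assoc, ← mul_pow]
  simp

theorem der_der (i j : ℕ) (x : V) : 𝒱.der i (𝒱.der j x) = (i + j).choose i • 𝒱.der (i + j) x := by
  have h := 𝒱.associator x 𝒱.vac 𝒱.vac (-1 - j) (-1 - i)
  have h1 : EvSum (fun l : ℕ => if l = i then (i + j).choose i • 𝒱.der (i + j) x else 0)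
      ((i + j).choose i • 𝒱.der (i + j) x) := ⟨i + 1, fun K hK => by
    rw [Finset.sum_ite_eq' , if_pos (Finset.mem_range.2 (by omega))]⟩
  refine h.unique (h1.congr fun l => ?_)
  rw [𝒱.op_nonneg_vac (n := l) (by omega), map_zero, smul_zero, sub_zero, 𝒱.vac_op]
  rcases eq_or_ne l i with rfl | hl
  · rw [if_pos rfl, if_pos (by omega), negOnePow_mul_choose, natCast_zsmul, der_apply]
    congr 3
    push_cast; ring_nf
  · rw [if_neg hl, if_neg (by omega), map_zero, smul_zero]

theorem der_op (n : ℕ) (x y : V) : 𝒱.der n (𝒱.op (-1) x y) =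
    ∑ p ∈ Finset.HasAntidiagonal.antidiagonal n, 𝒱.op (-1) (𝒱.der p.1 x) (𝒱.der p.2 y) := by
  have h := 𝒱.associator x y 𝒱.vac (-1) (-1 - n)
  rw [Finset.Nat.sum_antidiagonal_eq_sum_range_succ_mk]
  refine h.unique ((EvSum.of_eventually_zero (K := n + 1) fun j hj => ?_).conv (fun j => rfl) ?_)
  · rw [𝒱.op_nonneg_vac (n := j) (by omega), 𝒱.op_nonneg_vac (n := -1 - n + j) (by omega), map_zero,
      map_zero, smul_zero, sub_zero, smul_zero]
  · refine Finset.sum_congr rfl fun j hj => ?_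
    have hj' := Finset.mem_range.1 hj
    have hc := negOnePow_mul_choose j 0
    rw [Nat.cast_zero, sub_zero, add_zero, Nat.choose_self] at hc
    rw [𝒱.op_nonneg_vac (n := j) (by omega), map_zero, smul_zero, sub_zero, hc, op_der, der_apply,
      Nat.cast_one, one_smul]
    congr 2
    push_cast [Nat.lt_succ_iff.1 hj']; ring_nf

end VertexAlgebra

namespace VertexAlgebroid

open Envelope

section

variable {k A T Ω : Type*} [CommRing k] [Invertible (2 : k)]
    [CommRing A] [Algebra k A]
    [LieRing T] [LieAlgebra k T] [Module A T] [LieRingModule T A] [LieRinehartRing A T]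
    [LieRinehartAlgebra k A T]
    [AddCommGroup Ω] [Module k Ω] [Module A Ω] [IsScalarTower k A Ω]
    [LieRingModule T Ω] [LieModule k T Ω]
    (𝒜 : VertexAlgebroid k A T Ω)

/-! ### Commutation relations in the vertex envelope -/

theorem op_gen₀_gen₀ (m l : ℤ) (a b : A) (u : 𝒜.Envelope) :
    (vertexAlgebra 𝒜).op m (gen₀ 𝒜 a) ((vertexAlgebra 𝒜).op l (gen₀ 𝒜 b) u) =
      (vertexAlgebra 𝒜).op l (gen₀ 𝒜 b) ((vertexAlgebra 𝒜).op m (gen₀ 𝒜 a) u) := by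
  refine sub_eq_zero.1 (((vertexAlgebra 𝒜).commutator _ _ _ m l).unique
    (EvSum.zero.congr fun j => ?_))
  rw [(vertexAlgebra 𝒜).op_eq_zero ((isTruncatedHom_gen 𝒜).mem₀ a) ((isTruncatedHom_gen 𝒜).mem₀ b)
    (by push_cast; omega), map_zero, LinearMap.zero_apply, smul_zero]

theorem op_gen₁_gen₀ (m l : ℤ) (x : T × Ω) (a : A) (u : 𝒜.Envelope) :
    (vertexAlgebra 𝒜).op m (gen₁ 𝒜 x) ((vertexAlgebra 𝒜).op l (gen₀ 𝒜 a) u) =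
      (vertexAlgebra 𝒜).op l (gen₀ 𝒜 a) ((vertexAlgebra 𝒜).op m (gen₁ 𝒜 x) u) +
        (vertexAlgebra 𝒜).op (m + l) (gen₀ 𝒜 (𝒜.act x a)) u := by
  rw [← sub_eq_iff_eq_add']
  refine ((vertexAlgebra 𝒜).commutator _ _ _ m l).unique
    ((EvSum.single_zero fun j => ?_).conv (fun j => rfl) ?_)
  · rw [(vertexAlgebra 𝒜).op_eq_zero ((isTruncatedHom_gen 𝒜).mem₁ x)
      ((isTruncatedHom_gen 𝒜).mem₀ a) (by push_cast; omega), map_zero, LinearMap.zero_apply,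
      smul_zero]
  · rw [Nat.cast_zero, (isTruncatedHom_gen 𝒜).map_act]
    simp

theorem op_gen₁_gen₁ (m l : ℤ) (x y : T × Ω) (u : 𝒜.Envelope) :
    (vertexAlgebra 𝒜).op m (gen₁ 𝒜 x) ((vertexAlgebra 𝒜).op l (gen₁ 𝒜 y) u) =
      (vertexAlgebra 𝒜).op l (gen₁ 𝒜 y) ((vertexAlgebra 𝒜).op m (gen₁ 𝒜 x) u) +
        ((vertexAlgebra 𝒜).op (m + l) (gen₁ 𝒜 (𝒜.bracket x y)) u +
          m • (vertexAlgebra 𝒜).op (m + l - 1) (gen₀ 𝒜 (𝒜.form x y)) u) := by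
  rw [← sub_eq_iff_eq_add']
  refine ((vertexAlgebra 𝒜).commutator _ _ _ m l).unique
    ((EvSum.of_succ (EvSum.single_zero fun j => ?_)).conv (fun j => rfl) ?_)
  · rw [(vertexAlgebra 𝒜).op_eq_zero ((isTruncatedHom_gen 𝒜).mem₁ x)
      ((isTruncatedHom_gen 𝒜).mem₁ y) (by push_cast; omega), map_zero, LinearMap.zero_apply,
      smul_zero]
  · rw [Nat.cast_zero, zero_add, Nat.cast_one, (isTruncatedHom_gen 𝒜).map_bracket,
      (isTruncatedHom_gen 𝒜).map_form]
    simp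

/-! ### Monomials -/

variable {𝒜}

theorem IsMonomial.op_A₀ {i p : ℕ} {u : 𝒜.Envelope} (h : 𝒜.IsMonomial i p u) (a : A) :
    𝒜.IsMonomial i p ((vertexAlgebra 𝒜).op (-1) (gen₀ 𝒜 a) u) := .letter_A₀ i p a u h

theorem IsMonomial.op_A {i p : ℕ} {u : 𝒜.Envelope} (h : 𝒜.IsMonomial i p u) (j : ℕ) (a : A) :
    𝒜.IsMonomial i (p + 1) ((vertexAlgebra 𝒜).op (-1 - (j + 1 : ℕ)) (gen₀ 𝒜 a) u) := by
  rw [← VertexAlgebra.op_der]; exact .letter_A i p j a u h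

theorem IsMonomial.op_Ω {i p : ℕ} {u : 𝒜.Envelope} (h : 𝒜.IsMonomial i p u) (j : ℕ) (ω : Ω) :
    𝒜.IsMonomial i (p + 1) ((vertexAlgebra 𝒜).op (-1 - j) (gen₁ 𝒜 (0, ω)) u) := by
  rw [← VertexAlgebra.op_der]; exact .letter_Ω i p j ω u h

theorem IsMonomial.op_T {i p : ℕ} {u : 𝒜.Envelope} (h : 𝒜.IsMonomial i p u) (j : ℕ) (τ : T) :
    𝒜.IsMonomial (i + 1) (p + 1) ((vertexAlgebra 𝒜).op (-1 - j) (gen₁ 𝒜 (τ, 0)) u) := by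
  rw [← VertexAlgebra.op_der]; exact .letter_T i p j τ u h

/-- Induction over monomials, written in terms of the modes of the generators. -/
theorem IsMonomial.mode_induction {P : ℕ → 𝒜.Envelope → Prop}
    (vac : P 0 (vertexAlgebra 𝒜).vac)
    (hA : ∀ i (j : ℕ) a u, P i u → P i ((vertexAlgebra 𝒜).op (-1 - j) (gen₀ 𝒜 a) u))
    (hΩ : ∀ i (j : ℕ) ω u, P i u → P i ((vertexAlgebra 𝒜).op (-1 - j) (gen₁ 𝒜 (0, ω)) u))
    (hT : ∀ i (j : ℕ) τ u, P i u → P (i + 1) ((vertexAlgebra 𝒜).op (-1 - j) (gen₁ 𝒜 (τ, 0)) u))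
    {i p : ℕ} {u : 𝒜.Envelope} (h : 𝒜.IsMonomial i p u) : P i u := by
  induction h with
  | vac => exact vac
  | letter_A₀ i p a u _ ih => simpa using hA i 0 a u ih
  | letter_A i p j a u _ ih => rw [VertexAlgebra.op_der]; exact hA i (j + 1) a u ih
  | letter_Ω i p j a u _ ih => rw [VertexAlgebra.op_der]; exact hΩ i j a u ih
  | letter_T i p j a u _ ih => rw [VertexAlgebra.op_der]; exact hT i j a u ih

variable (𝒜)

/-! ### The filtration `F` -/

/-- The filtration `F`, indexed by integers. -/
noncomputable def filZ (i : ℤ) : Submodule k 𝒜.Envelope :=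
  Submodule.span k {u | ∃ i' p : ℕ, (i' : ℤ) ≤ i ∧ 𝒜.IsMonomial i' p u}

theorem filF_eq (i : ℕ) : 𝒜.filF i = 𝒜.filZ i := by
  refine congrArg _ (Set.ext fun u => ⟨?_, ?_⟩)
  · rintro ⟨i', h, p, hu⟩; exact ⟨i', p, by exact_mod_cast h, hu⟩
  · rintro ⟨i', p, h, hu⟩; exact ⟨i', by exact_mod_cast h, p, hu⟩

theorem filZ_neg {i : ℤ} (hi : i < 0) : 𝒜.filZ i = ⊥ := by
  rw [filZ, Submodule.span_eq_bot]
  rintro u ⟨i', p, h, -⟩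
  omega

theorem filF'_eq (i : ℕ) : 𝒜.filF' i = 𝒜.filZ (i - 1) := by
  rcases i with _ | i
  · rw [𝒜.filZ_neg (by norm_num)]; rfl
  · rw [filF', filF_eq]; congr 1; push_cast; ring

variable {𝒜}

theorem filZ_mono {i j : ℤ} (h : i ≤ j) : 𝒜.filZ i ≤ 𝒜.filZ j :=
  Submodule.span_mono fun _ ⟨i', p, h', hu⟩ => ⟨i', p, h'.trans h, hu⟩

theorem IsMonomial.mem_filZ {i p : ℕ} {u : 𝒜.Envelope} (h : 𝒜.IsMonomial i p u) {j : ℤ}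
    (hj : i ≤ j) : u ∈ 𝒜.filZ j := Submodule.subset_span ⟨i, p, hj, h⟩

theorem filZ_map (f : 𝒜.Envelope →ₗ[k] 𝒜.Envelope) (S : Submodule k 𝒜.Envelope) {i : ℤ}
    (h : ∀ (i' p : ℕ) u, (i' : ℤ) ≤ i → 𝒜.IsMonomial i' p u → f u ∈ S) :
    ∀ u ∈ 𝒜.filZ i, f u ∈ S := by
  suffices H : 𝒜.filZ i ≤ S.comap f from H
  exact Submodule.span_le.2 fun u ⟨i', p, hi, hu⟩ => h i' p u hi hu

theorem neg_A_mem {n : ℤ} (hn : n < 0) (a : A) {i : ℤ} : ∀ u ∈ 𝒜.filZ i,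
    (vertexAlgebra 𝒜).op n (gen₀ 𝒜 a) u ∈ 𝒜.filZ i := by
  refine filZ_map _ _ fun i' p u hi hu => ?_
  obtain ⟨j, rfl⟩ : ∃ j : ℕ, n = -1 - j := ⟨(-1 - n).toNat, by omega⟩
  rcases j with _ | j
  · simpa using (hu.op_A₀ a).mem_filZ hi
  · exact (hu.op_A j a).mem_filZ hi

theorem neg_Ω_mem {n : ℤ} (hn : n < 0) (ω : Ω) {i : ℤ} : ∀ u ∈ 𝒜.filZ i,
    (vertexAlgebra 𝒜).op n (gen₁ 𝒜 (0, ω)) u ∈ 𝒜.filZ i := by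
  refine filZ_map _ _ fun i' p u hi hu => ?_
  obtain ⟨j, rfl⟩ : ∃ j : ℕ, n = -1 - j := ⟨(-1 - n).toNat, by omega⟩
  exact (hu.op_Ω j ω).mem_filZ hi

theorem neg_E_mem {n : ℤ} (hn : n < 0) (x : T × Ω) {i j : ℤ} (hj : i + 1 = j) : ∀ u ∈ 𝒜.filZ i,
    (vertexAlgebra 𝒜).op n (gen₁ 𝒜 x) u ∈ 𝒜.filZ j := by
  subst hj
  intro u hu
  have e : x = (x.1, 0) + (0, x.2) := by simp
  rw [e, map_add, map_add, LinearMap.add_apply]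
  refine add_mem ?_ (filZ_mono (by omega) (neg_Ω_mem hn x.2 u hu))
  revert u
  refine filZ_map _ _ fun i' p u hi hu => ?_
  obtain ⟨j, rfl⟩ : ∃ j : ℕ, n = -1 - j := ⟨(-1 - n).toNat, by omega⟩
  exact (hu.op_T j x.1).mem_filZ (by push_cast; omega)

/-- Bounds for the action of the modes of the generators on `u`. -/
def ModeBounds (𝒜 : VertexAlgebroid k A T Ω) (i : ℕ) (u : 𝒜.Envelope) : Prop :=
  u ∈ 𝒜.filZ i ∧ ∀ n : ℤ, 0 ≤ n →
    (∀ a, (vertexAlgebra 𝒜).op n (gen₀ 𝒜 a) u ∈ 𝒜.filZ (i - 1)) ∧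
    (∀ ω, (vertexAlgebra 𝒜).op n (gen₁ 𝒜 (0, ω)) u ∈ 𝒜.filZ (i - 1)) ∧
    ∀ x, (vertexAlgebra 𝒜).op n (gen₁ 𝒜 x) u ∈ 𝒜.filZ i

theorem IsMonomial.nonneg_mem {i p : ℕ} {u : 𝒜.Envelope} (h : 𝒜.IsMonomial i p u) :
    ∀ n : ℤ, 0 ≤ n → (∀ a, (vertexAlgebra 𝒜).op n (gen₀ 𝒜 a) u ∈ 𝒜.filZ (i - 1)) ∧
      (∀ ω, (vertexAlgebra 𝒜).op n (gen₁ 𝒜 (0, ω)) u ∈ 𝒜.filZ (i - 1)) ∧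
      ∀ x, (vertexAlgebra 𝒜).op n (gen₁ 𝒜 x) u ∈ 𝒜.filZ i := by
  suffices H : 𝒜.ModeBounds i u from H.2
  have hA' : ∀ {i : ℕ} {u : 𝒜.Envelope}, 𝒜.ModeBounds i u → ∀ n : ℤ,
      (∀ a, (vertexAlgebra 𝒜).op n (gen₀ 𝒜 a) u ∈ 𝒜.filZ i) ∧
      (∀ ω, (vertexAlgebra 𝒜).op n (gen₁ 𝒜 (0, ω)) u ∈ 𝒜.filZ i) ∧
      ∀ x, (vertexAlgebra 𝒜).op n (gen₁ 𝒜 x) u ∈ 𝒜.filZ (i + 1) := by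
    intro i u ⟨hu, h⟩ n
    rcases lt_or_ge n 0 with hn | hn
    · exact ⟨fun a => neg_A_mem hn a u hu, fun ω => neg_Ω_mem hn ω u hu,
        fun x => neg_E_mem hn x rfl u hu⟩
    · obtain ⟨h1, h2, h3⟩ := h n hn
      exact ⟨fun a => filZ_mono (by omega) (h1 a), fun a => filZ_mono (by omega) (h2 a),
        fun a => filZ_mono (by omega) (h3 a)⟩
  have act_Ω : ∀ (ω : Ω) (a : A), 𝒜.act ((0, ω) : T × Ω) a = 0 := fun ω a => by simp [act]
  have br_Ω : ∀ (x : T × Ω) (ω : Ω), ∃ ω', 𝒜.bracket x (0, ω) = (0, ω') := fun x ω =>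
    ⟨(𝒜.bracket x (0, ω)).2, by ext <;> simp [bracket]⟩
  have Ω_br : ∀ (x : T × Ω) (ω : Ω), ∃ ω', 𝒜.bracket (0, ω) x = (0, ω') := fun x ω =>
    ⟨(𝒜.bracket (0, ω) x).2, by ext <;> simp [bracket]⟩
  have br_ΩΩ : ∀ ω ω' : Ω, 𝒜.bracket ((0, ω) : T × Ω) (0, ω') = 0 := fun ω ω' => by
    ext <;> simp [bracket]
  have form_ΩΩ : ∀ ω ω' : Ω, 𝒜.form ((0, ω) : T × Ω) (0, ω') = 0 := fun ω ω' => by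
    simp [form]
  refine h.mode_induction (P := fun i u => 𝒜.ModeBounds i u) ?_ ?_ ?_ ?_
  · refine ⟨IsMonomial.vac.mem_filZ le_rfl, fun n hn => ⟨fun a => ?_, fun a => ?_, fun a => ?_⟩⟩ <;>
    · rw [VertexAlgebra.op_nonneg_vac _ hn]; exact zero_mem _
  · intro i j b u ih
    have hj : -1 - (j : ℤ) < 0 := by omega
    have all := hA' ih
    refine ⟨neg_A_mem hj _ _ ih.1, fun n hn => ⟨fun a => ?_, fun ω => ?_, fun x => ?_⟩⟩
    · rw [op_gen₀_gen₀]
      exact neg_A_mem hj _ _ ((ih.2 n hn).1 a)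
    · rw [op_gen₁_gen₀, act_Ω, map_zero, map_zero, LinearMap.zero_apply, add_zero]
      exact neg_A_mem hj _ _ ((ih.2 n hn).2.1 ω)
    · rw [op_gen₁_gen₀]
      exact add_mem (neg_A_mem hj _ _ ((ih.2 n hn).2.2 x)) ((all _).1 _)
  · intro i j ω' u ih
    have hj : -1 - (j : ℤ) < 0 := by omega
    have all := hA' ih
    refine ⟨neg_Ω_mem hj _ _ ih.1, fun n hn => ⟨fun a => ?_, fun ω => ?_, fun x => ?_⟩⟩
    · have := op_gen₁_gen₀ 𝒜 (-1 - j) n (0, ω') a u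
      rw [act_Ω, map_zero, map_zero, LinearMap.zero_apply, add_zero] at this
      rw [← this]
      exact neg_Ω_mem hj _ _ ((ih.2 n hn).1 a)
    · rw [op_gen₁_gen₁, br_ΩΩ, form_ΩΩ, map_zero, map_zero, map_zero, map_zero,
        LinearMap.zero_apply, smul_zero, add_zero, add_zero]
      exact neg_Ω_mem hj _ _ ((ih.2 n hn).2.1 ω)
    · obtain ⟨ω'', h⟩ := br_Ω x ω'
      rw [op_gen₁_gen₁, h]
      exact add_mem (neg_Ω_mem hj _ _ ((ih.2 n hn).2.2 x))
        (add_mem ((all _).2.1 _) (zsmul_mem ((all _).1 _) _))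
  · intro i j τ u ih
    have hj : -1 - (j : ℤ) < 0 := by omega
    have all := hA' ih
    rw [ModeBounds]
    push_cast
    rw [add_sub_cancel_right]
    refine ⟨neg_E_mem hj _ rfl _ ih.1, fun n hn => ⟨fun a => ?_, fun ω => ?_, fun x => ?_⟩⟩
    · have := op_gen₁_gen₀ 𝒜 (-1 - j) n (τ, 0) a u
      rw [← sub_eq_iff_eq_add] at this
      rw [← this]
      exact sub_mem (neg_E_mem hj _ (by ring) _ ((ih.2 n hn).1 a)) ((all _).1 _)
    · obtain ⟨ω'', h⟩ := Ω_br (τ, 0) ω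
      rw [op_gen₁_gen₁, h]
      exact add_mem (neg_E_mem hj _ (by ring) _ ((ih.2 n hn).2.1 ω))
        (add_mem ((all _).2.1 _) (zsmul_mem ((all _).1 _) _))
    · rw [op_gen₁_gen₁]
      exact add_mem (neg_E_mem hj _ rfl _ ((ih.2 n hn).2.2 x))
        (add_mem ((all _).2.2 _) (zsmul_mem (filZ_mono (by omega) ((all _).1 _)) _))

theorem nonneg_A_mem {n : ℤ} (hn : 0 ≤ n) (a : A) {i : ℤ} : ∀ u ∈ 𝒜.filZ i,
    (vertexAlgebra 𝒜).op n (gen₀ 𝒜 a) u ∈ 𝒜.filZ (i - 1) :=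
  filZ_map _ _ fun _ _ _ hi hu => filZ_mono (by omega) ((hu.nonneg_mem n hn).1 a)

theorem nonneg_Ω_mem {n : ℤ} (hn : 0 ≤ n) (ω : Ω) {i : ℤ} : ∀ u ∈ 𝒜.filZ i,
    (vertexAlgebra 𝒜).op n (gen₁ 𝒜 (0, ω)) u ∈ 𝒜.filZ (i - 1) :=
  filZ_map _ _ fun _ _ _ hi hu => filZ_mono (by omega) ((hu.nonneg_mem n hn).2.1 ω)

theorem nonneg_E_mem {n : ℤ} (hn : 0 ≤ n) (x : T × Ω) {i : ℤ} : ∀ u ∈ 𝒜.filZ i,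
    (vertexAlgebra 𝒜).op n (gen₁ 𝒜 x) u ∈ 𝒜.filZ i :=
  filZ_map _ _ fun _ _ _ hi hu => filZ_mono (by omega) ((hu.nonneg_mem n hn).2.2 x)

/-- `x` has degree at most `d` as an operator for the filtration `F`. -/
def HasOpDegree (𝒜 : VertexAlgebroid k A T Ω) (d : ℤ) (x : 𝒜.Envelope) : Prop :=
  ∀ (n j : ℤ), ∀ v ∈ 𝒜.filZ j, (vertexAlgebra 𝒜).op n x v ∈ 𝒜.filZ (d + j) ∧
    (0 ≤ n → (vertexAlgebra 𝒜).op n x v ∈ 𝒜.filZ (d + j - 1))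

theorem hasOpDegree_gen₀ (a : A) : 𝒜.HasOpDegree 0 (gen₀ 𝒜 a) := by
  intro n j v hv
  rw [zero_add]
  refine ⟨?_, fun hn => nonneg_A_mem hn a v hv⟩
  rcases lt_or_ge n 0 with hn | hn
  · exact neg_A_mem hn a v hv
  · exact filZ_mono (by omega) (nonneg_A_mem hn a v hv)

theorem hasOpDegree_Ω (ω : Ω) : 𝒜.HasOpDegree 0 (gen₁ 𝒜 (0, ω)) := by
  intro n j v hv
  rw [zero_add]
  refine ⟨?_, fun hn => nonneg_Ω_mem hn ω v hv⟩
  rcases lt_or_ge n 0 with hn | hn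
  · exact neg_Ω_mem hn ω v hv
  · exact filZ_mono (by omega) (nonneg_Ω_mem hn ω v hv)

theorem hasOpDegree_gen₁ (x : T × Ω) : 𝒜.HasOpDegree 1 (gen₁ 𝒜 x) := by
  intro n j v hv
  rw [add_sub_cancel_left]
  refine ⟨?_, fun hn => nonneg_E_mem hn x v hv⟩
  rcases lt_or_ge n 0 with hn | hn
  · exact neg_E_mem hn x (add_comm _ _) v hv
  · exact filZ_mono (by omega) (nonneg_E_mem hn x v hv)

theorem hasOpDegree_vac : 𝒜.HasOpDegree 0 (vertexAlgebra 𝒜).vac := by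
  rw [← (isTruncatedHom_gen 𝒜).map_one]; exact hasOpDegree_gen₀ 1

theorem HasOpDegree.op {d e : ℤ} {x y : 𝒜.Envelope} (hx : 𝒜.HasOpDegree d x)
    (hy : 𝒜.HasOpDegree e y) (m : ℤ) : 𝒜.HasOpDegree (d + e) ((vertexAlgebra 𝒜).op m x y) := by
  intro n j v hv
  constructor
  · refine ((vertexAlgebra 𝒜).associator x y v m n).mem (𝒜.filZ (d + e + j)) fun i =>
      zsmul_mem (sub_mem ?_ (zsmul_mem ?_ _)) _
    · rw [add_assoc]
      exact (hx _ _ _ (hy _ _ _ hv).1).1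
    · rw [add_comm d e, add_assoc]
      exact (hy _ _ _ (hx _ _ _ hv).1).1
  · intro hn
    refine ((vertexAlgebra 𝒜).associator x y v m n).mem (𝒜.filZ (d + e + j - 1)) fun i =>
      zsmul_mem (sub_mem ?_ (zsmul_mem ?_ _)) _
    · have := (hx (m - i) _ _ ((hy (n + i) _ _ hv).2 (by omega))).1
      rwa [show d + (e + j - 1) = d + e + j - 1 by ring] at this
    · have := (hy (m + n - i) _ _ ((hx i _ _ hv).2 (by omega))).1
      rwa [show e + (d + j - 1) = d + e + j - 1 by ring] at this

theorem HasOpDegree.mono {d e : ℤ} {x : 𝒜.Envelope} (hx : 𝒜.HasOpDegree d x) (h : d ≤ e) :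
    𝒜.HasOpDegree e x := fun n j v hv =>
  ⟨filZ_mono (by omega) (hx n j v hv).1, fun hn => filZ_mono (by omega) ((hx n j v hv).2 hn)⟩

theorem hasOpDegree_of_mem {i : ℤ} : ∀ u ∈ 𝒜.filZ i, 𝒜.HasOpDegree i u := by
  suffices H : 𝒜.filZ i ≤
    { carrier := {u | 𝒜.HasOpDegree i u}
      add_mem' := fun {x y} hx hy n j v hv => by
        rw [map_add, LinearMap.add_apply]
        exact ⟨add_mem (hx n j v hv).1 (hy n j v hv).1,
          fun hn => add_mem ((hx n j v hv).2 hn) ((hy n j v hv).2 hn)⟩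
      zero_mem' := fun n j v hv => by
        rw [map_zero, LinearMap.zero_apply]
        exact ⟨zero_mem _, fun _ => zero_mem _⟩
      smul_mem' := fun c x hx n j v hv => by
        rw [map_smul, LinearMap.smul_apply]
        exact ⟨Submodule.smul_mem _ _ (hx n j v hv).1,
          fun hn => Submodule.smul_mem _ _ ((hx n j v hv).2 hn)⟩ } from H
  refine Submodule.span_le.2 ?_
  rintro u ⟨i', p, hi, hu⟩
  refine HasOpDegree.mono (d := i') ?_ hi
  clear hi
  refine hu.mode_induction (P := fun i u => 𝒜.HasOpDegree i u) hasOpDegree_vac ?_ ?_ ?_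
  · intro i j a u ih
    simpa using (hasOpDegree_gen₀ a).op ih (-1 - j)
  · intro i j a u ih
    simpa using (hasOpDegree_Ω a).op ih (-1 - j)
  · intro i j a u ih
    simpa [add_comm] using (hasOpDegree_gen₁ (a, 0)).op ih (-1 - j)

theorem op_mem_filZ (n : ℤ) {i j : ℤ} {u v : 𝒜.Envelope} (hu : u ∈ 𝒜.filZ i)
    (hv : v ∈ 𝒜.filZ j) : (vertexAlgebra 𝒜).op n u v ∈ 𝒜.filZ (i + j) :=
  (hasOpDegree_of_mem u hu n j v hv).1

theorem op_nonneg_mem_filZ {n : ℤ} (hn : 0 ≤ n) {i j : ℤ} {u v : 𝒜.Envelope} (hu : u ∈ 𝒜.filZ i)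
    (hv : v ∈ 𝒜.filZ j) : (vertexAlgebra 𝒜).op n u v ∈ 𝒜.filZ (i + j - 1) :=
  (hasOpDegree_of_mem u hu n j v hv).2 hn

theorem vac_mem_filZ : (vertexAlgebra 𝒜).vac ∈ 𝒜.filZ 0 := IsMonomial.vac.mem_filZ le_rfl

theorem op_comm_mem_filZ {i j : ℤ} {u v : 𝒜.Envelope} (hu : u ∈ 𝒜.filZ i) (hv : v ∈ 𝒜.filZ j) :
    (vertexAlgebra 𝒜).op (-1) u v - (vertexAlgebra 𝒜).op (-1) v u ∈ 𝒜.filZ (i + j - 1) := by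
  have h := (vertexAlgebra 𝒜).commutator u v (vertexAlgebra 𝒜).vac (-1) (-1)
  rw [VertexAlgebra.op_vac, VertexAlgebra.op_vac] at h
  refine h.mem (𝒜.filZ (i + j - 1)) fun l => zsmul_mem ?_ _
  simpa using op_mem_filZ (-1 + -1 - l) (op_nonneg_mem_filZ (n := l) (by omega) hu hv) vac_mem_filZ

theorem op_assoc_mem_filZ {i j l : ℤ} {u v w : 𝒜.Envelope} (hu : u ∈ 𝒜.filZ i)
    (hv : v ∈ 𝒜.filZ j) (hw : w ∈ 𝒜.filZ l) :
    (vertexAlgebra 𝒜).op (-1) ((vertexAlgebra 𝒜).op (-1) u v) w -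
      (vertexAlgebra 𝒜).op (-1) u ((vertexAlgebra 𝒜).op (-1) v w) ∈ 𝒜.filZ (i + j + l - 1) := by
  have h := (vertexAlgebra 𝒜).associator u v w (-1) (-1)
  have key : ∀ m : ℕ, (vertexAlgebra 𝒜).op (-1 + -1 - m) v ((vertexAlgebra 𝒜).op m u w) ∈
      𝒜.filZ (i + j + l - 1) := fun m => by
    have := op_mem_filZ (-1 + -1 - m) hv (op_nonneg_mem_filZ (n := m) (by omega) hu hw)
    rwa [show j + (i + l - 1) = i + j + l - 1 by ring] at this
  have h0 := h.succ
  have h1 := h0.mem (𝒜.filZ (i + j + l - 1)) fun m => zsmul_mem (sub_mem (by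
    have := op_mem_filZ (-1 - (m + 1 : ℕ)) hu
      (op_nonneg_mem_filZ (n := -1 + (m + 1 : ℕ)) (by push_cast; omega) hv hw)
    rwa [show i + (j + l - 1) = i + j + l - 1 by ring] at this) (zsmul_mem (key _) _)) _
  have h2 := sub_mem h1 (zsmul_mem (key 0) ((-1 : ℤ).negOnePow : ℤ))
  convert h2 using 1
  simp
  abel

/-- The monomials span the vertex envelope. -/
theorem iSup_filZ (u : 𝒜.Envelope) : ∃ i, u ∈ 𝒜.filZ i := by
  induction u using Envelope.induction 𝒜 with
  | zero => exact ⟨0, zero_mem _⟩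
  | add x y hx hy =>
    obtain ⟨i, hi⟩ := hx
    obtain ⟨j, hj⟩ := hy
    exact ⟨max i j, add_mem (filZ_mono (le_max_left _ _) hi) (filZ_mono (le_max_right _ _) hj)⟩
  | smul r x hx => exact hx.imp fun i hi => Submodule.smul_mem _ _ hi
  | mon t =>
    induction t with
    | gen g =>
      rcases g with a | x
      · have := neg_A_mem (by norm_num : (-1 : ℤ) < 0) a _ (vac_mem_filZ (𝒜 := 𝒜))
        rw [VertexAlgebra.op_vac] at this
        exact ⟨_, this⟩
      · have := neg_E_mem (by norm_num : (-1 : ℤ) < 0) x rfl _ (vac_mem_filZ (𝒜 := 𝒜))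
        rw [VertexAlgebra.op_vac] at this
        exact ⟨_, this⟩
    | vac => exact ⟨0, vac_mem_filZ⟩
    | op n s t hs ht =>
      obtain ⟨i, hi⟩ := hs
      obtain ⟨j, hj⟩ := ht
      rw [← op_mon]
      exact ⟨_, op_mem_filZ n hi hj⟩

end

end VertexAlgebroid

namespace VertexAlgebroid

open Envelope

section

variable {k A T Ω : Type*} [CommRing k] [Invertible (2 : k)]
    [CommRing A] [Algebra k A]
    [LieRing T] [LieAlgebra k T] [Module A T] [LieRingModule T A] [LieRinehartRing A T]
    [LieRinehartAlgebra k A T]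
    [AddCommGroup Ω] [Module k Ω] [Module A Ω] [IsScalarTower k A Ω]
    [LieRingModule T Ω] [LieModule k T Ω]
    {𝒜 : VertexAlgebroid k A T Ω}

/-! ### Letters -/

/-- The letters of monomials, with their numbers of letters from `T` and of positive weight. -/
inductive IsLetter (𝒜 : VertexAlgebroid k A T Ω) : ℕ → ℕ → 𝒜.Envelope → Prop
  | A₀ (a : A) : IsLetter 𝒜 0 0 (gen₀ 𝒜 a)
  | A (j : ℕ) (a : A) : IsLetter 𝒜 0 1 ((vertexAlgebra 𝒜).der (j + 1) (gen₀ 𝒜 a))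
  | Ω (j : ℕ) (ω : Ω) : IsLetter 𝒜 0 1 ((vertexAlgebra 𝒜).der j (gen₁ 𝒜 (0, ω)))
  | T (j : ℕ) (τ : T) : IsLetter 𝒜 1 1 ((vertexAlgebra 𝒜).der j (gen₁ 𝒜 (τ, 0)))

theorem IsMonomial.cons {i p d e : ℕ} {x u : 𝒜.Envelope} (hx : 𝒜.IsLetter d e x)
    (hu : 𝒜.IsMonomial i p u) :
    𝒜.IsMonomial (i + d) (p + e) ((vertexAlgebra 𝒜).op (-1) x u) := by
  cases hx with
  | A₀ a => exact .letter_A₀ i p a u hu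
  | A j a => exact .letter_A i p j a u hu
  | Ω j ω => exact .letter_Ω i p j ω u hu
  | T j τ => exact .letter_T i p j τ u hu

/-- Induction over the letters of a monomial. -/
theorem IsMonomial.letter_induction {P : ℕ → ℕ → 𝒜.Envelope → Prop}
    (vac : P 0 0 (vertexAlgebra 𝒜).vac)
    (cons : ∀ i p d e x u, 𝒜.IsLetter d e x → 𝒜.IsMonomial i p u → P i p u →
      P (i + d) (p + e) ((vertexAlgebra 𝒜).op (-1) x u))
    {i p : ℕ} {u : 𝒜.Envelope} (h : 𝒜.IsMonomial i p u) : P i p u := by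
  induction h with
  | vac => exact vac
  | letter_A₀ i p a u hu ih => exact cons _ _ _ _ _ _ (.A₀ a) hu ih
  | letter_A i p j a u hu ih => exact cons _ _ _ _ _ _ (.A j a) hu ih
  | letter_Ω i p j a u hu ih => exact cons _ _ _ _ _ _ (.Ω j a) hu ih
  | letter_T i p j a u hu ih => exact cons _ _ _ _ _ _ (.T j a) hu ih

theorem IsLetter.isMonomial {d e : ℕ} {x : 𝒜.Envelope} (hx : 𝒜.IsLetter d e x) :
    𝒜.IsMonomial d e x := by
  have := IsMonomial.cons hx .vac
  rwa [VertexAlgebra.op_vac, zero_add, zero_add] at this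

theorem IsLetter.exists_wt {d e : ℕ} {x : 𝒜.Envelope} (hx : 𝒜.IsLetter d e x) :
    d ≤ e ∧ ∃ n ≥ e, x ∈ (vertexAlgebra 𝒜).wt n := by
  have h0 := (isTruncatedHom_gen 𝒜).mem₀
  have h1 := (isTruncatedHom_gen 𝒜).mem₁
  cases hx with
  | A₀ a => exact ⟨le_rfl, 0, le_rfl, h0 a⟩
  | A j a => exact ⟨zero_le_one, _, by omega, VertexAlgebra.der_mem _ (h0 a) _⟩
  | Ω j ω => exact ⟨zero_le_one, _, by omega, VertexAlgebra.der_mem _ (h1 _) _⟩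
  | T j τ => exact ⟨le_rfl, _, by omega, VertexAlgebra.der_mem _ (h1 _) _⟩

theorem IsMonomial.exists_wt {i p : ℕ} {u : 𝒜.Envelope} (hu : 𝒜.IsMonomial i p u) :
    i ≤ p ∧ ∃ n ≥ p, u ∈ (vertexAlgebra 𝒜).wt n := by
  refine hu.letter_induction (P := fun i p u => i ≤ p ∧ ∃ n ≥ p, u ∈ (vertexAlgebra 𝒜).wt n)
    ⟨le_rfl, 0, le_rfl, (vertexAlgebra 𝒜).vac_mem⟩ ?_
  rintro i p d e x u hx - ⟨h, n, hn, hu⟩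
  obtain ⟨h', m, hm, hx⟩ := hx.exists_wt
  exact ⟨by omega, m + n, by omega, (vertexAlgebra 𝒜).op_mem hx hu (by push_cast; ring)⟩

theorem IsLetter.der {d e : ℕ} {x : 𝒜.Envelope} (hx : 𝒜.IsLetter d e x) (n : ℕ) :
    ∃ c : ℕ, ∃ e' ≥ e, ∃ y, 𝒜.IsLetter d e' y ∧ (vertexAlgebra 𝒜).der n x = c • y := by
  cases hx with
  | A₀ a =>
    rcases n with _ | n
    · exact ⟨1, 0, le_rfl, _, .A₀ a, by rw [VertexAlgebra.der_zero, one_smul]⟩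
    · exact ⟨1, 1, zero_le_one, _, .A n a, (one_smul _ _).symm⟩
  | A j a => exact ⟨_, 1, le_rfl, _, .A (n + j) a, VertexAlgebra.der_der _ _ _ _⟩
  | Ω j ω => exact ⟨_, 1, le_rfl, _, .Ω (n + j) ω, VertexAlgebra.der_der _ _ _ _⟩
  | T j τ => exact ⟨_, 1, le_rfl, _, .T (n + j) τ, VertexAlgebra.der_der _ _ _ _⟩

/-! ### The filtration `H` -/

theorem filZ_le_filH (i p : ℕ) : 𝒜.filZ (i - 1) ≤ 𝒜.filH (i, p) := by
  rw [filH, filF'_eq]; exact le_sup_left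

theorem IsMonomial.mem_filH {i p p' : ℕ} {u : 𝒜.Envelope} (hu : 𝒜.IsMonomial i p' u)
    (hp : p ≤ p') : u ∈ 𝒜.filH (i, p) :=
  Submodule.mem_sup_right (Submodule.subset_span ⟨p', hp, hu⟩)

theorem filH_map (f : 𝒜.Envelope →ₗ[k] 𝒜.Envelope) (S : Submodule k 𝒜.Envelope) {i p : ℕ}
    (h₁ : ∀ u ∈ 𝒜.filZ (i - 1), f u ∈ S)
    (h₂ : ∀ p' u, p ≤ p' → 𝒜.IsMonomial i p' u → f u ∈ S) : ∀ u ∈ 𝒜.filH (i, p), f u ∈ S := by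
  suffices H : 𝒜.filH (i, p) ≤ S.comap f from H
  rw [filH, filF'_eq]
  exact sup_le h₁ (Submodule.span_le.2 fun u ⟨p', hp, hu⟩ => h₂ p' u hp hu)

theorem filH_le_filZ (i p : ℕ) : 𝒜.filH (i, p) ≤ 𝒜.filZ i := fun u hu =>
  filH_map LinearMap.id (𝒜.filZ i) (fun _ hu => filZ_mono (by omega) hu)
    (fun _ _ _ hu => hu.mem_filZ le_rfl) u hu

theorem filH_anti {i p q : ℕ} (h : p ≤ q) : 𝒜.filH (i, q) ≤ 𝒜.filH (i, p) := fun u hu =>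
  filH_map LinearMap.id (𝒜.filH (i, p)) (fun _ hu => filZ_le_filH i p hu)
    (fun _ _ hp hu => hu.mem_filH (h.trans hp)) u hu

theorem filH_zero (i : ℕ) : 𝒜.filH (i, 0) = 𝒜.filF i := by
  rw [filF_eq]
  refine le_antisymm (filH_le_filZ i 0) (Submodule.span_le.2 ?_)
  rintro u ⟨i', p, hi, hu⟩
  rcases (Nat.cast_le.1 hi).lt_or_eq with h | rfl
  · exact filZ_le_filH i 0 (hu.mem_filZ (by omega))
  · exact hu.mem_filH (Nat.zero_le _)

theorem letter_mem_filH {d e i p : ℕ} {x : 𝒜.Envelope} (hx : 𝒜.IsLetter d e x) :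
    ∀ u ∈ 𝒜.filH (i, p), (vertexAlgebra 𝒜).op (-1) x u ∈ 𝒜.filH (i + d, p + e) := by
  refine filH_map _ _ (fun u hu => filZ_le_filH _ _ ?_)
    fun p' u hp hu => (hu.cons hx).mem_filH (by omega)
  have := op_mem_filZ (-1) (hx.isMonomial.mem_filZ le_rfl) hu
  exact filZ_mono (by push_cast; omega) this

theorem IsMonomial.op_mem_filH {i p : ℕ} {u : 𝒜.Envelope} (hu : 𝒜.IsMonomial i p u) :
    ∀ {j q : ℕ} {v : 𝒜.Envelope}, v ∈ 𝒜.filH (j, q) →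
      (vertexAlgebra 𝒜).op (-1) u v ∈ 𝒜.filH (i + j, p + q) := by
  refine hu.letter_induction (P := fun i p u => ∀ {j q : ℕ} {v : 𝒜.Envelope}, v ∈ 𝒜.filH (j, q) →
      (vertexAlgebra 𝒜).op (-1) u v ∈ 𝒜.filH (i + j, p + q)) ?_ ?_
  · intro j q v hv
    rwa [VertexAlgebra.vac_op, if_pos rfl, zero_add, zero_add]
  · intro i p d e x u hx hu ih j q v hv
    have h1 := op_assoc_mem_filZ (hx.isMonomial.mem_filZ le_rfl) (hu.mem_filZ le_rfl)
      (filH_le_filZ _ _ hv)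
    have h2 := letter_mem_filH hx _ (ih hv)
    rw [show i + j + d = i + d + j by ring, show p + q + e = p + e + q by ring] at h2
    have h3 := add_mem (filZ_le_filH (i + d + j) (p + e + q) (filZ_mono (by push_cast; omega) h1)) h2
    rwa [sub_add_cancel] at h3

theorem op_mem_filH {q q' : ℕ × ℕ} {u v : 𝒜.Envelope} (hu : u ∈ 𝒜.filH q) (hv : v ∈ 𝒜.filH q') :
    (vertexAlgebra 𝒜).op (-1) u v ∈ 𝒜.filH (q + q') := by
  obtain ⟨i, p⟩ := q
  obtain ⟨j, r⟩ := q'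
  refine filH_map ((vertexAlgebra 𝒜).op (-1) |>.flip v) (𝒜.filH (i + j, p + r)) (fun u hu => ?_)
    (fun p' u hp hu => filH_anti (by omega) (hu.op_mem_filH hv)) u hu
  exact filZ_le_filH _ _ (filZ_mono (by push_cast; omega)
    (op_mem_filZ (-1) hu (filH_le_filZ _ _ hv)))

theorem der_mem_filZ {i : ℤ} {u : 𝒜.Envelope} (hu : u ∈ 𝒜.filZ i) (n : ℕ) :
    (vertexAlgebra 𝒜).der n u ∈ 𝒜.filZ i := by
  rw [VertexAlgebra.der_apply]
  simpa using op_mem_filZ (-1 - n) hu vac_mem_filZ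

theorem IsMonomial.der_mem_filH {i p : ℕ} {u : 𝒜.Envelope} (hu : 𝒜.IsMonomial i p u) :
    ∀ n, (vertexAlgebra 𝒜).der n u ∈ 𝒜.filH (i, p) := by
  refine hu.letter_induction
    (P := fun i p u => ∀ n, (vertexAlgebra 𝒜).der n u ∈ 𝒜.filH (i, p)) ?_ ?_
  · intro n
    rcases n with _ | n
    · rw [VertexAlgebra.der_zero]; exact IsMonomial.vac.mem_filH le_rfl
    · rw [VertexAlgebra.der_apply, VertexAlgebra.vac_op, if_neg (by push_cast; omega)]
      exact zero_mem _
  · intro i p d e x u hx hu ih n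
    rw [VertexAlgebra.der_op]
    refine sum_mem fun r _ => ?_
    obtain ⟨c, e', he, y, hy, h⟩ := hx.der r.1
    rw [h, map_nsmul, LinearMap.smul_apply]
    exact nsmul_mem (filH_anti (by omega) (letter_mem_filH hy _ (ih r.2))) _

theorem der_mem_filH {q : ℕ × ℕ} {u : 𝒜.Envelope} (hu : u ∈ 𝒜.filH q) (n : ℕ) :
    (vertexAlgebra 𝒜).der n u ∈ 𝒜.filH q :=
  filH_map ((vertexAlgebra 𝒜).der n) _ (fun _ hu => filZ_le_filH _ _ (der_mem_filZ hu n))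
    (fun _ _ hp hu => filH_anti hp (hu.der_mem_filH n)) u hu

/-! ### Compatibility with the conformal weight -/

theorem filZ_graded (i : ℤ) : 𝒜.filZ i ≤ ⨆ n, 𝒜.filZ i ⊓ (vertexAlgebra 𝒜).wt n := by
  refine Submodule.span_le.2 ?_
  rintro u ⟨i', p, hi, hu⟩
  obtain ⟨-, n, -, hn⟩ := hu.exists_wt
  exact Submodule.mem_iSup_of_mem n ⟨hu.mem_filZ hi, hn⟩

theorem filH_graded (q : ℕ × ℕ) : 𝒜.filH q ≤ ⨆ n, 𝒜.filH q ⊓ (vertexAlgebra 𝒜).wt n := by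
  obtain ⟨i, p⟩ := q
  refine filH_map LinearMap.id (⨆ n, 𝒜.filH (i, p) ⊓ (vertexAlgebra 𝒜).wt n) (fun u hu => ?_)
    fun p' u hp hu => ?_
  · have h : ⨆ n, 𝒜.filZ (i - 1) ⊓ (vertexAlgebra 𝒜).wt n ≤
        ⨆ n, 𝒜.filH (i, p) ⊓ (vertexAlgebra 𝒜).wt n :=
      iSup_mono fun n => inf_le_inf_right _ (filZ_le_filH i p)
    exact h (filZ_graded _ hu)
  · obtain ⟨-, n, -, hn⟩ := hu.exists_wt
    exact Submodule.mem_iSup_of_mem n ⟨hu.mem_filH hp, hn⟩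

end

end VertexAlgebroid

namespace VertexAlgebra

variable {k V : Type*} [CommRing k] [AddCommGroup V] [Module k V] (𝒱 : VertexAlgebra k V)

/-- The projection to the component of weight `n`. -/
noncomputable def proj (n : ℕ) : V →ₗ[k] V :=
  (𝒱.wt n).subtype ∘ₗ DirectSum.component k ℕ (fun n => 𝒱.wt n) n ∘ₗ
    (LinearEquiv.ofBijective (DirectSum.coeLinearMap 𝒱.wt) 𝒱.isInternal).symm.toLinearMap

theorem proj_of_mem {n m : ℕ} {x : V} (hx : x ∈ 𝒱.wt n) :
    𝒱.proj m x = if m = n then x else 0 := by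
  have h : (LinearEquiv.ofBijective (DirectSum.coeLinearMap 𝒱.wt) 𝒱.isInternal).symm x =
      DirectSum.lof k ℕ (fun n => 𝒱.wt n) n ⟨x, hx⟩ := by
    rw [LinearEquiv.symm_apply_eq]
    exact (DirectSum.coeLinearMap_lof 𝒱.wt n ⟨x, hx⟩).symm
  rw [proj, LinearMap.comp_apply, LinearMap.comp_apply, LinearEquiv.coe_coe, h]
  split_ifs with hm
  · subst hm
    rw [DirectSum.component.lof_self]; rfl
  · rw [DirectSum.component.of, dif_neg (Ne.symm hm), map_zero]

theorem proj_mem_of_graded {S : Submodule k V} (hS : S ≤ ⨆ n, S ⊓ 𝒱.wt n) (n : ℕ) {x : V}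
    (hx : x ∈ S) : 𝒱.proj n x ∈ S := by
  suffices H : ⨆ n, S ⊓ 𝒱.wt n ≤ S.comap (𝒱.proj n) from H (hS hx)
  refine iSup_le fun m y ⟨hy, hm⟩ => ?_
  rw [Submodule.mem_comap, 𝒱.proj_of_mem hm]
  split_ifs
  · exact hy
  · exact zero_mem _

end VertexAlgebra

namespace VertexAlgebroid

open Envelope

section

variable {k A T Ω : Type*} [CommRing k] [Invertible (2 : k)]
    [CommRing A] [Algebra k A]
    [LieRing T] [LieAlgebra k T] [Module A T] [LieRingModule T A] [LieRinehartRing A T]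
    [LieRinehartAlgebra k A T]
    [AddCommGroup Ω] [Module k Ω] [Module A Ω] [IsScalarTower k A Ω]
    [LieRingModule T Ω] [LieModule k T Ω]
    {𝒜 : VertexAlgebroid k A T Ω}

theorem filH_eq_iSup (q : ℕ × ℕ) : 𝒜.filH q = ⨆ n, 𝒜.filH q ⊓ (vertexAlgebra 𝒜).wt n :=
  le_antisymm (filH_graded q) (iSup_le fun _ => inf_le_left)

theorem wt_le_filH (n : ℕ) : (vertexAlgebra 𝒜).wt n ≤ 𝒜.filH (n, 0) := by
  intro u hu
  obtain ⟨i, hi⟩ := iSup_filZ u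
  have h := filZ_map ((vertexAlgebra 𝒜).proj n) (𝒜.filZ n) (fun i' p v _ hv => ?_) u hi
  · rw [VertexAlgebra.proj_of_mem _ hu, if_pos rfl] at h
    rwa [filH_zero, filF_eq]
  · obtain ⟨h, m, hm, hw⟩ := hv.exists_wt
    rw [VertexAlgebra.proj_of_mem _ hw]
    split_ifs with hmn
    · exact hv.mem_filZ (by omega)
    · exact zero_mem _

theorem wt_inf_filH_zero (n : ℕ) : (vertexAlgebra 𝒜).wt n ⊓ 𝒜.filH (0, n + 1) = ⊥ := by
  rw [eq_bot_iff]
  rintro u ⟨hu, hu'⟩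
  have h := filH_map ((vertexAlgebra 𝒜).proj n) ⊥ (fun v hv => ?_) (fun p' v hp hv => ?_) u hu'
  · rwa [VertexAlgebra.proj_of_mem _ hu, if_pos rfl] at h
  · rw [𝒜.filZ_neg (by norm_num), Submodule.mem_bot] at hv
    rw [hv, map_zero]; exact zero_mem _
  · obtain ⟨-, m, hm, hw⟩ := hv.exists_wt
    rw [VertexAlgebra.proj_of_mem _ hw, if_neg (by omega)]
    exact zero_mem _

theorem wt_inf_filH_succ {n p : ℕ} (i : ℕ) (hp : n < p) :
    (vertexAlgebra 𝒜).wt n ⊓ 𝒜.filH (i + 1, p) = (vertexAlgebra 𝒜).wt n ⊓ 𝒜.filH (i, 0) := by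
  have e : 𝒜.filH (i, 0) = 𝒜.filZ ((i + 1 : ℕ) - 1) := by
    rw [filH_zero, filF_eq]; congr 1; push_cast; ring
  refine le_antisymm ?_ (inf_le_inf_left _ (by rw [e]; exact filZ_le_filH _ _))
  rintro u ⟨hu, hu'⟩
  refine ⟨hu, ?_⟩
  have h := filH_map ((vertexAlgebra 𝒜).proj n) (𝒜.filH (i, 0)) (fun v hv => ?_)
    (fun p' v hp' hv => ?_) u hu'
  · rwa [VertexAlgebra.proj_of_mem _ hu, if_pos rfl] at h
  · rw [e]
    exact VertexAlgebra.proj_mem_of_graded _ (filZ_graded _) n hv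
  · obtain ⟨-, m, hm, hw⟩ := hv.exists_wt
    rw [VertexAlgebra.proj_of_mem _ hw, if_neg (by omega)]
    exact zero_mem _

/-! ### Functoriality -/

variable {A' T' Ω' : Type*}
    [CommRing A'] [Algebra k A']
    [LieRing T'] [LieAlgebra k T'] [Module A' T'] [LieRingModule T' A'] [LieRinehartRing A' T']
    [LieRinehartAlgebra k A' T']
    [AddCommGroup Ω'] [Module k Ω'] [Module A' Ω'] [IsScalarTower k A' Ω']
    [LieRingModule T' Ω'] [LieModule k T' Ω']
    {𝒜' : VertexAlgebroid k A' T' Ω'}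

theorem IsMonomial.envelopeMap_mem (g : 𝒜.Hom 𝒜') {i p : ℕ} {u : 𝒜.Envelope}
    (hu : 𝒜.IsMonomial i p u) : g.envelopeMap u ∈ 𝒜'.filH (i, p) := by
  have hg := lift_isHom g.isTruncatedHom
  have hder : ∀ (j : ℕ) x, g.envelopeMap ((vertexAlgebra 𝒜).der j x) =
      (vertexAlgebra 𝒜').der j (g.envelopeMap x) := fun j x => by
    rw [VertexAlgebra.der_apply, VertexAlgebra.der_apply, ← hg.map_vac]
    exact hg.map_op _ _ _
  have hop : ∀ x y, g.envelopeMap ((vertexAlgebra 𝒜).op (-1) x y) =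
      (vertexAlgebra 𝒜').op (-1) (g.envelopeMap x) (g.envelopeMap y) := hg.map_op _
  have h₀ : ∀ a, g.envelopeMap (gen₀ 𝒜 a) = gen₀ 𝒜' (g.map₀ a) := lift_gen₀ g.isTruncatedHom
  have h₁ : ∀ x, g.envelopeMap (gen₁ 𝒜 x) = gen₁ 𝒜' (g.map₁ x) := lift_gen₁ g.isTruncatedHom
  induction hu with
  | vac =>
    rw [show g.envelopeMap (vertexAlgebra 𝒜).vac = _ from hg.map_vac]
    exact IsMonomial.vac.mem_filH le_rfl
  | letter_A₀ i p a u _ ih =>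
    rw [hop, h₀]
    exact letter_mem_filH (.A₀ _) _ ih
  | letter_A i p j a u _ ih =>
    rw [hop, hder, h₀]
    exact letter_mem_filH (.A _ _) _ ih
  | letter_Ω i p j ω u _ ih =>
    rw [hop, hder, h₁, show g.map₁ (0, ω) = (0, (g.map₁ (0, ω)).2) from
      Prod.ext (g.map_Ω ω) rfl]
    exact letter_mem_filH (.Ω _ _) _ ih
  | letter_T i p j τ u _ ih =>
    rw [hop, hder, h₁, show g.map₁ (τ, 0) = ((g.map₁ (τ, 0)).1, 0) + (0, (g.map₁ (τ, 0)).2) by simp,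
      map_add, map_add, map_add, LinearMap.add_apply]
    refine add_mem (letter_mem_filH (.T _ _) _ ih) (filZ_le_filH _ _ ?_)
    exact filZ_mono (by push_cast; omega) (filH_le_filZ _ _ (letter_mem_filH (.Ω _ _) _ ih))

theorem map_filH_le (g : 𝒜.Hom 𝒜') (q : ℕ × ℕ) : (𝒜.filH q).map g.envelopeMap ≤ 𝒜'.filH q := by
  obtain ⟨i, p⟩ := q
  have hF : ∀ j : ℤ, 𝒜.filZ j ≤ (𝒜'.filZ j).comap g.envelopeMap := fun j =>
    Submodule.span_le.2 fun u ⟨i', p, hi, hu⟩ =>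
      filZ_mono hi (filH_le_filZ _ _ (hu.envelopeMap_mem g))
  rw [Submodule.map_le_iff_le_comap, filH, filF'_eq]
  refine sup_le ((hF _).trans (Submodule.comap_mono (filZ_le_filH i p))) (Submodule.span_le.2 ?_)
  rintro u ⟨p', hp, hu⟩
  exact filH_anti hp (hu.envelopeMap_mem g)

end

end VertexAlgebroid

namespace Gr

variable {ι k U X : Type*} [CommRing k] [AddCommGroup U] [Module k U] [AddCommGroup X] [Module k X]
  [DecidableEq ι] {S S' : ι → Submodule k U}

/-- The linear map on the associated graded module given by maps vanishing on the `S' i`. -/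
noncomputable def lift (f : ∀ i, S i →ₗ[k] X) (h : ∀ i (x : S i), (x : U) ∈ S' i → f i x = 0) :
    Gr S S' →ₗ[k] X :=
  DirectSum.toModule k ι X fun i =>
    ((S' i).comap (S i).subtype).liftQ (f i) fun x hx => h i x hx

theorem lift_symb (f : ∀ i, S i →ₗ[k] X) (h : ∀ i (x : S i), (x : U) ∈ S' i → f i x = 0) (i : ι)
    (x : S i) : lift f h (symb S S' i x) = f i x :=
  (DirectSum.toModule_lof _ _ _).trans (Submodule.liftQ_apply _ _ _)

theorem induction {P : Gr S S' → Prop} (add : ∀ x y, P x → P y → P (x + y)) (zero : P 0)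
    (symb : ∀ i x, P (symb S S' i x)) (z : Gr S S') : P z := by
  refine DirectSum.induction_on z zero (fun i x => ?_) add
  obtain ⟨x, rfl⟩ := Submodule.mkQ_surjective _ x
  exact symb i x

theorem hom_ext {f g : Gr S S' →ₗ[k] X} (h : ∀ i x, f (symb S S' i x) = g (symb S S' i x)) :
    f = g := by
  refine LinearMap.ext fun z => ?_
  induction z using induction with
  | add x y hx hy => rw [map_add, map_add, hx, hy]
  | zero => rw [map_zero, map_zero]
  | symb i x => exact h i x

theorem symb_eq_zero {i : ι} {x : S i} : symb S S' i x = 0 ↔ (x : U) ∈ S' i := by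
  have h : Function.Injective (DirectSum.of (fun i => S i ⧸ (S' i).comap (S i).subtype) i) :=
    DirectSum.of_injective i
  exact ((injective_iff_map_eq_zero' _).1 h (Submodule.Quotient.mk x)).trans
    (Submodule.Quotient.mk_eq_zero _)

theorem symb_congr {i j : ι} (h : i = j) {x y : U} (hx : x ∈ S i) (hy : y ∈ S j)
    (hxy : x - y ∈ S' i) : symb S S' i ⟨x, hx⟩ = symb S S' j ⟨y, hy⟩ := by
  subst h
  rw [← sub_eq_zero, ← map_sub, symb_eq_zero]
  exact hxy

theorem symb_congr' {i j : ι} (h : i = j) {x y : U} (hx : x ∈ S i) (hy : y ∈ S j)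
    (hxy : x = y) : symb S S' i ⟨x, hx⟩ = symb S S' j ⟨y, hy⟩ :=
  symb_congr h hx hy (by rw [hxy, sub_self]; exact zero_mem _)

/-- A linear endomorphism preserving the `S i` and the `S' i` acts on the associated graded
module. -/
noncomputable def map (f : U →ₗ[k] U) (h : ∀ i, ∀ x ∈ S i, f x ∈ S i)
    (h' : ∀ i, ∀ x ∈ S' i, f x ∈ S' i) : Gr S S' →ₗ[k] Gr S S' :=
  lift (fun i => symb S S' i ∘ₗ f.restrict (h i)) fun i x hx => symb_eq_zero.2 (h' i x hx)

theorem map_symb (f : U →ₗ[k] U) (h : ∀ i, ∀ x ∈ S i, f x ∈ S i)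
    (h' : ∀ i, ∀ x ∈ S' i, f x ∈ S' i) {i : ι} {x : U} (hx : x ∈ S i) :
    map f h h' (symb S S' i ⟨x, hx⟩) = symb S S' i ⟨f x, h i x hx⟩ := lift_symb _ _ _ _

variable [AddCommMonoid ι]

/-- Conditions under which a vertex algebra structure induces a `∂`-algebra structure on the
associated graded module. -/
structure Compatible (𝒱 : VertexAlgebra k U) (S S' : ι → Submodule k U) : Prop where
  vac_mem : 𝒱.vac ∈ S 0
  mul_mem : ∀ {i j x y}, x ∈ S i → y ∈ S j → 𝒱.op (-1) x y ∈ S (i + j)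
  mul_mem_left : ∀ {i j x y}, x ∈ S' i → y ∈ S j → 𝒱.op (-1) x y ∈ S' (i + j)
  mul_mem_right : ∀ {i j x y}, x ∈ S i → y ∈ S' j → 𝒱.op (-1) x y ∈ S' (i + j)
  comm : ∀ {i j x y}, x ∈ S i → y ∈ S j → 𝒱.op (-1) x y - 𝒱.op (-1) y x ∈ S' (i + j)
  assoc : ∀ {i j l x y z}, x ∈ S i → y ∈ S j → z ∈ S l →
    𝒱.op (-1) (𝒱.op (-1) x y) z - 𝒱.op (-1) x (𝒱.op (-1) y z) ∈ S' (i + j + l)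
  der_mem : ∀ n i, ∀ x ∈ S i, 𝒱.der n x ∈ S i
  der_mem' : ∀ n i, ∀ x ∈ S' i, 𝒱.der n x ∈ S' i
  graded : ∀ i, S i ≤ ⨆ n, S i ⊓ 𝒱.wt n
  graded' : ∀ i, S' i ≤ ⨆ n, S' i ⊓ 𝒱.wt n

namespace Compatible

variable {𝒱 : VertexAlgebra k U} (h : Compatible 𝒱 S S')

/-- The product of homogeneous elements. -/
noncomputable def mulSymb (i j : ι) : S i →ₗ[k] S j →ₗ[k] Gr S S' :=
  LinearMap.mk₂ k (fun x y => symb S S' (i + j) ⟨𝒱.op (-1) x y, h.mul_mem x.2 y.2⟩)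
    (fun x y z => by
      rw [← map_add]; exact congrArg _ (Subtype.ext (by simp)))
    (fun c x y => by
      rw [← map_smul]; exact congrArg _ (Subtype.ext (by simp)))
    (fun x y z => by
      rw [← map_add]; exact congrArg _ (Subtype.ext (by simp)))
    (fun c x y => by
      rw [← map_smul]; exact congrArg _ (Subtype.ext (by simp)))

/-- The left multiplication by a homogeneous element. -/
noncomputable def mulLeft (i : ι) (x : S i) : Gr S S' →ₗ[k] Gr S S' :=
  lift (fun j => h.mulSymb i j x) fun _ _ hy => symb_eq_zero.2 (h.mul_mem_right x.2 hy)

theorem mulLeft_symb (h : Compatible 𝒱 S S') {i j : ι} (x : S i) (y : S j) :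
    h.mulLeft i x (symb S S' j y) = h.mulSymb i j x y := lift_symb _ _ _ _

/-- The product of the associated graded module. -/
noncomputable def mul : Gr S S' →ₗ[k] Gr S S' →ₗ[k] Gr S S' :=
  lift (fun i =>
    { toFun := h.mulLeft i
      map_add' := fun x y => hom_ext fun j z => by
        rw [LinearMap.add_apply, mulLeft_symb, mulLeft_symb, mulLeft_symb, map_add,
          LinearMap.add_apply]
      map_smul' := fun c x => hom_ext fun j z => by
        rw [LinearMap.smul_apply, mulLeft_symb, mulLeft_symb, map_smul, LinearMap.smul_apply,
          RingHom.id_apply] })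
    fun i x hx => hom_ext fun j y => (h.mulLeft_symb x y).trans
      (symb_eq_zero.2 (h.mul_mem_left hx y.2))

theorem mul_symb (h : Compatible 𝒱 S S') {i j : ι} {x y : U} (hx : x ∈ S i) (hy : y ∈ S j) :
    h.mul (symb S S' i ⟨x, hx⟩) (symb S S' j ⟨y, hy⟩) =
      symb S S' (i + j) ⟨𝒱.op (-1) x y, h.mul_mem hx hy⟩ := by
  rw [mul, lift_symb]
  exact h.mulLeft_symb _ _

/-- The projection to the component of weight `n` of the associated graded module. -/
noncomputable def proj (n : ℕ) : Gr S S' →ₗ[k] Gr S S' :=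
  Gr.map (𝒱.proj n) (fun i _ hx => 𝒱.proj_mem_of_graded (h.graded i) n hx)
    (fun i _ hx => 𝒱.proj_mem_of_graded (h.graded' i) n hx)

/-- The operators `∂^(n)` of the associated graded module. -/
noncomputable def der (n : ℕ) : Gr S S' →ₗ[k] Gr S S' :=
  Gr.map (𝒱.der n) (h.der_mem n) (h.der_mem' n)

theorem der_symb (h : Compatible 𝒱 S S') (n : ℕ) {i : ι} {x : U} (hx : x ∈ S i) :
    h.der n (symb S S' i ⟨x, hx⟩) = symb S S' i ⟨𝒱.der n x, h.der_mem n i x hx⟩ := map_symb _ _ _ _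

/-- The component of weight `n` of the associated graded module. -/
def wt (𝒱 : VertexAlgebra k U) (S S' : ι → Submodule k U) (n : ℕ) : Submodule k (Gr S S') :=
  Submodule.span k {z | ∃ (i : ι) (x : S i), (x : U) ∈ 𝒱.wt n ∧ z = symb S S' i x}

theorem symb_mem_wt {n : ℕ} {i : ι} {x : U} (hx : x ∈ S i) (hn : x ∈ 𝒱.wt n) :
    symb S S' i ⟨x, hx⟩ ∈ wt 𝒱 S S' n := Submodule.subset_span ⟨i, ⟨x, hx⟩, hn, rfl⟩

theorem isInternal (h : Compatible 𝒱 S S') : DirectSum.IsInternal (wt 𝒱 S S') := by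
  have key : ∀ n m, ∀ x ∈ wt 𝒱 S S' n, h.proj m x = if m = n then x else 0 := by
    intro n m x hx
    induction hx using Submodule.span_induction with
    | mem x hx =>
      obtain ⟨i, ⟨x, hi⟩, hx, rfl⟩ := hx
      rw [proj, map_symb]
      split_ifs with hm
      · exact symb_congr' rfl _ _ (by rw [𝒱.proj_of_mem hx, if_pos hm])
      · rw [symb_eq_zero]
        change 𝒱.proj m x ∈ S' i
        rw [𝒱.proj_of_mem hx, if_neg hm]
        exact zero_mem _
    | zero => simp
    | add x y _ _ hx hy => rw [map_add, hx, hy]; split_ifs <;> simp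
    | smul c x _ hx => rw [map_smul, hx]; split_ifs <;> simp
  refine isInternal_of_projections _ h.proj (fun i x hx => ?_) (fun i j hij x hx => ?_) ?_
  · rw [key i i x hx, if_pos rfl]
  · rw [key j i x hx, if_neg hij]
  · rw [eq_top_iff]
    rintro z -
    induction z using Gr.induction with
    | add x y hx hy => exact add_mem hx hy
    | zero => exact zero_mem _
    | symb i x =>
      obtain ⟨x, hx⟩ := x
      suffices H : ∃ hx : x ∈ S i, symb S S' i ⟨x, hx⟩ ∈ ⨆ n, wt 𝒱 S S' n from H.2
      refine Submodule.iSup_induction _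
        (motive := fun x => ∃ hx : x ∈ S i, symb S S' i ⟨x, hx⟩ ∈ ⨆ n, wt 𝒱 S S' n)
        (h.graded i hx) (fun n y hy => ⟨hy.1, Submodule.mem_iSup_of_mem n (symb_mem_wt _ hy.2)⟩)
        ⟨zero_mem _, ?_⟩ ?_
      · rw [symb_eq_zero.2 (zero_mem _)]; exact zero_mem _
      · rintro x y ⟨hx, hx'⟩ ⟨hy, hy'⟩
        refine ⟨add_mem hx hy, ?_⟩
        have := add_mem hx' hy'
        rwa [← map_add] at this

/-- The `∂`-algebra structure on the associated graded module. -/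
noncomputable def dAlgebra : DAlgebra k (Gr S S') where
  one := symb S S' 0 ⟨𝒱.vac, h.vac_mem⟩
  mul := h.mul
  mul_comm a b := by
    induction a using Gr.induction with
    | add x y hx hy => rw [map_add, map_add, LinearMap.add_apply, hx, hy]
    | zero => simp
    | symb i x =>
      induction b using Gr.induction with
      | add x y hx hy => rw [map_add, map_add, LinearMap.add_apply, hx, hy]
      | zero => simp
      | symb j y =>
        rw [mul_symb, mul_symb]
        exact symb_congr (add_comm _ _) _ _ (h.comm x.2 y.2)
  mul_assoc a b c := by
    induction a using Gr.induction with
    | add x y hx hy => simp only [map_add, LinearMap.add_apply, hx, hy]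
    | zero => simp
    | symb i x =>
      induction b using Gr.induction with
      | add x y hx hy => simp only [map_add, LinearMap.add_apply, hx, hy]
      | zero => simp
      | symb j y =>
        induction c using Gr.induction with
        | add x y hx hy => simp only [map_add, hx, hy]
        | zero => simp
        | symb l z =>
          rw [mul_symb, mul_symb, mul_symb, mul_symb]
          exact symb_congr (add_assoc _ _ _) _ _ (h.assoc x.2 y.2 z.2)
  one_mul a := by
    induction a using Gr.induction with
    | add x y hx hy => rw [map_add, hx, hy]
    | zero => simp
    | symb i x =>
      rw [mul_symb]
      exact symb_congr' (zero_add _) _ _ (by rw [𝒱.vac_op, if_pos rfl])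
  wt := wt 𝒱 S S'
  isInternal := h.isInternal
  one_mem := symb_mem_wt _ 𝒱.vac_mem
  mul_mem {n m a b} ha hb := by
    induction ha using Submodule.span_induction with
    | zero => simp
    | add x y _ _ hx hy => rw [map_add, LinearMap.add_apply]; exact add_mem hx hy
    | smul c x _ hx => rw [map_smul, LinearMap.smul_apply]; exact Submodule.smul_mem _ _ hx
    | mem x hx =>
      obtain ⟨i, x, hx, rfl⟩ := hx
      induction hb using Submodule.span_induction with
      | zero => simp
      | add x y _ _ hx hy => rw [map_add]; exact add_mem hx hy
      | smul c x _ hx => rw [map_smul]; exact Submodule.smul_mem _ _ hx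
      | mem y hy =>
        obtain ⟨j, y, hy, rfl⟩ := hy
        rw [mul_symb]
        exact symb_mem_wt _ (𝒱.op_mem hx hy (by push_cast; ring))
  der := h.der
  der_mem {n} j a ha := by
    induction ha using Submodule.span_induction with
    | zero => simp
    | add x y _ _ hx hy => rw [map_add]; exact add_mem hx hy
    | smul c x _ hx => rw [map_smul]; exact Submodule.smul_mem _ _ hx
    | mem x hx =>
      obtain ⟨i, x, hx, rfl⟩ := hx
      rw [der_symb]
      exact symb_mem_wt _ (𝒱.der_mem hx j)
  der_zero a := by
    induction a using Gr.induction with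
    | add x y hx hy => rw [map_add, hx, hy]
    | zero => simp
    | symb i x =>
      rw [der_symb]
      exact symb_congr' rfl _ _ (𝒱.der_zero _)
  der_der n m a := by
    induction a using Gr.induction with
    | add x y hx hy => simp only [map_add, hx, hy, smul_add]
    | zero => simp
    | symb i x =>
      rw [der_symb, der_symb, der_symb, ← map_nsmul]
      exact congrArg _ (Subtype.ext (𝒱.der_der _ _ _))
  der_mul n a b := by
    induction a using Gr.induction with
    | add x y hx hy =>
      simp only [map_add, LinearMap.add_apply, hx, hy, Finset.sum_add_distrib]
    | zero => simp
    | symb i x =>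
      induction b using Gr.induction with
      | add x y hx hy => simp only [map_add, hx, hy, Finset.sum_add_distrib]
      | zero => simp
      | symb j y =>
        have e : ∀ p : ℕ × ℕ, h.mul (h.der p.1 (symb S S' i x)) (h.der p.2 (symb S S' j y)) =
            symb S S' (i + j) ⟨𝒱.op (-1) (𝒱.der p.1 x) (𝒱.der p.2 y),
              h.mul_mem (h.der_mem _ _ _ x.2) (h.der_mem _ _ _ y.2)⟩ := fun p => by
          rw [der_symb, der_symb, mul_symb]
        rw [mul_symb, der_symb, Finset.sum_congr rfl fun p _ => e p, ← map_sum]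
        refine congrArg _ (Subtype.ext ?_)
        rw [AddSubmonoidClass.coe_finsetSum]
        exact 𝒱.der_op n x y

theorem isInduced : IsInduced 𝒱 S S' h.dAlgebra where
  one := ⟨h.vac_mem, rfl⟩
  mul _ _ x y := ⟨_, h.mul_symb x.2 y.2⟩
  der n _ x := ⟨_, h.der_symb n x.2⟩
  wt _ := rfl

end Compatible

end Gr

namespace VertexAlgebroid

open Envelope

variable {k A T Ω : Type*} [CommRing k] [Invertible (2 : k)]
    [CommRing A] [Algebra k A]
    [LieRing T] [LieAlgebra k T] [Module A T] [LieRingModule T A] [LieRinehartRing A T]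
    [LieRinehartAlgebra k A T]
    [AddCommGroup Ω] [Module k Ω] [Module A Ω] [IsScalarTower k A Ω]
    [LieRingModule T Ω] [LieModule k T Ω]
    (𝒜 : VertexAlgebroid k A T Ω)

theorem compatible_filF : Gr.Compatible (vertexAlgebra 𝒜) 𝒜.filF 𝒜.filF' where
  vac_mem := by rw [filF_eq]; exact vac_mem_filZ
  mul_mem hx hy := by
    rw [filF_eq] at *; exact filZ_mono (by push_cast; omega) (op_mem_filZ _ hx hy)
  mul_mem_left hx hy := by
    rw [filF_eq, filF'_eq] at *; exact filZ_mono (by push_cast; omega) (op_mem_filZ _ hx hy)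
  mul_mem_right hx hy := by
    rw [filF_eq, filF'_eq] at *; exact filZ_mono (by push_cast; omega) (op_mem_filZ _ hx hy)
  comm hx hy := by
    rw [filF_eq, filF'_eq] at *; exact filZ_mono (by push_cast; omega) (op_comm_mem_filZ hx hy)
  assoc hx hy hz := by
    rw [filF_eq, filF'_eq] at *; exact filZ_mono (by push_cast; omega) (op_assoc_mem_filZ hx hy hz)
  der_mem n i x hx := by rw [filF_eq] at *; exact der_mem_filZ hx n
  der_mem' n i x hx := by rw [filF'_eq] at *; exact der_mem_filZ hx n
  graded i := by rw [filF_eq]; exact filZ_graded _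
  graded' i := by rw [filF'_eq]; exact filZ_graded _

theorem compatible_filH : Gr.Compatible (vertexAlgebra 𝒜) 𝒜.filH 𝒜.filH' where
  vac_mem := IsMonomial.vac.mem_filH le_rfl
  mul_mem hx hy := op_mem_filH hx hy
  mul_mem_left {i j x y} hx hy := by
    rw [filH'] at hx ⊢
    have := op_mem_filH hx hy
    rwa [show (i.1, i.2 + 1) + j = ((i + j).1, (i + j).2 + 1) from
      Prod.ext rfl (by simp; ring)] at this
  mul_mem_right {i j x y} hx hy := by
    rw [filH'] at hy ⊢
    have := op_mem_filH hx hy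
    rwa [show i + (j.1, j.2 + 1) = ((i + j).1, (i + j).2 + 1) from
      Prod.ext rfl (by simp; ring)] at this
  comm {i j x y} hx hy := by
    have := op_comm_mem_filZ (filH_le_filZ _ _ hx) (filH_le_filZ _ _ hy)
    rw [filH']
    exact filZ_le_filH _ _ (filZ_mono (by rw [Prod.fst_add]; push_cast; omega) this)
  assoc {i j l x y z} hx hy hz := by
    have := op_assoc_mem_filZ (filH_le_filZ _ _ hx) (filH_le_filZ _ _ hy) (filH_le_filZ _ _ hz)
    rw [filH']
    exact filZ_le_filH _ _ (filZ_mono (by rw [Prod.fst_add, Prod.fst_add]; push_cast; omega) this)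
  der_mem n i x hx := der_mem_filH hx n
  der_mem' n i x hx := by rw [filH'] at *; exact der_mem_filH hx n
  graded i := filH_graded i
  graded' i := by rw [filH']; exact filH_graded _

end VertexAlgebroid

namespace DAlgebra

variable {k B : Type*} [CommRing k] [AddCommGroup B] [Module k B]

/-- The module underlying a `∂`-algebra, as an algebra. -/
def Carrier (_D : DAlgebra k B) := B

variable (D : DAlgebra k B)

instance : AddCommGroup D.Carrier := inferInstanceAs (AddCommGroup B)

instance : Module k D.Carrier := inferInstanceAs (Module k B)

noncomputable instance : CommRing D.Carrier where
  __ := (inferInstance : AddCommGroup D.Carrier)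
  mul x y := D.mul x y
  one := D.one
  mul_assoc := D.mul_assoc
  mul_comm := D.mul_comm
  one_mul := D.one_mul
  mul_one x := (D.mul_comm _ _).trans (D.one_mul x)
  zero_mul x := LinearMap.map_zero₂ D.mul x
  mul_zero x := map_zero (D.mul x)
  left_distrib x y z := map_add (D.mul x) y z
  right_distrib x y z := LinearMap.map_add₂ D.mul x y z

noncomputable instance : Algebra k D.Carrier :=
  Algebra.ofModule (fun c x y => LinearMap.map_smul₂ D.mul c x y) fun c x y => map_smul (D.mul x) c y

/-- The identity map to the underlying algebra. -/
noncomputable def toCarrier : B ≃ₗ[k] D.Carrier := LinearEquiv.refl k B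

theorem der_one {n : ℕ} (hn : n ≠ 0) : D.der n D.one = 0 := by
  induction n using Nat.strong_induction_on with
  | _ n ih =>
    have h := D.der_mul n D.one D.one
    rw [D.one_mul, Finset.sum_eq_add (0, n) (n, 0) (fun h => hn (congrArg Prod.snd h)),
      D.der_zero, D.one_mul, D.mul_comm, D.one_mul] at h
    · exact add_eq_left.1 h.symm
    · rintro ⟨p, q⟩ hp ⟨h1, h2⟩
      rw [Finset.HasAntidiagonal.mem_antidiagonal] at hp
      simp only [ne_eq, Prod.mk.injEq, not_and] at h1 h2 hp
      rw [ih p (by omega) (by omega), map_zero, LinearMap.zero_apply]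
    · simp
    · simp

end DAlgebra

namespace Jet

open MvPolynomial

variable {k A M B : Type*} [CommRing k] [CommRing A] [Algebra k A] [AddCommGroup M] [Module k M]
  [Module A M] (d : Derivation k A M) [AddCommGroup B] [Module k B]

/-- Linear maps `A → B`, `M → B` which extend to the jet algebra. -/
structure Compatible (D : DAlgebra k B) (f₀ : A →ₗ[k] B) (f₁ : M →ₗ[k] B) : Prop where
  map_one : f₀ 1 = D.one
  map_mul : ∀ a b, f₀ (a * b) = D.mul (f₀ a) (f₀ b)
  map_smul : ∀ a x, f₁ (a • x) = D.mul (f₀ a) (f₁ x)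
  map_d : ∀ a, D.der 1 (f₀ a) = f₁ (d a)
  mem₀ : ∀ a, f₀ a ∈ D.wt 0
  mem₁ : ∀ x, f₁ x ∈ D.wt 1

variable (D : DAlgebra k B) (f₀ : A →ₗ[k] B) (f₁ : M →ₗ[k] B)

/-- The evaluation of polynomials in the variables `∂^(j) y`. -/
noncomputable def evalPoly : Poly k A M →ₐ[k] D.Carrier :=
  aeval fun v => D.toCarrier (D.der v.1 (Sum.elim f₀ f₁ v.2))

theorem evalPoly_X (v : ℕ × (A ⊕ M)) : D.toCarrier.symm (evalPoly D f₀ f₁ (X v)) =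
    D.der v.1 (Sum.elim f₀ f₁ v.2) := by
  rw [evalPoly, aeval_X]; rfl

theorem evalPoly_mul (x y : Poly k A M) : D.toCarrier.symm (evalPoly D f₀ f₁ (x * y)) =
    D.mul (D.toCarrier.symm (evalPoly D f₀ f₁ x)) (D.toCarrier.symm (evalPoly D f₀ f₁ y)) := by
  rw [map_mul]; rfl

theorem evalPoly_C (r : k) : D.toCarrier.symm (evalPoly D f₀ f₁ (C r)) = r • D.one := by
  rw [evalPoly, aeval_C, Algebra.algebraMap_eq_smul_one]; rfl

theorem evalPoly_smul (r : k) (x : Poly k A M) : D.toCarrier.symm (evalPoly D f₀ f₁ (r • x)) =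
    r • D.toCarrier.symm (evalPoly D f₀ f₁ x) := by
  rw [smul_eq_C_mul, evalPoly_mul, evalPoly_C, LinearMap.map_smul₂, D.one_mul]

theorem evalPoly_one : D.toCarrier.symm (evalPoly D f₀ f₁ 1) = D.one := by
  rw [← C_1, evalPoly_C, one_smul]

theorem evalPoly_polyDer (n : ℕ) (x : Poly k A M) :
    D.toCarrier.symm (evalPoly D f₀ f₁ (polyDer n x)) =
      D.der n (D.toCarrier.symm (evalPoly D f₀ f₁ x)) := by
  induction x using MvPolynomial.induction_on generalizing n with
  | C r =>
    rw [polyDer_C, evalPoly_C, map_smul]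
    split_ifs with h
    · rw [h, D.der_zero, evalPoly_C]
    · rw [D.der_one h, smul_zero, map_zero, map_zero]
  | add x y hx hy => simp only [map_add, hx, hy]
  | mul_X x v hx =>
    rw [polyDer_mul, map_sum, map_sum, evalPoly_mul, D.der_mul]
    refine Finset.sum_congr rfl fun p _ => ?_
    rw [evalPoly_mul, hx, polyDer_X, map_nsmul, map_nsmul, evalPoly_X, evalPoly_X, D.der_der]

theorem evalPoly_mem (h₀ : ∀ a, f₀ a ∈ D.wt 0) (h₁ : ∀ x, f₁ x ∈ D.wt 1) {i : ℕ} {x : Poly k A M}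
    (hx : IsWeightedHomogeneous varWt x i) : D.toCarrier.symm (evalPoly D f₀ f₁ x) ∈ D.wt i := by
  have key : ∀ (s : (ℕ × (A ⊕ M)) →₀ ℕ) (c : k),
      D.toCarrier.symm (evalPoly D f₀ f₁ (monomial s c)) ∈ D.wt (Finsupp.weight varWt s) := by
    intro s c
    induction s using Finsupp.induction generalizing c with
    | zero =>
      change D.toCarrier.symm (evalPoly D f₀ f₁ (C c)) ∈ _
      rw [evalPoly_C, map_zero]
      exact Submodule.smul_mem _ _ D.one_mem
    | single_add v m s _ _ hs =>
      clear * - hs h₀ h₁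
      induction m with
      | zero => simpa using hs c
      | succ m ih =>
        have : (monomial (Finsupp.single v (m + 1) + s) c : Poly k A M) =
            X v * monomial (Finsupp.single v m + s) c := by
          rw [X, monomial_mul, one_mul, ← add_assoc, ← Finsupp.single_add, add_comm 1]
        rw [this, evalPoly_mul, evalPoly_X]
        have hv : D.der v.1 (Sum.elim f₀ f₁ v.2) ∈ D.wt (varWt v) := by
          obtain ⟨j, a | x⟩ := v
          · have := D.der_mem j (h₀ a); rwa [zero_add] at this
          · have := D.der_mem j (h₁ x); rwa [add_comm] at this
        convert D.mul_mem hv ih using 1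
        simp only [Finsupp.single_add, map_add, Finsupp.weight_single, one_smul]
        abel_nf
  rw [← support_sum_monomial_coeff x, map_sum, map_sum]
  refine sum_mem fun s hs => ?_
  rw [← hx (mem_support_iff.1 hs)]
  exact key _ _

variable {d D f₀ f₁}

theorem Compatible.evalPoly_eq_zero (h : Compatible d D f₀ f₁) {x : Poly k A M}
    (hx : x ∈ relIdeal d) : evalPoly D f₀ f₁ x = 0 := by
  suffices H : relIdeal d ≤ RingHom.ker (evalPoly D f₀ f₁) from H hx
  refine Ideal.span_le.2 ?_
  rintro _ ⟨n, r, hr, rfl⟩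
  refine RingHom.mem_ker.2 (D.toCarrier.symm.injective ?_)
  rw [evalPoly_polyDer, map_zero]
  suffices H : D.toCarrier.symm (evalPoly D f₀ f₁ r) = 0 by rw [H, map_zero]
  have e₀ : ∀ a, D.toCarrier.symm (evalPoly D f₀ f₁ (X (0, Sum.inl a))) = f₀ a := fun a => by
    rw [evalPoly_X, D.der_zero]; rfl
  have e₁ : ∀ x, D.toCarrier.symm (evalPoly D f₀ f₁ (X (0, Sum.inr x))) = f₁ x := fun a => by
    rw [evalPoly_X, D.der_zero]; rfl
  cases hr with
  | add₀ a b => simp only [map_sub, e₀, map_add]; abel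
  | smul₀ r a => rw [map_sub, map_sub, evalPoly_smul, e₀, e₀, _root_.map_smul, sub_self]
  | add₁ x y => simp only [map_sub, e₁, map_add]; abel
  | smul₁ r x => rw [map_sub, map_sub, evalPoly_smul, e₁, e₁, _root_.map_smul, sub_self]
  | one =>
    rw [map_sub, map_sub, e₀, h.map_one, evalPoly_one, sub_self]
  | mul a b => rw [map_sub, map_sub, evalPoly_mul, e₀, e₀, e₀, h.map_mul, sub_self]
  | smul a x => rw [map_sub, map_sub, evalPoly_mul, e₀, e₁, e₁, h.map_smul, sub_self]
  | der a =>
    rw [map_sub, map_sub, e₁, evalPoly_X]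
    exact sub_eq_zero.2 (h.map_d a)

/-- The morphism from the jet algebra given by its universal property. -/
noncomputable def lift (h : Compatible d D f₀ f₁) : Jet d →ₗ[k] B :=
  D.toCarrier.symm.toLinearMap ∘ₗ
    (Ideal.Quotient.liftₐ (relIdeal d) (evalPoly D f₀ f₁) fun _ hx =>
      h.evalPoly_eq_zero hx).toLinearMap

theorem lift_mk (h : Compatible d D f₀ f₁) (x : Poly k A M) :
    lift h (mk d x) = D.toCarrier.symm (evalPoly D f₀ f₁ x) := rfl

theorem lift_inA (h : Compatible d D f₀ f₁) (a : A) : lift h (inA d a) = f₀ a := by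
  rw [inA, lift_mk, evalPoly_X, D.der_zero]; rfl

theorem lift_inM (h : Compatible d D f₀ f₁) (x : M) : lift h (inM d x) = f₁ x := by
  rw [inM, lift_mk, evalPoly_X, D.der_zero]; rfl

theorem lift_isHom (h : Compatible d D f₀ f₁) : (dAlgebra d).IsHom D (lift h) where
  map_one := by
    change lift h 1 = _
    rw [← map_one (mk d), lift_mk, evalPoly_one]
  map_mul a b := by
    obtain ⟨x, rfl⟩ := mk_surjective d a
    obtain ⟨y, rfl⟩ := mk_surjective d b
    change lift h (mk d x * mk d y) = _
    rw [← map_mul, lift_mk, evalPoly_mul]; rfl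
  map_wt := by
    rintro i _ ⟨x, hx, rfl⟩
    exact evalPoly_mem D f₀ f₁ h.mem₀ h.mem₁ hx
  map_der n a := by
    obtain ⟨x, rfl⟩ := mk_surjective d a
    exact evalPoly_polyDer D f₀ f₁ n x

theorem mk_X (v : ℕ × (A ⊕ M)) : mk d (X v) = der d v.1 (Sum.elim (inA d) (inM d) v.2) := by
  obtain ⟨j, a | x⟩ := v
  · refine (congrArg (mk d) ?_).trans (descend_mk d (polyDer j) _ (X (0, Sum.inl a))).symm
    rw [polyDer_X]; simp
  · refine (congrArg (mk d) ?_).trans (descend_mk d (polyDer j) _ (X (0, Sum.inr x))).symm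
    rw [polyDer_X]; simp

theorem mk_C (r : k) : mk d (C r) = r • (1 : Jet d) := by
  rw [← Algebra.algebraMap_eq_smul_one]
  exact (mk d).commutes r

theorem inM_add (x y : M) : inM d (x + y) = inM d x + inM d y := by
  have h := (mk_eq_zero d).2 (Ideal.subset_span ⟨0, _, .add₁ x y, (polyDer_zero _).symm⟩)
  rwa [map_sub, map_sub, sub_sub, sub_eq_zero] at h

theorem hom_ext {φ ψ : Jet d →ₗ[k] B} (hφ : (dAlgebra d).IsHom D φ) (hψ : (dAlgebra d).IsHom D ψ)
    (h₀ : ∀ a, φ (inA d a) = ψ (inA d a)) (h₁ : ∀ x, φ (inM d x) = ψ (inM d x)) : φ = ψ := by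
  refine LinearMap.ext fun x => ?_
  obtain ⟨x, rfl⟩ := mk_surjective d x
  induction x using MvPolynomial.induction_on with
  | C r =>
    have e : mk d (C r) = r • (dAlgebra d).one := mk_C r
    rw [e, map_smul, map_smul, hφ.map_one, hψ.map_one]
  | add x y hx hy => simp only [map_add, hx, hy]
  | mul_X x v hx =>
    have e : mk d (x * X v) = (dAlgebra d).mul (mk d x)
        ((dAlgebra d).der v.1 (Sum.elim (inA d) (inM d) v.2)) := (map_mul _ _ _).trans
      (congrArg (mk d x * ·) (mk_X v))
    rw [e, hφ.map_mul, hψ.map_mul, hφ.map_der, hψ.map_der, hx]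
    congr 2
    obtain ⟨j, a | x⟩ := v
    · exact h₀ a
    · exact h₁ x

end Jet

theorem Ideal.mem_pow_zero {R : Type*} [CommRing R] (I : Ideal R) (x : R) : x ∈ I ^ 0 := by
  rw [pow_zero, Ideal.one_eq_top]; trivial

theorem Ideal.mul_mem_pow_add {R : Type*} [CommRing R] {I : Ideal R} {m n : ℕ} {x y : R}
    (hx : x ∈ I ^ m) (hy : y ∈ I ^ n) : x * y ∈ I ^ (m + n) := by
  rw [pow_add]; exact Ideal.mul_mem_mul hx hy

theorem Ideal.pow_succ_le {R : Type*} [CommRing R] {I J : Ideal R} {n : ℕ}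
    (h : ∀ x ∈ I ^ n, ∀ y ∈ I, x * y ∈ J) : I ^ (n + 1) ≤ J := by
  rw [pow_succ]; exact Ideal.mul_le.2 h

namespace VertexAlgebroid

open Envelope

variable {k A T Ω : Type*} [CommRing k] [Invertible (2 : k)]
    [CommRing A] [Algebra k A]
    [LieRing T] [LieAlgebra k T] [Module A T] [LieRingModule T A] [LieRinehartRing A T]
    [LieRinehartAlgebra k A T]
    [AddCommGroup Ω] [Module k Ω] [Module A Ω] [IsScalarTower k A Ω]
    [LieRingModule T Ω] [LieModule k T Ω]
    {𝒜 : VertexAlgebroid k A T Ω}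

/-! ### Monomials in the jet algebra -/

/-- Corresponding letters of monomials in the vertex envelope and in the jet algebra. -/
inductive JetLetter (𝒜 : VertexAlgebroid k A T Ω) : ℕ → ℕ → 𝒜.Envelope → Jet 𝒜.abDer → Prop
  | A₀ (a : A) : JetLetter 𝒜 0 0 (gen₀ 𝒜 a) (Jet.inA 𝒜.abDer a)
  | A (j : ℕ) (a : A) : JetLetter 𝒜 0 1 ((vertexAlgebra 𝒜).der (j + 1) (gen₀ 𝒜 a))
      (Jet.der 𝒜.abDer (j + 1) (Jet.inA 𝒜.abDer a))
  | Ω (j : ℕ) (ω : Ω) : JetLetter 𝒜 0 1 ((vertexAlgebra 𝒜).der j (gen₁ 𝒜 (0, ω)))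
      (Jet.der 𝒜.abDer j (Jet.inM 𝒜.abDer (0, ω)))
  | T (j : ℕ) (τ : T) : JetLetter 𝒜 1 1 ((vertexAlgebra 𝒜).der j (gen₁ 𝒜 (τ, 0)))
      (Jet.der 𝒜.abDer j (Jet.inM 𝒜.abDer (τ, 0)))

/-- Corresponding monomials in the vertex envelope and in the jet algebra. -/
inductive JetMonomial (𝒜 : VertexAlgebroid k A T Ω) : ℕ → ℕ → 𝒜.Envelope → Jet 𝒜.abDer → Prop
  | one : JetMonomial 𝒜 0 0 (vertexAlgebra 𝒜).vac 1
  | cons {i p d e : ℕ} {x u : 𝒜.Envelope} {y z : Jet 𝒜.abDer} : JetLetter 𝒜 d e x y →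
      JetMonomial 𝒜 i p u z →
      JetMonomial 𝒜 (i + d) (p + e) ((vertexAlgebra 𝒜).op (-1) x u) (y * z)

theorem JetLetter.isLetter {d e : ℕ} {x : 𝒜.Envelope} {y : Jet 𝒜.abDer}
    (h : 𝒜.JetLetter d e x y) : 𝒜.IsLetter d e x := by
  cases h with
  | A₀ a => exact .A₀ a
  | A j a => exact .A j a
  | Ω j ω => exact .Ω j ω
  | T j τ => exact .T j τ

theorem IsLetter.exists_jet {d e : ℕ} {x : 𝒜.Envelope} (h : 𝒜.IsLetter d e x) :
    ∃ y, 𝒜.JetLetter d e x y := by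
  cases h with
  | A₀ a => exact ⟨_, .A₀ a⟩
  | A j a => exact ⟨_, .A j a⟩
  | Ω j ω => exact ⟨_, .Ω j ω⟩
  | T j τ => exact ⟨_, .T j τ⟩

theorem JetMonomial.isMonomial {i p : ℕ} {u : 𝒜.Envelope} {z : Jet 𝒜.abDer}
    (h : 𝒜.JetMonomial i p u z) : 𝒜.IsMonomial i p u := by
  induction h with
  | one => exact .vac
  | cons hx _ ih => exact ih.cons hx.isLetter

theorem IsMonomial.exists_jet {i p : ℕ} {u : 𝒜.Envelope} (h : 𝒜.IsMonomial i p u) :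
    ∃ z, 𝒜.JetMonomial i p u z := by
  refine h.letter_induction (P := fun i p u => ∃ z, 𝒜.JetMonomial i p u z) ⟨_, .one⟩ ?_
  rintro i p d e x u hx - ⟨z, hz⟩
  obtain ⟨y, hy⟩ := hx.exists_jet
  exact ⟨_, .cons hy hz⟩

theorem JetMonomial.mul {i j p q : ℕ} {u v : 𝒜.Envelope} {y z : Jet 𝒜.abDer}
    (hy : 𝒜.JetMonomial i p u y) (hz : 𝒜.JetMonomial j q v z) :
    ∃ w, 𝒜.JetMonomial (i + j) (p + q) w (y * z) := by
  induction hy with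
  | one => exact ⟨_, by rwa [zero_add, zero_add, one_mul]⟩
  | @cons i p d e x u y y' hx _ ih =>
    obtain ⟨w, hw⟩ := ih
    refine ⟨(vertexAlgebra 𝒜).op (-1) x w, ?_⟩
    rw [mul_assoc, show i + d + j = i + j + d by ring, show p + e + q = p + q + e by ring]
    exact .cons hx hw

/-- The span of the monomials with at least `p` letters of positive weight. -/
noncomputable def jetSpan (𝒜 : VertexAlgebroid k A T Ω) (p : ℕ) : Submodule k (Jet 𝒜.abDer) :=
  Submodule.span k {z | ∃ i p' u, p ≤ p' ∧ 𝒜.JetMonomial i p' u z}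

theorem JetMonomial.mem_jetSpan {i p p' : ℕ} {u : 𝒜.Envelope} {z : Jet 𝒜.abDer}
    (h : 𝒜.JetMonomial i p' u z) (hp : p ≤ p') : z ∈ 𝒜.jetSpan p :=
  Submodule.subset_span ⟨i, p', u, hp, h⟩

theorem mul_mem_jetSpan {p q : ℕ} {y z : Jet 𝒜.abDer} (hy : y ∈ 𝒜.jetSpan p)
    (hz : z ∈ 𝒜.jetSpan q) : y * z ∈ 𝒜.jetSpan (p + q) := by
  have h := Submodule.mul_mem_mul hy hz
  rw [jetSpan, jetSpan, Submodule.span_mul_span] at h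
  refine Submodule.span_le.2 ?_ h
  rintro _ ⟨_, ⟨i, p', u, hp, hu⟩, _, ⟨j, q', v, hq, hv⟩, rfl⟩
  obtain ⟨w, hw⟩ := hu.mul hv
  exact hw.mem_jetSpan (add_le_add hp hq)

theorem JetLetter.mem_jetSpan {d e p : ℕ} {x : 𝒜.Envelope} {y : Jet 𝒜.abDer}
    (h : 𝒜.JetLetter d e x y) (hp : p ≤ e) : y ∈ 𝒜.jetSpan p := by
  have := JetMonomial.cons h .one
  rw [mul_one, zero_add, zero_add] at this
  exact this.mem_jetSpan hp

theorem der_inM_mem_jetSpan (j : ℕ) (x : T × Ω) :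
    Jet.der 𝒜.abDer j (Jet.inM 𝒜.abDer x) ∈ 𝒜.jetSpan 1 := by
  have e : Jet.inM 𝒜.abDer x = Jet.inM 𝒜.abDer (x.1, 0) + Jet.inM 𝒜.abDer (0, x.2) := by
    rw [← Jet.inM_add]; simp
  rw [e, map_add]
  exact add_mem ((JetLetter.T j x.1).mem_jetSpan le_rfl) ((JetLetter.Ω j x.2).mem_jetSpan le_rfl)

theorem X_mem_jetSpan {p : ℕ} (v : ℕ × (A ⊕ T × Ω)) (h : p ≤ min 1 (Jet.varWt v)) :
    Jet.mk 𝒜.abDer (MvPolynomial.X v) ∈ 𝒜.jetSpan p := by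
  have anti : 𝒜.jetSpan 1 ≤ 𝒜.jetSpan p :=
    Submodule.span_mono fun z ⟨i, p', u, hp, hz⟩ => ⟨i, p', u, by omega, hz⟩
  rw [Jet.mk_X]
  obtain ⟨j, a | x⟩ := v
  · rcases j with _ | j
    · have e : Jet.der 𝒜.abDer 0 (Jet.inA 𝒜.abDer a) = Jet.inA 𝒜.abDer a :=
        (Jet.dAlgebra 𝒜.abDer).der_zero _
      change Jet.der 𝒜.abDer 0 (Jet.inA 𝒜.abDer a) ∈ _
      rw [e]
      exact (JetLetter.A₀ a).mem_jetSpan (h.trans (min_le_right _ _))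
    · exact anti ((JetLetter.A j a).mem_jetSpan le_rfl)
  · exact anti (der_inM_mem_jetSpan j x)

theorem mem_jetSpan_zero (z : Jet 𝒜.abDer) : z ∈ 𝒜.jetSpan 0 := by
  obtain ⟨x, rfl⟩ := Jet.mk_surjective 𝒜.abDer z
  induction x using MvPolynomial.induction_on with
  | C r =>
    rw [Jet.mk_C]
    exact Submodule.smul_mem _ _ (JetMonomial.one.mem_jetSpan le_rfl)
  | add x y hx hy => rw [map_add]; exact add_mem hx hy
  | mul_X x v hx =>
    rw [map_mul]
    exact mul_mem_jetSpan (p := 0) (q := 0) hx (X_mem_jetSpan v (Nat.zero_le _))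

/-- The span of the monomials with at least `p` letters of positive weight, as an ideal. -/
noncomputable def jetIdeal (𝒜 : VertexAlgebroid k A T Ω) (p : ℕ) : Ideal (Jet 𝒜.abDer) where
  toAddSubmonoid := (𝒜.jetSpan p).toAddSubmonoid
  smul_mem' z y hy := by
    have := mul_mem_jetSpan (mem_jetSpan_zero z) hy
    rwa [zero_add] at this

theorem augIdeal_le_jetIdeal : Jet.augIdeal 𝒜.abDer ≤ 𝒜.jetIdeal 1 := by
  refine Ideal.span_le.2 ?_
  rintro _ ⟨i, hi, x, hx, rfl⟩
  change Jet.mk 𝒜.abDer x ∈ 𝒜.jetIdeal 1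
  rw [← MvPolynomial.support_sum_monomial_coeff x, map_sum]
  refine sum_mem fun s hs => ?_
  have hw : Finsupp.weight Jet.varWt s = i := hx (MvPolynomial.mem_support_iff.1 hs)
  obtain ⟨v, hv, hv'⟩ : ∃ v ∈ s.support, Jet.varWt v ≠ 0 := by
    by_contra! H
    rw [Finsupp.weight_apply, Finsupp.sum, Finset.sum_eq_zero fun v hv => by
      rw [H v hv, smul_zero]] at hw
    omega
  have e : (MvPolynomial.monomial s (x.coeff s) : Jet.Poly k A (T × Ω)) =
      MvPolynomial.monomial (s - Finsupp.single v 1) (x.coeff s) * MvPolynomial.X v := by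
    rw [MvPolynomial.X, MvPolynomial.monomial_mul, mul_one, tsub_add_cancel_of_le]
    rw [Finsupp.single_le_iff]
    exact Nat.one_le_iff_ne_zero.2 (Finsupp.mem_support_iff.1 hv)
  rw [e, map_mul]
  exact Ideal.mul_mem_left _ _ (X_mem_jetSpan v (le_min le_rfl (by omega)))

theorem augIdeal_pow_le (p : ℕ) : Jet.augIdeal 𝒜.abDer ^ p ≤ 𝒜.jetIdeal p := by
  induction p with
  | zero => exact fun z _ => mem_jetSpan_zero z
  | succ p ih =>
    exact Ideal.pow_succ_le fun y hy z hz => mul_mem_jetSpan (ih hy) (augIdeal_le_jetIdeal hz)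

theorem JetLetter.mem_augIdeal {d e : ℕ} {x : 𝒜.Envelope} {y : Jet 𝒜.abDer}
    (h : 𝒜.JetLetter d e x y) : y ∈ Jet.augIdeal 𝒜.abDer ^ e := by
  have hX : ∀ v : ℕ × (A ⊕ T × Ω), 1 ≤ Jet.varWt v →
      Jet.mk 𝒜.abDer (MvPolynomial.X v) ∈ Jet.augIdeal 𝒜.abDer ^ 1 := fun v hv => by
    rw [pow_one]
    exact Ideal.subset_span ⟨_, hv, _, MvPolynomial.isWeightedHomogeneous_X k _ v, rfl⟩
  cases h with
  | A₀ a => exact Ideal.mem_pow_zero _ _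
  | A j a =>
    have := hX (j + 1, Sum.inl a) (by simp [Jet.varWt])
    rwa [Jet.mk_X] at this
  | Ω j ω =>
    have := hX (j, Sum.inr (0, ω)) (by simp [Jet.varWt])
    rwa [Jet.mk_X] at this
  | T j τ =>
    have := hX (j, Sum.inr (τ, 0)) (by simp [Jet.varWt])
    rwa [Jet.mk_X] at this

theorem JetMonomial.mem_augIdeal {i p : ℕ} {u : 𝒜.Envelope} {z : Jet 𝒜.abDer}
    (h : 𝒜.JetMonomial i p u z) : z ∈ Jet.augIdeal 𝒜.abDer ^ p := by
  induction h with
  | one => exact Ideal.mem_pow_zero _ _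
  | @cons i p d e x u y z hx _ ih =>
    rw [mul_comm]
    exact Ideal.mul_mem_pow_add ih hx.mem_augIdeal

/-! ### The canonical map to `gr_F` -/

variable (𝒜)

theorem gen₀_mem_filF (a : A) : gen₀ 𝒜 a ∈ 𝒜.filF 0 := by
  rw [filF_eq]; exact (IsLetter.A₀ a).isMonomial.mem_filZ le_rfl

theorem gen₁_Ω_mem_filF (ω : Ω) : gen₁ 𝒜 (0, ω) ∈ 𝒜.filF 0 := by
  have := (IsLetter.Ω (𝒜 := 𝒜) 0 ω).isMonomial.mem_filZ le_rfl
  rwa [VertexAlgebra.der_zero, ← filF_eq] at this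

theorem gen₁_T_mem_filF (τ : T) : gen₁ 𝒜 (τ, 0) ∈ 𝒜.filF 1 := by
  have := (IsLetter.T (𝒜 := 𝒜) 0 τ).isMonomial.mem_filZ le_rfl
  rwa [VertexAlgebra.der_zero, ← filF_eq] at this

/-- The class of `a` in `gr_F`. -/
noncomputable def jetMap₀ : A →ₗ[k] 𝒜.GrF :=
  Gr.symb 𝒜.filF 𝒜.filF' 0 ∘ₗ (gen₀ 𝒜).codRestrict _ 𝒜.gen₀_mem_filF

/-- The class of `ω` in `gr_F`. -/
noncomputable def jetMapΩ : Ω →ₗ[k] 𝒜.GrF :=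
  Gr.symb 𝒜.filF 𝒜.filF' 0 ∘ₗ
    (gen₁ 𝒜 ∘ₗ LinearMap.inr k T Ω).codRestrict _ 𝒜.gen₁_Ω_mem_filF

/-- The class of `τ` in `gr_F`. -/
noncomputable def jetMapT : T →ₗ[k] 𝒜.GrF :=
  Gr.symb 𝒜.filF 𝒜.filF' 1 ∘ₗ
    (gen₁ 𝒜 ∘ₗ LinearMap.inl k T Ω).codRestrict _ 𝒜.gen₁_T_mem_filF

/-- The class of `x ∈ T ⊕ Ω` in `gr_F`. -/
noncomputable def jetMap₁ : T × Ω →ₗ[k] 𝒜.GrF := 𝒜.jetMapT.coprod 𝒜.jetMapΩ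

/-- The `∂`-algebra structure of `gr_F`. -/
noncomputable abbrev dF : DAlgebra k 𝒜.GrF := 𝒜.compatible_filF.dAlgebra

theorem jetMap_compatible :
    Jet.Compatible 𝒜.abDer 𝒜.dF 𝒜.jetMap₀ 𝒜.jetMap₁ where
  map_one := Gr.symb_congr' rfl _ _ (isTruncatedHom_gen 𝒜).map_one
  map_mul a b := ((𝒜.compatible_filF.mul_symb (𝒜.gen₀_mem_filF a) (𝒜.gen₀_mem_filF b)).trans
    (Gr.symb_congr' (zero_add 0) _ _ ((isTruncatedHom_gen 𝒜).map_mul a b))).symm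
  map_smul a x := by
    have h := (isTruncatedHom_gen 𝒜).map_nprod a
    change 𝒜.jetMapT (a • x.1) + 𝒜.jetMapΩ (a • x.2) =
      𝒜.dF.mul (𝒜.jetMap₀ a) (𝒜.jetMapT x.1 + 𝒜.jetMapΩ x.2)
    rw [map_add]
    refine congrArg₂ (· + ·) ?_ ?_ <;> refine Eq.symm ((𝒜.compatible_filF.mul_symb _ _).trans ?_)
    · refine Gr.symb_congr rfl _ _ ?_
      change (vertexAlgebra 𝒜).op (-1) (gen₀ 𝒜 a) (gen₁ 𝒜 (x.1, 0)) - gen₁ 𝒜 (a • x.1, 0) ∈ 𝒜.filF 0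
      rw [h, ← map_sub]
      convert 𝒜.gen₁_Ω_mem_filF (-𝒜.γ a x.1) using 2
      simp [nprod]
    · refine Gr.symb_congr' rfl _ _ ?_
      change (vertexAlgebra 𝒜).op (-1) (gen₀ 𝒜 a) (gen₁ 𝒜 (0, x.2)) = gen₁ 𝒜 (0, a • x.2)
      rw [h]
      simp [nprod]
  map_d a := by
    change _ = 𝒜.jetMapT 0 + 𝒜.jetMapΩ (𝒜.d a)
    rw [map_zero, zero_add]
    exact (𝒜.compatible_filF.der_symb 1 _).trans
      (Gr.symb_congr' rfl _ _ ((isTruncatedHom_gen 𝒜).map_del a))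
  mem₀ a := Gr.Compatible.symb_mem_wt _ ((isTruncatedHom_gen 𝒜).mem₀ a)
  mem₁ x := add_mem (Gr.Compatible.symb_mem_wt _ ((isTruncatedHom_gen 𝒜).mem₁ _))
    (Gr.Compatible.symb_mem_wt _ ((isTruncatedHom_gen 𝒜).mem₁ _))

/-- The canonical map `J(𝒜^ab) → gr_F U𝒜`. -/
noncomputable def jetToGr : Jet 𝒜.abDer →ₗ[k] 𝒜.GrF := Jet.lift 𝒜.jetMap_compatible

theorem jetToGr_isCanonicalF : 𝒜.IsCanonicalF 𝒜.dF 𝒜.jetToGr where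
  isHom := Jet.lift_isHom _
  map_A a := ⟨𝒜.gen₀_mem_filF a, Jet.lift_inA _ a⟩
  map_Ω ω := ⟨𝒜.gen₁_Ω_mem_filF ω, (Jet.lift_inM _ _).trans (by
    change 𝒜.jetMapT 0 + 𝒜.jetMapΩ ω = _
    rw [map_zero, zero_add]; rfl)⟩
  map_T τ := ⟨𝒜.gen₁_T_mem_filF τ, (Jet.lift_inM _ _).trans (by
    change 𝒜.jetMapT τ + 𝒜.jetMapΩ 0 = _
    rw [map_zero, add_zero]; rfl)⟩

variable {𝒜}

theorem IsCanonicalF.ext {φ ψ : Jet 𝒜.abDer →ₗ[k] 𝒜.GrF} {D : DAlgebra k 𝒜.GrF}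
    (hφ : 𝒜.IsCanonicalF D φ) (hψ : 𝒜.IsCanonicalF D ψ) : φ = ψ := by
  refine Jet.hom_ext hφ.isHom hψ.isHom (fun a => ?_) fun x => ?_
  · obtain ⟨_, h⟩ := hφ.map_A a
    obtain ⟨_, h'⟩ := hψ.map_A a
    rw [h, h']
  · have e : Jet.inM 𝒜.abDer x = Jet.inM 𝒜.abDer (x.1, 0) + Jet.inM 𝒜.abDer (0, x.2) := by
      rw [← Jet.inM_add]; simp
    obtain ⟨_, h₁⟩ := hφ.map_T x.1
    obtain ⟨_, h₁'⟩ := hψ.map_T x.1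
    obtain ⟨_, h₂⟩ := hφ.map_Ω x.2
    obtain ⟨_, h₂'⟩ := hψ.map_Ω x.2
    rw [e, map_add, map_add, h₁, h₁', h₂, h₂']

theorem IsMonomial.mem_filF {i p : ℕ} {u : 𝒜.Envelope} (h : 𝒜.IsMonomial i p u) : u ∈ 𝒜.filF i :=
  Submodule.subset_span ⟨i, le_rfl, p, h⟩

theorem JetLetter.jetToGr_eq {d e : ℕ} {x : 𝒜.Envelope} {y : Jet 𝒜.abDer}
    (h : 𝒜.JetLetter d e x y) :
    𝒜.jetToGr y = Gr.symb 𝒜.filF 𝒜.filF' d ⟨x, h.isLetter.isMonomial.mem_filF⟩ := by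
  have hφ := 𝒜.jetToGr_isCanonicalF
  have hder : ∀ n y, 𝒜.jetToGr (Jet.der 𝒜.abDer n y) = 𝒜.dF.der n (𝒜.jetToGr y) :=
    hφ.isHom.map_der
  cases h with
  | A₀ a => exact (hφ.map_A a).2
  | A j a =>
    rw [hder, (hφ.map_A a).2]
    exact 𝒜.compatible_filF.der_symb _ _
  | Ω j ω =>
    rw [hder, (hφ.map_Ω ω).2]
    exact 𝒜.compatible_filF.der_symb _ _
  | T j τ =>
    rw [hder, (hφ.map_T τ).2]
    exact 𝒜.compatible_filF.der_symb _ _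

theorem JetMonomial.jetToGr_eq {i p : ℕ} {u : 𝒜.Envelope} {z : Jet 𝒜.abDer}
    (h : 𝒜.JetMonomial i p u z) :
    𝒜.jetToGr z = Gr.symb 𝒜.filF 𝒜.filF' i ⟨u, h.isMonomial.mem_filF⟩ := by
  have hφ := 𝒜.jetToGr_isCanonicalF.isHom
  induction h with
  | one => exact hφ.map_one
  | @cons i p d e x u y z hx _ ih =>
    refine (hφ.map_mul y z).trans ?_
    rw [ih, hx.jetToGr_eq]
    exact (𝒜.compatible_filF.mul_symb _ _).trans (Gr.symb_congr' (add_comm _ _) _ _ rfl)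

theorem exists_of_mem_filH {i p : ℕ} {x : 𝒜.Envelope} (hx : x ∈ 𝒜.filH (i, p)) :
    ∃ h : x ∈ 𝒜.filF i, ∃ y ∈ Jet.augIdeal 𝒜.abDer ^ p,
      𝒜.jetToGr y = Gr.symb 𝒜.filF 𝒜.filF' i ⟨x, h⟩ := by
  have key := filH_map LinearMap.id
    ((((Jet.augIdeal 𝒜.abDer ^ p).restrictScalars k).map 𝒜.jetToGr |>.comap
      (Gr.symb 𝒜.filF 𝒜.filF' i)).map (𝒜.filF i).subtype) (fun u hu => ?_) (fun p' u hp hu => ?_) x hx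
  · obtain ⟨⟨x, h⟩, ⟨y, hy, hxy⟩, rfl⟩ := key
    exact ⟨h, y, hy, hxy⟩
  · rw [← filF'_eq] at hu
    refine ⟨⟨u, ?_⟩, ⟨0, zero_mem _, ?_⟩, rfl⟩
    · rw [filF_eq]; rw [filF'_eq] at hu; exact filZ_mono (by omega) hu
    · rw [map_zero]; exact (Gr.symb_eq_zero.2 hu).symm
  · obtain ⟨z, hz⟩ := hu.exists_jet
    exact ⟨⟨u, hu.mem_filF⟩, ⟨z, Ideal.pow_le_pow_right hp hz.mem_augIdeal, hz.jetToGr_eq⟩, rfl⟩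

theorem jetToGr_surjective : Function.Surjective 𝒜.jetToGr := by
  intro z
  induction z using Gr.induction with
  | add x y hx hy =>
    obtain ⟨x, rfl⟩ := hx
    obtain ⟨y, rfl⟩ := hy
    exact ⟨x + y, map_add _ _ _⟩
  | zero => exact ⟨0, map_zero _⟩
  | symb i x =>
    obtain ⟨x, hx⟩ := x
    obtain ⟨_, y, -, h⟩ := exists_of_mem_filH (𝒜 := 𝒜) (x := x) (by rw [filH_zero]; exact hx)
    exact ⟨y, h⟩

/-- The map `gr_F U𝒜 → U𝒜 / H (i, p)` induced by the inclusion of `F i`. -/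
noncomputable def grToQuotient (𝒜 : VertexAlgebroid k A T Ω) (i p : ℕ) :
    𝒜.GrF →ₗ[k] 𝒜.Envelope ⧸ 𝒜.filH (i, p) :=
  Gr.lift (fun j => if j = i then (𝒜.filH (i, p)).mkQ ∘ₗ (𝒜.filF j).subtype else 0) fun j x hx => by
    split_ifs with h
    · subst h
      refine (Submodule.Quotient.mk_eq_zero _).2 (filZ_le_filH _ _ ?_)
      rwa [← filF'_eq]
    · rfl

theorem grToQuotient_symb (i p : ℕ) {x : 𝒜.Envelope} (hx : x ∈ 𝒜.filF i) :
    𝒜.grToQuotient i p (Gr.symb 𝒜.filF 𝒜.filF' i ⟨x, hx⟩) = Submodule.Quotient.mk x := by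
  rw [grToQuotient, Gr.lift_symb, if_pos rfl]; rfl

theorem grToQuotient_symb_ne {i j : ℕ} (p : ℕ) (h : j ≠ i) (x : 𝒜.filF j) :
    𝒜.grToQuotient i p (Gr.symb 𝒜.filF 𝒜.filF' j x) = 0 := by
  rw [grToQuotient, Gr.lift_symb, if_neg h]; rfl

theorem mem_filH_iff (i p : ℕ) (x : 𝒜.filF i) : (x : 𝒜.Envelope) ∈ 𝒜.filH (i, p) ↔
    ∃ y ∈ Jet.augIdeal 𝒜.abDer ^ p, 𝒜.jetToGr y = Gr.symb 𝒜.filF 𝒜.filF' i x := by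
  refine ⟨fun hx => (exists_of_mem_filH hx).2, ?_⟩
  rintro ⟨y, hy, hyx⟩
  rw [← Submodule.Quotient.mk_eq_zero, ← grToQuotient_symb i p x.2]
  change 𝒜.grToQuotient i p (Gr.symb 𝒜.filF 𝒜.filF' i x) = 0
  rw [← hyx]
  suffices H : 𝒜.jetSpan p ≤ LinearMap.ker (𝒜.grToQuotient i p ∘ₗ 𝒜.jetToGr) from
    H (augIdeal_pow_le p hy)
  refine Submodule.span_le.2 ?_
  rintro z ⟨j, p', u, hp, hu⟩
  change 𝒜.grToQuotient i p (𝒜.jetToGr z) = 0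
  rw [hu.jetToGr_eq]
  by_cases h : j = i
  · subst h
    rw [grToQuotient_symb, Submodule.Quotient.mk_eq_zero]
    exact hu.isMonomial.mem_filH hp
  · exact grToQuotient_symb_ne p h _

end VertexAlgebroid

theorem Finsupp.prod_map_toMultiset' {σ M : Type*} [CommMonoid M] (t : σ → M) (s : σ →₀ ℕ) :
    ((Finsupp.toMultiset s).map t).prod = s.prod fun i n => t i ^ n := by
  induction s using Finsupp.induction_linear with
  | zero => simp
  | add f g hf hg =>
    rw [map_add, Multiset.map_add, Multiset.prod_add, hf, hg,
      Finsupp.prod_add_index' (by simp) (by simp [pow_add])]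
  | single i n => simp [Finsupp.toMultiset_single, Multiset.map_nsmul, Multiset.prod_nsmul]

theorem Finsupp.card_toMultiset_eq_degree {σ : Type*} (s : σ →₀ ℕ) :
    Multiset.card (Finsupp.toMultiset s) = s.degree := by
  rw [Finsupp.card_toMultiset]; rfl

namespace VertexAlgebroid

open Envelope MvPolynomial

section

variable {k A T Ω : Type*} [CommRing k] [Algebra ℚ k] [Invertible (2 : k)]
    [CommRing A] [Algebra k A]
    [LieRing T] [LieAlgebra k T] [Module A T] [LieRingModule T A] [LieRinehartRing A T]
    [LieRinehartAlgebra k A T]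
    [AddCommGroup Ω] [Module k Ω] [Module A Ω] [IsScalarTower k A Ω]
    [LieRingModule T Ω] [LieModule k T Ω]
    (𝒜 : VertexAlgebroid k A T Ω) {I Λ : Type*} (bT : Module.Basis I A T)
    (bΩ : Module.Basis Λ A Ω)

/-! ### The image of the filtrations in the Fock module -/

/-- The map from the vertex envelope to the Fock module. -/
noncomputable def toFock : 𝒜.Envelope →ₗ[k] 𝒜.Fock bT bΩ := toRep (𝒜.fockRep bT bΩ)

theorem toFock_op_gen₀ (n : ℤ) (a : A) (u : 𝒜.Envelope) :
    𝒜.toFock bT bΩ ((vertexAlgebra 𝒜).op n (gen₀ 𝒜 a) u) =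
      𝒜.opA bT bΩ n a (𝒜.toFock bT bΩ u) := toRep_op_gen₀ _ _ _ _

theorem toFock_op_gen₁ (n : ℤ) (x : T × Ω) (u : 𝒜.Envelope) :
    𝒜.toFock bT bΩ ((vertexAlgebra 𝒜).op n (gen₁ 𝒜 x) u) =
      𝒜.opE bT bΩ n x (𝒜.toFock bT bΩ u) := toRep_op_gen₁ _ _ _ _

theorem toFock_vac : 𝒜.toFock bT bΩ (vertexAlgebra 𝒜).vac = 𝒜.vec bT bΩ 1 := toRep_vac _

theorem toFock_gen₀ (a : A) : 𝒜.toFock bT bΩ (gen₀ 𝒜 a) = 𝒜.vec bT bΩ (C a) := by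
  rw [← VertexAlgebra.op_vac (vertexAlgebra 𝒜) (gen₀ 𝒜 a), toFock_op_gen₀, toFock_vac, opA_vec,
    show (-1 - (-1) : ℤ) = 0 by norm_num, dp_zero, mul_one]

theorem mul_mem_pow_succ {R : Type*} [CommRing R] {J : Ideal R} {x b : R} (hx : x ∈ J) {q : ℕ}
    (hb : b ∈ J ^ q) : x * b ∈ J ^ (q + 1) := by
  rw [pow_succ']; exact Ideal.mul_mem_mul hx hb

variable {𝒜} in
theorem IsMonomial.toFock_mem {i p : ℕ} {u : 𝒜.Envelope} (hu : 𝒜.IsMonomial i p u) :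
    𝒜.toFock bT bΩ u ∈ 𝒜.fockFil bT bΩ i p := by
  induction hu with
  | vac =>
    rw [toFock_vac]
    exact 𝒜.single_mem_fockFil bT bΩ (Multiset.card_zero) (Ideal.mem_pow_zero _ _)
  | letter_A₀ i p a u _ ih =>
    rw [toFock_op_gen₀]
    refine 𝒜.act_baseModes_mem_fockFil bT bΩ (e := 0) (𝒜.modeA_mem_baseModes _ a)
      (fun q b hb => ?_) _ ih
    rw [modeBot_A]
    exact Ideal.mul_mem_left _ _ hb
  | letter_A i p j a u _ ih =>
    rw [VertexAlgebra.op_der, toFock_op_gen₀]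
    refine 𝒜.act_baseModes_mem_fockFil bT bΩ (e := 1) (𝒜.modeA_mem_baseModes _ a)
      (fun q b hb => ?_) _ ih
    rw [modeBot_A, show (-1 - (-1 - (j + 1 : ℕ)) : ℤ) = j + 1 by push_cast; ring]
    exact mul_mem_pow_succ (𝒜.dp_C_mem bΩ j a) hb
  | letter_Ω i p j ω u _ ih =>
    rw [VertexAlgebra.op_der, toFock_op_gen₁]
    refine 𝒜.act_baseModes_mem_fockFil bT bΩ (e := 1) (𝒜.modeE_mem_baseModes _ ω)
      (fun q b hb => ?_) _ ih
    rw [modeBot_Ω]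
    exact mul_mem_pow_succ (𝒜.dp_inΩ_mem bΩ _ ω) hb
  | letter_T i p j τ u _ ih =>
    rw [VertexAlgebra.op_der, toFock_op_gen₁]
    exact 𝒜.act_mem_fockFil bT bΩ _ _ ih

/-- The coefficient of `U𝒜 → Fock` at a basis monomial. -/
noncomputable def fockCoeff (N : Multiset (CreationIndex I)) (M : Λ × ℕ →₀ ℕ) :
    𝒜.Envelope →ₗ[k] A :=
  (MvPolynomial.lcoeff A M).restrictScalars k ∘ₗ Finsupp.lapply N ∘ₗ 𝒜.toFock bT bΩ

theorem fockCoeff_eq_zero_of_mem_filZ {N : Multiset (CreationIndex I)} {M : Λ × ℕ →₀ ℕ} {i : ℤ}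
    (hi : i < Multiset.card N) {u : 𝒜.Envelope} (hu : u ∈ 𝒜.filZ i) :
    𝒜.fockCoeff bT bΩ N M u = 0 := by
  suffices H : 𝒜.filZ i ≤ LinearMap.ker (𝒜.fockCoeff bT bΩ N M) from H hu
  refine Submodule.span_le.2 ?_
  rintro u ⟨i', p, h, hu⟩
  exact 𝒜.coeff_eq_zero_of_mem_fockFil bT bΩ (hu.toFock_mem bT bΩ) (Or.inl (by omega))

theorem fockCoeff_eq_zero_of_mem_filH {N : Multiset (CreationIndex I)} {M : Λ × ℕ →₀ ℕ}
    {u : 𝒜.Envelope}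
    (hu : u ∈ 𝒜.filH (Multiset.card N, Multiset.card N + M.degree + 1)) :
    𝒜.fockCoeff bT bΩ N M u = 0 := by
  rw [filH, filF'_eq] at hu
  revert u
  suffices H : _ ≤ LinearMap.ker (𝒜.fockCoeff bT bΩ N M) from fun {u} hu => H hu
  refine sup_le (fun u hu => 𝒜.fockCoeff_eq_zero_of_mem_filZ bT bΩ (by omega) hu)
    (Submodule.span_le.2 ?_)
  rintro u ⟨p, hp, hu⟩
  exact 𝒜.coeff_eq_zero_of_mem_fockFil bT bΩ (hu.toFock_mem bT bΩ)
    (Or.inr ⟨rfl, by simp only at hp; omega⟩)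

/-! ### Basis monomials -/

/-- The letter `∂^(m) τᵢ`. -/
noncomputable def letterT (j : CreationIndex I) : 𝒜.Envelope :=
  (vertexAlgebra 𝒜).der j.ord (gen₁ 𝒜 (bT j.gen, 0))

/-- The letter `∂^(m) ω`, for `ω` in the basis. -/
noncomputable def letterΩ (w : Λ × ℕ) : 𝒜.Envelope :=
  (vertexAlgebra 𝒜).der w.2 (gen₁ 𝒜 (0, bΩ w.1))

/-- The monomial with given letters. -/
noncomputable def word (L : List (CreationIndex I)) (W : List (Λ × ℕ)) (a : A) : 𝒜.Envelope :=
  L.foldr (fun j => (vertexAlgebra 𝒜).op (-1) (𝒜.letterT bT j))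
    (W.foldr (fun w => (vertexAlgebra 𝒜).op (-1) (𝒜.letterΩ bΩ w)) (gen₀ 𝒜 a))

theorem toFock_word {L : List (CreationIndex I)} (hL : L.Pairwise (· ≤ ·)) (W : List (Λ × ℕ))
    (a : A) : 𝒜.toFock bT bΩ (𝒜.word bT bΩ L W a) =
      Finsupp.single (L : Multiset (CreationIndex I)) ((W.map X).prod * C a) := by
  induction L with
  | nil =>
    change 𝒜.toFock bT bΩ (W.foldr _ _) = 𝒜.vec bT bΩ _
    induction W with
    | nil => rw [List.foldr_nil, toFock_gen₀, List.map_nil, List.prod_nil, one_mul]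
    | cons w W ih =>
      rw [List.foldr_cons, letterΩ, VertexAlgebra.op_der, toFock_op_gen₁, ih, opE_Ω_vec,
        show (-1 - (-1 - (w.2 : ℤ))) = w.2 by ring, inΩ_basis, dp_X, List.map_cons, List.prod_cons,
        mul_assoc]
  | cons j L ih =>
    rw [List.pairwise_cons] at hL
    change 𝒜.toFock bT bΩ ((vertexAlgebra 𝒜).op (-1) (𝒜.letterT bT j) (𝒜.word bT bΩ L W a)) = _
    rw [letterT, VertexAlgebra.op_der, toFock_op_gen₁, ih hL.2,
      𝒜.opE_creation_single bT bΩ (by simpa using hL.1)]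
    rfl

open Classical in
theorem fockCoeff_word (N N' : Multiset (CreationIndex I)) (M M' : Λ × ℕ →₀ ℕ) (a : A) :
    𝒜.fockCoeff bT bΩ N M (𝒜.word bT bΩ (N'.sort (· ≤ ·)) (Finsupp.toMultiset M').toList a) =
      if N' = N ∧ M' = M then a else 0 := by
  have e : ((Finsupp.toMultiset M').toList.map X).prod * C a = monomial M' a := by
    rw [monomial_eq, mul_comm, ← Finsupp.prod_map_toMultiset', ← Multiset.prod_coe,
      ← Multiset.map_coe, Multiset.coe_toList]
  change MvPolynomial.coeff M (𝒜.toFock bT bΩ _ N) = _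
  rw [toFock_word _ _ _ (Multiset.pairwise_sort _ _), e, Multiset.sort_eq, Finsupp.single_apply]
  split_ifs with h1 h2 h2
  · rw [coeff_monomial, if_pos h2.2]
  · rw [coeff_monomial, if_neg fun h => h2 ⟨h1, h⟩]
  · exact absurd h2.1 h1
  · rw [coeff_zero]

/-! ### Injectivity of canonical maps -/

variable {ι C : Type*} [AddCommMonoid ι] [DecidableEq ι] [CommRing C]
  {S S' : ι → Submodule k 𝒜.Envelope}

/-- The evaluation of polynomials in the letters. -/
noncomputable def evalLetters (f : A →+* C) (y : Λ × ℕ → C) (t : CreationIndex I → C) :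
    MvPolynomial (CreationIndex I) (MvPolynomial (Λ × ℕ) A) →+* C :=
  eval₂Hom (eval₂Hom f y) t

variable (h : Gr.Compatible (vertexAlgebra 𝒜) S S') {f : A →+* C} {y : Λ × ℕ → C}
  {t : CreationIndex I → C} {φ : C →+ Gr S S'} {κT κΩ : ι}

theorem exists_map_word (h : Gr.Compatible (vertexAlgebra 𝒜) S S')
    (hmul : ∀ x y, φ (x * y) = h.mul (φ x) (φ y))
    (hA : ∀ a, ∃ h, φ (f a) = Gr.symb S S' 0 ⟨gen₀ 𝒜 a, h⟩)
    (hΩ : ∀ w, ∃ h, φ (y w) = Gr.symb S S' κΩ ⟨𝒜.letterΩ bΩ w, h⟩)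
    (hT : ∀ j, ∃ h, φ (t j) = Gr.symb S S' κT ⟨𝒜.letterT bT j, h⟩)
    (L : List (CreationIndex I)) (W : List (Λ × ℕ)) (a : A) :
    ∃ h, φ ((L.map t).prod * ((W.map y).prod * f a)) =
      Gr.symb S S' (L.length • κT + W.length • κΩ) ⟨𝒜.word bT bΩ L W a, h⟩ := by
  induction L with
  | nil =>
    rw [List.map_nil, List.prod_nil, one_mul, List.length_nil, zero_smul, zero_add]
    induction W with
    | nil =>
      rw [List.map_nil, List.prod_nil, one_mul, List.length_nil, zero_smul]
      exact hA a
    | cons w W ih =>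
      obtain ⟨h1, h2⟩ := ih
      obtain ⟨h3, h4⟩ := hΩ w
      rw [List.map_cons, List.prod_cons, mul_assoc, hmul, h2, h4, h.mul_symb, List.length_cons,
        succ_nsmul, add_comm _ κΩ]
      exact ⟨_, rfl⟩
  | cons j L ih =>
    obtain ⟨h1, h2⟩ := ih
    obtain ⟨h3, h4⟩ := hT j
    rw [List.map_cons, List.prod_cons, mul_assoc, hmul, h2, h4, h.mul_symb, List.length_cons,
      succ_nsmul, add_comm _ κT, add_assoc]
    exact ⟨_, rfl⟩

theorem injective_of_letters (h : Gr.Compatible (vertexAlgebra 𝒜) S S')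
    (hmul : ∀ x y, φ (x * y) = h.mul (φ x) (φ y))
    (hA : ∀ a, ∃ h, φ (f a) = Gr.symb S S' 0 ⟨gen₀ 𝒜 a, h⟩)
    (hΩ : ∀ w, ∃ h, φ (y w) = Gr.symb S S' κΩ ⟨𝒜.letterΩ bΩ w, h⟩)
    (hT : ∀ j, ∃ h, φ (t j) = Gr.symb S S' κT ⟨𝒜.letterT bT j, h⟩)
    (hS' : ∀ (N : Multiset (CreationIndex I)) (M : Λ × ℕ →₀ ℕ),
      ∀ u ∈ S' (Multiset.card N • κT + M.degree • κΩ), 𝒜.fockCoeff bT bΩ N M u = 0)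
    (hsurj : Function.Surjective (evalLetters (I := I) f y t)) : Function.Injective φ := by
  rw [injective_iff_map_eq_zero]
  intro z hz
  obtain ⟨v, rfl⟩ := hsurj z
  let ψ : ∀ (N : CreationIndex I →₀ ℕ) (M : Λ × ℕ →₀ ℕ), Gr S S' →ₗ[k] A := fun N M =>
    Gr.lift (fun i => if i = N.degree • κT + M.degree • κΩ
      then 𝒜.fockCoeff bT bΩ (Finsupp.toMultiset N) M ∘ₗ (S i).subtype else 0) fun i x hx => by
        split_ifs with hi
        · subst hi
          refine hS' (Finsupp.toMultiset N) M x ?_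
          rwa [Finsupp.card_toMultiset_eq_degree]
        · rfl
  have key : ∀ N M v, ψ N M (φ (evalLetters f y t v)) = coeff M (coeff N v) := by
    classical
    intro N M v
    induction v using MvPolynomial.induction_on' with
    | add v w hv hw => simp only [map_add, coeff_add, hv, hw]
    | monomial N' b =>
      induction b using MvPolynomial.induction_on' with
      | add v w hv hw => simp only [map_add, coeff_add, hv, hw]
      | monomial M' a =>
        obtain ⟨h1, h2⟩ := 𝒜.exists_map_word bT bΩ h hmul hA hΩ hT
          ((Finsupp.toMultiset N').sort (· ≤ ·)) (Finsupp.toMultiset M').toList a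
        have e : evalLetters f y t (monomial N' (monomial M' a)) =
            (((Finsupp.toMultiset N').sort (· ≤ ·)).map t).prod *
              (((Finsupp.toMultiset M').toList.map y).prod * f a) := by
          rw [evalLetters, coe_eval₂Hom, eval₂_monomial, coe_eval₂Hom, eval₂_monomial,
            ← Finsupp.prod_map_toMultiset', ← Finsupp.prod_map_toMultiset', ← Multiset.prod_coe,
            ← Multiset.prod_coe, ← Multiset.map_coe, ← Multiset.map_coe, Multiset.coe_toList,
            Multiset.sort_eq]
          ring
        have e1 : Finsupp.toMultiset N' = Finsupp.toMultiset N ∧ M' = M ↔ N' = N ∧ M' = M := by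
          rw [(Function.LeftInverse.injective Finsupp.toMultiset_toFinsupp).eq_iff]
        have e2 : coeff M (coeff N (monomial N' (monomial M' a))) =
            if N' = N ∧ M' = M then a else 0 := by
          rw [coeff_monomial]
          split_ifs with h1 h2 h2
          · rw [coeff_monomial, if_pos h2.2]
          · rw [coeff_monomial, if_neg fun h => h2 ⟨h1, h⟩]
          · exact absurd h2.1 h1
          · rw [coeff_zero]
        have e3 : ((Finsupp.toMultiset N').sort (· ≤ ·)).length • κT +
            (Finsupp.toMultiset M').toList.length • κΩ = N'.degree • κT + M'.degree • κΩ := by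
          rw [Multiset.length_sort, Multiset.length_toList, Finsupp.card_toMultiset_eq_degree,
            Finsupp.card_toMultiset_eq_degree]
        rw [e, h2, Gr.lift_symb, e2]
        split_ifs with h3 h4 h4
        · refine (𝒜.fockCoeff_word bT bΩ _ _ _ _ a).trans (if_pos (e1.2 h4))
        · refine (𝒜.fockCoeff_word bT bΩ _ _ _ _ a).trans (if_neg fun h => h4 (e1.1 h))
        · exact absurd (e3.trans (by rw [h4.1, h4.2])) h3
        · rfl
  rw [MvPolynomial.ext_iff.2 fun N => MvPolynomial.ext_iff.2 fun M =>
    (key N M v).symm.trans (by rw [hz, map_zero, coeff_zero, coeff_zero]), map_zero]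

end

end VertexAlgebroid

namespace Jet

open MvPolynomial

variable {k A M : Type*} [CommRing k] [CommRing A] [Algebra k A] [AddCommGroup M] [Module k M]
  [Module A M] {d : Derivation k A M}

theorem mk_rel {r : Poly k A M} (h : Rel d r) : mk d r = 0 :=
  (mk_eq_zero d).2 (Ideal.subset_span ⟨0, r, h, (polyDer_zero r).symm⟩)

theorem inA_add (a b : A) : inA d (a + b) = inA d a + inA d b := by
  have h := mk_rel (d := d) (.add₀ a b)
  rwa [map_sub, map_sub, sub_sub, sub_eq_zero] at h

theorem inA_one : inA d 1 = 1 := by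
  have h := mk_rel (d := d) .one
  rwa [map_sub, map_one, sub_eq_zero] at h

theorem inA_mul (a b : A) : inA d (a * b) = inA d a * inA d b := by
  have h := mk_rel (d := d) (.mul a b)
  rwa [map_sub, map_mul, sub_eq_zero] at h

theorem inA_smul (r : k) (a : A) : inA d (r • a) = r • inA d a := by
  have h := mk_rel (d := d) (.smul₀ r a)
  rwa [map_sub, map_smul, sub_eq_zero] at h

theorem inM_smul (a : A) (x : M) : inM d (a • x) = inA d a * inM d x := by
  have h := mk_rel (d := d) (.smul a x)
  rwa [map_sub, map_mul, sub_eq_zero] at h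

theorem der_one_inA (a : A) : der d 1 (inA d a) = inM d (d a) := by
  have h := mk_rel (d := d) (.der a)
  rw [map_sub, sub_eq_zero, mk_X] at h
  exact h

/-- The ring homomorphism from `A` to the jet algebra. -/
noncomputable def inAHom (d : Derivation k A M) : A →+* Jet d where
  toFun := inA d
  map_one' := inA_one
  map_mul' := inA_mul
  map_zero' := by simpa using inA_smul (d := d) (0 : k) 0
  map_add' := inA_add

/-- The jet algebra of a free module is generated by `A` and the derivatives of a basis. -/
theorem eq_top_of_basis [Algebra ℚ k] {ι : Type*} (b : Module.Basis ι A M) (R : Subring (Jet d))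
    (hA : ∀ a, inA d a ∈ R) (hb : ∀ i j, der d j (inM d (b i)) ∈ R) : R = ⊤ := by
  have hsmul : ∀ (r : k), ∀ z ∈ R, r • z ∈ R := fun r z hz => by
    have : r • z = inA d (r • 1) * z := by rw [inA_smul, inA_one, smul_mul_assoc, one_mul]
    rw [this]
    exact mul_mem (hA _) hz
  have hM : ∀ n, (∀ p ≤ n, ∀ a, der d p (inA d a) ∈ R) → ∀ x, ∀ q ≤ n, der d q (inM d x) ∈ R := by
    intro n hn x
    have hx : x ∈ Submodule.span A (Set.range b) := by rw [b.span_eq]; trivial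
    induction hx using Submodule.span_induction with
    | mem x hx => obtain ⟨i, rfl⟩ := hx; exact fun q _ => hb i q
    | zero =>
      intro q _
      have : inM d (0 : M) = 0 := by simpa using inM_add (d := d) (0 : M) 0
      rw [this, map_zero]
      exact zero_mem _
    | add x y _ _ hx hy =>
      intro q hq
      rw [inM_add, map_add]
      exact add_mem (hx q hq) (hy q hq)
    | smul a x _ hx =>
      intro q hq
      rw [inM_smul]
      have e := (dAlgebra d).der_mul q (inA d a) (inM d x)
      change der d q (inA d a * inM d x) = _ at e
      rw [e]
      refine sum_mem fun p hp => ?_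
      rw [Finset.HasAntidiagonal.mem_antidiagonal] at hp
      exact mul_mem (hn _ (by omega) a) (hx _ (by omega))
  have hA' : ∀ n, ∀ p ≤ n, ∀ a, der d p (inA d a) ∈ R := by
    intro n
    induction n with
    | zero =>
      intro p hp a
      rw [Nat.le_zero.1 hp]
      have e := (dAlgebra d).der_zero (inA d a)
      change der d 0 (inA d a) = _ at e
      rw [e]
      exact hA a
    | succ n ih =>
      intro p hp a
      rcases Nat.le_succ_iff.1 hp with hp | rfl
      · exact ih p hp a
      · have h := hM n ih (d a) n le_rfl
        rw [← der_one_inA] at h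
        have e := (dAlgebra d).der_der n 1 (inA d a)
        change der d n (der d 1 (inA d a)) = _ • der d (n + 1) (inA d a) at e
        rw [e, Nat.choose_succ_self_right] at h
        have h2 := hsmul (algebraMap ℚ k ((n + 1 : ℕ) : ℚ)⁻¹) _ h
        rw [← Nat.cast_smul_eq_nsmul k, smul_smul, ← map_natCast (algebraMap ℚ k), ← map_mul,
          inv_mul_cancel₀ (by exact_mod_cast Nat.succ_ne_zero n), map_one, one_smul] at h2
        exact h2
  rw [eq_top_iff]
  rintro z -
  obtain ⟨x, rfl⟩ := mk_surjective d z
  induction x using MvPolynomial.induction_on with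
  | C r => rw [mk_C]; exact hsmul r _ (one_mem _)
  | add x y hx hy => rw [map_add]; exact add_mem hx hy
  | mul_X x v hx =>
    rw [map_mul, mk_X]
    refine mul_mem hx ?_
    obtain ⟨j, a | x⟩ := v
    · exact hA' j j le_rfl a
    · exact hM j (hA' j) x j le_rfl

end Jet

namespace VertexAlgebroid

open Envelope MvPolynomial

variable {k A T Ω : Type*} [CommRing k] [Algebra ℚ k] [Invertible (2 : k)]
    [CommRing A] [Algebra k A]
    [LieRing T] [LieAlgebra k T] [Module A T] [LieRingModule T A] [LieRinehartRing A T]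
    [LieRinehartAlgebra k A T]
    [AddCommGroup Ω] [Module k Ω] [Module A Ω] [IsScalarTower k A Ω]
    [LieRingModule T Ω] [LieModule k T Ω]
    (𝒜 : VertexAlgebroid k A T Ω) 

theorem evalLetters_jet_surjective {I Λ : Type*} (bT : Module.Basis I A T)
    (bΩ : Module.Basis Λ A Ω) : Function.Surjective
      (evalLetters (Jet.inAHom 𝒜.abDer)
        (fun w : Λ × ℕ => Jet.der 𝒜.abDer w.2 (Jet.inM 𝒜.abDer (0, bΩ w.1)))
        (fun j : CreationIndex I => Jet.der 𝒜.abDer j.ord (Jet.inM 𝒜.abDer (bT j.gen, 0)))) := by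
  rw [← RingHom.range_eq_top]
  refine Jet.eq_top_of_basis (bT.prod bΩ) _ (fun a => ⟨C (C a), ?_⟩) fun i j => ?_
  · rw [evalLetters, coe_eval₂Hom, eval₂_C, coe_eval₂Hom, eval₂_C]; rfl
  · obtain i | l := i
    · refine ⟨X ⟨i, j⟩, ?_⟩
      rw [evalLetters, coe_eval₂Hom, eval₂_X]
      simp
    · refine ⟨C (X (l, j)), ?_⟩
      rw [evalLetters, coe_eval₂Hom, eval₂_C, coe_eval₂Hom, eval₂_X]
      simp

theorem jetToGr_injective [Module.Free A T] [Module.Free A Ω] :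
    Function.Injective 𝒜.jetToGr := by
  have hφ := 𝒜.jetToGr_isCanonicalF
  have h0 : ∀ d e (x : 𝒜.Envelope) y, 𝒜.JetLetter d e x y → ∃ h,
    𝒜.jetToGr y = Gr.symb 𝒜.filF 𝒜.filF' d ⟨x, h⟩ := fun d e x y h => ⟨_, h.jetToGr_eq⟩
  refine 𝒜.injective_of_letters (Module.Free.chooseBasis A T) (Module.Free.chooseBasis A Ω)
    (φ := 𝒜.jetToGr.toAddMonoidHom) (κT := 1) (κΩ := 0) 𝒜.compatible_filF hφ.isHom.map_mul
    (fun a => h0 _ _ _ _ (.A₀ a)) (fun w => h0 _ _ _ _ (.Ω w.2 _)) (fun j => h0 _ _ _ _ (.T j.ord _))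
    (fun N M u hu => ?_) (𝒜.evalLetters_jet_surjective _ _)
  rw [smul_zero, add_zero, smul_eq_mul, mul_one, filF'_eq] at hu
  exact 𝒜.fockCoeff_eq_zero_of_mem_filZ _ _ (by omega) hu

end VertexAlgebroid

namespace VertexAlgebroid

open Envelope MvPolynomial

section

variable {k A T Ω : Type*} [CommRing k] [Invertible (2 : k)]
    [CommRing A] [Algebra k A]
    [LieRing T] [LieAlgebra k T] [Module A T] [LieRingModule T A] [LieRinehartRing A T]
    [LieRinehartAlgebra k A T]
    [AddCommGroup Ω] [Module k Ω] [Module A Ω] [IsScalarTower k A Ω]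
    [LieRingModule T Ω] [LieModule k T Ω]
    (𝒜 : VertexAlgebroid k A T Ω)

/-! ### The canonical map to `gr_H` -/

theorem gen₀_mem_filH (a : A) : gen₀ 𝒜 a ∈ 𝒜.filH (0, 0) :=
  (IsLetter.A₀ a).isMonomial.mem_filH le_rfl

theorem gen₁_Ω_mem_filH (ω : Ω) : gen₁ 𝒜 (0, ω) ∈ 𝒜.filH (0, 1) := by
  have := (IsLetter.Ω (𝒜 := 𝒜) 0 ω).isMonomial.mem_filH le_rfl
  rwa [VertexAlgebra.der_zero] at this

theorem gen₁_T_mem_filH (τ : T) : gen₁ 𝒜 (τ, 0) ∈ 𝒜.filH (1, 1) := by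
  have := (IsLetter.T (𝒜 := 𝒜) 0 τ).isMonomial.mem_filH le_rfl
  rwa [VertexAlgebra.der_zero] at this

/-- The class of `a` in `gr_H`. -/
noncomputable def symMap₀ : A →ₗ[k] 𝒜.GrH :=
  Gr.symb 𝒜.filH 𝒜.filH' (0, 0) ∘ₗ (gen₀ 𝒜).codRestrict _ 𝒜.gen₀_mem_filH

/-- The class of `ω` in `gr_H`. -/
noncomputable def symMapΩ : Ω →ₗ[k] 𝒜.GrH :=
  Gr.symb 𝒜.filH 𝒜.filH' (0, 1) ∘ₗ
    (gen₁ 𝒜 ∘ₗ LinearMap.inr k T Ω).codRestrict _ 𝒜.gen₁_Ω_mem_filH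

/-- The class of `τ` in `gr_H`. -/
noncomputable def symMapT : T →ₗ[k] 𝒜.GrH :=
  Gr.symb 𝒜.filH 𝒜.filH' (1, 1) ∘ₗ
    (gen₁ 𝒜 ∘ₗ LinearMap.inl k T Ω).codRestrict _ 𝒜.gen₁_T_mem_filH

/-- The `∂`-algebra structure of `gr_H`. -/
noncomputable abbrev dH : DAlgebra k 𝒜.GrH := 𝒜.compatible_filH.dAlgebra

theorem symMap₀_one : 𝒜.symMap₀ 1 = 𝒜.dH.one :=
  Gr.symb_congr' rfl _ _ (isTruncatedHom_gen 𝒜).map_one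

theorem symMap₀_mul (a b : A) : 𝒜.symMap₀ (a * b) = 𝒜.dH.mul (𝒜.symMap₀ a) (𝒜.symMap₀ b) :=
  ((𝒜.compatible_filH.mul_symb (𝒜.gen₀_mem_filH a) (𝒜.gen₀_mem_filH b)).trans
    (Gr.symb_congr' (zero_add _) _ _ ((isTruncatedHom_gen 𝒜).map_mul a b))).symm

theorem symMapΩ_smul (a : A) (ω : Ω) :
    𝒜.symMapΩ (a • ω) = 𝒜.dH.mul (𝒜.symMap₀ a) (𝒜.symMapΩ ω) := by
  refine ((𝒜.compatible_filH.mul_symb (𝒜.gen₀_mem_filH a) (𝒜.gen₁_Ω_mem_filH ω)).trans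
    (Gr.symb_congr' (zero_add _) _ _ ?_)).symm
  change (vertexAlgebra 𝒜).op (-1) (gen₀ 𝒜 a) (gen₁ 𝒜 (0, ω)) = gen₁ 𝒜 (0, a • ω)
  rw [(isTruncatedHom_gen 𝒜).map_nprod]
  simp [nprod]

theorem symMapT_smul (a : A) (τ : T) :
    𝒜.symMapT (a • τ) = 𝒜.dH.mul (𝒜.symMap₀ a) (𝒜.symMapT τ) := by
  refine ((𝒜.compatible_filH.mul_symb (𝒜.gen₀_mem_filH a) (𝒜.gen₁_T_mem_filH τ)).trans
    (Gr.symb_congr (zero_add _) _ _ ?_)).symm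
  change (vertexAlgebra 𝒜).op (-1) (gen₀ 𝒜 a) (gen₁ 𝒜 (τ, 0)) - gen₁ 𝒜 (a • τ, 0) ∈ 𝒜.filH (1, 2)
  rw [(isTruncatedHom_gen 𝒜).map_nprod, ← map_sub]
  have h := filZ_le_filH 1 2 (filH_le_filZ 0 1 (𝒜.gen₁_Ω_mem_filH (-𝒜.γ a τ)))
  convert h using 2
  simp [nprod]

theorem der_symMap₀ {n : ℕ} (hn : n ≠ 0) (a : A) : 𝒜.dH.der n (𝒜.symMap₀ a) = 0 := by
  obtain ⟨n, rfl⟩ := Nat.exists_eq_succ_of_ne_zero hn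
  refine (𝒜.compatible_filH.der_symb _ (𝒜.gen₀_mem_filH a)).trans (Gr.symb_eq_zero.2 ?_)
  exact (IsLetter.A n a).isMonomial.mem_filH le_rfl

theorem der_symMap₀_mul (n : ℕ) (a : A) (z : 𝒜.GrH) :
    𝒜.dH.der n (𝒜.dH.mul (𝒜.symMap₀ a) z) = 𝒜.dH.mul (𝒜.symMap₀ a) (𝒜.dH.der n z) := by
  rw [𝒜.dH.der_mul, Finset.sum_eq_single (0, n), 𝒜.dH.der_zero]
  · rintro ⟨p, q⟩ hp hne
    rw [Finset.HasAntidiagonal.mem_antidiagonal] at hp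
    rw [𝒜.der_symMap₀, map_zero, LinearMap.zero_apply]
    rintro rfl
    exact hne (Prod.ext rfl (by simpa using hp))
  · simp

/-- The associated graded of `H` as an algebra. -/
def GrHAlgebra := 𝒜.dH.Carrier

noncomputable instance : CommRing 𝒜.GrHAlgebra := inferInstanceAs (CommRing 𝒜.dH.Carrier)

noncomputable instance : Algebra A 𝒜.GrHAlgebra := RingHom.toAlgebra
  { toFun := 𝒜.symMap₀
    map_one' := 𝒜.symMap₀_one
    map_mul' := 𝒜.symMap₀_mul
    map_zero' := map_zero _
    map_add' := map_add _ }

/-- The identity map to the associated graded algebra. -/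
noncomputable def toGrHAlgebra : 𝒜.GrH ≃+ 𝒜.GrHAlgebra := AddEquiv.refl 𝒜.GrH

theorem toGrHAlgebra_symMap₀ (a : A) :
    𝒜.toGrHAlgebra (𝒜.symMap₀ a) = algebraMap A 𝒜.GrHAlgebra a := rfl

theorem toGrHAlgebra_mul (x y : 𝒜.GrH) :
    𝒜.toGrHAlgebra (𝒜.dH.mul x y) = 𝒜.toGrHAlgebra x * 𝒜.toGrHAlgebra y := rfl

/-- The classes of `∂^(n) τ`. -/
noncomputable def symDerT (n : ℕ) : T →ₗ[A] 𝒜.GrHAlgebra where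
  toFun τ := 𝒜.toGrHAlgebra (𝒜.dH.der n (𝒜.symMapT τ))
  map_add' x y := by rw [map_add, map_add, map_add]
  map_smul' a x := by
    rw [symMapT_smul, der_symMap₀_mul, toGrHAlgebra_mul, toGrHAlgebra_symMap₀, RingHom.id_apply,
      Algebra.smul_def]

/-- The classes of `∂^(n) ω`. -/
noncomputable def symDerΩ (n : ℕ) : Ω →ₗ[A] 𝒜.GrHAlgebra where
  toFun τ := 𝒜.toGrHAlgebra (𝒜.dH.der n (𝒜.symMapΩ τ))
  map_add' x y := by rw [map_add, map_add, map_add]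
  map_smul' a x := by
    rw [symMapΩ_smul, der_symMap₀_mul, toGrHAlgebra_mul, toGrHAlgebra_symMap₀, RingHom.id_apply,
      Algebra.smul_def]

/-- The canonical map from the symmetric algebra, as a morphism of algebras. -/
noncomputable def symHom : 𝒜.SymTΩ →ₐ[A] 𝒜.GrHAlgebra :=
  SymmetricAlgebra.lift ((Finsupp.lsum A fun i : ℕ+ => 𝒜.symDerT (i - 1)).coprod
    (Finsupp.lsum A fun i : ℕ+ => 𝒜.symDerΩ (i - 1)))

theorem symHom_symT (i : ℕ+) (τ : T) : 𝒜.symHom (𝒜.symT i τ) = 𝒜.symDerT (i - 1) τ := by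
  rw [symHom, symT, SymmetricAlgebra.lift_ι_apply]
  simp

theorem symHom_symΩ (i : ℕ+) (ω : Ω) : 𝒜.symHom (𝒜.symΩ i ω) = 𝒜.symDerΩ (i - 1) ω := by
  rw [symHom, symΩ, SymmetricAlgebra.lift_ι_apply]
  simp

/-- The canonical map `Sym_A(…) → gr_H U𝒜`. -/
noncomputable def symToGr : 𝒜.SymTΩ →ₗ[k] 𝒜.GrH where
  toFun x := 𝒜.toGrHAlgebra.symm (𝒜.symHom x)
  map_add' x y := by rw [map_add, map_add]
  map_smul' c x := by
    have e : c • x = algebraMap A 𝒜.SymTΩ (c • 1) * x := by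
      rw [← Algebra.smul_def, smul_assoc, one_smul]
    rw [e, map_mul, AlgHom.commutes, ← toGrHAlgebra_symMap₀, map_smul, symMap₀_one]
    exact (LinearMap.map_smul₂ 𝒜.dH.mul c _ _).trans (congrArg (c • ·) (𝒜.dH.one_mul _))

theorem symToGr_mul (x y : 𝒜.SymTΩ) :
    𝒜.symToGr (x * y) = 𝒜.dH.mul (𝒜.symToGr x) (𝒜.symToGr y) := by
  change 𝒜.toGrHAlgebra.symm (𝒜.symHom (x * y)) = _
  rw [map_mul]; rfl

theorem symToGr_one : 𝒜.symToGr 1 = 𝒜.dH.one := by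
  change 𝒜.toGrHAlgebra.symm (𝒜.symHom 1) = _
  rw [map_one]; rfl

theorem symToGr_algebraMap (a : A) : 𝒜.symToGr (algebraMap A _ a) = 𝒜.symMap₀ a := by
  change 𝒜.toGrHAlgebra.symm (𝒜.symHom _) = _
  rw [AlgHom.commutes]; rfl

theorem symToGr_symT (i : ℕ+) (τ : T) :
    𝒜.symToGr (𝒜.symT i τ) = 𝒜.dH.der (i - 1) (𝒜.symMapT τ) := by
  change 𝒜.toGrHAlgebra.symm (𝒜.symHom _) = _
  rw [symHom_symT]; rfl

theorem symToGr_symΩ (i : ℕ+) (ω : Ω) :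
    𝒜.symToGr (𝒜.symΩ i ω) = 𝒜.dH.der (i - 1) (𝒜.symMapΩ ω) := by
  change 𝒜.toGrHAlgebra.symm (𝒜.symHom _) = _
  rw [symHom_symΩ]; rfl

theorem der_der_pnat (i j : ℕ+) (z : 𝒜.GrH) : 𝒜.dH.der j (𝒜.dH.der (i - 1) z) =
    ((i + j - 1 : ℕ).choose j) • 𝒜.dH.der ((i + j : ℕ+) - 1) z := by
  have hi := i.pos
  rw [𝒜.dH.der_der, PNat.add_coe, show (j : ℕ) + (i - 1) = i + j - 1 by omega]

theorem symToGr_isCanonicalH : 𝒜.IsCanonicalH 𝒜.dH 𝒜.symToGr where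
  map_one := 𝒜.symToGr_one
  map_mul := 𝒜.symToGr_mul
  map_A a := ⟨𝒜.gen₀_mem_filH a, 𝒜.symToGr_algebraMap a⟩
  map_T i τ := ⟨_, (𝒜.symToGr_symT i τ).trans
    (𝒜.compatible_filH.der_symb _ (𝒜.gen₁_T_mem_filH τ))⟩
  map_Ω i ω := ⟨_, (𝒜.symToGr_symΩ i ω).trans
    (𝒜.compatible_filH.der_symb _ (𝒜.gen₁_Ω_mem_filH ω))⟩
  der_A j a hj := by rw [symToGr_algebraMap, 𝒜.der_symMap₀ hj.ne']
  der_T i j τ := by rw [symToGr_symT, symToGr_symT, der_der_pnat]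
  der_Ω i j ω := by rw [symToGr_symΩ, symToGr_symΩ, der_der_pnat]

variable {𝒜}

/-- Induction on elements of the symmetric algebra. -/
theorem symTΩ_induction {P : 𝒜.SymTΩ → Prop} (algebraMap : ∀ a, P (algebraMap A _ a))
    (symT : ∀ i τ, P (𝒜.symT i τ)) (symΩ : ∀ i ω, P (𝒜.symΩ i ω))
    (mul : ∀ x y, P x → P y → P (x * y)) (add : ∀ x y, P x → P y → P (x + y)) (x : 𝒜.SymTΩ) :
    P x := by
  induction x using SymmetricAlgebra.induction with
  | algebraMap a => exact algebraMap a
  | mul x y hx hy => exact mul x y hx hy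
  | add x y hx hy => exact add x y hx hy
  | ι x =>
    have h0 : P 0 := by simpa using algebraMap 0
    obtain ⟨f, g⟩ := x
    have e : SymmetricAlgebra.ι A _ ((f, g) : (ℕ+ →₀ T) × (ℕ+ →₀ Ω)) =
        SymmetricAlgebra.ι A _ (f, 0) + SymmetricAlgebra.ι A _ (0, g) := by
      rw [← map_add]; simp
    rw [e]
    refine add _ _ ?_ ?_
    · induction f using Finsupp.induction_linear with
      | zero => rw [Prod.mk_zero_zero, map_zero]; exact h0
      | add f g hf hg =>
        have := add _ _ (hf ?_) (hg ?_)
        · rwa [← map_add, Prod.mk_add_mk, add_zero] at this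
        all_goals rw [← map_add]; simp
      | single i τ => exact symT i τ
    · induction g using Finsupp.induction_linear with
      | zero => rw [Prod.mk_zero_zero, map_zero]; exact h0
      | add f g hf hg =>
        have := add _ _ (hf ?_) (hg ?_)
        · rwa [← map_add, Prod.mk_add_mk, add_zero] at this
        all_goals rw [← map_add]; simp
      | single i τ => exact symΩ i τ

theorem IsCanonicalH.ext {φ ψ : 𝒜.SymTΩ →ₗ[k] 𝒜.GrH} {D : DAlgebra k 𝒜.GrH}
    (hφ : 𝒜.IsCanonicalH D φ) (hψ : 𝒜.IsCanonicalH D ψ) : φ = ψ := by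
  refine LinearMap.ext fun x => ?_
  induction x using symTΩ_induction with
  | algebraMap a => rw [(hφ.map_A a).2, (hψ.map_A a).2]
  | symT i τ => rw [(hφ.map_T i τ).2, (hψ.map_T i τ).2]
  | symΩ i ω => rw [(hφ.map_Ω i ω).2, (hψ.map_Ω i ω).2]
  | mul x y hx hy => rw [hφ.map_mul, hψ.map_mul, hx, hy]
  | add x y hx hy => rw [map_add, map_add, hx, hy]

theorem mul_mem_range_symToGr {x y : 𝒜.GrH} (hx : x ∈ LinearMap.range 𝒜.symToGr)
    (hy : y ∈ LinearMap.range 𝒜.symToGr) : 𝒜.dH.mul x y ∈ LinearMap.range 𝒜.symToGr := by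
  obtain ⟨x, rfl⟩ := hx
  obtain ⟨y, rfl⟩ := hy
  exact ⟨x * y, 𝒜.symToGr_mul x y⟩

theorem der_symMapT_mem_range (n : ℕ) (τ : T) :
    𝒜.dH.der n (𝒜.symMapT τ) ∈ LinearMap.range 𝒜.symToGr :=
  ⟨𝒜.symT n.succPNat τ, 𝒜.symToGr_symT _ _⟩

theorem der_symMapΩ_mem_range (n : ℕ) (ω : Ω) :
    𝒜.dH.der n (𝒜.symMapΩ ω) ∈ LinearMap.range 𝒜.symToGr :=
  ⟨𝒜.symΩ n.succPNat ω, 𝒜.symToGr_symΩ _ _⟩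

end

section

variable {k A T Ω : Type*} [CommRing k] [Algebra ℚ k] [Invertible (2 : k)]
    [CommRing A] [Algebra k A]
    [LieRing T] [LieAlgebra k T] [Module A T] [LieRingModule T A] [LieRinehartRing A T]
    [LieRinehartAlgebra k A T]
    [AddCommGroup Ω] [Module k Ω] [Module A Ω] [IsScalarTower k A Ω]
    [LieRingModule T Ω] [LieModule k T Ω]
    {𝒜 : VertexAlgebroid k A T Ω}

theorem IsLetter.symb_mem_range {d e : ℕ} {x : 𝒜.Envelope} (hx : 𝒜.IsLetter d e x) :
    Gr.symb 𝒜.filH 𝒜.filH' (d, e) ⟨x, hx.isMonomial.mem_filH le_rfl⟩ ∈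
      LinearMap.range 𝒜.symToGr := by
  cases hx with
  | A₀ a => exact ⟨_, 𝒜.symToGr_algebraMap a⟩
  | A j a =>
    have h := der_symMapΩ_mem_range (𝒜 := 𝒜) j (𝒜.d a)
    have e : 𝒜.dH.der j (𝒜.symMapΩ (𝒜.d a)) = (j + 1) •
        Gr.symb 𝒜.filH 𝒜.filH' (0, 1) ⟨(vertexAlgebra 𝒜).der (j + 1) (gen₀ 𝒜 a),
          (IsLetter.A j a).isMonomial.mem_filH le_rfl⟩ := by
      refine (𝒜.compatible_filH.der_symb _ (𝒜.gen₁_Ω_mem_filH _)).trans ?_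
      rw [← map_nsmul]
      refine congrArg _ (Subtype.ext ?_)
      change (vertexAlgebra 𝒜).der j (gen₁ 𝒜 (𝒜.del a)) = (j + 1) • _
      rw [← (isTruncatedHom_gen 𝒜).map_del, VertexAlgebra.der_der, Nat.choose_succ_self_right]
    rw [e] at h
    have h2 := Submodule.smul_mem _ (algebraMap ℚ k ((j + 1 : ℕ) : ℚ)⁻¹) h
    rw [← Nat.cast_smul_eq_nsmul k, smul_smul, ← map_natCast (algebraMap ℚ k), ← map_mul,
      inv_mul_cancel₀ (by exact_mod_cast Nat.succ_ne_zero j), map_one, one_smul] at h2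
    exact h2
  | Ω j ω =>
    have h := der_symMapΩ_mem_range (𝒜 := 𝒜) j ω
    rwa [show 𝒜.dH.der j (𝒜.symMapΩ ω) = _ from
      𝒜.compatible_filH.der_symb _ (𝒜.gen₁_Ω_mem_filH ω)] at h
  | T j τ =>
    have h := der_symMapT_mem_range (𝒜 := 𝒜) j τ
    rwa [show 𝒜.dH.der j (𝒜.symMapT τ) = _ from
      𝒜.compatible_filH.der_symb _ (𝒜.gen₁_T_mem_filH τ)] at h

theorem IsMonomial.symb_mem_range {i p : ℕ} {u : 𝒜.Envelope} (hu : 𝒜.IsMonomial i p u) :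
    ∃ h, Gr.symb 𝒜.filH 𝒜.filH' (i, p) ⟨u, h⟩ ∈ LinearMap.range 𝒜.symToGr := by
  refine hu.letter_induction (P := fun i p u => ∃ h, Gr.symb 𝒜.filH 𝒜.filH' (i, p) ⟨u, h⟩ ∈
    LinearMap.range 𝒜.symToGr) ⟨𝒜.compatible_filH.vac_mem, 1, 𝒜.symToGr_one⟩ ?_
  rintro i p d e x u hx hu ⟨h, ih⟩
  refine ⟨(hu.cons hx).mem_filH le_rfl, ?_⟩
  have h2 := mul_mem_range_symToGr hx.symb_mem_range ih
  rw [show 𝒜.dH.mul _ _ = _ from 𝒜.compatible_filH.mul_symb _ _] at h2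
  rwa [Gr.symb_congr' (S := 𝒜.filH) (S' := 𝒜.filH')
    (show (d, e) + (i, p) = (i + d, p + e) from Prod.ext (add_comm _ _) (add_comm _ _)) _
      ((hu.cons hx).mem_filH le_rfl) rfl] at h2

theorem symToGr_surjective : Function.Surjective 𝒜.symToGr := by
  rw [← LinearMap.range_eq_top, eq_top_iff]
  rintro z -
  induction z using Gr.induction with
  | add x y hx hy => exact add_mem hx hy
  | zero => exact zero_mem _
  | symb q x =>
    obtain ⟨i, p⟩ := q
    obtain ⟨x, hx⟩ := x
    have key := filH_map LinearMap.id
      (((LinearMap.range 𝒜.symToGr).comap (Gr.symb 𝒜.filH 𝒜.filH' (i, p))).map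
        (𝒜.filH (i, p)).subtype) (fun u hu => ?_) (fun p' u hp hu => ?_) x hx
    · obtain ⟨⟨x, h⟩, hx', rfl⟩ := key
      exact hx'
    · refine ⟨⟨u, filZ_le_filH i p hu⟩, ⟨0, ?_⟩, rfl⟩
      rw [map_zero]
      exact (Gr.symb_eq_zero.2 (show u ∈ 𝒜.filH (i, p + 1) from filZ_le_filH i _ hu)).symm
    · rcases hp.lt_or_eq with hp | rfl
      · refine ⟨⟨u, hu.mem_filH hp.le⟩, ⟨0, ?_⟩, rfl⟩
        rw [map_zero]
        exact (Gr.symb_eq_zero.2 (hu.mem_filH hp)).symm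
      · obtain ⟨h, h2⟩ := hu.symb_mem_range
        exact ⟨⟨u, h⟩, h2, rfl⟩

variable (𝒜)

theorem evalLetters_sym_surjective {I Λ : Type*} (bT : Module.Basis I A T)
    (bΩ : Module.Basis Λ A Ω) : Function.Surjective
      (evalLetters (algebraMap A 𝒜.SymTΩ) (fun w : Λ × ℕ => 𝒜.symΩ w.2.succPNat (bΩ w.1))
        (fun j : CreationIndex I => 𝒜.symT j.ord.succPNat (bT j.gen))) := by
  rw [← RingHom.range_eq_top, eq_top_iff]
  have hA : ∀ a, algebraMap A 𝒜.SymTΩ a ∈ (evalLetters (algebraMap A 𝒜.SymTΩ)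
      (fun w : Λ × ℕ => 𝒜.symΩ w.2.succPNat (bΩ w.1))
      (fun j : CreationIndex I => 𝒜.symT j.ord.succPNat (bT j.gen))).range := fun a =>
    ⟨C (C a), by rw [evalLetters, coe_eval₂Hom, eval₂_C, coe_eval₂Hom, eval₂_C]⟩
  rintro x -
  induction x using symTΩ_induction with
  | algebraMap a => exact hA a
  | mul x y hx hy => exact mul_mem hx hy
  | add x y hx hy => exact add_mem hx hy
  | symT i τ =>
    have hτ : τ ∈ Submodule.span A (Set.range bT) := by rw [bT.span_eq]; trivial
    rw [show 𝒜.symT i τ = (SymmetricAlgebra.ι A _ ∘ₗ LinearMap.inl A _ _ ∘ₗ Finsupp.lsingle i) τ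
      from rfl]
    induction hτ using Submodule.span_induction with
    | mem x hx =>
      obtain ⟨j, rfl⟩ := hx
      refine ⟨X ⟨j, i.natPred⟩, ?_⟩
      rw [evalLetters, coe_eval₂Hom, eval₂_X, PNat.succPNat_natPred]; rfl
    | zero => simp only [map_zero]; exact zero_mem _
    | add x y _ _ hx hy => simp only [map_add]; exact add_mem hx hy
    | smul a x _ hx =>
      simp only [map_smul]
      rw [Algebra.smul_def]
      exact mul_mem (hA a) hx
  | symΩ i τ =>
    have hτ : τ ∈ Submodule.span A (Set.range bΩ) := by rw [bΩ.span_eq]; trivial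
    rw [show 𝒜.symΩ i τ = (SymmetricAlgebra.ι A _ ∘ₗ LinearMap.inr A _ _ ∘ₗ Finsupp.lsingle i) τ
      from rfl]
    induction hτ using Submodule.span_induction with
    | mem x hx =>
      obtain ⟨j, rfl⟩ := hx
      refine ⟨C (X ⟨j, i.natPred⟩), ?_⟩
      rw [evalLetters, coe_eval₂Hom, eval₂_C, coe_eval₂Hom, eval₂_X, PNat.succPNat_natPred]; rfl
    | zero => simp only [map_zero]; exact zero_mem _
    | add x y _ _ hx hy => simp only [map_add]; exact add_mem hx hy
    | smul a x _ hx =>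
      simp only [map_smul]
      rw [Algebra.smul_def]
      exact mul_mem (hA a) hx

theorem symToGr_injective [Module.Free A T] [Module.Free A Ω] :
    Function.Injective 𝒜.symToGr := by
  have hφ := 𝒜.symToGr_isCanonicalH
  refine 𝒜.injective_of_letters (Module.Free.chooseBasis A T) (Module.Free.chooseBasis A Ω)
    (φ := 𝒜.symToGr.toAddMonoidHom) (κT := (1, 1)) (κΩ := (0, 1)) 𝒜.compatible_filH hφ.map_mul
    hφ.map_A (fun w => hφ.map_Ω w.2.succPNat _) (fun j => hφ.map_T j.ord.succPNat _)
    (fun N M u hu => ?_) (𝒜.evalLetters_sym_surjective _ _)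
  refine 𝒜.fockCoeff_eq_zero_of_mem_filH _ _ ?_
  rw [filH'] at hu
  convert hu using 2
  simp

end

end VertexAlgebroid

theorem theorem9p16 {k A T Ω : Type*} [CommRing k] [Algebra ℚ k] [Invertible (2 : k)]
    [CommRing A] [Algebra k A]
    [LieRing T] [LieAlgebra k T] [Module A T] [LieRingModule T A] [LieRinehartRing A T]
    [LieRinehartAlgebra k A T]
    [AddCommGroup Ω] [Module k Ω] [Module A Ω] [IsScalarTower k A Ω]
    [LieRingModule T Ω] [LieModule k T Ω]
    [Module.Free A T] [Module.Free A Ω]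
    (𝒜 : VertexAlgebroid k A T Ω) :
    -- the canonical map `J(𝒜^ab) → gr_F U𝒜` is an isomorphism of `∂`-algebras, and the filtration
    -- `H` is the refinement of `F` by the `J⁺`-adic filtration
    (∃ D : DAlgebra k 𝒜.GrF,
      Gr.IsInduced (VertexAlgebroid.Envelope.vertexAlgebra 𝒜) 𝒜.filF 𝒜.filF' D ∧
      ∃ φ : Jet 𝒜.abDer →ₗ[k] 𝒜.GrF, 𝒜.IsCanonicalF D φ ∧
        (∀ ψ, 𝒜.IsCanonicalF D ψ → ψ = φ) ∧ Function.Bijective φ ∧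
        ∀ (i p : ℕ) (x : 𝒜.filF i), (x : 𝒜.Envelope) ∈ 𝒜.filH (i, p) ↔
          ∃ y ∈ Jet.augIdeal 𝒜.abDer ^ p, φ y = Gr.symb 𝒜.filF 𝒜.filF' i x) ∧
    -- the canonical map from the symmetric algebra to `gr_H U𝒜` is an isomorphism of `∂`-algebras
    (∃ D : DAlgebra k 𝒜.GrH,
      Gr.IsInduced (VertexAlgebroid.Envelope.vertexAlgebra 𝒜) 𝒜.filH 𝒜.filH' D ∧
      ∃ φ : 𝒜.SymTΩ →ₗ[k] 𝒜.GrH, 𝒜.IsCanonicalH D φ ∧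
        (∀ ψ, 𝒜.IsCanonicalH D ψ → ψ = φ) ∧ Function.Bijective φ) ∧
    -- `H` is compatible with the conformal grading
    (∀ q, 𝒜.filH q =
      ⨆ n, 𝒜.filH q ⊓ (VertexAlgebroid.Envelope.vertexAlgebra 𝒜).wt n) ∧
    -- `H` is finite on the component of conformal weight `n`
    (∀ n, (VertexAlgebroid.Envelope.vertexAlgebra 𝒜).wt n ≤ 𝒜.filH (n, 0) ∧
      (VertexAlgebroid.Envelope.vertexAlgebra 𝒜).wt n ⊓ 𝒜.filH (0, n + 1) = ⊥ ∧
      ∀ i p, n < p → (VertexAlgebroid.Envelope.vertexAlgebra 𝒜).wt n ⊓ 𝒜.filH (i + 1, p) =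
        (VertexAlgebroid.Envelope.vertexAlgebra 𝒜).wt n ⊓ 𝒜.filH (i, 0)) ∧
    -- morphisms of vertex algebroids respect the filtrations `H`
    (∀ {A' T' Ω' : Type*} [CommRing A'] [Algebra k A']
      [LieRing T'] [LieAlgebra k T'] [Module A' T'] [LieRingModule T' A'] [LieRinehartRing A' T']
      [LieRinehartAlgebra k A' T']
      [AddCommGroup Ω'] [Module k Ω'] [Module A' Ω'] [IsScalarTower k A' Ω']
      [LieRingModule T' Ω'] [LieModule k T' Ω']
      (𝒜' : VertexAlgebroid k A' T' Ω') (g : 𝒜.Hom 𝒜') (q : ℕ × ℕ),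
      (𝒜.filH q).map g.envelopeMap ≤ 𝒜'.filH q) := by
  exact ⟨⟨𝒜.dF, 𝒜.compatible_filF.isInduced, 𝒜.jetToGr, 𝒜.jetToGr_isCanonicalF,
      fun ψ h => h.ext 𝒜.jetToGr_isCanonicalF, ⟨𝒜.jetToGr_injective, 𝒜.jetToGr_surjective⟩,
      𝒜.mem_filH_iff⟩,
    ⟨𝒜.dH, 𝒜.compatible_filH.isInduced, 𝒜.symToGr, 𝒜.symToGr_isCanonicalH,
      fun ψ h => h.ext 𝒜.symToGr_isCanonicalH, ⟨𝒜.symToGr_injective, 𝒜.symToGr_surjective⟩⟩,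
    𝒜.filH_eq_iSup,
    fun n => ⟨𝒜.wt_le_filH n, 𝒜.wt_inf_filH_zero n, fun i p h => 𝒜.wt_inf_filH_succ i h⟩,
    fun 𝒜' g q => VertexAlgebroid.map_filH_le g q⟩
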